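/- Let $d\ge 3$. Let $(\Omega,\mathcal F,\mathbb P)$ be a probability space with a (jointly measurable) group of translations $\tau_x:\Omega\to\Omega$, $x\in\mathbb R^d$, which leaves $\mathbb P$ invariant and is ergodic (if $A\in\mathcal F$ satisfies $\tau_xA\subset A$ for all $x$, then $\mathbb P(A)\in\{0,1\}$). Let $\mathsf V:\Omega\to\mathbb R$ be measurable and $\mathbb P$-a.s. bounded, let $V(x,\omega)=\mathsf V(\tau_{-x}\omega)$ be the associated stationary potential, and put $V_\varepsilon(x)=\varepsilon^{-1}V(x/\varepsilon)$, $R(x)=\mathbb E\{V(0)V(x)\}$, $\hat R(\xi)=(2\pi)^{-d}\int_{\mathbb R^d}e^{-i\xi\cdot x}R(x)\,dx$ and $\rho=\int_{\mathbb R^d}\hat R(\xi)|\xi|^{-2}\,d\xi$. Write $\mathcal H=L^2(\Omega,\mathcal F,\mathbb P)$. Assume that $R\in L^1(\mathbb R^d)$ and that there is a function $\eta:[0,\infty)\to[0,\infty)$ with $\eta(|\cdot|)\in L^1(\mathbb R^d)$ such that for all $x_1,x_2,x_3,x_4\in\mathbb R^d$ $$\Big|\mathbb E\Big\{\prod_{j=1}^4V(x_j)\Big\}-R(x_1-x_2)R(x_3-x_4)\Big|\le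 \eta(|x_1-x_3|)\,\eta(|x_2-x_4|)+\eta(|x_1-x_4|)\,\eta(|x_2-x_3|).$$ Then $\hat R(\xi)|\xi|^{-2}$ is integrable, and for every $f\in L^2(\mathbb R^d;\mathbb C)$ the equations $$(-\Delta+1-iV_\varepsilon)u_\varepsilon=f\quad(\varepsilon>0),\qquad -\Delta u+(1+\rho)u=f\qquad\text{on }\mathbb R^d$$ have unique weak solutions, $u_\varepsilon$ (jointly measurable and, $\mathbb P$-a.s., in $H^1(\mathbb R^d;\mathbb C)$) and $u\in H^1(\mathbb R^d;\mathbb C)$ (deterministic), and $u_\varepsilon\to u$ in $L^2(\mathbb R^d;\mathcal H)$ as $\varepsilon\to0$. Moreover, let $G$ be the fundamental solution of $-\Delta+1$ on $\mathbb R^d$, let $\psi_\varepsilon=-G*V_\varepsilon$ (so $(-\Delta+1)\psi_\varepsilon+V_\varepsilon=0$), let $\psi^\varepsilon(y)=\varepsilon^{-1}\psi_\varepsilon(\varepsilon y)$ (so $(-\Delta+\varepsilon^2)\psi^\varepsilon+V=0$), and let $u_1=-\frac{i}{\varepsilon}\psi_\varepsilon u$. Then $\nabla\psi^\varepsilon$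 converges in $L^2_{\rm loc}(\mathbb R^d;\mathcal H)$, as $\varepsilon\to0$, to a stationary field $\Xi(y,\omega)=\mathsf X(\tau_{-y}\omega)$ with $\mathsf X\in L^2(\Omega;\mathbb R^d)$ (formally $\Xi=\nabla\Delta^{-1}V$), and there is a constant $C$, independent of $f$ and $\varepsilon$, such that for all $f\in L^2(\mathbb R^d;\mathbb C)$ and all $0<\varepsilon\le\frac12$ each of the three quantities $$\|u_\varepsilon-u\|_{L^2(\mathbb R^d;\mathcal H)},\qquad \|u_\varepsilon-u-\varepsilon u_1\|_{H^1(\mathbb R^d;\mathcal H)},\qquad \Big\|\nabla u_\varepsilon-\nabla u+i\,u\,\Xi\big(\tfrac{\cdot}{\varepsilon}\big)\Big\|_{L^2(\mathbb R^d;\mathcal H)}$$ is bounded by $$C\,\|f\|_{L^2(\mathbb R^d)}\times\begin{cases}\sqrt{\varepsilon}, & d=3,\\ \varepsilon\sqrt{|\ln\varepsilon|}, & d=4,\\ \varepsilon, & d>4.\end{cases}$$ -/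

import Mathlib

open MeasureTheory Filter Topology
open scoped ENNReal ComplexConjugate

noncomputable section

namespace RandomPotential

/-- The Euclidean space `ℝ^d`. -/
abbrev Rd (d : ℕ) : Type := EuclideanSpace ℝ (Fin d)

/-! ### Sobolev space `H¹` and weak solutions -/

/-- `g` is the weak gradient of `u` on `ℝ^d`. -/
def IsWeakGradient {d : ℕ} {𝕜 : Type*} [RCLike 𝕜]
    (u : Rd d → 𝕜) (g : Rd d → EuclideanSpace 𝕜 (Fin d)) : Prop :=
  LocallyIntegrable u volume ∧ LocallyIntegrable g volume ∧
    ∀ φ : Rd d → ℝ, ContDiff ℝ ((⊤ : ℕ∞) : WithTop ℕ∞) φ → HasCompactSupport φ → ∀ j : Fin d,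
      ∫ x, u x * ((fderiv ℝ φ x (EuclideanSpace.single j 1) : ℝ) : 𝕜)
        = - ∫ x, g x j * ((φ x : ℝ) : 𝕜)

/-- `u ∈ H¹(ℝ^d; ℂ)`, with weak gradient `g`. -/
structure MemH1 {d : ℕ} (u : Rd d → ℂ) (g : Rd d → EuclideanSpace ℂ (Fin d)) : Prop where
  memLp : MemLp u 2 volume
  memLp_grad : MemLp g 2 volume
  weakGradient : IsWeakGradient u g

/-- `u ∈ H¹(ℝ^d; ℂ)`, with weak gradient `g`, is the weak solution of `-Δ u + c u = f`:
`∫ ∇u · ∇v^* + c u v^* = ∫ f v^*` for every `v ∈ H¹(ℝ^d; ℂ)`. -/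
structure IsWeakSolution {d : ℕ} (c f u : Rd d → ℂ)
    (g : Rd d → EuclideanSpace ℂ (Fin d)) : Prop where
  memH1 : MemH1 u g
  weakForm : ∀ (v : Rd d → ℂ) (gv : Rd d → EuclideanSpace ℂ (Fin d)), MemH1 v gv →
    ∫ x, ((∑ j, g x j * conj (gv x j)) + c x * u x * conj (v x)) = ∫ x, f x * conj (v x)

/-! ### The stationary random potential -/

section Potential

variable {d : ℕ} {Ω : Type*} [AddAction (Rd d) Ω]

/-- The stationary field `V(x, ω) = V(τ_{-x} ω)`; the translation `τ_x ω` is written `x +ᵥ ω`. -/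
def field (V : Ω → ℝ) (x : Rd d) (ω : Ω) : ℝ := V ((-x) +ᵥ ω)

/-- The large, highly oscillatory potential `V_ε(x, ω) = ε⁻¹ V(x / ε, ω)`. -/
def scaledField (V : Ω → ℝ) (ε : ℝ) (x : Rd d) (ω : Ω) : ℝ :=
  ε⁻¹ * field V (ε⁻¹ • x) ω

variable [MeasurableSpace Ω]

/-- Ergodicity of the translation group. -/
def IsErgodic (d : ℕ) {Ω : Type*} [AddAction (Rd d) Ω] [MeasurableSpace Ω]
    (P : Measure Ω) : Prop :=
  ∀ A : Set Ω, MeasurableSet A → (∀ x : Rd d, (fun ω => x +ᵥ ω) '' A ⊆ A) → P A = 0 ∨ P A = 1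

/-- The correlation function `R(x) = E[V(0) V(x)]`. -/
def correlation (P : Measure Ω) (V : Ω → ℝ) (x : Rd d) : ℝ :=
  ∫ ω, field V (0 : Rd d) ω * field V x ω ∂P

/-- The power spectrum `(2π)^{-d} ∫ e^{-i ξ·x} R(x) dx`; it is real because `R` is even. -/
def powerSpectrum (P : Measure Ω) (V : Ω → ℝ) (ξ : Rd d) : ℝ :=
  ((2 * Real.pi) ^ d)⁻¹ *
    (∫ x : Rd d, Complex.exp (-(Complex.I * ((inner ℝ ξ x : ℝ) : ℂ)))
      * ((correlation P V x : ℝ) : ℂ)).re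

/-- The homogenized potential `ρ = ∫ R̂(ξ) / |ξ|² dξ`. -/
def homogenizedPotential (d : ℕ) {Ω : Type*} [AddAction (Rd d) Ω] [MeasurableSpace Ω]
    (P : Measure Ω) (V : Ω → ℝ) : ℝ :=
  ∫ ξ : Rd d, powerSpectrum P V ξ / ‖ξ‖ ^ 2

/-- `u_ε`, with gradient `g`, is the solution of `(-Δ + 1 - i V_ε) u_ε = f`: it is jointly
measurable and, almost surely, the weak solution in `H¹(ℝ^d; ℂ)`. -/
structure IsRandomSolution (P : Measure Ω) (V : Ω → ℝ) (ε : ℝ) (f : Rd d → ℂ)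
    (u : Rd d → Ω → ℂ) (g : Rd d → Ω → EuclideanSpace ℂ (Fin d)) : Prop where
  aestronglyMeasurable : AEStronglyMeasurable (fun p : Rd d × Ω => u p.1 p.2) (volume.prod P)
  aestronglyMeasurable_grad :
    AEStronglyMeasurable (fun p : Rd d × Ω => g p.1 p.2) (volume.prod P)
  weakSolution : ∀ᵐ ω ∂P,
    IsWeakSolution (fun x => 1 - Complex.I * ((scaledField V ε x ω : ℝ) : ℂ)) f
      (fun x => u x ω) (fun x => g x ω)

/-! ### Correctors -/

/-- The fundamental solution of `-Δ + 1` on `ℝ^d`, as the Laplace transform in time of the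
heat kernel. -/
def green {d : ℕ} (x : Rd d) : ℝ :=
  ∫ t in Set.Ioi (0 : ℝ),
    (4 * Real.pi * t) ^ (-(d : ℝ) / 2) * Real.exp (-t - ‖x‖ ^ 2 / (4 * t))

/-- The corrector `ψ_ε = -G * V_ε`, solution of `(-Δ + 1) ψ_ε + V_ε = 0`. -/
def corrector (V : Ω → ℝ) (ε : ℝ) (x : Rd d) (ω : Ω) : ℝ :=
  - ∫ y, green (x - y) * scaledField V ε y ω

/-- The corrector in the fast variable, `ψ^ε(y) = ε⁻¹ ψ_ε(ε y)`, solution of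
`(-Δ + ε²) ψ^ε + V = 0`. -/
def fastCorrector (V : Ω → ℝ) (ε : ℝ) (y : Rd d) (ω : Ω) : ℝ :=
  ε⁻¹ * corrector V ε (ε • y) ω

/-- The first order term `u_1 = -χ_ε u` with `χ_ε = (i / ε) ψ_ε = G * (-i ε⁻² V(· / ε))`. -/
def firstOrderTerm (V : Ω → ℝ) (ε : ℝ) (u : Rd d → ℂ) (x : Rd d) (ω : Ω) : ℂ :=
  -((Complex.I / (ε : ℂ)) * ((corrector V ε x ω : ℝ) : ℂ)) * u x

/-- `X ∈ L²(Ω)^d` is such that the stationary field `Ξ(y, ω) = X(τ_{-y} ω)` is the limit in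
`L²_loc(ℝ^d; L²(Ω))` of the gradients `∇ψ^ε` as `ε → 0`. -/
def IsCorrectorGradient (P : Measure Ω) (V : Ω → ℝ) (X : Ω → Rd d) : Prop :=
  MemLp X 2 P ∧
  ∃ D : ℝ → Rd d → Ω → Rd d,
    (∀ ε : ℝ, 0 < ε →
      AEStronglyMeasurable (fun p : Rd d × Ω => D ε p.1 p.2) (volume.prod P) ∧
      ∀ᵐ ω ∂P, IsWeakGradient (fun y => fastCorrector V ε y ω) (fun y => D ε y ω)) ∧
    ∀ K : Set (Rd d), IsCompact K →
      Tendsto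
        (fun ε : ℝ => eLpNorm (fun p : Rd d × Ω => D ε p.1 p.2 - X ((-p.1) +ᵥ p.2)) 2
          ((volume.restrict K).prod P))
        (𝓝[>] 0) (𝓝 0)

end Potential

/-- The rate of convergence. -/
def rate (d : ℕ) (ε : ℝ) : ℝ :=
  if d = 3 then √ε else if d = 4 then ε * √|Real.log ε| else ε

end RandomPotential

end

open RandomPotential

/-!
# Homogenization of `-Δ + 1 - i V_ε`, with a large random potential

Everything is done in real space with the heat kernel, the kernel `resK lam` of `(-Δ + lam)⁻¹` being
its Laplace transform. The potential is first truncated, which changes it on a null set only, so that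
it is bounded everywhere. Then the corrector `ψ_ε = -G * V_ε` is bounded with a bounded gradient
for each fixed `ε` (`isBoundedCorrector_conv`), and products of `H¹` functions with it are in `H¹`.

*Well-posedness.* The random problem is solved by a contraction in `L²(ℝ^d × Ω)`, which gives joint
measurability at once (`exists_random_weakSolution`); uniqueness follows from the energy identity,
in which the imaginary potential does not appear.

*The remainder.* Let `w = u_ε - u + i ψ_ε u = u_ε - u - ε u₁`. Combining the equations of `u_ε`, of
`u` and of `ψ_ε` gives, with `V_ε ψ_ε = m + q` and `m` the mean (`integral_remainder`),
`(-Δ + 1 - i V_ε) w = (ρ + m) u + q u - 2 i ∇·(ψ_ε ∇u) - i ψ_ε (f - (1 + ρ) u)`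
in the weak sense. The energy estimate (`remainder_energy_le`, `lintegral_remainder_le`) bounds the
expected `H¹` norm of `w` by four quantities, all of them estimated in `exists_momentBounds`:

* the second moment of `ψ_ε`. It is a double integral of `R` against two resolvent kernels, which
  is at most a multiple of `ε² ∫ t exp (-ε² t) min (1, t^(-d/2)) dt` (`timeMass`). This integral is
  the source of the rates `ε`, `ε² |log ε|`, `ε²` for `d = 3`, `d = 4`, `d > 4`;
* the defect `ρ + m`. Since `|ξ|⁻² = ∫ exp (-t |ξ|²) dt` and the power spectrum is nonnegative,
  `ρ = ∫ ⟨heat t, R⟩ dt` (`homogenizedPotential_eq`), while `-m` is the same integral with the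
  additional factor `exp (-ε² t)`;
* the energy `𝔼 ⟨q u, (-Δ + 1)⁻¹ (q u)⟩`. By stationarity it is at most
  `‖u‖² ∫ resK 1 z |Cov_q(z / ε)| dz` (`integrable_energy_and_enorm_le`). The hypothesis on the
  fourth moments bounds `∫ |Cov_q|` by the same time integral
  (`lintegral_correlation_fluctuation_le`);
* the second moment of `ψ_ε` against `∇u` and against `f - (1 + ρ) u`.

*The gradient.* `∇ψ^ε` is the stationary field `-∫ ∇ exp(t(Δ - ε²)) V dt`. Minkowski's inequality
in `L²(Ω)` with the weight `1 - exp (-ε² t)` shows that it converges to `limitGradient` at the same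
rate (`lintegral_enorm_sq_average_gradK_add_le`). The estimates of `u_ε - u` and of
`∇u_ε - ∇u + i u Ξ(·/ε)` follow from that of `w` by the triangle inequality.
-/

open MeasureTheory Filter Topology
open scoped ENNReal ComplexConjugate

noncomputable section

namespace RandomPotential

/-! ### The heat kernel and the resolvent kernels -/

section Heat

variable {d : ℕ}

/-- The heat kernel of `∂ₜ - Δ` on `ℝ^d`. -/
def heat (t : ℝ) (x : Rd d) : ℝ :=
  (4 * Real.pi * t) ^ (-(d : ℝ) / 2) * Real.exp (-‖x‖ ^ 2 / (4 * t))

lemma heat_nonneg {t : ℝ} (ht : 0 ≤ t) (x : Rd d) : 0 ≤ heat t x := by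
  unfold heat; positivity

lemma measurable_heat : Measurable (fun p : ℝ × Rd d => heat p.1 p.2) := by
  unfold heat
  fun_prop

@[fun_prop]
lemma continuous_heat (t : ℝ) : Continuous (heat t : Rd d → ℝ) := by
  unfold heat
  fun_prop

lemma heat_le {t : ℝ} (ht : 0 < t) (x : Rd d) : heat t x ≤ t ^ (-(d : ℝ) / 2) := by
  unfold heat
  have h1 : (4 * Real.pi * t) ^ (-(d : ℝ) / 2) ≤ t ^ (-(d : ℝ) / 2) := by
    apply Real.rpow_le_rpow_of_nonpos ht
    · nlinarith [Real.pi_gt_three]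
    · have : (0 : ℝ) ≤ d := by positivity
      linarith
  have h2 : Real.exp (-‖x‖ ^ 2 / (4 * t)) ≤ 1 := by
    rw [Real.exp_le_one_iff]
    apply div_nonpos_of_nonpos_of_nonneg <;> [nlinarith [sq_nonneg ‖x‖]; positivity]
  calc _ ≤ t ^ (-(d : ℝ) / 2) * 1 := by gcongr
    _ = _ := mul_one _

lemma integral_exp_heat {t : ℝ} (ht : 0 < t) :
    ∫ x : Rd d, Real.exp (-‖x‖ ^ 2 / (4 * t)) = (4 * Real.pi * t) ^ ((d : ℝ) / 2) := by
  have h := GaussianFourier.integral_rexp_neg_mul_sq_norm (V := Rd d) (b := 1 / (4 * t))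
    (by positivity)
  rw [finrank_euclideanSpace_fin] at h
  convert! h using 2
  · ext x; congr 1; ring
  · field_simp

lemma integral_heat {t : ℝ} (ht : 0 < t) : ∫ x : Rd d, heat t x = 1 := by
  unfold heat
  rw [integral_const_mul, integral_exp_heat ht, ← Real.rpow_add (by positivity)]
  have : -(d : ℝ) / 2 + d / 2 = 0 := by ring
  rw [this, Real.rpow_zero]

lemma integrable_heat {t : ℝ} (ht : 0 < t) : Integrable (heat t : Rd d → ℝ) := by
  by_contra h
  have := integral_heat (d := d) ht
  rw [integral_undef h] at this
  exact zero_ne_one this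

lemma lintegral_heat {t : ℝ} (ht : 0 < t) :
    ∫⁻ x : Rd d, ENNReal.ofReal (heat t x) = 1 := by
  rw [← ofReal_integral_eq_lintegral_ofReal (integrable_heat ht)
    (Eventually.of_forall fun x => heat_nonneg ht.le x), integral_heat ht, ENNReal.ofReal_one]

/-- The modulus of the gradient of the heat kernel is dominated by a heat kernel at a later time,
which gives at once its bounds in `L¹` and in `L^∞`. -/
lemma norm_mul_heat_le {t : ℝ} (ht : 0 < t) (x : Rd d) :
    ‖x‖ * (heat t x / (2 * t)) ≤ 2 ^ ((d : ℝ) / 2) * t ^ (-(1 / 2) : ℝ) * heat (2 * t) x := by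
  set s : ℝ := ‖x‖ / √t with hs
  have hst : 0 < √t := Real.sqrt_pos.2 ht
  have hx : ‖x‖ = s * √t := by rw [hs]; field_simp
  have hs0 : 0 ≤ s := by positivity
  have htt : √t ^ 2 = t := Real.sq_sqrt ht.le
  have e1 : -‖x‖ ^ 2 / (4 * t) = -(s ^ 2 / 8) + -‖x‖ ^ 2 / (4 * (2 * t)) := by
    rw [hx, mul_pow, htt]; field_simp; ring
  have e2 : s * Real.exp (-(s ^ 2 / 8)) ≤ 2 := by
    have : s ≤ 2 * Real.exp (s ^ 2 / 8) := by
      have := Real.add_one_le_exp (s ^ 2 / 8)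
      nlinarith [sq_nonneg (s / 2 - 1)]
    rw [Real.exp_neg]
    have hp := Real.exp_pos (s ^ 2 / 8)
    rw [← div_eq_mul_inv, div_le_iff₀ hp]
    exact this
  have e3 : (4 * Real.pi * t) ^ (-(d : ℝ) / 2)
      = 2 ^ ((d : ℝ) / 2) * (4 * Real.pi * (2 * t)) ^ (-(d : ℝ) / 2) := by
    have : 4 * Real.pi * (2 * t) = 2 * (4 * Real.pi * t) := by ring
    rw [this, Real.mul_rpow (x := 2) (y := 4 * Real.pi * t) (by norm_num) (by positivity), ← mul_assoc,
      ← Real.rpow_add (by norm_num)]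
    have : (d : ℝ) / 2 + -(d : ℝ) / 2 = 0 := by ring
    rw [this, Real.rpow_zero, one_mul]
  have e4 : t ^ (-(1 / 2) : ℝ) = 1 / √t := by
    rw [Real.rpow_neg ht.le, ← Real.sqrt_eq_rpow, one_div]
  unfold heat
  rw [e1, Real.exp_add, e3, e4]
  set A := (4 * Real.pi * (2 * t)) ^ (-(d : ℝ) / 2) with hA
  have hA0 : 0 ≤ A := by positivity
  set B := Real.exp (-‖x‖ ^ 2 / (4 * (2 * t)))
  have hB0 : 0 ≤ B := (Real.exp_pos _).le
  calc ‖x‖ * (2 ^ ((d : ℝ) / 2) * A * (Real.exp (-(s ^ 2 / 8)) * B) / (2 * t))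
      = (s * Real.exp (-(s ^ 2 / 8))) * (√t / (2 * t)) * (2 ^ ((d : ℝ) / 2) * A * B) := by
        rw [hx]; ring
    _ ≤ 2 * (√t / (2 * t)) * (2 ^ ((d : ℝ) / 2) * A * B) := by gcongr
    _ = 2 ^ ((d : ℝ) / 2) * (1 / √t) * (A * B) := by
        nth_rewrite 2 [← htt]
        field_simp

/-- The heat kernel at the time `ε² t` and the point `ε y`. -/
lemma heat_scale {ε : ℝ} (hε : 0 < ε) {t : ℝ} (ht : 0 < t) (y : Rd d) :
    heat (ε ^ 2 * t) (ε • y) * ε ^ d = heat t y := by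
  unfold heat
  have h1 : (4 * Real.pi * (ε ^ 2 * t)) ^ (-(d : ℝ) / 2)
      = (ε ^ d)⁻¹ * (4 * Real.pi * t) ^ (-(d : ℝ) / 2) := by
    have : 4 * Real.pi * (ε ^ 2 * t) = ε ^ 2 * (4 * Real.pi * t) := by ring
    rw [this, Real.mul_rpow (by positivity) (by positivity)]
    congr 1
    rw [← Real.rpow_natCast ε 2, ← Real.rpow_mul hε.le, ← Real.rpow_natCast ε d,
      ← Real.rpow_neg hε.le]
    congr 1
    push_cast; ring
  have h2 : -‖ε • y‖ ^ 2 / (4 * (ε ^ 2 * t)) = -‖y‖ ^ 2 / (4 * t) := by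
    rw [norm_smul, Real.norm_of_nonneg hε.le, mul_pow]
    field_simp
  rw [h1, h2]
  field_simp

/-- The resolvent kernel of `-Δ + lam`, as the Laplace transform of the heat kernel. -/
def resK (lam : ℝ) (x : Rd d) : ℝ :=
  ∫ t in Set.Ioi (0 : ℝ), Real.exp (-(lam * t)) * heat t x

/-- The scalar factor of the gradient of the resolvent kernel. -/
def gradKScalar (lam : ℝ) (x : Rd d) : ℝ :=
  ∫ t in Set.Ioi (0 : ℝ), Real.exp (-(lam * t)) * (heat t x / (2 * t))

/-- The gradient of the resolvent kernel of `-Δ + lam`. -/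
def gradK (lam : ℝ) (x : Rd d) : Rd d := -(gradKScalar lam x • x)

lemma green_eq_resK (x : Rd d) : green x = resK 1 x := by
  unfold green resK heat
  refine setIntegral_congr_fun measurableSet_Ioi fun t _ => ?_
  rw [sub_eq_add_neg, Real.exp_add, one_mul, neg_div]
  ring_nf

lemma resK_nonneg (lam : ℝ) (x : Rd d) : 0 ≤ resK lam x :=
  setIntegral_nonneg measurableSet_Ioi fun _ ht =>
    mul_nonneg (Real.exp_pos _).le (heat_nonneg (le_of_lt ht) x)

lemma gradKScalar_nonneg (lam : ℝ) (x : Rd d) : 0 ≤ gradKScalar lam x :=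
  setIntegral_nonneg measurableSet_Ioi fun _ ht =>
    mul_nonneg (Real.exp_pos _).le (div_nonneg (heat_nonneg (le_of_lt ht) x)
      (mul_nonneg zero_le_two (le_of_lt ht)))

lemma measurable_resK (lam : ℝ) : Measurable (resK lam : Rd d → ℝ) := by
  have h : StronglyMeasurable
      (fun p : Rd d × ℝ => Real.exp (-(lam * p.2)) * heat p.2 p.1) := by
    apply Measurable.stronglyMeasurable
    have := (measurable_heat (d := d)).comp measurable_swap
    exact (by fun_prop : Measurable fun p : Rd d × ℝ => Real.exp (-(lam * p.2))).mul this
  exact (h.integral_prod_right' (ν := volume.restrict (Set.Ioi 0))).measurable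

lemma measurable_gradKScalar (lam : ℝ) : Measurable (gradKScalar lam : Rd d → ℝ) := by
  have h : StronglyMeasurable
      (fun p : Rd d × ℝ => Real.exp (-(lam * p.2)) * (heat p.2 p.1 / (2 * p.2))) := by
    apply Measurable.stronglyMeasurable
    have := (measurable_heat (d := d)).comp measurable_swap
    exact (by fun_prop : Measurable fun p : Rd d × ℝ => Real.exp (-(lam * p.2))).mul
      (this.div (by fun_prop))
  exact (h.integral_prod_right' (ν := volume.restrict (Set.Ioi 0))).measurable

lemma measurable_gradK (lam : ℝ) : Measurable (gradK lam : Rd d → Rd d) :=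
  ((measurable_gradKScalar lam).smul measurable_id).neg

lemma resK_scale {ε : ℝ} (hε : 0 < ε) (y : Rd d) :
    resK 1 (ε • y) * ε ^ d = ε ^ 2 * resK (ε ^ 2) y := by
  have h := integral_comp_mul_left_Ioi (fun t => Real.exp (-(1 * t)) * heat t (ε • y)) 0
    (pow_pos hε 2)
  rw [mul_zero, smul_eq_mul] at h
  have h' : resK 1 (ε • y) = ε ^ 2 *
      ∫ t in Set.Ioi (0 : ℝ), Real.exp (-(1 * (ε ^ 2 * t))) * heat (ε ^ 2 * t) (ε • y) := by
    rw [h, resK]; field_simp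
  rw [h', mul_assoc, ← integral_mul_const, resK]
  congr 1
  refine setIntegral_congr_fun measurableSet_Ioi fun t ht => ?_
  rw [mul_assoc, heat_scale hε ht, one_mul]

lemma gradK_scale {ε : ℝ} (hε : 0 < ε) (y : Rd d) :
    ε ^ d • gradK 1 (ε • y) = ε • gradK (ε ^ 2) y := by
  have h := integral_comp_mul_left_Ioi
    (fun t => Real.exp (-(1 * t)) * (heat t (ε • y) / (2 * t))) 0 (pow_pos hε 2)
  rw [mul_zero, smul_eq_mul] at h
  have h' : gradKScalar 1 (ε • y) = ε ^ 2 * ∫ t in Set.Ioi (0 : ℝ),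
      Real.exp (-(1 * (ε ^ 2 * t))) * (heat (ε ^ 2 * t) (ε • y) / (2 * (ε ^ 2 * t))) := by
    rw [h, gradKScalar, ← mul_assoc, mul_inv_cancel₀ (by positivity), one_mul]
  have h2 : gradKScalar 1 (ε • y) * ε ^ d = gradKScalar (ε ^ 2) y := by
    rw [h', mul_assoc, ← integral_mul_const, gradKScalar, ← integral_const_mul]
    refine setIntegral_congr_fun measurableSet_Ioi fun t ht => ?_
    have ht' : t ≠ 0 := ne_of_gt ht
    rw [← heat_scale hε ht y, one_mul]
    field_simp
  simp only [gradK, smul_neg, smul_smul]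
  rw [← h2]
  congr 2; ring

end Heat

section ResolventKernel

variable {d : ℕ}

lemma integral_comp_sqrt_smul {E : Type*} [NormedAddCommGroup E] [NormedSpace ℝ E]
    {t : ℝ} (ht : 0 < t) (F : Rd d → E) :
    ∫ x, heat t x • F x = ∫ y, heat 1 y • F (√t • y) := by
  have hst : 0 < √t := Real.sqrt_pos.2 ht
  have h := Measure.integral_comp_smul (volume : Measure (Rd d)) (fun x => heat t x • F x) √t
  rw [finrank_euclideanSpace_fin, abs_of_pos (by positivity)] at h
  have h2 : ∫ x, heat t x • F x
      = √t ^ d • ∫ y, heat t (√t • y) • F (√t • y) := by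
    rw [h, smul_smul, mul_inv_cancel₀ (by positivity), one_smul]
  rw [h2, ← integral_smul]
  congr 1
  ext y
  rw [smul_smul, mul_comm]
  congr 1
  have := heat_scale hst one_pos y
  rwa [mul_one, Real.sq_sqrt ht.le] at this

lemma integrable_heat_prod {lam : ℝ} (hl : 0 < lam) :
    Integrable (fun p : ℝ × Rd d => Real.exp (-(lam * p.1)) * heat p.1 p.2)
      ((volume.restrict (Set.Ioi 0)).prod volume) := by
  rw [integrable_prod_iff]
  · refine ⟨?_, ?_⟩
    · refine (ae_restrict_iff' measurableSet_Ioi).2 (Eventually.of_forall fun t ht => ?_)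
      exact (integrable_heat (d := d) ht).const_mul (Real.exp (-(lam * t)))
    · have h := exp_neg_integrableOn_Ioi 0 hl
      refine h.congr ?_
      refine (ae_restrict_iff' measurableSet_Ioi).2 (Eventually.of_forall fun t ht => ?_)
      have ht' : 0 < t := ht
      simp only [norm_mul, Real.norm_eq_abs, Real.abs_exp]
      rw [integral_const_mul]
      have : ∫ x : Rd d, |heat t x| = 1 := by
        rw [← integral_heat (d := d) ht']
        exact integral_congr_ae (Eventually.of_forall fun x => abs_of_nonneg (heat_nonneg ht'.le x))
      rw [this, mul_one, neg_mul]
  · exact ((by fun_prop : Measurable fun p : ℝ × Rd d => Real.exp (-(lam * p.1))).mul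
      measurable_heat).aestronglyMeasurable

lemma integrable_norm_heat_prod {lam : ℝ} (hl : 0 < lam) :
    Integrable (fun p : ℝ × Rd d =>
        Real.exp (-(lam * p.1)) * (‖p.2‖ * (heat p.1 p.2 / (2 * p.1))))
      ((volume.restrict (Set.Ioi 0)).prod volume) := by
  have hmeas : Measurable (fun p : ℝ × Rd d => heat (2 * p.1) p.2) :=
    measurable_heat.comp (by fun_prop : Measurable fun p : ℝ × Rd d => (2 * p.1, p.2))
  have hdom : Integrable (fun p : ℝ × Rd d =>
      Real.exp (-(lam * p.1)) * (2 ^ ((d : ℝ) / 2) * p.1 ^ (-(1 / 2) : ℝ) * heat (2 * p.1) p.2))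
      ((volume.restrict (Set.Ioi 0)).prod volume) := by
    rw [integrable_prod_iff]
    · refine ⟨?_, ?_⟩
      · refine (ae_restrict_iff' measurableSet_Ioi).2 (Eventually.of_forall fun t ht => ?_)
        have ht' : 0 < 2 * t := mul_pos two_pos ht
        exact ((integrable_heat (d := d) ht').const_mul (2 ^ ((d : ℝ) / 2) * t ^ (-(1 / 2) : ℝ))).const_mul
          (Real.exp (-(lam * t)))
      · have h := (integrableOn_rpow_mul_exp_neg_mul_rpow (p := 1) (s := -(1 / 2)) (b := lam)
          (by norm_num) one_pos hl).const_mul (2 ^ ((d : ℝ) / 2))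
        refine h.congr ?_
        refine (ae_restrict_iff' measurableSet_Ioi).2 (Eventually.of_forall fun t ht => ?_)
        have ht' : 0 < t := ht
        have : ∀ x : Rd d, ‖Real.exp (-(lam * t)) *
            (2 ^ ((d : ℝ) / 2) * t ^ (-(1 / 2) : ℝ) * heat (2 * t) x)‖
            = Real.exp (-(lam * t)) * (2 ^ ((d : ℝ) / 2) * t ^ (-(1 / 2) : ℝ)) * heat (2 * t) x := by
          intro x
          have := heat_nonneg (by positivity : 0 ≤ 2 * t) x
          rw [Real.norm_of_nonneg (by positivity)]
          ring
        simp only [this]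
        rw [integral_const_mul, integral_heat (by positivity), Real.rpow_one, neg_mul]
        ring
    · exact Measurable.aestronglyMeasurable (by fun_prop)
  refine hdom.mono' ?_ ?_
  · exact ((by fun_prop : Measurable fun p : ℝ × Rd d => Real.exp (-(lam * p.1))).mul
      ((by fun_prop : Measurable fun p : ℝ × Rd d => ‖p.2‖).mul
        (measurable_heat.div (by fun_prop)))).aestronglyMeasurable
  · have : ∀ᵐ p : ℝ × Rd d ∂((volume.restrict (Set.Ioi 0)).prod volume), 0 < p.1 :=
      Measure.quasiMeasurePreserving_fst.ae
        ((ae_restrict_iff' measurableSet_Ioi).2 (Eventually.of_forall fun t ht => ht))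
    filter_upwards [this] with p hp
    have h0 := heat_nonneg hp.le p.2
    rw [Real.norm_of_nonneg (by positivity)]
    exact mul_le_mul_of_nonneg_left (norm_mul_heat_le hp p.2) (Real.exp_pos _).le

lemma integrable_resK {lam : ℝ} (hl : 0 < lam) : Integrable (resK lam : Rd d → ℝ) :=
  (integrable_heat_prod hl).integral_prod_right

lemma norm_gradK (lam : ℝ) (x : Rd d) : ‖gradK lam x‖ = ∫ t in Set.Ioi (0 : ℝ),
    Real.exp (-(lam * t)) * (‖x‖ * (heat t x / (2 * t))) := by
  rw [gradK, norm_neg, norm_smul, Real.norm_of_nonneg (gradKScalar_nonneg _ _), gradKScalar,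
    ← integral_mul_const]
  congr 1; ext t; ring

lemma integrable_gradK {lam : ℝ} (hl : 0 < lam) : Integrable (gradK lam : Rd d → Rd d) := by
  rw [← integrable_norm_iff (measurable_gradK lam).aestronglyMeasurable]
  simp only [norm_gradK]
  exact (integrable_norm_heat_prod hl).integral_prod_right

variable {E : Type*} [NormedAddCommGroup E] [NormedSpace ℝ E]

lemma integrable_gradK_prod_smul {lam : ℝ} (hl : 0 < lam) {F : Rd d → E}
    (hF : AEStronglyMeasurable F volume) {C : ℝ} (hC : ∀ x, ‖F x‖ ≤ C * ‖x‖) :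
    Integrable (Function.uncurry fun (t : ℝ) (x : Rd d) =>
      (Real.exp (-(lam * t)) * (heat t x / (2 * t))) • F x)
      ((volume.restrict (Set.Ioi 0)).prod volume) := by
  refine ((integrable_norm_heat_prod (d := d) hl).const_mul C).mono' ?_ ?_
  · have : Measurable fun p : ℝ × Rd d =>
        Real.exp (-(lam * p.1)) * (heat p.1 p.2 / (2 * p.1)) :=
      (by fun_prop : Measurable fun p : ℝ × Rd d => Real.exp (-(lam * p.1))).mul
        (measurable_heat.div (by fun_prop))
    exact this.aestronglyMeasurable.smul hF.comp_snd
  · have : ∀ᵐ p : ℝ × Rd d ∂((volume.restrict (Set.Ioi 0)).prod volume), 0 < p.1 :=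
      Measure.quasiMeasurePreserving_fst.ae
        ((ae_restrict_iff' measurableSet_Ioi).2 (Eventually.of_forall fun t ht => ht))
    filter_upwards [this] with p hp
    have h0 := heat_nonneg hp.le p.2
    simp only [Function.uncurry]
    rw [norm_smul, Real.norm_of_nonneg (by positivity)]
    calc _ ≤ Real.exp (-(lam * p.1)) * (heat p.1 p.2 / (2 * p.1)) * (C * ‖p.2‖) := by
          gcongr
          exact hC p.2
      _ = _ := by ring

variable [CompleteSpace E]

lemma integral_resK_smul {lam : ℝ} (hl : 0 < lam) {F : Rd d → E}
    (hF : AEStronglyMeasurable F volume) {C : ℝ} (hC : ∀ x, ‖F x‖ ≤ C) :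
    ∫ x, resK lam x • F x
      = ∫ t in Set.Ioi (0 : ℝ), Real.exp (-(lam * t)) • ∫ x, heat t x • F x := by
  have hint : Integrable (Function.uncurry fun (t : ℝ) (x : Rd d) =>
      (Real.exp (-(lam * t)) * heat t x) • F x) ((volume.restrict (Set.Ioi 0)).prod volume) := by
    refine ((integrable_heat_prod (d := d) hl).norm.mul_const C).mono'
      ((integrable_heat_prod (d := d) hl).aestronglyMeasurable.smul hF.comp_snd)
      (Eventually.of_forall fun p => ?_)
    simp only [Function.uncurry]
    rw [norm_smul]
    gcongr
    exact hC _
  have h := integral_integral_swap hint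
  rw [show (∫ x, resK lam x • F x) = ∫ x, ∫ t in Set.Ioi (0 : ℝ),
      (Real.exp (-(lam * t)) * heat t x) • F x by simp only [integral_smul_const, resK], ← h]
  simp only [mul_smul, integral_smul]

lemma integral_gradKScalar_smul {lam : ℝ} (hl : 0 < lam) {F : Rd d → E}
    (hF : AEStronglyMeasurable F volume) {C : ℝ} (hC : ∀ x, ‖F x‖ ≤ C * ‖x‖) :
    ∫ x, gradKScalar lam x • F x
      = ∫ t in Set.Ioi (0 : ℝ), Real.exp (-(lam * t)) • ∫ x, (heat t x / (2 * t)) • F x := by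
  have h := integral_integral_swap (integrable_gradK_prod_smul hl hF hC)
  rw [show (∫ x, gradKScalar lam x • F x) = ∫ x, ∫ t in Set.Ioi (0 : ℝ),
      (Real.exp (-(lam * t)) * (heat t x / (2 * t))) • F x by
        simp only [integral_smul_const, gradKScalar], ← h]
  simp only [mul_smul, integral_smul]

lemma hasFDerivAt_heat (t : ℝ) (x : Rd d) :
    HasFDerivAt (heat t) (-(heat t x / (2 * t)) • innerSL ℝ x) x := by
  have h1 := (((hasStrictFDerivAt_norm_sq x).hasFDerivAt.neg.mul_const (4 * t)⁻¹).exp).const_mul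
    ((4 * Real.pi * t) ^ (-(d : ℝ) / 2))
  refine h1.congr_fderiv ?_
  ext v
  simp only [heat, smul_apply, neg_apply, smul_eq_mul,
    Pi.neg_apply, nsmul_eq_mul]
  rcases eq_or_ne t 0 with rfl | ht
  · simp
  · simp
    field_simp
    ring

lemma integral_heat_fderiv {t : ℝ} {φ : Rd d → ℝ} (hφ : ContDiff ℝ 1 φ)
    (hc : HasCompactSupport φ) (v : Rd d) :
    ∫ x, heat t x * fderiv ℝ φ x v = ∫ x, heat t x / (2 * t) * (inner ℝ x v * φ x) := by
  have hfd : Continuous (fun x => fderiv ℝ φ x v) :=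
    (hφ.continuous_fderiv (by norm_num)).clm_apply continuous_const
  have hcd : HasCompactSupport (fun x => fderiv ℝ φ x v) := hc.fderiv_apply (𝕜 := ℝ) v
  have e : ∀ x : Rd d, fderiv ℝ (heat t) x v = -(heat t x / (2 * t)) * inner ℝ x v := fun x => by
    rw [(hasFDerivAt_heat t x).fderiv]; simp
  rw [integral_mul_fderiv_eq_neg_fderiv_mul_of_integrable, ← integral_neg]
  · congr 1; ext x; rw [e]; ring
  · simp_rw [e]
    exact Continuous.integrable_of_hasCompactSupport (by have := hφ.continuous; fun_prop) hc.mul_left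
  · exact Continuous.integrable_of_hasCompactSupport (by fun_prop) hcd.mul_left
  · exact Continuous.integrable_of_hasCompactSupport (by have := hφ.continuous; fun_prop) hc.mul_left
  · exact fun x _ => (hasFDerivAt_heat t x).differentiableAt
  · exact fun x _ => hφ.differentiable (by norm_num) x

/-- `gradK` is the weak gradient of `resK`. -/
lemma integral_resK_fderiv {lam : ℝ} (hl : 0 < lam) {φ : Rd d → ℝ} (hφ : ContDiff ℝ 1 φ)
    (hc : HasCompactSupport φ) (v : Rd d) :
    ∫ x, resK lam x * fderiv ℝ φ x v = - ∫ x, inner ℝ (gradK lam x) v * φ x := by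
  have hfd : Continuous (fun x => fderiv ℝ φ x v) :=
    (hφ.continuous_fderiv (by norm_num)).clm_apply continuous_const
  have hcd : HasCompactSupport (fun x => fderiv ℝ φ x v) := hc.fderiv_apply (𝕜 := ℝ) v
  obtain ⟨C, hC⟩ := hfd.bounded_above_of_compact_support hcd
  obtain ⟨C', hC'⟩ := hφ.continuous.bounded_above_of_compact_support hc
  have h1 := integral_resK_smul hl hfd.aestronglyMeasurable hC
  have h2 := integral_gradKScalar_smul hl (F := fun x => inner ℝ x v * φ x)
    (C := ‖v‖ * C')
    (by have := hφ.continuous; exact Continuous.aestronglyMeasurable (by fun_prop))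
    (fun x => by
      rw [norm_mul]
      calc _ ≤ (‖x‖ * ‖v‖) * C' := by
            gcongr
            · exact norm_inner_le_norm x v
            · exact hC' x
        _ = _ := by ring)
  simp only [smul_eq_mul] at h1 h2
  rw [h1, ← integral_neg]
  have e : ∀ x : Rd d, -(inner ℝ (gradK lam x) v * φ x)
      = gradKScalar lam x * (inner ℝ x v * φ x) := fun x => by
    rw [gradK, inner_neg_left, inner_smul_left]; simp; ring
  simp_rw [e]
  rw [h2]
  refine setIntegral_congr_fun measurableSet_Ioi fun t _ => ?_
  rw [integral_heat_fderiv hφ hc v]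

lemma fderiv_apply_self_bound {φ : Rd d → ℝ} (hφ : ContDiff ℝ 1 φ) (hc : HasCompactSupport φ) :
    ∃ C, 0 ≤ C ∧ ∀ x v, ‖fderiv ℝ φ x v‖ ≤ C * ‖v‖ := by
  obtain ⟨C, hC⟩ := (hφ.continuous_fderiv (by norm_num)).bounded_above_of_compact_support
    (hc.fderiv (𝕜 := ℝ))
  exact ⟨C, (norm_nonneg _).trans (hC 0), fun x v =>
    ((fderiv ℝ φ x).le_opNorm v).trans (by gcongr; exact hC x)⟩

/-- `resK lam` is the fundamental solution of `-Δ + lam`: along each ray `t ↦ √t • y` the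
integrand is the derivative of `-e^{-lam t} φ(√t y)`. -/
lemma integral_gradK_fderiv_add {lam : ℝ} (hl : 0 < lam) {φ : Rd d → ℝ} (hφ : ContDiff ℝ 1 φ)
    (hc : HasCompactSupport φ) :
    (∫ x, fderiv ℝ φ x (gradK lam x)) + lam * ∫ x, resK lam x * φ x = φ 0 := by
  obtain ⟨C, hC0, hC⟩ := fderiv_apply_self_bound hφ hc
  obtain ⟨C', hC'⟩ := hφ.continuous.bounded_above_of_compact_support hc
  have hφc := hφ.continuous
  have hfd : Continuous (fun x : Rd d => fderiv ℝ φ x x) :=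
    (hφ.continuous_fderiv (by norm_num)).clm_apply continuous_id
  have hC'0 : 0 ≤ C' := (norm_nonneg _).trans (hC' 0)
  have h1 := integral_resK_smul hl hφc.aestronglyMeasurable hC'
  have h2 := integral_gradKScalar_smul hl (F := fun x => fderiv ℝ φ x x) (C := C)
    hfd.aestronglyMeasurable (fun x => hC x x)
  simp only [smul_eq_mul] at h1 h2
  have e : ∀ x : Rd d, fderiv ℝ φ x (gradK lam x) = -(gradKScalar lam x * fderiv ℝ φ x x) :=
    fun x => by simp [gradK]
  simp_rw [e]
  rw [integral_neg, h1, h2]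
  -- the substitution `x = √t y` in both terms
  set A : ℝ → Rd d → ℝ := fun t y => heat 1 y * (Real.exp (-(lam * t)) *
    (lam * φ (√t • y) - fderiv ℝ φ (√t • y) (√t • y) / (2 * t))) with hA
  have k1 : ∀ t ∈ Set.Ioi (0 : ℝ), Real.exp (-(lam * t)) * ∫ x : Rd d, heat t x * φ x
      = ∫ y, heat 1 y * (Real.exp (-(lam * t)) * φ (√t • y)) := fun t ht => by
    have := integral_comp_sqrt_smul (d := d) ht φ
    simp only [smul_eq_mul] at this
    rw [this, ← integral_const_mul]
    congr 1; ext y; ring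
  have k2 : ∀ t ∈ Set.Ioi (0 : ℝ),
      Real.exp (-(lam * t)) * ∫ x : Rd d, heat t x / (2 * t) * fderiv ℝ φ x x
      = ∫ y, heat 1 y * (Real.exp (-(lam * t)) *
          (fderiv ℝ φ (√t • y) (√t • y) / (2 * t))) := fun t ht => by
    have := integral_comp_sqrt_smul (d := d) ht (fun x => fderiv ℝ φ x x / (2 * t))
    simp only [smul_eq_mul] at this
    have e3 : ∀ x : Rd d, heat t x / (2 * t) * fderiv ℝ φ x x
      = heat t x * (fderiv ℝ φ x x / (2 * t)) := fun x => by ring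
    simp_rw [e3]
    rw [this, ← integral_const_mul]
    congr 1; ext y; ring
  rw [setIntegral_congr_fun measurableSet_Ioi k1, setIntegral_congr_fun measurableSet_Ioi k2]
  have i1 : Integrable (Function.uncurry fun (t : ℝ) (y : Rd d) =>
      heat 1 y * (Real.exp (-(lam * t)) * φ (√t • y)))
      ((volume.restrict (Set.Ioi 0)).prod volume) := by
    have hd := ((exp_neg_integrableOn_Ioi 0 hl).mul_prod
      (integrable_heat (d := d) one_pos)).const_mul C'
    refine hd.mono' ?_ (Eventually.of_forall fun p => ?_)
    · apply Continuous.aestronglyMeasurable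
      simp only [Function.uncurry_def]
      fun_prop
    · simp only [Function.uncurry]
      rw [norm_mul, norm_mul, Real.norm_of_nonneg (heat_nonneg zero_le_one _),
        Real.norm_of_nonneg (Real.exp_pos _).le]
      have h0 := heat_nonneg zero_le_one p.2
      calc _ ≤ heat 1 p.2 * (Real.exp (-(lam * p.1)) * C') := by gcongr; exact hC' _
        _ = _ := by rw [neg_mul]; ring
  have i2 : Integrable (Function.uncurry fun (t : ℝ) (y : Rd d) =>
      heat 1 y * (Real.exp (-(lam * t)) * (fderiv ℝ φ (√t • y) (√t • y) / (2 * t))))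
      ((volume.restrict (Set.Ioi 0)).prod volume) := by
    have hh : Integrable (fun y : Rd d => ‖y‖ * heat 1 y) := by
      refine ((integrable_heat (d := d) (t := 2) two_pos).const_mul
        (2 * 2 ^ ((d : ℝ) / 2))).mono' (Continuous.aestronglyMeasurable (by fun_prop))
        (Eventually.of_forall fun y => ?_)
      have := norm_mul_heat_le one_pos y
      have h0 := heat_nonneg zero_le_one y
      rw [Real.norm_of_nonneg (by positivity)]
      simp only [Real.one_rpow, mul_one] at this
      linarith
    have hd := ((integrableOn_rpow_mul_exp_neg_mul_rpow (p := 1) (s := -(1 / 2)) (b := lam)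
          (by norm_num) one_pos hl).mul_prod hh).const_mul C
    refine hd.mono' ?_ ?_
    · apply Measurable.aestronglyMeasurable
      simp only [Function.uncurry_def]
      have m1 : Measurable fun p : ℝ × Rd d => fderiv ℝ φ (√p.1 • p.2) (√p.1 • p.2) :=
        hfd.measurable.comp (by fun_prop : Measurable fun p : ℝ × Rd d => √p.1 • p.2)
      fun_prop
    · have : ∀ᵐ p : ℝ × Rd d ∂((volume.restrict (Set.Ioi 0)).prod volume), 0 < p.1 :=
        Measure.quasiMeasurePreserving_fst.ae
          ((ae_restrict_iff' measurableSet_Ioi).2 (Eventually.of_forall fun t ht => ht))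
      filter_upwards [this] with p hp
      have h0 := heat_nonneg zero_le_one p.2
      simp only [Function.uncurry]
      rw [norm_mul, norm_mul, norm_div, Real.norm_of_nonneg h0,
        Real.norm_of_nonneg (Real.exp_pos _).le, Real.norm_of_nonneg (by positivity : 0 ≤ 2 * p.1)]
      have hb := hC (√p.1 • p.2) (√p.1 • p.2)
      rw [norm_smul, Real.norm_of_nonneg (Real.sqrt_nonneg _)] at hb
      have e4 : p.1 ^ (-(1 / 2) : ℝ) = 1 / √p.1 := by
        rw [Real.rpow_neg hp.le, ← Real.sqrt_eq_rpow, one_div]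
      have hsp : 0 < √p.1 := Real.sqrt_pos.2 hp
      have e5 : √p.1 / (2 * p.1) ≤ 1 / √p.1 := by
        rw [div_le_div_iff₀ (by positivity) hsp, Real.mul_self_sqrt hp.le]; linarith
      calc _ ≤ heat 1 p.2 * (Real.exp (-(lam * p.1)) * (C * (√p.1 * ‖p.2‖) / (2 * p.1))) := by
            gcongr
        _ = C * ((√p.1 / (2 * p.1)) * Real.exp (-(lam * p.1)) * (‖p.2‖ * heat 1 p.2)) := by ring
        _ ≤ C * ((1 / √p.1) * Real.exp (-(lam * p.1)) * (‖p.2‖ * heat 1 p.2)) := by gcongr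
        _ = _ := by rw [e4, neg_mul, Real.rpow_one]
  rw [integral_integral_swap i1, integral_integral_swap i2, ← integral_const_mul, ← sub_eq_neg_add,
    ← integral_sub]
  rotate_left
  · exact (i1.integral_prod_right).const_mul lam
  · exact i2.integral_prod_right
  have key : ∀ᵐ y : Rd d, (lam * ∫ t in Set.Ioi (0 : ℝ), heat 1 y * (Real.exp (-(lam * t)) * φ (√t • y)))
      - ∫ t in Set.Ioi (0 : ℝ), heat 1 y * (Real.exp (-(lam * t)) *
          (fderiv ℝ φ (√t • y) (√t • y) / (2 * t))) = heat 1 y * φ 0 := by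
    filter_upwards [i1.prod_left_ae, i2.prod_left_ae] with y h1 h2
    simp only [Function.uncurry] at h1 h2
    rw [← integral_const_mul, ← integral_sub (h1.const_mul lam) h2]
    -- the fundamental theorem of calculus along the ray through `y`
    have hder : ∀ t ∈ Set.Ioi (0 : ℝ), HasDerivAt
        (fun t : ℝ => -(heat 1 y * (Real.exp (-(lam * t)) * φ (√t • y))))
        (lam * (heat 1 y * (Real.exp (-(lam * t)) * φ (√t • y))) -
          heat 1 y * (Real.exp (-(lam * t)) * (fderiv ℝ φ (√t • y) (√t • y) / (2 * t)))) t := by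
      intro t ht
      have ht' : (0 : ℝ) < t := ht
      have hst : 0 < √t := Real.sqrt_pos.2 ht'
      have d1 : HasDerivAt (fun t : ℝ => √t • y) ((1 / (2 * √t)) • y) t :=
        (Real.hasDerivAt_sqrt ht'.ne').smul_const y
      have d2 : HasDerivAt (fun t : ℝ => φ (√t • y)) (fderiv ℝ φ (√t • y) ((1 / (2 * √t)) • y)) t :=
        ((hφ.differentiable (by norm_num)) (√t • y)).hasFDerivAt.comp_hasDerivAt t d1
      have d3 : HasDerivAt (fun t : ℝ => Real.exp (-(lam * t)))
          (Real.exp (-(lam * t)) * (-(lam * 1))) t :=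
        (((hasDerivAt_id t).const_mul lam).neg).exp
      have := ((d3.mul d2).const_mul (heat 1 y)).neg
      refine this.congr_deriv ?_
      rw [map_smul, map_smul, smul_eq_mul, smul_eq_mul]
      have : √t / (2 * t) = 1 / (2 * √t) := by
        rw [div_eq_div_iff (by positivity) (by positivity)]
        have := Real.mul_self_sqrt ht'.le
        linear_combination 2 * this
      rw [← this]
      ring
    have hlim : Tendsto (fun t : ℝ => -(heat 1 y * (Real.exp (-(lam * t)) * φ (√t • y))))
        atTop (𝓝 0) := by
      have hexp : Tendsto (fun t : ℝ => Real.exp (-(lam * t)) * (heat 1 y * C')) atTop (𝓝 0) := by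
        have : Tendsto (fun t : ℝ => Real.exp (-(lam * t))) atTop (𝓝 0) :=
          Real.tendsto_exp_neg_atTop_nhds_zero.comp (tendsto_id.const_mul_atTop hl)
        simpa using this.mul_const (heat 1 y * C')
      refine squeeze_zero_norm (fun t => ?_) hexp
      have h0 := heat_nonneg zero_le_one y
      rw [norm_neg, norm_mul, norm_mul, Real.norm_of_nonneg h0,
        Real.norm_of_nonneg (Real.exp_pos _).le]
      calc _ ≤ heat 1 y * (Real.exp (-(lam * t)) * C') := by gcongr; exact hC' _
        _ = _ := by ring
    rw [integral_Ioi_of_hasDerivAt_of_tendsto _ hder ((h1.const_mul lam).sub h2) hlim]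
    · simp
    · exact Continuous.continuousWithinAt (by fun_prop)
  rw [integral_congr_ae key, integral_mul_const, integral_heat one_pos, one_mul]

end ResolventKernel

/-! ### Weak gradients: passing from test functions to `H¹` -/

section WeakGradient

variable {d : ℕ}

lemma measurePreserving_shear {Z : Type*} [MeasurableSpace Z] (ν : Measure Z) [SFinite ν]
    {L : Z → Rd d} (hL : Measurable L) :
    MeasurePreserving (fun q : Rd d × Z => (q.1 + L q.2, q.2))
      ((volume : Measure (Rd d)).prod ν) ((volume : Measure (Rd d)).prod ν) := by
  have h1 : MeasurePreserving (fun q : Z × Rd d => (q.1, q.2 + L q.1)) (ν.prod volume)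
      (ν.prod (volume : Measure (Rd d))) :=
    MeasurePreserving.skew_product (g := fun z x => x + L z) (MeasurePreserving.id ν)
      (by fun_prop)
      (Eventually.of_forall fun z => (measurePreserving_add_right volume (L z)).map_eq)
  exact (Measure.measurePreserving_swap.comp h1).comp Measure.measurePreserving_swap

/-- Fubini's condition for `∬ K(z) p(x) v(x + L z)`, with `K` integrable and `p`, `v` square
integrable. -/
lemma integrable_kernel_mul_translate {L : Rd d → Rd d} (hL : Measurable L) {K : Rd d → ℝ}
    (hK : Integrable K) {p v : Rd d → ℂ} (hp : MemLp p 2 volume) (hv : MemLp v 2 volume) :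
    Integrable (fun q : Rd d × Rd d => (K q.2 : ℂ) * (p q.1 * v (q.1 + L q.2)))
      (volume.prod volume) := by
  have hsh := measurePreserving_shear (volume : Measure (Rd d)) hL
  have h1 : Integrable (fun q : Rd d × Rd d => ‖p q.1‖ ^ 2 * ‖K q.2‖) (volume.prod volume) :=
    (hp.norm.integrable_sq).mul_prod hK.norm
  have h2 : Integrable (fun q : Rd d × Rd d => ‖v q.1‖ ^ 2 * ‖K q.2‖) (volume.prod volume) :=
    (hv.norm.integrable_sq).mul_prod hK.norm
  have h3 : Integrable (fun q : Rd d × Rd d => ‖v (q.1 + L q.2)‖ ^ 2 * ‖K q.2‖)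
      (volume.prod volume) := hsh.integrable_comp_of_integrable h2
  refine (h1.add h3).mono' ?_ (Eventually.of_forall fun q => ?_)
  · have hv' : AEStronglyMeasurable (fun q : Rd d × Rd d => v (q.1 + L q.2))
        (volume.prod volume) :=
      (hv.aestronglyMeasurable.comp_fst (ν := (volume : Measure (Rd d)))).comp_measurePreserving hsh
    have hK' : AEStronglyMeasurable (fun q : Rd d × Rd d => (K q.2 : ℂ)) (volume.prod volume) :=
      Complex.continuous_ofReal.comp_aestronglyMeasurable hK.aestronglyMeasurable.comp_snd
    exact hK'.mul (hp.aestronglyMeasurable.comp_fst.mul hv')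
  · simp only [Pi.add_apply]
    rw [norm_mul, norm_mul, Complex.norm_real]
    have := norm_nonneg (K q.2)
    nlinarith [sq_nonneg (‖p q.1‖ - ‖v (q.1 + L q.2)‖), norm_nonneg (p q.1),
      norm_nonneg (v (q.1 + L q.2)), sq_nonneg (‖p q.1‖), sq_nonneg (‖v (q.1 + L q.2)‖),
      mul_nonneg this (sq_nonneg (‖p q.1‖ - ‖v (q.1 + L q.2)‖)),
      mul_nonneg this (sq_nonneg ‖p q.1‖), mul_nonneg this (sq_nonneg ‖v (q.1 + L q.2)‖)]

lemma continuous_integral_mul_translate {p v : Rd d → ℂ} (hp : MemLp p 2 volume)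
    (hv : MemLp v 2 volume) : Continuous fun z : Rd d => ∫ x, p x * v (x - z) := by
  let g : Rd d → C(Rd d, Rd d) := fun z => ⟨fun x => x - z, by fun_prop⟩
  have hg : Continuous g := by
    have : Continuous fun a : Rd d × Rd d => a.2 - a.1 := by fun_prop
    exact (ContinuousMap.curry ⟨_, this⟩).continuous
  have hgm : ∀ z, MeasurePreserving (g z) (volume : Measure (Rd d)) volume :=
    fun z => measurePreserving_sub_right volume z
  have hc := (continuous_const (y := hv.toLp v)).compMeasurePreservingLp hg hgm (by simp)
  have hi := (continuous_const (y := (hp.star).toLp (star p))).inner (𝕜 := ℂ) hc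
  refine hi.congr fun z => ?_
  rw [L2.inner_def]
  refine integral_congr_ae ?_
  filter_upwards [(hp.star).coeFn_toLp, Lp.coeFn_compMeasurePreserving (hv.toLp v) (hgm z),
    (hgm z).quasiMeasurePreserving.ae_eq_comp hv.coeFn_toLp] with x h1 h2 h3
  rw [h1, h2, h3]
  simp [g, mul_comm]

lemma integral_kernel_mul_integral {K : Rd d → ℝ}
    (hK : Integrable K) {p v : Rd d → ℂ} (hp : MemLp p 2 volume) (hv : MemLp v 2 volume) :
    ∫ z, (K z : ℂ) * ∫ x, p x * v (x - z) = ∫ x, p x * ∫ z, (K z : ℂ) * v (x - z) := by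
  have h := integrable_kernel_mul_translate (L := fun z => -z) measurable_neg hK hp hv
  simp_rw [← sub_eq_add_neg] at h
  simp_rw [← integral_const_mul]
  rw [integral_integral_swap]
  · congr 1; ext x; congr 1; ext z; ring
  · exact h.swap

lemma integral_kernel_mul_integral' {K : Rd d → ℝ}
    (hK : Integrable K) {p v : Rd d → ℂ} (hp : MemLp p 2 volume) (hv : MemLp v 2 volume) :
    ∫ z, (K z : ℂ) * ∫ x, p x * v (x - z) = ∫ y, v y * ∫ z, (K z : ℂ) * p (y + z) := by
  have h := integrable_kernel_mul_translate (L := fun z => z) measurable_id hK hv hp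
  have e : ∀ z, ∫ x, p x * v (x - z) = ∫ y, v y * p (y + z) := fun z => by
    rw [← integral_add_right_eq_self (fun x => p x * v (x - z)) z]
    congr 1; ext x; simp [mul_comm]
  simp_rw [e, ← integral_const_mul]
  rw [integral_integral_swap]
  · congr 1; ext x; congr 1; ext z; ring
  · exact h.swap

lemma integrable_mul_integral_kernel {K : Rd d → ℝ} (hK : Integrable K) {p v : Rd d → ℂ}
    (hp : MemLp p 2 volume) (hv : MemLp v 2 volume) :
    Integrable fun y => v y * ∫ z, (K z : ℂ) * p (y + z) := by
  have := (integrable_kernel_mul_translate (L := fun z => z) measurable_id hK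
    hv hp).integral_prod_left
  refine this.congr (Eventually.of_forall fun y => ?_)
  simp only [← integral_const_mul]
  congr 1; ext z; ring

lemma integrable_kernel_mul_comp_add {K : Rd d → ℝ} (hK : Continuous K)
    (hKc : HasCompactSupport K) {q : Rd d → ℂ} (hq : MemLp q 2 volume) (y : Rd d) :
    Integrable fun z => (K z : ℂ) * q (y + z) := by
  have hq' : MemLp (fun z => q (y + z)) 2 volume :=
    hq.comp_measurePreserving (measurePreserving_add_left volume y)
  have hK' : MemLp (fun z => (K z : ℂ)) 2 volume :=
    (Complex.continuous_ofReal.comp hK).memLp_of_hasCompactSupport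
      (hKc.comp_left (g := fun r : ℝ => (r : ℂ)) (by simp))
  exact hK'.integrable_mul hq'

lemma integrable_kernel_mul_integral {K : Rd d → ℝ} (hK : Continuous K)
    (hKc : HasCompactSupport K) {p v : Rd d → ℂ} (hp : MemLp p 2 volume) (hv : MemLp v 2 volume) :
    Integrable fun z => (K z : ℂ) * ∫ x, p x * v (x - z) :=
  (((Complex.continuous_ofReal.comp hK)).mul
    (continuous_integral_mul_translate hp hv)).integrable_of_hasCompactSupport
    ((hKc.comp_left (g := fun r : ℝ => (r : ℂ)) (by simp)).mul_right)

lemma MemH1.memLp_grad_apply {u : Rd d → ℂ} {g : Rd d → EuclideanSpace ℂ (Fin d)}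
    (h : MemH1 u g) (j : Fin d) : MemLp (fun x => g x j) 2 volume :=
  h.memLp_grad.eval_piLp j

lemma fderiv_comp_const_sub' {φ : Rd d → ℝ} (hφ : Differentiable ℝ φ) (x y v : Rd d) :
    fderiv ℝ (fun y => φ (x - y)) y v = -fderiv ℝ φ (x - y) v := by
  have := (hφ (x - y)).hasFDerivAt.comp y ((hasFDerivAt_id y).const_sub x)
  rw [HasFDerivAt.fderiv (f := fun y => φ (x - y)) this]
  simp

lemma hasCompactSupport_comp_const_sub {φ : Rd d → ℝ} (hc : HasCompactSupport φ) (x : Rd d) :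
    HasCompactSupport (fun y => φ (x - y)) :=
  hc.comp_homeomorph (Homeomorph.subLeft x)

lemma hasCompactSupport_comp_add_right {φ : Rd d → ℝ} (hc : HasCompactSupport φ) (x : Rd d) :
    HasCompactSupport (fun y => φ (y + x)) :=
  hc.comp_homeomorph (Homeomorph.addRight x)

/-- A functional `(v, ∇v) ↦ ∫ U · ∇v + p v` with square integrable `U` and `p` which vanishes on
the real test functions vanishes on `H¹`.  It is tested on the translates of a test function `ρ`,
and the result, integrated against `v`, says that the continuous function
`z ↦ ∫ U(x) · ∇v(x - z) + p(x) v(x - z) dx` is orthogonal to every test function `ρ`. -/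
theorem MemH1.integral_eq_zero_of_test {U : Rd d → EuclideanSpace ℂ (Fin d)} {p : Rd d → ℂ}
    (hU : MemLp U 2 volume) (hp : MemLp p 2 volume)
    (h : ∀ φ : Rd d → ℝ, ContDiff ℝ ((⊤ : ℕ∞) : WithTop ℕ∞) φ → HasCompactSupport φ →
      ∫ x, ((∑ j, U x j * ((fderiv ℝ φ x (EuclideanSpace.single j 1) : ℝ) : ℂ))
        + p x * ((φ x : ℝ) : ℂ)) = 0)
    {v : Rd d → ℂ} {g : Rd d → EuclideanSpace ℂ (Fin d)} (hv : MemH1 v g) :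
    ∫ x, ((∑ j, U x j * g x j) + p x * v x) = 0 := by
  have hUj : ∀ j, MemLp (fun x => U x j) 2 volume := fun j => hU.eval_piLp j
  have hgj := hv.memLp_grad_apply
  set F : Rd d → ℂ := fun z => (∑ j, ∫ x, U x j * g (x - z) j) + ∫ x, p x * v (x - z) with hF
  have hFc : Continuous F := by
    refine (continuous_finsetSum _ fun j _ => ?_).add
      (continuous_integral_mul_translate hp hv.memLp)
    exact continuous_integral_mul_translate (hUj j) (hgj j)
  have hF0 : ∀ᵐ z, F z = 0 := by
    refine ae_eq_zero_of_integral_contDiff_smul_eq_zero hFc.locallyIntegrable fun ρ hρ hρc => ?_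
    have hρi : Integrable ρ := hρ.continuous.integrable_of_hasCompactSupport hρc
    have hρ1 : ContDiff ℝ 1 ρ := hρ.of_le (by exact_mod_cast le_top)
    have hdc : ∀ j : Fin d, Continuous (fun x => fderiv ℝ ρ x (EuclideanSpace.single j 1)) :=
      fun j => (hρ1.continuous_fderiv (by norm_num)).clm_apply continuous_const
    have hds : ∀ j : Fin d, HasCompactSupport (fun x => fderiv ℝ ρ x (EuclideanSpace.single j 1)) :=
      fun j => hρc.fderiv_apply (𝕜 := ℝ) _
    have hdi : ∀ j : Fin d, Integrable (fun x => fderiv ℝ ρ x (EuclideanSpace.single j 1)) :=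
      fun j => (hdc j).integrable_of_hasCompactSupport (hds j)
    -- the derivative is moved from `v` to `ρ`, for fixed `x`
    have s1 : ∀ j, ∫ z, (ρ z : ℂ) * ∫ x, U x j * g (x - z) j
        = ∫ z, ((fderiv ℝ ρ z (EuclideanSpace.single j 1) : ℝ) : ℂ) * ∫ x, U x j * v (x - z) := by
      intro j
      rw [integral_kernel_mul_integral hρi (hUj j) (hgj j),
        integral_kernel_mul_integral (hdi j) (hUj j) hv.memLp]
      congr 1; ext x; congr 1
      have hw := hv.weakGradient.2.2 (fun y => ρ (x - y))
        (hρ.comp (contDiff_const.sub contDiff_id)) (hasCompactSupport_comp_const_sub hρc x) j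
      simp only [fderiv_comp_const_sub' (hρ1.differentiable (by norm_num))] at hw
      rw [← integral_sub_left_eq_self (fun z => (ρ z : ℂ) * g (x - z) j) volume x,
        ← integral_sub_left_eq_self (fun z => ((fderiv ℝ ρ z (EuclideanSpace.single j 1) : ℝ) : ℂ) *
          v (x - z)) volume x]
      simp only [sub_sub_cancel]
      simp only [mul_neg, integral_neg, neg_inj, RCLike.ofReal_neg] at hw
      simp_rw [mul_comm] at hw ⊢
      exact hw.symm
    have s2 : ∫ z, ρ z • F z = ∫ y, v y * ∫ z,
        ((∑ j, U (y + z) j * ((fderiv ℝ ρ z (EuclideanSpace.single j 1) : ℝ) : ℂ))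
          + p (y + z) * ((ρ z : ℝ) : ℂ)) := by
      have e1 : ∀ y, ∫ z, ((∑ j, U (y + z) j *
            ((fderiv ℝ ρ z (EuclideanSpace.single j 1) : ℝ) : ℂ)) + p (y + z) * ((ρ z : ℝ) : ℂ))
          = (∑ j, ∫ z, ((fderiv ℝ ρ z (EuclideanSpace.single j 1) : ℝ) : ℂ) * U (y + z) j)
            + ∫ z, (ρ z : ℂ) * p (y + z) := by
        intro y
        simp_rw [mul_comm (U _ _), mul_comm (p _)]
        rw [integral_add, integral_finsetSum]
        · exact fun j _ => integrable_kernel_mul_comp_add (hdc j) (hds j) (hUj j) y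
        · exact integrable_finsetSum _ fun j _ => integrable_kernel_mul_comp_add (hdc j) (hds j) (hUj j) y
        · exact integrable_kernel_mul_comp_add hρ.continuous hρc hp y
      have e3 : ∀ z, ρ z • F z = (∑ j, (ρ z : ℂ) * ∫ x, U x j * g (x - z) j)
          + (ρ z : ℂ) * ∫ x, p x * v (x - z) := fun z => by
        simp only [hF, Complex.real_smul, mul_add, Finset.mul_sum]
      have e4 : ∀ y, v y * ((∑ j, ∫ z, ((fderiv ℝ ρ z (EuclideanSpace.single j 1) : ℝ) : ℂ) *
            U (y + z) j) + ∫ z, (ρ z : ℂ) * p (y + z))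
          = (∑ j, v y * ∫ z, ((fderiv ℝ ρ z (EuclideanSpace.single j 1) : ℝ) : ℂ) * U (y + z) j)
            + v y * ∫ z, (ρ z : ℂ) * p (y + z) := fun y => by
        rw [mul_add, Finset.mul_sum]
      rw [integral_congr_ae (Eventually.of_forall e3)]
      simp only [e1, e4]
      rw [integral_add (integrable_finsetSum _ fun j _ =>
          integrable_kernel_mul_integral hρ.continuous hρc (hUj j) (hgj j))
          (integrable_kernel_mul_integral hρ.continuous hρc hp hv.memLp),
        integral_finsetSum _ fun j _ =>
          integrable_kernel_mul_integral hρ.continuous hρc (hUj j) (hgj j),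
        integral_add (integrable_finsetSum _ fun j _ =>
          integrable_mul_integral_kernel (hdi j) (hUj j) hv.memLp)
          (integrable_mul_integral_kernel hρi hp hv.memLp),
        integral_finsetSum _ fun j _ => integrable_mul_integral_kernel (hdi j) (hUj j) hv.memLp,
        integral_kernel_mul_integral' hρi hp hv.memLp]
      congr 1
      refine Finset.sum_congr rfl fun j _ => ?_
      rw [s1, integral_kernel_mul_integral' (hdi j) (hUj j) hv.memLp]
    rw [s2]
    -- the hypothesis, applied to the translate of `ρ` by `y`
    have e2 : ∀ y, ∫ z, ((∑ j, U (y + z) j *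
          ((fderiv ℝ ρ z (EuclideanSpace.single j 1) : ℝ) : ℂ)) + p (y + z) * ((ρ z : ℝ) : ℂ))
        = 0 := by
      intro y
      have := h (fun x => ρ (x + -y)) (hρ.comp (contDiff_id.add contDiff_const))
        (hasCompactSupport_comp_add_right hρc (-y))
      simp only [fderiv_comp_add_right] at this
      rw [← this]
      conv_rhs => rw [← integral_add_left_eq_self _ y]
      simp
    simp [e2]
  have hF00 : F 0 = 0 := by
    have := (hFc.ae_eq_iff_eq volume continuous_const (g := fun _ => (0 : ℂ))).1 hF0
    exact congrFun this 0
  rw [← hF00, hF]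
  simp only [sub_zero]
  rw [integral_add, integral_finsetSum]
  · exact fun j _ => (hUj j).integrable_mul (hgj j)
  · exact integrable_finsetSum _ fun j _ => (hUj j).integrable_mul (hgj j)
  · exact hp.integrable_mul hv.memLp

end WeakGradient

/-! ### Convolution with the resolvent kernel -/

section Lintegral

variable {X : Type*} [MeasurableSpace X] {μ : Measure X}

lemma eLpNorm_two_sq {E : Type*} [NormedAddCommGroup E] (f : X → E) :
    eLpNorm f 2 μ ^ 2 = ∫⁻ x, ‖f x‖ₑ ^ 2 ∂μ := by
  rw [eLpNorm_eq_lintegral_rpow_enorm_toReal (by simp) (by simp), ← ENNReal.rpow_natCast,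
    ← ENNReal.rpow_mul]
  simp

lemma sq_lintegral_mul_le {f g : X → ℝ≥0∞} (hf : AEMeasurable f μ) (hg : AEMeasurable g μ) :
    (∫⁻ x, f x * g x ∂μ) ^ 2 ≤ (∫⁻ x, f x ^ 2 ∂μ) * ∫⁻ x, g x ^ 2 ∂μ := by
  have h := ENNReal.lintegral_mul_le_Lp_mul_Lq μ Real.HolderConjugate.two_two hf hg
  simp only [Pi.mul_apply, ENNReal.rpow_two] at h
  calc _ ≤ ((∫⁻ x, f x ^ 2 ∂μ) ^ (1 / 2 : ℝ) * (∫⁻ x, g x ^ 2 ∂μ) ^ (1 / 2 : ℝ)) ^ 2 := by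
        gcongr
    _ = _ := by
        rw [mul_pow, ← ENNReal.rpow_natCast, ← ENNReal.rpow_natCast, ← ENNReal.rpow_mul,
          ← ENNReal.rpow_mul]
        simp

lemma sq_lintegral_weight_mul_le {k g : X → ℝ≥0∞} (hk : AEMeasurable k μ)
    (hg : AEMeasurable g μ) :
    (∫⁻ x, k x * g x ∂μ) ^ 2 ≤ (∫⁻ x, k x ∂μ) * ∫⁻ x, k x * g x ^ 2 ∂μ := by
  have h := sq_lintegral_mul_le (μ := μ) (hk.pow_const (1 / 2 : ℝ))
    ((hk.pow_const (1 / 2 : ℝ)).mul hg)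
  have e : ∀ x, k x ^ (1 / 2 : ℝ) * k x ^ (1 / 2 : ℝ) = k x := fun x => by
    rw [← ENNReal.rpow_add_of_nonneg _ _ (by norm_num) (by norm_num)]; norm_num
  simp only [Pi.mul_apply, mul_pow, ← mul_assoc, sq (k _ ^ (1 / 2 : ℝ)), e] at h
  exact h

variable {Z : Type*} [MeasurableSpace Z] {ν : Measure Z}

/-- Young's inequality for the action of a family of measure preserving maps on `L²`. -/
lemma lintegral_sq_average_le [SFinite μ] [SFinite ν] {T : Z → X → X}
    (hT : Measurable (Function.uncurry T)) (hmp : ∀ z, MeasurePreserving (T z) μ μ)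
    {k : Z → ℝ≥0∞} (hk : Measurable k) {G : X → ℝ≥0∞} (hG : Measurable G) :
    ∫⁻ x, (∫⁻ z, k z * G (T z x) ∂ν) ^ 2 ∂μ ≤ (∫⁻ z, k z ∂ν) ^ 2 * ∫⁻ x, G x ^ 2 ∂μ := by
  have hGT : Measurable fun q : X × Z => G (T q.2 q.1) :=
    hG.comp (hT.comp measurable_swap)
  calc ∫⁻ x, (∫⁻ z, k z * G (T z x) ∂ν) ^ 2 ∂μ
      ≤ ∫⁻ x, (∫⁻ z, k z ∂ν) * ∫⁻ z, k z * G (T z x) ^ 2 ∂ν ∂μ := by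
        gcongr with x
        exact sq_lintegral_weight_mul_le hk.aemeasurable
          (hGT.comp measurable_prodMk_left).aemeasurable
    _ = (∫⁻ z, k z ∂ν) * ∫⁻ z, k z * ∫⁻ x, G (T z x) ^ 2 ∂μ ∂ν := by
        have hm : Measurable fun q : X × Z => k q.2 * G (T q.2 q.1) ^ 2 :=
          (hk.comp measurable_snd).mul (hGT.pow_const 2)
        rw [lintegral_const_mul _ hm.lintegral_prod_right', lintegral_lintegral_swap hm.aemeasurable]
        congr 1
        refine lintegral_congr fun z => ?_
        simp only
        rw [lintegral_const_mul]
        exact (hGT.comp measurable_prodMk_right).pow_const 2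
    _ = (∫⁻ z, k z ∂ν) ^ 2 * ∫⁻ x, G x ^ 2 ∂μ := by
        simp_rw [(hmp _).lintegral_comp (hG.pow_const 2)]
        rw [lintegral_mul_const _ hk, sq, mul_assoc]

end Lintegral

section Convolution

variable {d : ℕ}

/-- The convolution of a function with a real kernel. -/
def conv {𝕜 : Type*} [RCLike 𝕜] (K : Rd d → ℝ) (F : Rd d → 𝕜) (x : Rd d) : 𝕜 :=
  ∫ z, K z • F (x - z)

/-- The convolution of a function with the gradient of the resolvent kernel. -/
def gradConv {𝕜 : Type*} [RCLike 𝕜] (lam : ℝ) (F : Rd d → 𝕜) (x : Rd d) :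
    EuclideanSpace 𝕜 (Fin d) :=
  WithLp.toLp 2 fun j => conv (fun z => gradK lam z j) F x

lemma integrable_gradK_apply {lam : ℝ} (hl : 0 < lam) (j : Fin d) :
    Integrable fun z : Rd d => gradK lam z j :=
  (EuclideanSpace.proj (𝕜 := ℝ) j).integrable_comp (integrable_gradK hl)

variable {𝕜 : Type*} [RCLike 𝕜]

lemma conv_congr_ae {K : Rd d → ℝ} {F F' : Rd d → 𝕜} (h : F =ᵐ[volume] F') (x : Rd d) :
    conv K F x = conv K F' x := by
  have h1 : (fun z => F (x - z)) =ᵐ[volume] fun z => F' (x - z) :=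
    (Measure.measurePreserving_sub_left volume x).quasiMeasurePreserving.ae_eq_comp h
  refine integral_congr_ae ?_
  filter_upwards [h1] with z hz
  rw [hz]

lemma enorm_conv_le (K : Rd d → ℝ) (F : Rd d → 𝕜) (x : Rd d) :
    ‖conv K F x‖ₑ ≤ ∫⁻ z, ‖K z‖ₑ * ‖F (x - z)‖ₑ :=
  (enorm_integral_le_lintegral_enorm _).trans (by simp only [enorm_smul]; exact le_rfl)

lemma norm_conv_le {K : Rd d → ℝ} (hK : Integrable K) {F : Rd d → 𝕜} {C : ℝ}
    (hC : ∀ x, ‖F x‖ ≤ C) (x : Rd d) : ‖conv K F x‖ ≤ (∫ z, ‖K z‖) * C := by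
  rw [← integral_mul_const]
  refine norm_integral_le_of_norm_le (hK.norm.mul_const C) (Eventually.of_forall fun z => ?_)
  rw [norm_smul]
  gcongr
  exact hC _

lemma stronglyMeasurable_conv_prod {Ω : Type*} [MeasurableSpace Ω] {K : Rd d → ℝ}
    (hK : Measurable K) {F : Rd d × Ω → 𝕜} (hF : Measurable F) :
    StronglyMeasurable fun q : Rd d × Ω => conv K (fun x => F (x, q.2)) q.1 := by
  have : StronglyMeasurable fun p : (Rd d × Ω) × Rd d => K p.2 • F (p.1.1 - p.2, p.1.2) := by
    apply Measurable.stronglyMeasurable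
    exact (hK.comp measurable_snd).smul (hF.comp (by fun_prop))
  exact this.integral_prod_right'

lemma stronglyMeasurable_conv {K : Rd d → ℝ} (hK : Measurable K) {F : Rd d → 𝕜}
    (hF : Measurable F) : StronglyMeasurable (conv K F) := by
  have : StronglyMeasurable fun p : Rd d × Rd d => K p.2 • F (p.1 - p.2) := by
    apply Measurable.stronglyMeasurable
    exact (hK.comp measurable_snd).smul (hF.comp (by fun_prop))
  exact this.integral_prod_right'

lemma eLpNorm_conv_prod_le {Ω : Type*} [MeasurableSpace Ω] {P : Measure Ω} [SFinite P]
    {K : Rd d → ℝ} (hK : Measurable K) {F : Rd d × Ω → 𝕜} (hF : Measurable F) :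
    eLpNorm (fun q : Rd d × Ω => conv K (fun x => F (x, q.2)) q.1) 2 (volume.prod P)
      ≤ (∫⁻ z, ‖K z‖ₑ) * eLpNorm F 2 (volume.prod P) := by
  rw [← ENNReal.pow_le_pow_left_iff two_ne_zero, mul_pow, eLpNorm_two_sq, eLpNorm_two_sq]
  refine le_trans ?_ (lintegral_sq_average_le (μ := (volume : Measure (Rd d)).prod P)
    (ν := (volume : Measure (Rd d)))
    (T := fun z q => (q.1 - z, q.2)) (by simp only [Function.uncurry_def]; fun_prop)
    (fun z => (measurePreserving_sub_right volume z).prod (MeasurePreserving.id P))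
    hK.enorm hF.enorm)
  gcongr with q
  exact enorm_conv_le _ _ _

lemma memLp_conv {K : Rd d → ℝ} (hKm : Measurable K) (hK : Integrable K) {F : Rd d → 𝕜}
    (hF : MemLp F 2 volume) : MemLp (conv K F) 2 volume := by
  have e : conv K F = conv K (hF.1.mk F) := funext fun x => conv_congr_ae hF.1.ae_eq_mk x
  have hm : Measurable (hF.1.mk F) := hF.1.stronglyMeasurable_mk.measurable
  have hF' : MemLp (hF.1.mk F) 2 volume := hF.ae_eq hF.1.ae_eq_mk
  rw [e]
  refine ⟨(stronglyMeasurable_conv hKm hm).aestronglyMeasurable, ?_⟩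
  have h := lintegral_sq_average_le (μ := (volume : Measure (Rd d)))
    (ν := (volume : Measure (Rd d)))
    (T := fun z x => x - z) (by simp only [Function.uncurry_def]; fun_prop)
    (fun z => measurePreserving_sub_right volume z) hKm.enorm hm.enorm
  have h2 : eLpNorm (conv K (hF.1.mk F)) 2 volume ^ 2 < ⊤ := by
    rw [eLpNorm_two_sq]
    refine lt_of_le_of_lt (lintegral_mono fun x => ?_) (h.trans_lt ?_)
    · exact pow_le_pow_left' (enorm_conv_le _ _ _) 2
    · rw [← eLpNorm_two_sq]
      exact ENNReal.mul_lt_top (ENNReal.pow_lt_top hK.2) (ENNReal.pow_lt_top hF'.2)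
  exact (ENNReal.pow_lt_top_iff.1 h2).resolve_right two_ne_zero

/-- Fubini's condition for the pairing of `K * F` with a test function. -/
def TestIntegrable (F : Rd d → 𝕜) : Prop :=
  ∀ K : Rd d → ℝ, Integrable K → ∀ φ : Rd d → ℝ, Continuous φ → HasCompactSupport φ →
    Integrable (fun q : Rd d × Rd d => (K q.2 * φ (q.1 + q.2)) • F q.1) (volume.prod volume)

lemma testIntegrable_of_bounded {F : Rd d → 𝕜} (hF : AEStronglyMeasurable F volume) {C : ℝ}
    (hC : ∀ x, ‖F x‖ ≤ C) : TestIntegrable F := by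
  intro K hK φ hφ hc
  have h1 : Integrable (fun q : Rd d × Rd d => φ q.1 * K q.2) (volume.prod volume) :=
    (hφ.integrable_of_hasCompactSupport hc).mul_prod hK
  have h2 : Integrable (fun q : Rd d × Rd d => φ (q.1 + q.2) * K q.2) (volume.prod volume) :=
    (measurePreserving_shear (volume : Measure (Rd d)) measurable_id).integrable_comp_of_integrable
      h1
  refine (h2.norm.mul_const C).mono' ?_ (Eventually.of_forall fun q => ?_)
  · simp_rw [mul_comm (K _)]
    exact h2.aestronglyMeasurable.smul hF.comp_fst
  · rw [norm_smul, mul_comm (K _)]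
    gcongr
    exact hC _

lemma testIntegrable_of_memLp {F : Rd d → ℂ} (hF : MemLp F 2 volume) : TestIntegrable F := by
  intro K hK φ hφ hc
  have hφ' : MemLp (fun x => (φ x : ℂ)) 2 volume :=
    (Complex.continuous_ofReal.comp hφ).memLp_of_hasCompactSupport
      (hc.comp_left (g := fun r : ℝ => (r : ℂ)) (by simp))
  refine (integrable_kernel_mul_translate (L := fun z => z) measurable_id hK hF hφ').congr
    (Eventually.of_forall fun q => ?_)
  simp only [Complex.real_smul]
  push_cast
  ring

section Pairing

variable {F : Rd d → 𝕜} (hF : TestIntegrable F) {K : Rd d → ℝ} (hK : Integrable K) {φ : Rd d → ℝ}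
  (hφ : Continuous φ) (hc : HasCompactSupport φ)

include hF hK hφ hc

lemma TestIntegrable.integrable_sub :
    Integrable (fun q : Rd d × Rd d => (K q.2 * φ q.1) • F (q.1 - q.2)) (volume.prod volume) := by
  have h := (measurePreserving_shear (volume : Measure (Rd d))
    measurable_neg).integrable_comp_of_integrable (hF K hK φ hφ hc)
  refine h.congr (Eventually.of_forall fun q => ?_)
  simp [sub_eq_add_neg]

lemma TestIntegrable.integrable_smul_conv : Integrable fun x => φ x • conv K F x := by
  refine (hF.integrable_sub hK hφ hc).integral_prod_left.congr (Eventually.of_forall fun x => ?_)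
  simp only [conv, ← integral_smul, smul_smul]
  congr 1; ext z; rw [mul_comm]

lemma TestIntegrable.integrable_integral_smul :
    Integrable fun y => (∫ z, K z * φ (y + z)) • F y := by
  refine (hF K hK φ hφ hc).integral_prod_left.congr (Eventually.of_forall fun x => ?_)
  simp only [← integral_smul_const]

lemma TestIntegrable.integral_smul_conv :
    ∫ x, φ x • conv K F x = ∫ y, (∫ z, K z * φ (y + z)) • F y := by
  simp only [conv, ← integral_smul_const, ← integral_smul, smul_smul]
  have e : ∀ x z, (φ x * K z) • F (x - z) = (K z * φ x) • F (x - z) := fun x z => by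
    rw [mul_comm]
  simp only [e]
  rw [integral_integral_swap (f := fun x z => (K z * φ x) • F (x - z))
      (hF.integrable_sub hK hφ hc),
    integral_integral_swap (f := fun y z => (K z * φ (y + z)) • F y) (hF K hK φ hφ hc)]
  congr 1; ext z
  rw [← integral_add_right_eq_self (fun x => (K z * φ x) • F (x - z)) z]
  simp

end Pairing

lemma fderiv_eq_sum (φ : Rd d → ℝ) (x v : Rd d) :
    fderiv ℝ φ x v = ∑ j, v j * fderiv ℝ φ x (EuclideanSpace.single j 1) := by
  have : v = ∑ j, v j • EuclideanSpace.single j (1 : ℝ) := by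
    ext i; simp [Finset.sum_apply, Pi.single_apply]
  conv_lhs => rw [this, map_sum]
  simp

lemma TestIntegrable.integral_conv_fderiv {F : Rd d → 𝕜} (hF : TestIntegrable F) {lam : ℝ}
    (hl : 0 < lam) {φ : Rd d → ℝ} (hφ : ContDiff ℝ 1 φ) (hc : HasCompactSupport φ) (j : Fin d) :
    ∫ x, fderiv ℝ φ x (EuclideanSpace.single j 1) • conv (resK lam) F x
      = -∫ x, φ x • gradConv lam F x j := by
  have hdc : Continuous (fun x => fderiv ℝ φ x (EuclideanSpace.single j 1)) :=
    (hφ.continuous_fderiv (by norm_num)).clm_apply continuous_const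
  have hds : HasCompactSupport (fun x => fderiv ℝ φ x (EuclideanSpace.single j 1)) :=
    hc.fderiv_apply (𝕜 := ℝ) _
  rw [hF.integral_smul_conv (integrable_resK hl) hdc hds]
  simp only [gradConv]
  rw [hF.integral_smul_conv (integrable_gradK_apply hl j) hφ.continuous hc, ← integral_neg]
  congr 1; ext y
  rw [← neg_smul]
  congr 1
  have h := integral_resK_fderiv hl (φ := fun z => φ (z + y))
    (hφ.comp (contDiff_id.add contDiff_const)) (hasCompactSupport_comp_add_right hc y)
    (EuclideanSpace.single j 1)
  simp only [fderiv_comp_add_right, EuclideanSpace.inner_single_right] at h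
  simp only [add_comm y]
  rw [h]
  simp

lemma TestIntegrable.integral_gradConv_fderiv_add {F : Rd d → 𝕜} (hF : TestIntegrable F) {lam : ℝ}
    (hl : 0 < lam) {φ : Rd d → ℝ} (hφ : ContDiff ℝ 1 φ) (hc : HasCompactSupport φ) :
    (∑ j, ∫ x, fderiv ℝ φ x (EuclideanSpace.single j 1) • gradConv lam F x j)
      + lam • ∫ x, φ x • conv (resK lam) F x = ∫ x, φ x • F x := by
  have hdc : ∀ j : Fin d, Continuous (fun x => fderiv ℝ φ x (EuclideanSpace.single j 1)) :=
    fun j => (hφ.continuous_fderiv (by norm_num)).clm_apply continuous_const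
  have hds : ∀ j : Fin d, HasCompactSupport (fun x => fderiv ℝ φ x (EuclideanSpace.single j 1)) :=
    fun j => hc.fderiv_apply (𝕜 := ℝ) _
  simp only [gradConv]
  simp_rw [fun j => hF.integral_smul_conv (integrable_gradK_apply hl j) (hdc j) (hds j)]
  rw [hF.integral_smul_conv (integrable_resK hl) hφ.continuous hc,
    ← integral_finsetSum _ fun j _ =>
      hF.integrable_integral_smul (integrable_gradK_apply hl j) (hdc j) (hds j),
    ← integral_smul]
  have hi := (hF.integrable_integral_smul (integrable_resK hl) hφ.continuous hc).smul lam
  simp only [Pi.smul_def] at hi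
  rw [← integral_add (integrable_finsetSum _ fun j _ =>
      hF.integrable_integral_smul (integrable_gradK_apply hl j) (hdc j) (hds j))
      hi]
  congr 1; ext y
  rw [← Finset.sum_smul, smul_smul, ← add_smul]
  congr 1
  have h := integral_gradK_fderiv_add hl (φ := fun z => φ (z + y))
    (hφ.comp (contDiff_id.add contDiff_const)) (hasCompactSupport_comp_add_right hc y)
  simp only [fderiv_comp_add_right, zero_add] at h
  rw [← h]
  simp only [add_comm y]
  congr 1
  rw [← integral_finsetSum]
  · congr 1; ext z
    rw [fderiv_eq_sum]
  · intro j _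
    obtain ⟨C, hC⟩ := (hdc j).bounded_above_of_compact_support (hds j)
    refine (integrable_gradK_apply hl j).mul_bdd (c := C) ?_ (Eventually.of_forall fun z => hC _)
    exact ((hdc j).comp (by fun_prop)).aestronglyMeasurable

end Convolution

/-! ### Weak solutions and products in `H¹` -/

section Sobolev

variable {d : ℕ}

/-- The complexification of a real vector. -/
def toComplexVec (x : Rd d) : EuclideanSpace ℂ (Fin d) := WithLp.toLp 2 fun j => ((x j : ℝ) : ℂ)

@[simp] lemma toComplexVec_apply (x : Rd d) (j : Fin d) : toComplexVec x j = ((x j : ℝ) : ℂ) := rfl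

lemma norm_toComplexVec (x : Rd d) : ‖toComplexVec x‖ = ‖x‖ := by
  simp [EuclideanSpace.norm_eq]

lemma toComplexVec_add (x y : Rd d) : toComplexVec (x + y) = toComplexVec x + toComplexVec y := by
  ext j; simp

lemma continuous_toComplexVec : Continuous (toComplexVec : Rd d → EuclideanSpace ℂ (Fin d)) := by
  unfold toComplexVec
  fun_prop

lemma inner_complex_eq_sum (a b : EuclideanSpace ℂ (Fin d)) :
    inner ℂ b a = ∑ j, a j * conj (b j) := by
  simp [PiLp.inner_apply]

lemma inner_toComplexVec_comm (x : Rd d) (g : EuclideanSpace ℂ (Fin d)) :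
    inner ℂ (toComplexVec x) g = ∑ j, ((x j : ℝ) : ℂ) * g j := by
  rw [inner_complex_eq_sum]
  simp [mul_comm]

/-- The vector of complex conjugates. -/
def conjVec (g : EuclideanSpace ℂ (Fin d)) : EuclideanSpace ℂ (Fin d) :=
  WithLp.toLp 2 fun j => conj (g j)

lemma memLp_of_bdd_smul {X : Type*} [MeasurableSpace X] {μ : Measure X} {𝕜 E : Type*}
    [NormedRing 𝕜] [NormedAddCommGroup E]
    [MulActionWithZero 𝕜 E] [IsBoundedSMul 𝕜 E] {a : X → 𝕜} {f : X → E} {p : ℝ≥0∞} {C : ℝ}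
    (ha : AEStronglyMeasurable a μ) (hC : ∀ x, ‖a x‖ ≤ C) (hf : MemLp f p μ) :
    MemLp (fun x => a x • f x) p μ :=
  hf.of_le_mul (ha.smul hf.1) (Eventually.of_forall fun x =>
    (norm_smul_le _ _).trans (by gcongr; exact hC x))

lemma MemLp.integrable_mul_fun {X : Type*} [MeasurableSpace X] {μ : Measure X} {u v : X → ℂ}
    (h : MemLp u 2 μ) (h' : MemLp v 2 μ) : Integrable (fun x => u x * v x) μ :=
  MeasureTheory.MemLp.integrable_mul h h'

lemma MemH1.conj {v : Rd d → ℂ} {g : Rd d → EuclideanSpace ℂ (Fin d)} (h : MemH1 v g) :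
    MemH1 (fun x => conj (v x)) (fun x => conjVec (g x)) := by
  have h1 : MemLp (fun x => conj (v x)) 2 volume := h.memLp.star
  have h2 : MemLp (fun x => conjVec (g x)) 2 volume :=
    memLp_piLp_iff.2 fun j => (h.memLp_grad_apply j).star
  refine ⟨h1, h2, h1.locallyIntegrable (by norm_num), h2.locallyIntegrable (by norm_num), ?_⟩
  intro φ hφ hc j
  have := congrArg conj (h.weakGradient.2.2 φ hφ hc j)
  rw [map_neg, ← integral_conj, ← integral_conj] at this
  simpa [conjVec] using this

lemma MemH1.add {v v' : Rd d → ℂ} {g g' : Rd d → EuclideanSpace ℂ (Fin d)} (h : MemH1 v g)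
    (h' : MemH1 v' g') : MemH1 (fun x => v x + v' x) (fun x => g x + g' x) := by
  have h1 := h.memLp.add h'.memLp
  have h2 := h.memLp_grad.add h'.memLp_grad
  refine ⟨h1, h2, h1.locallyIntegrable (by norm_num), h2.locallyIntegrable (by norm_num), ?_⟩
  intro φ hφ hc j
  have hcomp : ∀ {ψ : Rd d → ℝ}, Continuous ψ → HasCompactSupport ψ →
      MemLp (fun x => (ψ x : ℂ)) 2 volume := fun hψ hc =>
    (Complex.continuous_ofReal.comp hψ).memLp_of_hasCompactSupport
      (hc.comp_left (g := fun r : ℝ => (r : ℂ)) (by simp))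
  have hφ1 : ContDiff ℝ 1 φ := hφ.of_le (by exact_mod_cast le_top)
  have hd := hcomp ((hφ1.continuous_fderiv (by norm_num)).clm_apply
    (continuous_const (y := EuclideanSpace.single j (1 : ℝ)))) (hc.fderiv_apply (𝕜 := ℝ) _)
  have hφ' := hcomp hφ.continuous hc
  have e1 := h.weakGradient.2.2 φ hφ hc j
  have e2 := h'.weakGradient.2.2 φ hφ hc j
  simp only [add_mul, PiLp.add_apply]
  refine (integral_add (MemLp.integrable_mul_fun h.memLp hd)
    (MemLp.integrable_mul_fun h'.memLp hd)).trans (Eq.trans ?_ (congrArg Neg.neg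
      (integral_add (MemLp.integrable_mul_fun (h.memLp_grad_apply j) hφ')
        (MemLp.integrable_mul_fun (h'.memLp_grad_apply j) hφ'))).symm)
  rw [neg_add]
  exact congrArg₂ _ e1 e2

lemma MemH1.const_mul {v : Rd d → ℂ} {g : Rd d → EuclideanSpace ℂ (Fin d)} (h : MemH1 v g)
    (c : ℂ) : MemH1 (fun x => c * v x) (fun x => c • g x) := by
  have h1 := h.memLp.const_mul c
  have h2 := h.memLp_grad.const_smul c
  refine ⟨h1, h2, h1.locallyIntegrable (by norm_num), h2.locallyIntegrable (by norm_num), ?_⟩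
  intro φ hφ hc j
  have e1 := h.weakGradient.2.2 φ hφ hc j
  simp only [PiLp.smul_apply, smul_eq_mul, mul_assoc]
  rw [integral_const_mul, integral_const_mul, ← mul_neg]
  exact congrArg _ e1

lemma MemH1.sub {v v' : Rd d → ℂ} {g g' : Rd d → EuclideanSpace ℂ (Fin d)} (h : MemH1 v g)
    (h' : MemH1 v' g') : MemH1 (fun x => v x - v' x) (fun x => g x - g' x) := by
  have := h.add (h'.const_mul (-1))
  simpa [sub_eq_add_neg] using this

lemma IsWeakSolution.weakForm_inner {c f u : Rd d → ℂ} {g : Rd d → EuclideanSpace ℂ (Fin d)}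
    (h : IsWeakSolution c f u g) {v : Rd d → ℂ} {gv : Rd d → EuclideanSpace ℂ (Fin d)}
    (hv : MemH1 v gv) :
    ∫ x, (inner ℂ (gv x) (g x) + c x * u x * conj (v x)) = ∫ x, f x * conj (v x) := by
  simp only [inner_complex_eq_sum]
  exact h.weakForm v gv hv

lemma integrable_inner_of_memLp {X : Type*} [MeasurableSpace X] {μ : Measure X}
    {g g' : X → EuclideanSpace ℂ (Fin d)} (h : MemLp g 2 μ)
    (h' : MemLp g' 2 μ) : Integrable (fun x => inner ℂ (g' x) (g x)) μ := by
  simp only [inner_complex_eq_sum]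
  exact integrable_finsetSum _ fun j _ => (h.eval_piLp j).integrable_mul (h'.eval_piLp j).star

lemma integrable_mul_conj_of_memLp {X : Type*} [MeasurableSpace X] {μ : Measure X} {u v : X → ℂ}
    (h : MemLp u 2 μ) (h' : MemLp v 2 μ) : Integrable (fun x => u x * conj (v x)) μ :=
  h.integrable_mul h'.star

/-- The functional of `MemH1.integral_eq_zero_of_test`, in sesquilinear form. -/
lemma MemH1.integral_inner_eq_zero_of_test {U : Rd d → EuclideanSpace ℂ (Fin d)} {p : Rd d → ℂ}
    (hU : MemLp U 2 volume) (hp : MemLp p 2 volume)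
    (h : ∀ φ : Rd d → ℝ, ContDiff ℝ ((⊤ : ℕ∞) : WithTop ℕ∞) φ → HasCompactSupport φ →
      ∫ x, ((∑ j, U x j * ((fderiv ℝ φ x (EuclideanSpace.single j 1) : ℝ) : ℂ))
        + p x * ((φ x : ℝ) : ℂ)) = 0)
    {v : Rd d → ℂ} {g : Rd d → EuclideanSpace ℂ (Fin d)} (hv : MemH1 v g) :
    ∫ x, (inner ℂ (g x) (U x) + p x * conj (v x)) = 0 := by
  rw [← hv.conj.integral_eq_zero_of_test hU hp h]
  simp only [inner_complex_eq_sum, conjVec]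

lemma measurable_gradK_apply (lam : ℝ) (j : Fin d) :
    Measurable fun z : Rd d => gradK lam z j := by
  have := measurable_gradK (d := d) lam
  fun_prop

lemma memH1_conv {lam : ℝ} (hl : 0 < lam) {F : Rd d → ℂ} (hF : MemLp F 2 volume) :
    MemH1 (conv (resK lam) F) (gradConv lam F) := by
  have h1 : MemLp (conv (resK lam) F) 2 volume :=
    memLp_conv (measurable_resK lam) (integrable_resK hl) hF
  have h2 : MemLp (gradConv lam F) 2 volume := memLp_piLp_iff.2 fun j =>
    memLp_conv (measurable_gradK_apply lam j)
      (integrable_gradK_apply hl j) hF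
  refine ⟨h1, h2, h1.locallyIntegrable (by norm_num), h2.locallyIntegrable (by norm_num), ?_⟩
  intro φ hφ hc j
  have := (testIntegrable_of_memLp hF).integral_conv_fderiv hl
    (hφ.of_le (by exact_mod_cast le_top)) hc j
  simp only [Complex.real_smul, mul_comm (Complex.ofReal _)] at this
  exact this

/-- `conv (resK lam) F` solves `(-Δ + lam) u = F`. -/
lemma integral_inner_gradConv {lam : ℝ} (hl : 0 < lam) {F : Rd d → ℂ} (hF : MemLp F 2 volume)
    {v : Rd d → ℂ} {gv : Rd d → EuclideanSpace ℂ (Fin d)} (hv : MemH1 v gv) :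
    ∫ x, (inner ℂ (gv x) (gradConv lam F x) + (lam * conv (resK lam) F x - F x) * conj (v x))
      = 0 := by
  have hH := memH1_conv hl hF
  refine hv.integral_inner_eq_zero_of_test (p := fun x => lam * conv (resK lam) F x - F x)
    hH.memLp_grad ((hH.memLp.const_mul _).sub hF) ?_
  intro φ hφ hc
  have hφ1 : ContDiff ℝ 1 φ := hφ.of_le (by exact_mod_cast le_top)
  have hT := testIntegrable_of_memLp hF
  have hdc : ∀ j : Fin d, Continuous (fun x => fderiv ℝ φ x (EuclideanSpace.single j 1)) :=
    fun j => (hφ1.continuous_fderiv (by norm_num)).clm_apply continuous_const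
  have hds : ∀ j : Fin d, HasCompactSupport (fun x => fderiv ℝ φ x (EuclideanSpace.single j 1)) :=
    fun j => hc.fderiv_apply (𝕜 := ℝ) _
  have h := hT.integral_gradConv_fderiv_add hl hφ1 hc
  have i1 : ∀ j, Integrable fun x =>
      fderiv ℝ φ x (EuclideanSpace.single j 1) • gradConv lam F x j := fun j =>
    hT.integrable_smul_conv (integrable_gradK_apply hl j) (hdc j) (hds j)
  have i2 : Integrable fun x => lam • φ x • conv (resK lam) F x :=
    (hT.integrable_smul_conv (integrable_resK hl) hφ.continuous hc).smul lam
  have i4 : Integrable fun x =>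
      (∑ j, fderiv ℝ φ x (EuclideanSpace.single j 1) • gradConv lam F x j)
        + lam • φ x • conv (resK lam) F x := (integrable_finsetSum _ fun j _ => i1 j).add i2
  have i3 : Integrable fun x => φ x • F x := by
    have : MemLp (fun x => (φ x : ℂ)) 2 volume :=
      (Complex.continuous_ofReal.comp hφ.continuous).memLp_of_hasCompactSupport
        (hc.comp_left (g := fun r : ℝ => (r : ℂ)) (by simp))
    simpa only [Complex.real_smul] using MemLp.integrable_mul_fun this hF
  rw [← integral_finsetSum _ fun j _ => i1 j, ← integral_smul, ← integral_add
    (integrable_finsetSum _ fun j _ => i1 j) i2, ← sub_eq_zero, ← integral_sub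
    i4 i3] at h
  rw [← h]
  congr 1; ext x
  simp only [Complex.real_smul]
  rw [sub_mul, add_sub_assoc]
  congr 1
  · exact Finset.sum_congr rfl fun j _ => mul_comm _ _
  · ring

/-- A solution of the fixed point equation `u = (-Δ + lam)⁻¹ (f + (lam - c) u)` is a weak solution
of `-Δ u + c u = f`. -/
lemma isWeakSolution_of_fixedPoint {lam : ℝ} (hl : 0 < lam) {c f u : Rd d → ℂ}
    (hF : MemLp (fun x => f x + (lam - c x) * u x) 2 volume)
    (hu : ∀ x, u x = conv (resK lam) (fun x => f x + (lam - c x) * u x) x)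
    (hf : MemLp f 2 volume) :
    IsWeakSolution c f u (gradConv lam fun x => f x + (lam - c x) * u x) := by
  set F : Rd d → ℂ := fun x => f x + (lam - c x) * u x with hFdef
  have hH := memH1_conv hl hF
  have hu' : conv (resK lam) F = u := (funext hu).symm
  rw [hu'] at hH
  refine ⟨hH, fun v gv hv => ?_⟩
  have h := integral_inner_gradConv hl hF hv
  rw [hu'] at h
  have i1 := integrable_mul_conj_of_memLp hf hv.memLp
  have i2 := integrable_inner_of_memLp hH.memLp_grad hv.memLp_grad
  have hp : MemLp (fun x => lam * u x - F x) 2 volume := (hH.memLp.const_mul _).sub hF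
  have i3 := integrable_mul_conj_of_memLp hp hv.memLp
  have i4 : Integrable fun x => inner ℂ (gv x) (gradConv lam F x)
      + (lam * u x - F x) * conj (v x) := i2.add i3
  rw [← add_zero (∫ x, f x * conj (v x)), ← h, ← integral_add i1 i4]
  congr 1; ext x
  rw [← inner_complex_eq_sum, hFdef]
  ring

/-- The energy of a weak solution. -/
lemma IsWeakSolution.energy {c f u : Rd d → ℂ} {g : Rd d → EuclideanSpace ℂ (Fin d)}
    (h : IsWeakSolution c f u g) (hc : AEStronglyMeasurable c volume) {C : ℝ}
    (hC : ∀ᵐ x, ‖c x‖ ≤ C) (hf : MemLp f 2 volume) :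
    ∫ x, (‖g x‖ ^ 2 + (c x).re * ‖u x‖ ^ 2) = ∫ x, (f x * conj (u x)).re := by
  have hw := congrArg Complex.re (h.weakForm_inner h.memH1)
  have hcu : MemLp (fun x => c x * u x) 2 volume :=
    h.memH1.memLp.of_le_mul (hc.mul h.memH1.memLp.1) (by
      filter_upwards [hC] with x hx
      rw [norm_mul]; gcongr)
  have i1 := (integrable_inner_of_memLp h.memH1.memLp_grad h.memH1.memLp_grad).add
    (integrable_mul_conj_of_memLp hcu h.memH1.memLp)
  have i2 := integrable_mul_conj_of_memLp hf h.memH1.memLp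
  have e1 := integral_re i1
  have e2 := integral_re i2
  simp only [RCLike.re_eq_complex_re, Pi.add_apply] at e1 e2
  rw [← e1, ← e2] at hw
  rw [← hw]
  congr 1; ext x
  rw [Complex.add_re, mul_assoc (c x), Complex.mul_conj, Complex.re_mul_ofReal,
    Complex.normSq_eq_norm_sq, inner_self_eq_norm_sq_to_K]
  congr 1
  norm_cast

lemma IsWeakSolution.ae_eq {c f u u' : Rd d → ℂ} {g g' : Rd d → EuclideanSpace ℂ (Fin d)}
    (h : IsWeakSolution c f u g) (h' : IsWeakSolution c f u' g')
    (hc : AEStronglyMeasurable c volume) {C : ℝ} (hC : ∀ᵐ x, ‖c x‖ ≤ C)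
    (hc1 : ∀ᵐ x, 1 ≤ (c x).re) : u =ᵐ[volume] u' := by
  have hcu : ∀ {w : Rd d → ℂ}, MemLp w 2 volume → MemLp (fun x => c x * w x) 2 volume :=
    fun {w} hw => hw.of_le_mul (hc.mul hw.1) (by
      filter_upwards [hC] with x hx
      rw [norm_mul]; gcongr)
  have hs : IsWeakSolution c (fun _ => 0) (fun x => u x - u' x) (fun x => g x - g' x) := by
    refine ⟨h.memH1.sub h'.memH1, fun v gv hv => ?_⟩
    have e1 := h.weakForm_inner hv
    have e2 := h'.weakForm_inner hv
    have i1 := (integrable_inner_of_memLp h.memH1.memLp_grad hv.memLp_grad).add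
      (integrable_mul_conj_of_memLp (hcu h.memH1.memLp) hv.memLp)
    have i2 := (integrable_inner_of_memLp h'.memH1.memLp_grad hv.memLp_grad).add
      (integrable_mul_conj_of_memLp (hcu h'.memH1.memLp) hv.memLp)
    have e3 := e1.trans e2.symm
    have e4 : ∫ x, (inner ℂ (gv x) (g x) + c x * u x * conj (v x)
      - (inner ℂ (gv x) (g' x) + c x * u' x * conj (v x))) = 0 :=
      (integral_sub i1 i2).trans (sub_eq_zero.2 e3)
    simp only [zero_mul, integral_zero]
    rw [← e4]
    congr 1; ext x
    rw [← inner_complex_eq_sum, inner_sub_right]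
    ring
  have he := hs.energy hc hC MemLp.zero'
  simp only [zero_mul, Complex.zero_re, integral_zero] at he
  have hu2 : MemLp (fun x => u x - u' x) 2 volume := h.memH1.memLp.sub h'.memH1.memLp
  have hg2 : MemLp (fun x => g x - g' x) 2 volume := h.memH1.memLp_grad.sub h'.memH1.memLp_grad
  have i3 : Integrable fun x => (c x).re * ‖u x - u' x‖ ^ 2 :=
    (hu2.norm.integrable_sq).bdd_mul (c := C) (Complex.continuous_re.comp_aestronglyMeasurable hc)
      (by filter_upwards [hC] with x hx using (Complex.abs_re_le_norm _).trans hx)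
  have hnn : 0 ≤ᵐ[volume] fun x => ‖g x - g' x‖ ^ 2 + (c x).re * ‖u x - u' x‖ ^ 2 := by
    filter_upwards [hc1] with x hx
    simp only [Pi.zero_apply]
    positivity
  have hz := (integral_eq_zero_iff_of_nonneg_ae hnn (hg2.norm.integrable_sq.add i3)).1 he
  filter_upwards [hz, hc1] with x hx hx1
  simp only [Pi.zero_apply] at hx
  have h0 : ‖u x - u' x‖ ^ 2 ≤ 0 := by nlinarith [sq_nonneg ‖g x - g' x‖, sq_nonneg ‖u x - u' x‖]
  have h1 : ‖u x - u' x‖ = 0 := by nlinarith [norm_nonneg (u x - u' x)]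
  exact sub_eq_zero.1 (norm_eq_zero.1 h1)

end Sobolev

/-! ### Products with bounded correctors and the equation of the remainder -/

section Corrector

variable {d : ℕ}

/-- `ψ`, with gradient `gψ`, is a bounded solution of `(-Δ + lam) ψ + W = 0` with a bounded
gradient, for a bounded potential `W`. -/
structure IsBoundedCorrector (lam : ℝ) (W ψ : Rd d → ℝ) (gψ : Rd d → Rd d) : Prop where
  measurable_potential : Measurable W
  measurable : Measurable ψ
  measurable_grad : Measurable gψ
  bounded : ∃ C : ℝ, ∀ x, ‖W x‖ ≤ C ∧ ‖ψ x‖ ≤ C ∧ ‖gψ x‖ ≤ C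
  weakGradient : IsWeakGradient ψ gψ
  weakForm : ∀ φ : Rd d → ℝ, ContDiff ℝ ((⊤ : ℕ∞) : WithTop ℕ∞) φ → HasCompactSupport φ →
    ∫ x, ((∑ j, gψ x j * fderiv ℝ φ x (EuclideanSpace.single j 1)) + (lam * ψ x + W x) * φ x) = 0

lemma memLp_ofReal_of_hasCompactSupport {φ : Rd d → ℝ} (hφ : Continuous φ)
    (hc : HasCompactSupport φ) : MemLp (fun x => (φ x : ℂ)) 2 volume :=
  (Complex.continuous_ofReal.comp hφ).memLp_of_hasCompactSupport
    (hc.comp_left (g := fun r : ℝ => (r : ℂ)) (by simp))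

lemma continuous_fderiv_single {φ : Rd d → ℝ} (hφ : ContDiff ℝ ((⊤ : ℕ∞) : WithTop ℕ∞) φ)
    (j : Fin d) : Continuous fun x => fderiv ℝ φ x (EuclideanSpace.single j 1) :=
  ((hφ.of_le (by exact_mod_cast le_top) : ContDiff ℝ 1 φ).continuous_fderiv
    (by norm_num)).clm_apply continuous_const

lemma norm_conv_gradK_le {lam : ℝ} (hl : 0 < lam) {W : Rd d → ℝ} {C : ℝ} (hC : ∀ x, ‖W x‖ ≤ C) :
    ∃ C', ∀ x, ‖gradConv lam W x‖ ≤ C' := by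
  refine ⟨∑ j, (∫ z : Rd d, ‖gradK lam z j‖) * C, fun x => ?_⟩
  have : ‖gradConv lam W x‖ ≤ ∑ j, ‖gradConv lam W x j‖ := by
    rw [EuclideanSpace.norm_eq]
    refine Real.sqrt_le_iff.2 ⟨by positivity, ?_⟩
    exact Finset.sum_sq_le_sq_sum_of_nonneg fun j _ => norm_nonneg _
  refine this.trans (Finset.sum_le_sum fun j _ => ?_)
  exact norm_conv_le (integrable_gradK_apply hl j) hC x

lemma isBoundedCorrector_conv {lam : ℝ} (hl : 0 < lam) {W : Rd d → ℝ} (hW : Measurable W) {C : ℝ}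
    (hC : ∀ x, ‖W x‖ ≤ C) :
    IsBoundedCorrector lam W (fun x => -conv (resK lam) W x) (fun x => -gradConv lam W x) := by
  have m1 : Measurable (conv (resK lam) W) :=
    (stronglyMeasurable_conv (measurable_resK lam) hW).measurable
  have m2 : Measurable (gradConv lam W) := by
    have : ∀ j, Measurable fun x => gradConv lam W x j := fun j =>
      (stronglyMeasurable_conv (measurable_gradK_apply lam j) hW).measurable
    exact (PiLp.continuous_toLp 2 _).measurable.comp (measurable_pi_lambda _ this)
  obtain ⟨C', hC'⟩ := norm_conv_gradK_le hl hC
  have b1 := norm_conv_le (integrable_resK hl) hC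
  have hT : TestIntegrable W := testIntegrable_of_bounded hW.aestronglyMeasurable hC
  refine ⟨hW, m1.neg, m2.neg, ⟨max C (max ((∫ z : Rd d, ‖resK lam z‖) * C) C'), fun x => ⟨?_, ?_, ?_⟩⟩,
    ⟨?_, ?_, ?_⟩, ?_⟩
  · exact (hC x).trans (le_max_left _ _)
  · rw [norm_neg]; exact (b1 x).trans ((le_max_left _ _).trans (le_max_right _ _))
  · rw [norm_neg]; exact (hC' x).trans ((le_max_right _ _).trans (le_max_right _ _))
  · exact (memLp_top_of_bound m1.neg.aestronglyMeasurable _ (Eventually.of_forall fun x => by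
      simpa using b1 x)).locallyIntegrable le_top
  · exact (memLp_top_of_bound m2.neg.aestronglyMeasurable _ (Eventually.of_forall fun x => by
      simpa using hC' x)).locallyIntegrable le_top
  · intro φ hφ hc j
    have := hT.integral_conv_fderiv hl (hφ.of_le (by exact_mod_cast le_top)) hc j
    simp only [smul_eq_mul, mul_comm (fderiv ℝ φ _ _), mul_comm (φ _)] at this
    simp only [neg_mul, integral_neg, PiLp.neg_apply]
    exact congrArg Neg.neg this
  · intro φ hφ hc
    have hφ1 : ContDiff ℝ 1 φ := hφ.of_le (by exact_mod_cast le_top)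
    have h := hT.integral_gradConv_fderiv_add hl hφ1 hc
    have i1 : ∀ j, Integrable fun x =>
        fderiv ℝ φ x (EuclideanSpace.single j 1) • gradConv lam W x j := fun j =>
      hT.integrable_smul_conv (integrable_gradK_apply hl j) (continuous_fderiv_single hφ j)
        (hc.fderiv_apply (𝕜 := ℝ) _)
    have i2 : Integrable fun x => lam • φ x • conv (resK lam) W x :=
      (hT.integrable_smul_conv (integrable_resK hl) hφ.continuous hc).smul lam
    have i4 : Integrable fun x =>
        (∑ j, fderiv ℝ φ x (EuclideanSpace.single j 1) • gradConv lam W x j)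
          + lam • φ x • conv (resK lam) W x := (integrable_finsetSum _ fun j _ => i1 j).add i2
    have i3 : Integrable fun x => φ x • W x := by
      exact (hφ.continuous.integrable_of_hasCompactSupport hc).mul_bdd (c := C)
        hW.aestronglyMeasurable (Eventually.of_forall hC)
    rw [← integral_finsetSum _ fun j _ => i1 j, ← integral_smul, ← integral_add
      (integrable_finsetSum _ fun j _ => i1 j) i2, ← sub_eq_zero, ← integral_sub i4 i3,
      ← neg_eq_zero, ← integral_neg] at h
    rw [← h]
    congr 1; ext x
    simp only [smul_eq_mul, PiLp.neg_apply, neg_mul, Finset.sum_neg_distrib]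
    rw [show ∀ a b c : ℝ, -(a + b - c) = -a + (c - b) from fun a b c => by ring]
    congr 1
    · exact congrArg Neg.neg (Finset.sum_congr rfl fun j _ => mul_comm _ _)
    · ring

variable {lam : ℝ} {W ψ : Rd d → ℝ} {gψ : Rd d → Rd d}

lemma memLp_ofReal_mul {a : Rd d → ℝ} (ha : Measurable a) {C : ℝ} (hC : ∀ x, ‖a x‖ ≤ C)
    {v : Rd d → ℂ} (hv : MemLp v 2 volume) : MemLp (fun x => (a x : ℂ) * v x) 2 volume := by
  have hC' : ∀ x, ‖(a x : ℂ)‖ ≤ C := fun x => by simpa using hC x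
  exact memLp_of_bdd_smul (Complex.measurable_ofReal.comp ha).aestronglyMeasurable hC' hv

lemma memLp_smul_toComplexVec {b : Rd d → Rd d} (hb : Measurable b) {C : ℝ}
    (hC : ∀ x, ‖b x‖ ≤ C) {v : Rd d → ℂ} (hv : MemLp v 2 volume) :
    MemLp (fun x => v x • toComplexVec (b x)) 2 volume := by
  refine hv.of_le_mul (c := C) (hv.1.smul
    (continuous_toComplexVec.measurable.comp hb).aestronglyMeasurable)
    (Eventually.of_forall fun x => ?_)
  rw [norm_smul, norm_toComplexVec, mul_comm]
  gcongr
  exact hC x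

lemma memLp_toComplexVec_inner {b : Rd d → Rd d} (hb : Measurable b) {C : ℝ}
    (hC : ∀ x, ‖b x‖ ≤ C) {g : Rd d → EuclideanSpace ℂ (Fin d)} (hg : MemLp g 2 volume) :
    MemLp (fun x => inner ℂ (toComplexVec (b x)) (g x)) 2 volume := by
  refine hg.of_le_mul (c := C)
    ((continuous_toComplexVec.measurable.comp hb).aestronglyMeasurable.inner hg.1)
    (Eventually.of_forall fun x => ?_)
  refine (norm_inner_le_norm _ _).trans ?_
  rw [norm_toComplexVec]
  gcongr
  exact hC x

lemma fderiv_mul_apply' {φ φ' : Rd d → ℝ} (hφ : ContDiff ℝ ((⊤ : ℕ∞) : WithTop ℕ∞) φ)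
    (hφ' : ContDiff ℝ ((⊤ : ℕ∞) : WithTop ℕ∞) φ') (x v : Rd d) :
    fderiv ℝ (fun x => φ x * φ' x) x v = φ x * fderiv ℝ φ' x v + φ' x * fderiv ℝ φ x v := by
  rw [fderiv_fun_mul (hφ.differentiable (by simp) x) (hφ'.differentiable (by simp) x)]
  simp

/-- The product of an `H¹` function with a bounded corrector. -/
lemma IsBoundedCorrector.memH1_mul (h : IsBoundedCorrector lam W ψ gψ) {v : Rd d → ℂ}
    {g : Rd d → EuclideanSpace ℂ (Fin d)} (hv : MemH1 v g) :
    MemH1 (fun x => (ψ x : ℂ) * v x)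
      (fun x => (ψ x : ℂ) • g x + v x • toComplexVec (gψ x)) := by
  obtain ⟨C, hC⟩ := h.bounded
  have h1 : MemLp (fun x => (ψ x : ℂ) * v x) 2 volume :=
    memLp_ofReal_mul h.measurable (fun x => (hC x).2.1) hv.memLp
  have hC' : ∀ x, ‖(ψ x : ℂ)‖ ≤ C := fun x => by simpa using (hC x).2.1
  have h2a : MemLp (fun x => (ψ x : ℂ) • g x) 2 volume :=
    memLp_of_bdd_smul (Complex.measurable_ofReal.comp h.measurable).aestronglyMeasurable
      hC' hv.memLp_grad
  have h2b := memLp_smul_toComplexVec h.measurable_grad (fun x => (hC x).2.2) hv.memLp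
  have h2 := h2a.add h2b
  refine ⟨h1, h2, h1.locallyIntegrable (by norm_num), h2.locallyIntegrable (by norm_num), ?_⟩
  intro φ hφ hc j
  have hφL := memLp_ofReal_of_hasCompactSupport hφ.continuous hc
  have hdL := memLp_ofReal_of_hasCompactSupport (continuous_fderiv_single hφ j)
    (hc.fderiv_apply (𝕜 := ℝ) _)
  have hgj : ∀ x, ‖gψ x j‖ ≤ C := fun x => (PiLp.norm_apply_le _ j).trans (hC x).2.2
  have mgj : Measurable fun x => gψ x j := by
    have := h.measurable_grad
    fun_prop
  have hψφ := memLp_ofReal_mul h.measurable (fun x => (hC x).2.1) hφL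
  have hψd := memLp_ofReal_mul h.measurable (fun x => (hC x).2.1) hdL
  have hgφ := memLp_ofReal_mul mgj hgj hφL
  have hU : MemLp (fun x => ((ψ x : ℂ) * (φ x : ℂ)) • EuclideanSpace.single j (1 : ℂ)) 2 volume := by
    refine hψφ.of_le_mul (c := 1) (hψφ.1.smul aestronglyMeasurable_const)
      (Eventually.of_forall fun x => ?_)
    rw [norm_smul]; simp
  have key := hv.integral_eq_zero_of_test hU (hψd.add hgφ) (fun φ' hφ' hc' => by
    have hw := h.weakGradient.2.2 (fun x => φ x * φ' x) (hφ.mul hφ') hc.mul_right j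
    simp only [RCLike.ofReal_real_eq_id, id] at hw
    rw [eq_neg_iff_add_eq_zero] at hw
    have b1 : Integrable fun x => ψ x *
        fderiv ℝ (fun x => φ x * φ' x) x (EuclideanSpace.single j 1) :=
      ((continuous_fderiv_single (hφ.mul hφ') j).integrable_of_hasCompactSupport
        (hc.mul_right.fderiv_apply (𝕜 := ℝ) _)).bdd_mul h.measurable.aestronglyMeasurable
        (Eventually.of_forall fun x => (hC x).2.1)
    have b2 : Integrable fun x => gψ x j * (φ x * φ' x) :=
      ((hφ.continuous.mul hφ'.continuous).integrable_of_hasCompactSupport hc.mul_right).bdd_mul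
        mgj.aestronglyMeasurable (Eventually.of_forall hgj)
    rw [← integral_add b1 b2] at hw
    have hw' := congrArg (fun r : ℝ => (r : ℂ)) hw
    simp only [← integral_complex_ofReal, Complex.ofReal_zero] at hw'
    rw [← hw']
    congr 1; ext x
    rw [fderiv_mul_apply' hφ hφ']
    simp
    ring)
  have i1 := MemLp.integrable_mul_fun h1 hdL
  have i2 := MemLp.integrable_mul_fun (h2.eval_piLp j) hφL
  refine eq_neg_iff_add_eq_zero.2 ((integral_add i1 i2).symm.trans ?_)
  rw [← key]
  congr 1; ext x
  simp
  ring

/-- The equation of a bounded corrector, tested with the product of two `H¹` functions. -/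
lemma IsBoundedCorrector.integral_mul_eq_zero (h : IsBoundedCorrector lam W ψ gψ)
    {u v : Rd d → ℂ} {g gv : Rd d → EuclideanSpace ℂ (Fin d)} (hu : MemH1 u g) (hv : MemH1 v gv) :
    ∫ x, (inner ℂ (gv x) (u x • toComplexVec (gψ x)) + (inner ℂ (toComplexVec (gψ x)) (g x)
      + (lam * ψ x + W x : ℂ) * u x) * conj (v x)) = 0 := by
  obtain ⟨C, hC⟩ := h.bounded
  have mq : Measurable fun x => lam * ψ x + W x :=
    (h.measurable.const_mul lam).add h.measurable_potential
  have hq : ∀ x, ‖lam * ψ x + W x‖ ≤ ‖lam‖ * C + C := fun x => by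
    refine (norm_add_le _ _).trans ?_
    rw [norm_mul]
    gcongr
    · exact (hC x).2.1
    · exact (hC x).1
  have hp : ∀ {u : Rd d → ℂ} {g : Rd d → EuclideanSpace ℂ (Fin d)}, MemLp u 2 volume →
      MemLp g 2 volume → MemLp (fun x => inner ℂ (toComplexVec (gψ x)) (g x)
      + (lam * ψ x + W x : ℂ) * u x) 2 volume := fun hu hg => by
    have := memLp_ofReal_mul mq hq hu
    push_cast at this
    exact (memLp_toComplexVec_inner h.measurable_grad (fun x => (hC x).2.2) hg).add this
  refine hv.integral_inner_eq_zero_of_test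
    (memLp_smul_toComplexVec h.measurable_grad (fun x => (hC x).2.2) hu.memLp)
    (hp hu.memLp hu.memLp_grad) fun φ hφ hc => ?_
  have hφL := memLp_ofReal_of_hasCompactSupport hφ.continuous hc
  have hdφ : MemLp (fun x => (WithLp.toLp 2 fun j =>
      ((fderiv ℝ φ x (EuclideanSpace.single j 1) : ℝ) : ℂ) : EuclideanSpace ℂ (Fin d))) 2 volume :=
    memLp_piLp_iff.2 fun j => memLp_ofReal_of_hasCompactSupport (continuous_fderiv_single hφ j)
      (hc.fderiv_apply (𝕜 := ℝ) _)
  have key := hu.integral_eq_zero_of_test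
    (memLp_smul_toComplexVec h.measurable_grad (fun x => (hC x).2.2) hφL)
    (hp hφL hdφ) (fun φ' hφ' hc' => by
      have hw' := congrArg (fun r : ℝ => (r : ℂ)) (h.weakForm _ (hφ.mul hφ') hc.mul_right)
      simp only [← integral_complex_ofReal, Complex.ofReal_zero] at hw'
      rw [← hw']
      congr 1; ext x
      simp only [fderiv_mul_apply' hφ hφ', inner_toComplexVec_comm, PiLp.smul_apply, smul_eq_mul,
        toComplexVec_apply]
      push_cast
      simp only [mul_add, Finset.sum_add_distrib, add_mul, Finset.sum_mul, ← mul_assoc]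
      have e1 : ∀ j, (φ x : ℂ) * ((gψ x j : ℝ) : ℂ) *
          ((fderiv ℝ φ' x (EuclideanSpace.single j 1) : ℝ) : ℂ) = ((gψ x j : ℝ) : ℂ) * (φ x : ℂ) *
          ((fderiv ℝ φ' x (EuclideanSpace.single j 1) : ℝ) : ℂ) := fun j => by ring
      have e2 : ∀ j, ((gψ x j : ℝ) : ℂ) *
          ((fderiv ℝ φ x (EuclideanSpace.single j 1) : ℝ) : ℂ) * (φ' x : ℂ)
          = ((gψ x j : ℝ) : ℂ) * (φ' x : ℂ) *
          ((fderiv ℝ φ x (EuclideanSpace.single j 1) : ℝ) : ℂ) := fun j => by ring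
      simp only [e1, e2]
      ring)
  rw [← key]
  congr 1; ext x
  simp only [inner_toComplexVec_comm, PiLp.smul_apply, smul_eq_mul,
    toComplexVec_apply]
  simp only [add_mul, Finset.sum_mul]
  have e1 : ∀ j, u x * ((gψ x j : ℝ) : ℂ) *
      ((fderiv ℝ φ x (EuclideanSpace.single j 1) : ℝ) : ℂ) = ((gψ x j : ℝ) : ℂ) *
      ((fderiv ℝ φ x (EuclideanSpace.single j 1) : ℝ) : ℂ) * u x := fun j => by ring
  have e2 : ∀ j, ((gψ x j : ℝ) : ℂ) * g x j * (φ x : ℂ)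
      = (φ x : ℂ) * ((gψ x j : ℝ) : ℂ) * g x j := fun j => by ring
  simp only [e1, e2]
  ring

end Corrector

section Remainder

variable {d : ℕ} {W ψ : Rd d → ℝ} {gψ : Rd d → Rd d}

lemma re_mul_conj_le (a b : ℂ) : (a * conj b).re ≤ ‖a‖ * ‖b‖ := by
  refine (Complex.re_le_norm _).trans ?_
  simp

lemma re_mul_conj_self (a : ℂ) : (a * conj a).re = ‖a‖ ^ 2 := by
  rw [Complex.mul_conj, Complex.ofReal_re, Complex.normSq_eq_norm_sq]

lemma re_inner_self_vec (a : EuclideanSpace ℂ (Fin d)) : (inner ℂ a a).re = ‖a‖ ^ 2 := by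
  rw [inner_self_eq_norm_sq_to_K]; norm_cast

lemma re_inner_le_vec (a b : EuclideanSpace ℂ (Fin d)) : (inner ℂ a b).re ≤ ‖a‖ * ‖b‖ :=
  (Complex.re_le_norm _).trans (norm_inner_le_norm _ _)

lemma IsWeakSolution.energy_le {ρ : ℝ} (hρ : 0 ≤ ρ) {f u : Rd d → ℂ}
    {g : Rd d → EuclideanSpace ℂ (Fin d)} (h : IsWeakSolution (fun _ => 1 + (ρ : ℂ)) f u g)
    (hf : MemLp f 2 volume) :
    (∫ x, ‖g x‖ ^ 2) + ∫ x, ‖u x‖ ^ 2 ≤ ∫ x, ‖f x‖ ^ 2 := by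
  have he := h.energy aestronglyMeasurable_const (Eventually.of_forall fun _ => le_rfl) hf
  have iu := h.memH1.memLp.norm.integrable_sq
  have ig := h.memH1.memLp_grad.norm.integrable_sq
  have jf := hf.norm.integrable_sq
  have ifu : Integrable fun x => (f x * conj (u x)).re :=
    (integrable_mul_conj_of_memLp hf h.memH1.memLp).re
  rw [integral_add ig (iu.const_mul _), integral_const_mul] at he
  have hle : ∫ x, (f x * conj (u x)).re ≤ ∫ x, (1 / 2 * ‖f x‖ ^ 2 + 1 / 2 * ‖u x‖ ^ 2) := by
    refine integral_mono ifu ((jf.const_mul _).add (iu.const_mul _)) fun x => ?_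
    have := re_mul_conj_le (f x) (u x)
    simp only
    nlinarith [sq_nonneg (‖f x‖ - ‖u x‖)]
  rw [integral_add (jf.const_mul _) (iu.const_mul _), integral_const_mul, integral_const_mul] at hle
  have h2 : (1 + (ρ : ℂ)).re = 1 + ρ := by simp
  rw [h2] at he
  have n1 : 0 ≤ ∫ x, ‖u x‖ ^ 2 := integral_nonneg fun x => by positivity
  have n2 : 0 ≤ ∫ x, ‖g x‖ ^ 2 := integral_nonneg fun x => by positivity
  nlinarith [mul_nonneg hρ n1]

variable {ρ m : ℝ} {f u uε : Rd d → ℂ} {g gε : Rd d → EuclideanSpace ℂ (Fin d)}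

/-- The remainder `u_ε - u + i ψ u` of the first order expansion belongs to `H¹`. -/
lemma memH1_remainder (hψ : IsBoundedCorrector 1 W ψ gψ) (hε : MemH1 uε gε) (hu : MemH1 u g) :
    MemH1 (fun x => uε x - u x + Complex.I * (ψ x * u x))
      (fun x => gε x - g x + Complex.I • ((ψ x : ℂ) • g x + u x • toComplexVec (gψ x))) :=
  (hε.sub hu).add ((hψ.memH1_mul hu).const_mul Complex.I)

lemma integrable_sq_norm_corrector_mul (hψ : IsBoundedCorrector 1 W ψ gψ)
    (hf : MemLp f 2 volume) : Integrable fun x => (ψ x) ^ 2 * ‖f x‖ ^ 2 := by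
  obtain ⟨C, hC⟩ := hψ.bounded
  refine hf.norm.integrable_sq.bdd_mul (c := C ^ 2) (hψ.measurable.pow_const 2).aestronglyMeasurable
    (Eventually.of_forall fun x => ?_)
  rw [norm_pow]
  exact pow_le_pow_left₀ (norm_nonneg _) (hC x).2.1 2

lemma integrable_sq_norm_corrector_mul_vec (hψ : IsBoundedCorrector 1 W ψ gψ)
    (hf : MemLp g 2 volume) : Integrable fun x => (ψ x) ^ 2 * ‖g x‖ ^ 2 := by
  obtain ⟨C, hC⟩ := hψ.bounded
  refine hf.norm.integrable_sq.bdd_mul (c := C ^ 2) (hψ.measurable.pow_const 2).aestronglyMeasurable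
    (Eventually.of_forall fun x => ?_)
  rw [norm_pow]
  exact pow_le_pow_left₀ (norm_nonneg _) (hC x).2.1 2

lemma memLp_fluctuation (hψ : IsBoundedCorrector 1 W ψ gψ) (m : ℝ) (hu : MemLp u 2 volume) :
    MemLp (fun x => ((W x * ψ x - m : ℝ) : ℂ) * u x) 2 volume := by
  obtain ⟨C, hC⟩ := hψ.bounded
  refine memLp_ofReal_mul (C := C * C + ‖m‖)
    ((hψ.measurable_potential.mul hψ.measurable).sub_const m) (fun x => ?_) hu
  refine (norm_sub_le _ _).trans ?_
  rw [Pi.mul_apply, norm_mul]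
  have := (norm_nonneg _).trans (hC x).1
  gcongr
  · exact (hC x).1
  · exact (hC x).2.1

/-- The equation of the remainder `w = u_ε - u + i ψ u`: its right-hand side involves `ψ`, the
number `ρ + m`, and the fluctuation `q = W ψ - m`, which enters through the solution
`(-Δ + 1)⁻¹ (q u)`. -/
lemma integral_remainder (hψ : IsBoundedCorrector 1 W ψ gψ) (hf : MemLp f 2 volume)
    (hu : IsWeakSolution (fun _ => 1 + (ρ : ℂ)) f u g)
    (hε : IsWeakSolution (fun x => 1 - Complex.I * (W x : ℂ)) f uε gε)
    {w v : Rd d → ℂ} {gw gv : Rd d → EuclideanSpace ℂ (Fin d)}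
    (hw : w = fun x => uε x - u x + Complex.I * (ψ x * u x))
    (hgw : gw = fun x => gε x - g x + Complex.I • ((ψ x : ℂ) • g x + u x • toComplexVec (gψ x)))
    (hv : MemH1 v gv) (m : ℝ) {F : Rd d → ℂ}
    (hF : F = fun x => ((W x * ψ x - m : ℝ) : ℂ) * u x) :
    ∫ x, ((inner ℂ (gv x) (gw x) + (1 - Complex.I * (W x : ℂ)) * w x * conj (v x))
      - (((ρ + m : ℝ) : ℂ) * u x * conj (v x)
        + (inner ℂ (gv x) (gradConv 1 F x) + conv (resK 1) F x * conj (v x))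
        + 2 * Complex.I * ψ x * inner ℂ (gv x) (g x)
        - Complex.I * ψ x * (f x - (1 + (ρ : ℂ)) * u x) * conj (v x))) = 0 := by
  obtain ⟨C, hC⟩ := hψ.bounded
  have hFL : MemLp F 2 volume := hF ▸ memLp_fluctuation hψ m hu.memH1.memLp
  have hψv := hψ.memH1_mul hv
  have hWu : ∀ {z : Rd d → ℂ}, MemLp z 2 volume →
      MemLp (fun x => (1 - Complex.I * (W x : ℂ)) * z x) 2 volume := fun {z} hz => by
    have h1 := (memLp_ofReal_mul hψ.measurable_potential (fun x => (hC x).1) hz).const_mul Complex.I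
    refine (hz.sub h1).ae_eq (Eventually.of_forall fun x => ?_)
    simp only [Pi.sub_apply]; ring
  -- The identity is a combination of five equations: those of `u_ε` and `u` tested with `v`, that
  -- of `u` tested with `ψ v`, that of `ψ` tested with `u v`, and that of `(-Δ + 1)⁻¹ F`.
  have e1 := hε.weakForm_inner hv
  have e2 := hu.weakForm_inner hv
  have e3 := hu.weakForm_inner hψv
  have e4 := hψ.integral_mul_eq_zero hu.memH1 hv
  have e5 := integral_inner_gradConv one_pos hFL hv
  have hH := memH1_conv one_pos hFL
  have jf := integrable_mul_conj_of_memLp hf hv.memLp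
  have jf' := integrable_mul_conj_of_memLp hf hψv.memLp
  have i1 : Integrable fun x => inner ℂ (gv x) (gε x)
      + (1 - Complex.I * (W x : ℂ)) * uε x * conj (v x) :=
    (integrable_inner_of_memLp hε.memH1.memLp_grad hv.memLp_grad).add
      (integrable_mul_conj_of_memLp (hWu hε.memH1.memLp) hv.memLp)
  have i2 : Integrable fun x => inner ℂ (gv x) (g x) + (1 + (ρ : ℂ)) * u x * conj (v x) :=
    (integrable_inner_of_memLp hu.memH1.memLp_grad hv.memLp_grad).add
      (integrable_mul_conj_of_memLp (hu.memH1.memLp.const_mul _) hv.memLp)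
  have i3 : Integrable fun x => inner ℂ ((ψ x : ℂ) • gv x + v x • toComplexVec (gψ x)) (g x)
      + (1 + (ρ : ℂ)) * u x * conj ((ψ x : ℂ) * v x) :=
    (integrable_inner_of_memLp hu.memH1.memLp_grad hψv.memLp_grad).add
      (integrable_mul_conj_of_memLp (hu.memH1.memLp.const_mul _) hψv.memLp)
  have i4 : Integrable fun x => (inner ℂ (gv x) (u x • toComplexVec (gψ x))
      + (inner ℂ (toComplexVec (gψ x)) (g x) + ((1 : ℝ) * ψ x + W x : ℂ) * u x) * conj (v x)) := by
    have hq := memLp_ofReal_mul (a := fun x => 1 * ψ x + W x) (C := C + C)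
      ((hψ.measurable.const_mul 1).add hψ.measurable_potential)
      (fun x => (norm_add_le _ _).trans (by
        rw [one_mul]; exact add_le_add (hC x).2.1 (hC x).1)) hu.memH1.memLp
    push_cast at hq
    exact (integrable_inner_of_memLp (memLp_smul_toComplexVec hψ.measurable_grad
      (fun x => (hC x).2.2) hu.memH1.memLp) hv.memLp_grad).add
      (integrable_mul_conj_of_memLp ((memLp_toComplexVec_inner hψ.measurable_grad
        (fun x => (hC x).2.2) hu.memH1.memLp_grad).add (by simpa using hq)) hv.memLp)
  have i5 : Integrable fun x => inner ℂ (gv x) (gradConv 1 F x)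
      + ((1 : ℝ) * conv (resK 1) F x - F x) * conj (v x) :=
    (integrable_inner_of_memLp hH.memLp_grad hv.memLp_grad).add
      (integrable_mul_conj_of_memLp ((hH.memLp.const_mul _).sub hFL) hv.memLp)
  have e1' : ∫ x, ((inner ℂ (gv x) (gε x) + (1 - Complex.I * (W x : ℂ)) * uε x * conj (v x))
      - f x * conj (v x)) = 0 := by rw [integral_sub i1 jf, e1, sub_self]
  have e2' : ∫ x, ((inner ℂ (gv x) (g x) + (1 + (ρ : ℂ)) * u x * conj (v x))
      - f x * conj (v x)) = 0 := by rw [integral_sub i2 jf, e2, sub_self]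
  have e3' : ∫ x, ((inner ℂ ((ψ x : ℂ) • gv x + v x • toComplexVec (gψ x)) (g x)
      + (1 + (ρ : ℂ)) * u x * conj ((ψ x : ℂ) * v x)) - f x * conj ((ψ x : ℂ) * v x)) = 0 := by
    rw [integral_sub i3 jf', e3, sub_self]
  have i1' := i1.sub jf
  have i2' := i2.sub jf
  have i3' := (i3.sub jf').const_mul Complex.I
  have i4' := i4.const_mul Complex.I
  have key := integral_add (i1'.sub i2') (i4'.sub (i3'.add i5))
  rw [integral_sub' i1' i2', integral_sub' i4' (i3'.add i5), integral_add' i3' i5,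
    integral_const_mul, integral_const_mul] at key
  simp only [Pi.sub_apply] at key
  rw [e1', e2', e3', e4, e5] at key
  simp only [mul_zero, sub_self, add_zero] at key
  rw [← key]
  congr 1; ext x
  simp only [hw, hgw, Pi.add_apply, inner_add_right, inner_sub_right,
    inner_smul_right, inner_add_left, inner_smul_left, map_mul, Complex.conj_ofReal]
  have hFx : F x = ((W x : ℂ) * ψ x - m) * u x := by rw [hF]; push_cast; ring
  rw [hFx]
  push_cast
  linear_combination (-(conj (v x)) * u x * W x * ψ x) * Complex.I_sq

/-- The energy of the solution `Θ` of `(-Δ + 1) Θ = F`. -/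
lemma re_integral_mul_conj_conv {F : Rd d → ℂ} (hFL : MemLp F 2 volume) :
    (∫ x, ‖gradConv 1 F x‖ ^ 2) + ∫ x, ‖conv (resK 1) F x‖ ^ 2
      = (∫ x, F x * conj (conv (resK 1) F x)).re := by
  have hΘ := memH1_conv one_pos hFL
  have e := integral_inner_gradConv one_pos hFL hΘ
  have j1 := integrable_inner_of_memLp hΘ.memLp_grad hΘ.memLp_grad
  have j2 := integrable_mul_conj_of_memLp hΘ.memLp hΘ.memLp
  have j3 := integrable_mul_conj_of_memLp hFL hΘ.memLp
  have e' : (∫ x, inner ℂ (gradConv 1 F x) (gradConv 1 F x))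
      + (∫ x, conv (resK 1) F x * conj (conv (resK 1) F x))
      - ∫ x, F x * conj (conv (resK 1) F x) = 0 := by
    have j4 : Integrable fun x => inner ℂ (gradConv 1 F x) (gradConv 1 F x)
        + conv (resK 1) F x * conj (conv (resK 1) F x) := j1.add j2
    rw [← integral_add j1 j2, ← integral_sub j4 j3, ← e]
    congr 1; ext x
    push_cast; ring
  rw [sub_eq_zero] at e'
  rw [← e', Complex.add_re]
  have r1 := integral_re j1
  have r2 := integral_re j2
  simp only [RCLike.re_eq_complex_re] at r1 r2
  rw [← r1, ← r2]
  simp only [re_mul_conj_self, re_inner_self_vec]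

/-- The energy estimate of the remainder `w = u_ε - u + i ψ u`. The potential `W` does not enter,
because `-i W` contributes nothing to the real part of the energy. -/
theorem remainder_energy_le (hψ : IsBoundedCorrector 1 W ψ gψ) (hf : MemLp f 2 volume)
    (hu : IsWeakSolution (fun _ => 1 + (ρ : ℂ)) f u g)
    (hε : IsWeakSolution (fun x => 1 - Complex.I * (W x : ℂ)) f uε gε)
    {w : Rd d → ℂ} {gw : Rd d → EuclideanSpace ℂ (Fin d)}
    (hw : w = fun x => uε x - u x + Complex.I * (ψ x * u x))
    (hgw : gw = fun x => gε x - g x + Complex.I • ((ψ x : ℂ) • g x + u x • toComplexVec (gψ x)))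
    (m : ℝ) {F : Rd d → ℂ} (hF : F = fun x => ((W x * ψ x - m : ℝ) : ℂ) * u x) :
    (∫ x, ‖w x‖ ^ 2) + ∫ x, ‖gw x‖ ^ 2 ≤
      8 * ((ρ + m) ^ 2 * (∫ x, ‖u x‖ ^ 2) + (∫ x, F x * conj (conv (resK 1) F x)).re
        + (∫ x, ψ x ^ 2 * ‖g x‖ ^ 2) + ∫ x, ψ x ^ 2 * ‖f x - (1 + (ρ : ℂ)) * u x‖ ^ 2) := by
  have hH : MemH1 w gw := by
    rw [hw, hgw]; exact memH1_remainder hψ hε.memH1 hu.memH1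
  have hFL : MemLp F 2 volume := hF ▸ memLp_fluctuation hψ m hu.memH1.memLp
  have hΘ := memH1_conv one_pos hFL
  set Θ := conv (resK 1) F with hΘdef
  set gΘ := gradConv 1 F with hgΘdef
  have hh : MemLp (fun x => f x - (1 + (ρ : ℂ)) * u x) 2 volume :=
    hf.sub (hu.memH1.memLp.const_mul _)
  set h : Rd d → ℂ := fun x => f x - (1 + (ρ : ℂ)) * u x with hhdef
  have iw := hH.memLp.norm.integrable_sq
  have igw := hH.memLp_grad.norm.integrable_sq
  have iu := hu.memH1.memLp.norm.integrable_sq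
  have iΘ := hΘ.memLp.norm.integrable_sq
  have igΘ := hΘ.memLp_grad.norm.integrable_sq
  have iψg := integrable_sq_norm_corrector_mul_vec hψ hu.memH1.memLp_grad
  have iψh := integrable_sq_norm_corrector_mul hψ hh
  have eΘ := re_integral_mul_conj_conv hFL
  -- the identity for the remainder, tested with the remainder itself
  have key := integral_remainder hψ hf hu hε hw hgw hH m hF
  obtain ⟨C, hC⟩ := hψ.bounded
  have hWw : MemLp (fun x => (1 - Complex.I * (W x : ℂ)) * w x) 2 volume := by
    have h1 := (memLp_ofReal_mul hψ.measurable_potential (fun x => (hC x).1)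
      hH.memLp).const_mul Complex.I
    refine (hH.memLp.sub h1).ae_eq (Eventually.of_forall fun x => ?_)
    simp only [Pi.sub_apply]; ring
  have hpt : ∀ x, ‖gw x‖ ^ 2 + ‖w x‖ ^ 2 - ((inner ℂ (gw x) (gw x)
      + (1 - Complex.I * (W x : ℂ)) * w x * conj (w x))
      - (((ρ + m : ℝ) : ℂ) * u x * conj (w x)
        + (inner ℂ (gw x) (gΘ x) + Θ x * conj (w x))
        + 2 * Complex.I * ψ x * inner ℂ (gw x) (g x)
        - Complex.I * ψ x * h x * conj (w x))).re
      ≤ 2 * ((ρ + m) ^ 2 * ‖u x‖ ^ 2) + 2 * (‖gΘ x‖ ^ 2 + ‖Θ x‖ ^ 2) + 4 * (ψ x ^ 2 * ‖g x‖ ^ 2)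
        + 2 * (ψ x ^ 2 * ‖h x‖ ^ 2) + 1 / 2 * (‖gw x‖ ^ 2 + ‖w x‖ ^ 2) := by
    intro x
    have t0 : ((1 - Complex.I * (W x : ℂ)) * w x * conj (w x)).re = ‖w x‖ ^ 2 := by
      rw [mul_assoc, Complex.mul_conj, Complex.re_mul_ofReal, Complex.normSq_eq_norm_sq]
      simp
    have t1 : (((ρ + m : ℝ) : ℂ) * u x * conj (w x)).re ≤ |ρ + m| * ‖u x‖ * ‖w x‖ := by
      refine (re_mul_conj_le _ _).trans (le_of_eq ?_)
      rw [norm_mul, Complex.norm_real, Real.norm_eq_abs]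
    have t2 := re_inner_le_vec (gw x) (gΘ x)
    have t3 := re_mul_conj_le (Θ x) (w x)
    have t4 : (2 * Complex.I * ψ x * inner ℂ (gw x) (g x)).re ≤ 2 * |ψ x| * (‖gw x‖ * ‖g x‖) := by
      refine (Complex.re_le_norm _).trans ?_
      rw [norm_mul]
      refine mul_le_mul (le_of_eq ?_) (norm_inner_le_norm _ _) (norm_nonneg _) (by positivity)
      simp
    have t5 : -(Complex.I * ψ x * h x * conj (w x)).re ≤ |ψ x| * ‖h x‖ * ‖w x‖ := by
      refine (neg_le_abs _).trans ((Complex.abs_re_le_norm _).trans (le_of_eq ?_))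
      simp
    simp only [Complex.sub_re, Complex.add_re] at *
    rw [t0, re_inner_self_vec]
    -- Young's inequality for each product, leaving half of the energy of `w` to be absorbed
    have q1 := sq_nonneg (2 * (2 * (|ρ + m| * ‖u x‖)) - ‖w x‖)
    have q2 := sq_nonneg (2 * ‖gΘ x‖ - ‖gw x‖)
    have q3 := sq_nonneg (2 * (2 * ‖Θ x‖) - ‖w x‖)
    have q4 := sq_nonneg (4 * (|ψ x| * ‖g x‖) - ‖gw x‖)
    have q5 := sq_nonneg (2 * (2 * (|ψ x| * ‖h x‖)) - ‖w x‖)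
    have a1 := sq_abs (ρ + m)
    have a2 := sq_abs (ψ x)
    have b1 : (|ρ + m| * ‖u x‖) ^ 2 = (ρ + m) ^ 2 * ‖u x‖ ^ 2 := by rw [mul_pow, a1]
    have b2 : (|ψ x| * ‖g x‖) ^ 2 = ψ x ^ 2 * ‖g x‖ ^ 2 := by rw [mul_pow, a2]
    have b3 : (|ψ x| * ‖h x‖) ^ 2 = ψ x ^ 2 * ‖h x‖ ^ 2 := by rw [mul_pow, a2]
    rw [← b1, ← b2, ← b3]
    nlinarith [sq_nonneg ‖w x‖, sq_nonneg ‖gΘ x‖]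
  have jA : Integrable fun x => ((inner ℂ (gw x) (gw x)
      + (1 - Complex.I * (W x : ℂ)) * w x * conj (w x))
      - (((ρ + m : ℝ) : ℂ) * u x * conj (w x)
        + (inner ℂ (gw x) (gΘ x) + Θ x * conj (w x))
        + 2 * Complex.I * ψ x * inner ℂ (gw x) (g x)
        - Complex.I * ψ x * h x * conj (w x))) := by
    refine Integrable.sub (Integrable.add ?_ ?_) (Integrable.sub (Integrable.add (Integrable.add ?_
      (Integrable.add ?_ ?_)) ?_) ?_)
    · exact integrable_inner_of_memLp hH.memLp_grad hH.memLp_grad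
    · exact integrable_mul_conj_of_memLp hWw hH.memLp
    · exact integrable_mul_conj_of_memLp (hu.memH1.memLp.const_mul _) hH.memLp
    · exact integrable_inner_of_memLp hΘ.memLp_grad hH.memLp_grad
    · exact integrable_mul_conj_of_memLp hΘ.memLp hH.memLp
    · have : MemLp (fun x => (ψ x : ℂ) • g x) 2 volume := by
        have hC' : ∀ x, ‖(ψ x : ℂ)‖ ≤ C := fun x => by simpa using (hC x).2.1
        exact memLp_of_bdd_smul (Complex.measurable_ofReal.comp hψ.measurable).aestronglyMeasurable
          hC' hu.memH1.memLp_grad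
      refine ((integrable_inner_of_memLp this hH.memLp_grad).const_mul (2 * Complex.I)).congr
        (Eventually.of_forall fun x => ?_)
      simp only [inner_smul_right]
      ring
    · refine (integrable_mul_conj_of_memLp ((memLp_ofReal_mul hψ.measurable
        (fun x => (hC x).2.1) hh).const_mul Complex.I) hH.memLp).congr
        (Eventually.of_forall fun x => ?_)
      simp only
      ring
  have hkey := congrArg Complex.re key
  have r := integral_re jA
  simp only [RCLike.re_eq_complex_re] at r
  rw [← r, Complex.zero_re] at hkey
  have jL : Integrable fun x => ‖gw x‖ ^ 2 + ‖w x‖ ^ 2 := igw.add iw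
  have jΘ : Integrable fun x => ‖gΘ x‖ ^ 2 + ‖Θ x‖ ^ 2 := igΘ.add iΘ
  have hmono := integral_mono (jL.sub jA.re) (((((iu.const_mul ((ρ + m) ^ 2)).const_mul 2).add
    (jΘ.const_mul 2)).add (iψg.const_mul 4)).add (iψh.const_mul 2) |>.add
      (jL.const_mul (1 / 2))) hpt
  rw [integral_sub' jL jA.re] at hmono
  simp only [RCLike.re_eq_complex_re] at hmono
  rw [hkey, integral_add' (((((iu.const_mul ((ρ + m) ^ 2)).const_mul 2).add
    (jΘ.const_mul 2)).add (iψg.const_mul 4)).add (iψh.const_mul 2)) (jL.const_mul (1 / 2)),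
    integral_add' ((((iu.const_mul ((ρ + m) ^ 2)).const_mul 2).add
    (jΘ.const_mul 2)).add (iψg.const_mul 4)) (iψh.const_mul 2),
    integral_add' (((iu.const_mul ((ρ + m) ^ 2)).const_mul 2).add
    (jΘ.const_mul 2)) (iψg.const_mul 4),
    integral_add' ((iu.const_mul ((ρ + m) ^ 2)).const_mul 2)
    (jΘ.const_mul 2)] at hmono
  simp only [integral_const_mul] at hmono
  rw [integral_add igw iw, integral_add igΘ iΘ, eΘ] at hmono
  have n1 : 0 ≤ (ρ + m) ^ 2 * ∫ x, ‖u x‖ ^ 2 :=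
    mul_nonneg (sq_nonneg _) (integral_nonneg fun x => by positivity)
  have n2 : 0 ≤ (∫ x, F x * conj (Θ x)).re := by
    rw [← eΘ]
    exact add_nonneg (integral_nonneg fun x => by positivity) (integral_nonneg fun x => by positivity)
  have n3 : 0 ≤ ∫ x, ψ x ^ 2 * ‖h x‖ ^ 2 := integral_nonneg fun x => by positivity
  have n4 : 0 ≤ ∫ x, ψ x ^ 2 * ‖g x‖ ^ 2 := integral_nonneg fun x => by positivity
  linarith

end Remainder

/-! ### Well-posedness of the random problem -/

section RandomProblem

variable {d : ℕ} {Ω : Type*} [MeasurableSpace Ω] {P : Measure Ω}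

lemma integral_resK {lam : ℝ} (hl : 0 < lam) : ∫ x : Rd d, resK lam x = lam⁻¹ := by
  have h := integral_resK_smul hl (F := fun _ : Rd d => (1 : ℝ)) aestronglyMeasurable_const
    (C := 1) (by simp)
  simp only [smul_eq_mul, mul_one] at h
  rw [h, setIntegral_congr_fun (g := fun t => Real.exp (-lam * t)) measurableSet_Ioi fun t ht => by
    simp only [integral_heat (d := d) ht, mul_one, neg_mul], integral_exp_mul_Ioi (by linarith)]
  simp [neg_div_neg_eq]

lemma lintegral_enorm_resK {lam : ℝ} (hl : 0 < lam) :
    ∫⁻ x : Rd d, ‖resK lam x‖ₑ = ENNReal.ofReal lam⁻¹ := by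
  rw [← integral_resK (d := d) hl, ofReal_integral_eq_lintegral_ofReal (integrable_resK hl)
    (Eventually.of_forall fun x => resK_nonneg lam x)]
  refine lintegral_congr fun x => ?_
  rw [Real.enorm_of_nonneg (resK_nonneg lam x)]

lemma ae_ae_swap [SFinite P] {p : Rd d × Ω → Prop} (h : ∀ᵐ q ∂((volume : Measure (Rd d)).prod P), p q) :
    ∀ᵐ ω ∂P, ∀ᵐ x : Rd d, p (x, ω) :=
  Measure.ae_ae_of_ae_prod (Measure.measurePreserving_swap.quasiMeasurePreserving.ae h)

lemma ae_eq_prod_of_ae_ae [SFinite P] {E : Type*} [NormedAddCommGroup E] {F G : Rd d × Ω → E}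
    (hF : AEStronglyMeasurable F ((volume : Measure (Rd d)).prod P))
    (hG : AEStronglyMeasurable G ((volume : Measure (Rd d)).prod P))
    (h : ∀ᵐ ω ∂P, ∀ᵐ x : Rd d, F (x, ω) = G (x, ω)) :
    F =ᵐ[(volume : Measure (Rd d)).prod P] G := by
  have h1 : hF.mk F =ᵐ[(volume : Measure (Rd d)).prod P] hG.mk G := by
    have hm : MeasurableSet {q | hF.mk F q = hG.mk G q} :=
      hF.stronglyMeasurable_mk.measurableSet_eq_fun hG.stronglyMeasurable_mk
    have h2 : ∀ᵐ q ∂(P.prod (volume : Measure (Rd d))), hF.mk F q.swap = hG.mk G q.swap := by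
      refine (Measure.ae_prod_iff_ae_ae (p := fun q : Ω × Rd d =>
        hF.mk F q.swap = hG.mk G q.swap) (measurable_swap hm)).2 ?_
      filter_upwards [h, ae_ae_swap hF.ae_eq_mk, ae_ae_swap hG.ae_eq_mk] with ω a b c
      filter_upwards [a, b, c] with x a b c
      simp only [Prod.swap]
      rw [← b, ← c, a]
    have := (Measure.measurePreserving_swap
      (μ := (volume : Measure (Rd d))) (ν := P)).quasiMeasurePreserving.ae h2
    filter_upwards [this] with q hq using hq
  exact hF.ae_eq_mk.trans (h1.trans hG.ae_eq_mk.symm)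

lemma ae_memLp_section [SFinite P] {E : Type*} [NormedAddCommGroup E] {F : Rd d × Ω → E}
    (hF : MemLp F 2 ((volume : Measure (Rd d)).prod P)) (hm : StronglyMeasurable F) :
    ∀ᵐ ω ∂P, MemLp (fun x => F (x, ω)) 2 volume := by
  have h : ∫⁻ q, ‖F q‖ₑ ^ 2 ∂((volume : Measure (Rd d)).prod P) < ⊤ := by
    rw [← eLpNorm_two_sq]; exact ENNReal.pow_lt_top hF.2
  rw [lintegral_prod_symm' _ (hm.enorm.pow_const 2)] at h
  filter_upwards [ae_lt_top (hm.enorm.pow_const 2).lintegral_prod_left' h.ne] with ω hω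
  refine ⟨(hm.comp_measurable measurable_prodMk_right).aestronglyMeasurable, ?_⟩
  rw [← eLpNorm_two_sq] at hω
  exact (ENNReal.pow_lt_top_iff.1 hω).resolve_right two_ne_zero

lemma ae_integrable_conv_prod [SFinite P] {K : Rd d → ℝ} (hK : Measurable K)
    (hKi : Integrable K) {F : Rd d × Ω → ℂ} (hF : Measurable F)
    (hF2 : MemLp F 2 ((volume : Measure (Rd d)).prod P)) :
    ∀ᵐ q ∂((volume : Measure (Rd d)).prod P), Integrable fun z => K z • F (q.1 - z, q.2) := by
  have h := lintegral_sq_average_le (μ := (volume : Measure (Rd d)).prod P)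
    (ν := (volume : Measure (Rd d)))
    (T := fun z q => (q.1 - z, q.2)) (by simp only [Function.uncurry_def]; fun_prop)
    (fun z => (measurePreserving_sub_right volume z).prod (MeasurePreserving.id P))
    hK.enorm hF.enorm
  have hm : Measurable fun p : (Rd d × Ω) × Rd d => K p.2 • F (p.1.1 - p.2, p.1.2) :=
    (hK.comp measurable_snd).smul (hF.comp (by fun_prop))
  have hm' : Measurable fun q : Rd d × Ω => ∫⁻ z, ‖K z‖ₑ * ‖F (q.1 - z, q.2)‖ₑ := by
    have := hm.enorm.lintegral_prod_right' (ν := (volume : Measure (Rd d)))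
    simpa only [enorm_smul] using this
  rw [← eLpNorm_two_sq F] at h
  have hlt := h.trans_lt (ENNReal.mul_lt_top (ENNReal.pow_lt_top hKi.2) (ENNReal.pow_lt_top hF2.2))
  filter_upwards [ae_lt_top (hm'.pow_const 2) hlt.ne] with q hq
  refine ⟨(hm.comp measurable_prodMk_left).aestronglyMeasurable, ?_⟩
  simp only [HasFiniteIntegral, enorm_smul]
  exact (ENNReal.pow_lt_top_iff.1 hq).resolve_right two_ne_zero

/-- The random problem has a jointly measurable solution, the fixed point in `L²(ℝ^d × Ω)` of the
contraction `u ↦ (-Δ + lam)⁻¹ (f + (lam - 1 + i W) u)` for `lam = 1 + M²`. -/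
theorem exists_random_weakSolution [IsProbabilityMeasure P] {W : Rd d → Ω → ℝ}
    (hW : Measurable fun q : Rd d × Ω => W q.1 q.2) {M : ℝ} (hM : ∀ x ω, |W x ω| ≤ M)
    {f : Rd d → ℂ} (hf : MemLp f 2 volume) :
    ∃ (u : Rd d → Ω → ℂ) (g : Rd d → Ω → EuclideanSpace ℂ (Fin d)),
      StronglyMeasurable (fun q : Rd d × Ω => u q.1 q.2) ∧
      StronglyMeasurable (fun q : Rd d × Ω => g q.1 q.2) ∧
      ∀ᵐ ω ∂P, IsWeakSolution (fun x => 1 - Complex.I * (W x ω : ℂ)) f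
        (fun x => u x ω) (fun x => g x ω) := by
  set lam : ℝ := 1 + M ^ 2 with hlam
  have hl : 0 < lam := by positivity
  set f' := hf.1.mk f with hf'
  have hff' : f =ᵐ[volume] f' := hf.1.ae_eq_mk
  have hf'm : Measurable f' := hf.1.stronglyMeasurable_mk.measurable
  have hf'L : MemLp (fun q : Rd d × Ω => f' q.1) 2 (volume.prod P) :=
    (hf.ae_eq hff').comp_measurePreserving measurePreserving_fst
  set c : Rd d × Ω → ℂ := fun q => lam - (1 - Complex.I * (W q.1 q.2 : ℂ)) with hc
  have hcm : Measurable c := by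
    have := Complex.measurable_ofReal.comp hW
    exact measurable_const.sub (measurable_const.sub (measurable_const.mul this))
  -- `|lam - 1 + i W|² ≤ M⁴ + M² < lam²`, which makes the map a contraction
  set κ : ℝ := √(M ^ 4 + M ^ 2) with hκ
  have hcκ : ∀ q, ‖c q‖ ≤ κ := fun q => by
    have h1 : c q = (M ^ 2 : ℝ) + (W q.1 q.2 : ℝ) * Complex.I := by
      simp only [hc, hlam]; push_cast; ring
    rw [h1, Complex.norm_add_mul_I, hκ]
    apply Real.sqrt_le_sqrt
    have := sq_le_sq' (by linarith [abs_le.1 (hM q.1 q.2)]) (abs_le.1 (hM q.1 q.2)).2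
    nlinarith
  have hκl : κ * lam⁻¹ < 1 := by
    rw [← div_eq_mul_inv, div_lt_one hl, hκ, Real.sqrt_lt' hl, hlam]
    nlinarith [sq_nonneg M]
  have hκ0 : 0 ≤ κ := Real.sqrt_nonneg _
  set G : (Rd d × Ω → ℂ) → Rd d × Ω → ℂ := fun u q => f' q.1 + c q * u q with hG
  have hGm : ∀ {u}, Measurable u → Measurable (G u) := fun hu =>
    (hf'm.comp measurable_fst).add (hcm.mul hu)
  have hcL : ∀ {u : Rd d × Ω → ℂ}, MemLp u 2 (volume.prod P) →
      MemLp (fun q => c q * u q) 2 (volume.prod P) := fun hu =>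
    memLp_of_bdd_smul hcm.aestronglyMeasurable hcκ hu
  have hGL : ∀ {u}, MemLp u 2 (volume.prod P) → MemLp (G u) 2 (volume.prod P) := fun hu =>
    hf'L.add (hcL hu)
  set T : (Rd d × Ω → ℂ) → Rd d × Ω → ℂ :=
    fun u q => conv (resK lam) (fun x => G u (x, q.2)) q.1 with hT
  have hTm : ∀ {u}, Measurable u → StronglyMeasurable (T u) := fun hu =>
    stronglyMeasurable_conv_prod (measurable_resK lam) (hGm hu)
  have hTL : ∀ {u}, Measurable u → MemLp u 2 (volume.prod P) → MemLp (T u) 2 (volume.prod P) :=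
    fun hu hu2 => ⟨(hTm hu).aestronglyMeasurable,
      (eLpNorm_conv_prod_le (measurable_resK lam) (hGm hu)).trans_lt
        (ENNReal.mul_lt_top (integrable_resK hl).2 (hGL hu2).2)⟩
  have hLm : ∀ u : Lp ℂ 2 ((volume : Measure (Rd d)).prod P), Measurable u := fun u =>
    (Lp.stronglyMeasurable u).measurable
  let S : Lp ℂ 2 ((volume : Measure (Rd d)).prod P) → Lp ℂ 2 ((volume : Measure (Rd d)).prod P) :=
    fun u => (hTL (hLm u) (Lp.memLp u)).toLp (T u)
  have hS : ContractingWith (κ * lam⁻¹).toNNReal S := by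
    refine ⟨by simpa using hκl, fun u v => ?_⟩
    rw [Lp.edist_toLp_toLp, Lp.edist_def]
    have hd : T u - T v =ᵐ[(volume : Measure (Rd d)).prod P]
        fun q => conv (resK lam) (fun x => c (x, q.2) * ((u : _ → ℂ) (x, q.2) - (v : _ → ℂ) (x, q.2))) q.1 := by
      filter_upwards [ae_integrable_conv_prod (measurable_resK lam) (integrable_resK hl)
          (hGm (hLm u)) (hGL (Lp.memLp u)),
        ae_integrable_conv_prod (measurable_resK lam) (integrable_resK hl)
          (hGm (hLm v)) (hGL (Lp.memLp v))] with q h1 h2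
      simp only [Pi.sub_apply, hT, conv]
      rw [← integral_sub h1 h2]
      congr 1; ext z
      rw [← smul_sub]
      congr 1
      simp only [hG]; ring
    rw [eLpNorm_congr_ae hd]
    refine (eLpNorm_conv_prod_le (F := fun q => c q * ((u : _ → ℂ) q - (v : _ → ℂ) q))
      (measurable_resK lam) (hcm.mul ((hLm u).sub (hLm v)))).trans ?_
    rw [lintegral_enorm_resK hl]
    have h3 : eLpNorm (fun q => c q * ((u : _ → ℂ) q - (v : _ → ℂ) q)) 2 (volume.prod P)
        ≤ ENNReal.ofReal κ * eLpNorm ((u : Rd d × Ω → ℂ) - (v : Rd d × Ω → ℂ)) 2 (volume.prod P) :=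
      eLpNorm_le_mul_eLpNorm_of_ae_le_mul (Eventually.of_forall fun q => by
        rw [norm_mul]; exact mul_le_mul_of_nonneg_right (hcκ q) (norm_nonneg _)) 2
    calc _ ≤ ENNReal.ofReal lam⁻¹ * (ENNReal.ofReal κ * eLpNorm ((u : Rd d × Ω → ℂ) - (v : Rd d × Ω → ℂ)) 2 (volume.prod P)) := by
          gcongr
      _ = _ := by
          rw [← mul_assoc, ← ENNReal.ofReal_mul (by positivity), mul_comm lam⁻¹]; rfl
  set û := hS.fixedPoint S with hû
  have hfix : S û = û := hS.fixedPoint_isFixedPt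
  have hae : T û =ᵐ[(volume : Measure (Rd d)).prod P] û := by
    have := (hTL (hLm û) (Lp.memLp û)).coeFn_toLp
    have h2 : ((hTL (hLm û) (Lp.memLp û)).toLp (T û) : Rd d × Ω → ℂ) = û :=
      congrArg (fun w : Lp ℂ 2 ((volume : Measure (Rd d)).prod P) => (w : Rd d × Ω → ℂ)) hfix
    rw [h2] at this
    exact this.symm
  -- `T û` agrees almost everywhere with `û`, and its sections are defined by an integral for every
  -- `ω`, so that the equation holds for almost every `ω`
  refine ⟨fun x ω => T û (x, ω), fun x ω => gradConv lam (fun x => G û (x, ω)) x,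
    hTm (hLm û), ?_, ?_⟩
  · have : Measurable fun q : Rd d × Ω => fun j : Fin d =>
        conv (fun z => gradK lam z j) (fun x => G û (x, q.2)) q.1 :=
      measurable_pi_lambda _ fun j =>
        (stronglyMeasurable_conv_prod (measurable_gradK_apply lam j) (hGm (hLm û))).measurable
    exact ((PiLp.continuous_toLp 2 _).measurable.comp this).stronglyMeasurable
  · filter_upwards [ae_ae_swap hae, ae_memLp_section (Lp.memLp û) (Lp.stronglyMeasurable û)]
      with ω hω hω2
    have hF : (fun x => G û (x, ω)) =ᵐ[volume]
        fun x => f x + (lam - (1 - Complex.I * (W x ω : ℂ))) * T û (x, ω) := by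
      filter_upwards [hff', hω] with x h1 h2
      rw [h2, h1]
    have hFL : MemLp (fun x => G û (x, ω)) 2 volume := by
      have h1 : MemLp (fun x => c (x, ω) * (û : _ → ℂ) (x, ω)) 2 volume :=
        memLp_of_bdd_smul (hcm.comp measurable_prodMk_right).aestronglyMeasurable
          (fun x => hcκ (x, ω)) hω2
      exact (hf.ae_eq hff').add h1
    have hsol := isWeakSolution_of_fixedPoint hl (c := fun x => 1 - Complex.I * (W x ω : ℂ))
      (f := f) (u := fun x => T û (x, ω)) (hFL.ae_eq hF) (fun x => conv_congr_ae hF x) hf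
    have hg : gradConv lam (fun x => f x + (lam - (1 - Complex.I * (W x ω : ℂ))) * T û (x, ω))
        = gradConv lam (fun x => G û (x, ω)) := by
      ext x j
      exact (conv_congr_ae hF x).symm
    rw [hg] at hsol
    exact hsol

lemma exists_weakSolution {lam : ℝ} (hl : 0 < lam) {f : Rd d → ℂ} (hf : MemLp f 2 volume) :
    ∃ u g, IsWeakSolution (fun _ => (lam : ℂ)) f u g := by
  have := isWeakSolution_of_fixedPoint hl (c := fun _ => (lam : ℂ)) (f := f)
    (u := conv (resK lam) f) (by simpa using hf) (by simp) hf
  exact ⟨_, _, this⟩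

end RandomProblem

/-! ### Stationarity and the correlation function -/

section Stationary

variable {d : ℕ} {Ω : Type*} [AddAction (Rd d) Ω]

lemma field_vadd (V : Ω → ℝ) (x z : Rd d) (ω : Ω) : field V x (z +ᵥ ω) = field V (x - z) ω := by
  simp only [field, vadd_vadd]; congr 2; abel

variable [MeasurableSpace Ω] [MeasurableVAdd₂ (Rd d) Ω] {P : Measure Ω} {V : Ω → ℝ}

lemma measurable_field (hV : Measurable V) : Measurable fun q : Rd d × Ω => field V q.1 q.2 :=
  hV.comp (measurable_fst.neg.vadd measurable_snd)

lemma measurable_field_left (hV : Measurable V) (ω : Ω) : Measurable fun x : Rd d => field V x ω :=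
  (measurable_field hV).comp measurable_prodMk_right

lemma measurable_field_right (hV : Measurable V) (x : Rd d) : Measurable (field V x) :=
  (measurable_field hV).comp measurable_prodMk_left

lemma integral_vadd_eq [VAddInvariantMeasure (Rd d) Ω P] {E : Type*} [NormedAddCommGroup E]
    [NormedSpace ℝ E] (z : Rd d) (F : Ω → E) : ∫ ω, F (z +ᵥ ω) ∂P = ∫ ω, F ω ∂P :=
  (measurePreserving_vadd z P).integral_comp (measurableEmbedding_const_vadd z) F

lemma lintegral_vadd_eq [VAddInvariantMeasure (Rd d) Ω P] (z : Rd d) (F : Ω → ℝ≥0∞) :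
    ∫⁻ ω, F (z +ᵥ ω) ∂P = ∫⁻ ω, F ω ∂P :=
  (measurePreserving_vadd z P).lintegral_comp_emb (measurableEmbedding_const_vadd z) F

lemma integral_field_mul_field [VAddInvariantMeasure (Rd d) Ω P] (x y : Rd d) :
    ∫ ω, field V x ω * field V y ω ∂P = correlation P V (x - y) := by
  have h := integral_vadd_eq (P := P) (-y) fun ω => field V (0 : Rd d) ω * field V (x - y) ω
  rw [correlation, ← h]
  refine integral_congr_ae (Eventually.of_forall fun ω => ?_)
  simp only [field_vadd]
  rw [show (0 : Rd d) - -y = y by abel, show x - y - -y = x by abel, mul_comm]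

lemma correlation_neg [VAddInvariantMeasure (Rd d) Ω P] (x : Rd d) :
    correlation P V (-x) = correlation P V x := by
  have h := integral_field_mul_field (P := P) (V := V) (0 : Rd d) x
  rw [zero_sub] at h
  rw [← h]; rfl

lemma stronglyMeasurable_correlation [SFinite P] (hV : Measurable V) :
    StronglyMeasurable fun x : Rd d => correlation P V x := by
  have : StronglyMeasurable fun q : Rd d × Ω => field V (0 : Rd d) q.2 * field V q.1 q.2 :=
    (((measurable_field_right hV 0).comp measurable_snd).mul (measurable_field hV)).stronglyMeasurable
  exact this.integral_prod_right'

omit [MeasurableVAdd₂ (Rd d) Ω] in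
lemma abs_correlation_le [IsProbabilityMeasure P] {M : ℝ} (hM : ∀ ω, |V ω| ≤ M) (x : Rd d) :
    |correlation P V x| ≤ M ^ 2 := by
  have h := norm_integral_le_of_norm_le_const (μ := P)
    (f := fun ω => field V (0 : Rd d) ω * field V x ω) (C := M ^ 2) (Eventually.of_forall fun ω => by
      rw [norm_mul, sq]
      exact mul_le_mul (hM _) (hM _) (abs_nonneg _) ((abs_nonneg _).trans (hM ω)))
  simpa [correlation] using h

end Stationary

/-! ### The power spectrum -/

section Spectrum

variable {d : ℕ} {Ω : Type*} [MeasurableSpace Ω] [AddAction (Rd d) Ω]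
  [MeasurableVAdd₂ (Rd d) Ω] {P : Measure Ω} [IsProbabilityMeasure P]
  [VAddInvariantMeasure (Rd d) Ω P] {V : Ω → ℝ}

lemma integrable_exp_neg_mul_sq_norm {a : ℝ} (ha : 0 < a) :
    Integrable fun x : Rd d => Real.exp (-a * ‖x‖ ^ 2) := by
  have h := GaussianFourier.integrable_cexp_neg_mul_sq_norm_add (V := Rd d) (b := (a : ℂ))
    (by simpa using ha) 0 0
  refine h.re.congr (Eventually.of_forall fun x => ?_)
  simp only [zero_mul, add_zero, RCLike.re_eq_complex_re]
  rw [← Complex.ofReal_pow, ← Complex.ofReal_neg, ← Complex.ofReal_mul, Complex.exp_ofReal_re]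

/-- The Fourier character `x ↦ exp (-i ξ·x)`. -/
def character (ξ x : Rd d) : ℂ := Complex.exp (-(Complex.I * ((inner ℝ ξ x : ℝ) : ℂ)))

lemma norm_character (ξ x : Rd d) : ‖character ξ x‖ = 1 := by
  rw [character, ← mul_neg, ← Complex.ofReal_neg, mul_comm, Complex.norm_exp_ofReal_mul_I]

lemma continuous_character : Continuous fun q : Rd d × Rd d => character q.1 q.2 := by
  unfold character; fun_prop

lemma character_sub (ξ x y : Rd d) :
    character ξ x * conj (character ξ y) = character ξ (x - y) := by
  simp only [character, ← Complex.exp_conj, ← Complex.exp_add, inner_sub_right]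
  congr 1
  simp
  ring

omit [MeasurableVAdd₂ (Rd d) Ω] [IsProbabilityMeasure P] [VAddInvariantMeasure (Rd d) Ω P] in
lemma powerSpectrum_eq (ξ : Rd d) : powerSpectrum P V ξ = ((2 * Real.pi) ^ d)⁻¹ *
    (∫ x : Rd d, character ξ x * (correlation P V x : ℂ)).re := rfl

/-- The convolution square of a Gaussian is a Gaussian. -/
lemma integral_exp_neg_mul_sq_norm_add (a : ℝ) (x : Rd d) :
    ∫ y : Rd d, Real.exp (-a * ‖x + y‖ ^ 2) * Real.exp (-a * ‖y‖ ^ 2)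
      = Real.exp (-(a / 2) * ‖x‖ ^ 2) * ∫ y : Rd d, Real.exp (-(2 * a) * ‖y‖ ^ 2) := by
  rw [← integral_sub_right_eq_self _ ((2 : ℝ)⁻¹ • x), ← integral_const_mul]
  congr 1; ext y
  rw [← Real.exp_add, ← Real.exp_add]
  congr 1
  rw [show x + (y - (2 : ℝ)⁻¹ • x) = y + (2 : ℝ)⁻¹ • x by
      nth_rewrite 1 [show x = (2 : ℝ)⁻¹ • x + (2 : ℝ)⁻¹ • x by rw [← two_smul ℝ, smul_smul]; simp]
      abel,
    norm_add_sq_real, norm_sub_sq_real, norm_smul]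
  norm_num
  ring

/-- Positivity of the power spectrum, regularized by a Gaussian: up to a positive factor the
integral is `𝔼 |∫ V(x) exp (-a |x|² - i ξ·x) dx|²`. -/
lemma re_integral_character_gaussian_nonneg (hV : Measurable V) {M : ℝ} (hM : ∀ ω, |V ω| ≤ M)
    (ξ : Rd d) {a : ℝ} (ha : 0 < a) :
    0 ≤ (∫ z : Rd d, character ξ z * (correlation P V z : ℂ) *
      (Real.exp (-(a / 2) * ‖z‖ ^ 2) : ℂ)).re := by
  obtain ⟨χ, hχ⟩ : ∃ χ : Rd d → ℝ, χ = fun x => Real.exp (-a * ‖x‖ ^ 2) := ⟨_, rfl⟩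
  have hχi : Integrable χ := hχ ▸ integrable_exp_neg_mul_sq_norm ha
  have hχc : Continuous χ := by rw [hχ]; fun_prop
  have hχ0 : ∀ x, 0 < χ x := fun x => by rw [hχ]; exact Real.exp_pos _
  have hch : Continuous (character ξ) :=
    continuous_character.comp (continuous_const.prodMk continuous_id)
  obtain ⟨g, hg⟩ : ∃ g : Ω → Rd d → ℂ, g = fun ω x => field V x ω * χ x * character ξ x := ⟨_, rfl⟩
  have hgm : Measurable fun q : Ω × Rd d => g q.1 q.2 := by
    rw [hg]
    exact ((Complex.measurable_ofReal.comp ((measurable_field hV).comp measurable_swap)).mul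
      (Complex.measurable_ofReal.comp (hχc.measurable.comp measurable_snd))).mul
      (hch.measurable.comp measurable_snd)
  have hHm : Measurable fun q : Ω × (Rd d × Rd d) => g q.1 q.2.1 * conj (g q.1 q.2.2) :=
    (hgm.comp (by fun_prop : Measurable fun q : Ω × (Rd d × Rd d) => (q.1, q.2.1))).mul
      (Complex.continuous_conj.measurable.comp
        (hgm.comp (by fun_prop : Measurable fun q : Ω × (Rd d × Rd d) => (q.1, q.2.2))))
  have hM0 : ∀ ω x, ‖g ω x‖ ≤ M * χ x := fun ω x => by
    simp only [hg, norm_mul, norm_character, mul_one, Complex.norm_real]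
    rw [Real.norm_of_nonneg (hχ0 x).le]
    exact mul_le_mul_of_nonneg_right (hM _) (hχ0 x).le
  have hHi : Integrable (fun q : Ω × (Rd d × Rd d) => g q.1 q.2.1 * conj (g q.1 q.2.2))
      (P.prod (volume.prod volume)) := by
    have h1 : Integrable (fun q : Ω × (Rd d × Rd d) => (M * χ q.2.1) * (M * χ q.2.2))
        (P.prod (volume.prod volume)) :=
      ((hχi.const_mul M).mul_prod (hχi.const_mul M)).comp_snd P
    refine h1.mono' hHm.aestronglyMeasurable (Eventually.of_forall fun q => ?_)
    rw [norm_mul, RCLike.norm_conj]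
    exact mul_le_mul (hM0 _ _) (hM0 _ _) (norm_nonneg _) ((norm_nonneg _).trans (hM0 q.1 _))
  have hE : ∀ p : Rd d × Rd d, ∫ ω, g ω p.1 * conj (g ω p.2) ∂P =
      character ξ (p.1 - p.2) * correlation P V (p.1 - p.2) * (χ p.1 * χ p.2 : ℝ) := fun p => by
    rw [← character_sub, ← integral_field_mul_field, ← integral_complex_ofReal,
      ← integral_const_mul, ← integral_mul_const]
    refine integral_congr_ae (Eventually.of_forall fun ω => ?_)
    simp only [hg, map_mul, Complex.conj_ofReal]
    push_cast; ring
  -- the same triple integral, with `ω` outside and with `ω` inside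
  have h1 : ∫ q : Ω × (Rd d × Rd d), g q.1 q.2.1 * conj (g q.1 q.2.2) ∂(P.prod (volume.prod volume))
      = ((∫ ω, ‖∫ x, g ω x‖ ^ 2 ∂P : ℝ) : ℂ) := by
    rw [integral_prod _ hHi, ← integral_complex_ofReal]
    refine integral_congr_ae (Eventually.of_forall fun ω => ?_)
    dsimp only
    rw [integral_prod_mul (fun x => g ω x) (fun x => conj (g ω x)), integral_conj,
      Complex.mul_conj, Complex.normSq_eq_norm_sq]
  have h2 : ∫ q : Ω × (Rd d × Rd d), g q.1 q.2.1 * conj (g q.1 q.2.2) ∂(P.prod (volume.prod volume))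
      = ((∫ x : Rd d, Real.exp (-(2 * a) * ‖x‖ ^ 2) : ℝ) : ℂ) *
      ∫ z : Rd d, character ξ z * (correlation P V z : ℂ) * (Real.exp (-(a / 2) * ‖z‖ ^ 2) : ℂ) := by
    rw [integral_prod_symm _ hHi]
    simp only [hE]
    have hHi2 : Integrable (fun p : Rd d × Rd d => character ξ (p.1 - p.2) *
        correlation P V (p.1 - p.2) * ((χ p.1 * χ p.2 : ℝ) : ℂ)) (volume.prod volume) :=
      hHi.integral_prod_right.congr (Eventually.of_forall hE)
    have hsh := measurePreserving_shear (volume : Measure (Rd d)) (L := fun x : Rd d => x)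
      measurable_id
    have hHi3 := hsh.integrable_comp_of_integrable hHi2
    rw [← hsh.map_eq, integral_map hsh.aemeasurable (hsh.map_eq.symm ▸ hHi2.1)]
    simp only [Function.comp_def] at hHi3 ⊢
    rw [integral_prod _ hHi3, ← integral_const_mul]
    congr 1; ext z
    simp only [add_sub_cancel_right]
    rw [integral_const_mul, integral_complex_ofReal, hχ, integral_exp_neg_mul_sq_norm_add]
    push_cast; ring
  have h3 : 0 < ∫ x : Rd d, Real.exp (-(2 * a) * ‖x‖ ^ 2) :=
    integral_exp_pos (integrable_exp_neg_mul_sq_norm (by positivity))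
  have h4 := congrArg Complex.re (h1.symm.trans h2)
  rw [Complex.ofReal_re, Complex.re_ofReal_mul] at h4
  exact nonneg_of_mul_nonneg_right (h4 ▸ integral_nonneg fun ω => by positivity) h3

/-- The power spectrum is the limit of the regularized integrals of
`re_integral_character_gaussian_nonneg` as the Gaussian widens. -/
lemma powerSpectrum_nonneg (hV : Measurable V) {M : ℝ} (hM : ∀ ω, |V ω| ≤ M)
    (hR : Integrable (fun x : Rd d => correlation P V x) volume) (ξ : Rd d) :
    0 ≤ powerSpectrum P V ξ := by
  rw [powerSpectrum_eq]
  refine mul_nonneg (by positivity) ?_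
  have hch : Continuous (character ξ) :=
    continuous_character.comp (continuous_const.prodMk continuous_id)
  have ht : Tendsto (fun a : ℝ => (∫ z : Rd d, character ξ z * (correlation P V z : ℂ) *
      (Real.exp (-(a / 2) * ‖z‖ ^ 2) : ℂ)).re) (𝓝[>] 0)
      (𝓝 (∫ x : Rd d, character ξ x * (correlation P V x : ℂ)).re) := by
    refine (Complex.continuous_re.tendsto _).comp ?_
    refine tendsto_integral_filter_of_dominated_convergence
      (fun x => ‖correlation P V x‖) ?_ ?_ hR.norm ?_
    · refine Eventually.of_forall fun a => ?_
      exact (hch.aestronglyMeasurable.mul hR.ofReal.1).mul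
        (by fun_prop : Continuous fun z : Rd d =>
          (Real.exp (-(a / 2) * ‖z‖ ^ 2) : ℂ)).aestronglyMeasurable
    · filter_upwards [self_mem_nhdsWithin] with a ha
      refine Eventually.of_forall fun z => ?_
      rw [norm_mul, norm_mul, norm_character, one_mul, Complex.norm_real, Complex.norm_real,
        Real.norm_of_nonneg (Real.exp_pos _).le]
      refine mul_le_of_le_one_right (norm_nonneg _) (Real.exp_le_one_iff.2 ?_)
      have : 0 < a := ha
      have : 0 ≤ a / 2 * ‖z‖ ^ 2 := by positivity
      linarith
    · refine Eventually.of_forall fun z => ?_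
      have hc : Continuous fun a : ℝ => character ξ z * (correlation P V z : ℂ) *
        (Real.exp (-(a / 2) * ‖z‖ ^ 2) : ℂ) := by fun_prop
      have := (hc.tendsto 0).mono_left (nhdsWithin_le_nhds (s := Set.Ioi (0 : ℝ)))
      simpa using this
  refine ge_of_tendsto ht ?_
  filter_upwards [self_mem_nhdsWithin] with a ha
  exact re_integral_character_gaussian_nonneg hV hM ξ ha

/-- The average of the correlation function against the heat kernel. -/
def heatCorr (P : Measure Ω) (V : Ω → ℝ) (d : ℕ) [AddAction (Rd d) Ω] (t : ℝ) : ℝ :=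
  ∫ x : Rd d, heat t x * correlation P V x

omit [MeasurableVAdd₂ (Rd d) Ω] [IsProbabilityMeasure P] [VAddInvariantMeasure (Rd d) Ω P] in
lemma abs_powerSpectrum_le (ξ : Rd d) :
    |powerSpectrum P V ξ| ≤ ((2 * Real.pi) ^ d)⁻¹ * ∫ x : Rd d, |correlation P V x| := by
  rw [powerSpectrum_eq, abs_mul, abs_of_nonneg (by positivity)]
  refine mul_le_mul_of_nonneg_left ((Complex.abs_re_le_norm _).trans
    ((norm_integral_le_integral_norm _).trans_eq ?_)) (by positivity)
  simp [norm_character]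

omit [VAddInvariantMeasure (Rd d) Ω P] in
lemma measurable_powerSpectrum (hV : Measurable V) :
    Measurable fun ξ : Rd d => powerSpectrum P V ξ := by
  have : StronglyMeasurable fun q : Rd d × Rd d => character q.1 q.2 * (correlation P V q.2 : ℂ) :=
    continuous_character.stronglyMeasurable.mul (Complex.continuous_ofReal.comp_stronglyMeasurable
      ((stronglyMeasurable_correlation hV).comp_measurable measurable_snd))
  exact (Complex.measurable_re.comp this.integral_prod_right'.measurable).const_mul _

lemma gaussian_constant {t : ℝ} (ht : 0 < t) :
    ((2 * Real.pi) ^ d)⁻¹ * (Real.pi / t) ^ ((d : ℝ) / 2) = (4 * Real.pi * t) ^ (-(d : ℝ) / 2) := by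
  have hp := Real.pi_pos
  have h1 : ((2 * Real.pi) ^ 2)⁻¹ * (Real.pi / t) = (4 * Real.pi * t)⁻¹ := by field_simp; ring
  have h2 : ((2 * Real.pi) ^ d)⁻¹ = (((2 * Real.pi) ^ 2)⁻¹) ^ ((d : ℝ) / 2) := by
    rw [Real.inv_rpow (by positivity), ← Real.rpow_natCast _ 2, ← Real.rpow_mul (by positivity),
      ← Real.rpow_natCast]
    congr 2; push_cast; ring
  rw [h2, ← Real.mul_rpow (by positivity) (by positivity), h1, neg_div,
    Real.rpow_neg (by positivity), Real.inv_rpow (by positivity)]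

omit [MeasurableVAdd₂ (Rd d) Ω] [IsProbabilityMeasure P] [VAddInvariantMeasure (Rd d) Ω P] in
/-- Parseval's identity for the power spectrum and a Gaussian. -/
lemma integral_powerSpectrum_mul_exp
    (hR : Integrable (fun x : Rd d => correlation P V x) volume) {t : ℝ} (ht : 0 < t) :
    ∫ ξ : Rd d, powerSpectrum P V ξ * Real.exp (-t * ‖ξ‖ ^ 2) = heatCorr P V d t := by
  have hi : Integrable (fun q : Rd d × Rd d => (Real.exp (-t * ‖q.1‖ ^ 2) : ℂ) *
      (character q.1 q.2 * (correlation P V q.2 : ℂ))) (volume.prod volume) := by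
    refine Integrable.mono' ((integrable_exp_neg_mul_sq_norm ht).mul_prod hR.norm) ?_
      (Eventually.of_forall fun q => ?_)
    · have h1 : Continuous fun q : Rd d × Rd d => (Real.exp (-t * ‖q.1‖ ^ 2) : ℂ) := by fun_prop
      exact h1.aestronglyMeasurable.mul (continuous_character.aestronglyMeasurable.mul
        hR.ofReal.1.comp_snd)
    · rw [norm_mul, norm_mul, norm_character, one_mul, Complex.norm_real, Complex.norm_real,
        Real.norm_of_nonneg (Real.exp_pos _).le]
  have h1 := integral_integral_swap (f := fun ξ x : Rd d =>
    (Real.exp (-t * ‖ξ‖ ^ 2) : ℂ) * (character ξ x * (correlation P V x : ℂ))) hi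
  have h2 : ∀ x : Rd d, ∫ ξ : Rd d, (Real.exp (-t * ‖ξ‖ ^ 2) : ℂ) *
      (character ξ x * (correlation P V x : ℂ)) =
      (((Real.pi / t) ^ ((d : ℝ) / 2) * (Real.exp (-‖x‖ ^ 2 / (4 * t)) * correlation P V x) : ℝ) : ℂ) :=
    fun x => by
    have h3 := GaussianFourier.integral_cexp_neg_mul_sq_norm_add (V := Rd d) (b := (t : ℂ))
      (by simpa using ht) (-Complex.I) x
    have h4 : ∀ ξ : Rd d, (Real.exp (-t * ‖ξ‖ ^ 2) : ℂ) * (character ξ x * (correlation P V x : ℂ))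
        = Complex.exp (-(t : ℂ) * ‖ξ‖ ^ 2 + -Complex.I * (inner ℝ x ξ : ℝ)) *
          (correlation P V x : ℂ) := fun ξ => by
      rw [Complex.exp_add, character, real_inner_comm, ← mul_assoc]
      push_cast
      congr 3; ring
    simp only [h4]
    rw [integral_mul_const, h3]
    simp only [finrank_euclideanSpace, Fintype.card_fin]
    push_cast
    rw [Complex.ofReal_cpow (by positivity), mul_assoc]
    push_cast
    congr 3
    rw [neg_sq, Complex.I_sq]; ring
  simp only [h2] at h1
  rw [integral_complex_ofReal] at h1
  have h5 : ∀ ξ : Rd d, powerSpectrum P V ξ * Real.exp (-t * ‖ξ‖ ^ 2) = ((2 * Real.pi) ^ d)⁻¹ *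
      (∫ x : Rd d, (Real.exp (-t * ‖ξ‖ ^ 2) : ℂ) * (character ξ x * (correlation P V x : ℂ))).re :=
    fun ξ => by
    rw [integral_const_mul, Complex.re_ofReal_mul, powerSpectrum_eq]; ring
  simp only [h5]
  have h6 := congrArg Complex.re h1
  rw [Complex.ofReal_re, ← RCLike.re_eq_complex_re, ← integral_re hi.integral_prod_left] at h6
  rw [integral_const_mul]
  simp only [RCLike.re_eq_complex_re] at h6
  rw [h6, integral_const_mul, ← mul_assoc, gaussian_constant ht, heatCorr, ← integral_const_mul]
  congr 1; ext x
  rw [heat]; ring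

lemma heatCorr_nonneg (hV : Measurable V) {M : ℝ} (hM : ∀ ω, |V ω| ≤ M)
    (hR : Integrable (fun x : Rd d => correlation P V x) volume) {t : ℝ} (ht : 0 < t) :
    0 ≤ heatCorr P V d t := by
  rw [← integral_powerSpectrum_mul_exp hR ht]
  exact integral_nonneg fun ξ => mul_nonneg (powerSpectrum_nonneg hV hM hR ξ) (Real.exp_pos _).le

omit [VAddInvariantMeasure (Rd d) Ω P] in
lemma stronglyMeasurable_heatCorr (hV : Measurable V) :
    StronglyMeasurable (heatCorr P V d) := by
  have : StronglyMeasurable fun q : ℝ × Rd d => heat q.1 q.2 * correlation P V q.2 :=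
    measurable_heat.stronglyMeasurable.mul
      ((stronglyMeasurable_correlation hV).comp_measurable measurable_snd)
  exact this.integral_prod_right'

/-- The decay of the heat kernel: `‖heat t‖_∞ ≤ t^(-d/2)`, capped by the total mass `1`. -/
def decay (d : ℕ) (t : ℝ) : ℝ := min 1 (t ^ (-(d : ℝ) / 2))

omit [MeasurableVAdd₂ (Rd d) Ω] [VAddInvariantMeasure (Rd d) Ω P] in
lemma heatCorr_le {M : ℝ} (hM : ∀ ω, |V ω| ≤ M)
    (hR : Integrable (fun x : Rd d => correlation P V x) volume) {t : ℝ} (ht : 0 < t) :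
    heatCorr P V d t ≤ max (M ^ 2) (∫ x : Rd d, |correlation P V x|) * decay d t := by
  have hi : Integrable fun x : Rd d => heat t x * correlation P V x :=
    (integrable_heat ht).mul_bdd (c := M ^ 2) hR.1
      (Eventually.of_forall fun x => abs_correlation_le hM x)
  have hK : 0 ≤ max (M ^ 2) (∫ x : Rd d, |correlation P V x|) := (sq_nonneg M).trans (le_max_left _ _)
  rw [decay, mul_min_of_nonneg _ _ hK, mul_one]
  refine le_min ?_ ?_
  · refine le_trans ?_ (le_max_left _ _)
    calc heatCorr P V d t ≤ ∫ x : Rd d, heat t x * M ^ 2 :=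
          integral_mono hi ((integrable_heat ht).mul_const _) fun x =>
            mul_le_mul_of_nonneg_left ((le_abs_self _).trans (abs_correlation_le hM x))
              (heat_nonneg ht.le x)
      _ = M ^ 2 := by rw [integral_mul_const, integral_heat ht, one_mul]
  · rw [mul_comm]
    refine le_trans ?_ (mul_le_mul_of_nonneg_left (le_max_right _ _) (by positivity))
    rw [← integral_const_mul]
    exact integral_mono hi (hR.abs.const_mul _) fun x =>
      (mul_le_mul_of_nonneg_left (le_abs_self _) (heat_nonneg ht.le x)).trans
        (mul_le_mul_of_nonneg_right (heat_le ht x) (abs_nonneg _))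

end Spectrum

/-! ### Time integrals -/

section TimeIntegrals

variable {d : ℕ}

lemma decay_nonneg {t : ℝ} (ht : 0 ≤ t) : 0 ≤ decay d t := le_min zero_le_one (by positivity)

lemma decay_le_one (t : ℝ) : decay d t ≤ 1 := min_le_left _ _

lemma decay_le_rpow {β : ℝ} (hβ : 0 ≤ β) (hβd : β ≤ d / 2) {t : ℝ} (ht : 0 < t) :
    decay d t ≤ t ^ (-β) := by
  rcases le_total t 1 with h | h
  · exact (min_le_left _ _).trans (Real.one_le_rpow_of_pos_of_le_one_of_nonpos ht h (by linarith))
  · exact (min_le_right _ _).trans (Real.rpow_le_rpow_of_exponent_le h (by linarith))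

lemma measurable_decay : Measurable (decay d) :=
  measurable_const.min (measurable_id.pow_const _)

lemma integrableOn_decay (hd : 3 ≤ d) : IntegrableOn (decay d) (Set.Ioi 0) := by
  have hd' : (3 : ℝ) ≤ d := by exact_mod_cast hd
  rw [← Set.Ioc_union_Ioi_eq_Ioi (zero_le_one (α := ℝ))]
  refine IntegrableOn.union ?_ ?_
  · refine Integrable.mono' (g := fun _ => (1 : ℝ)) (by simp)
      measurable_decay.aestronglyMeasurable ?_
    filter_upwards [ae_restrict_mem measurableSet_Ioc] with t ht
    rw [Real.norm_of_nonneg (decay_nonneg ht.1.le)]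
    exact decay_le_one t
  · refine Integrable.mono' (integrableOn_Ioi_rpow_of_lt (show -(3 / 2 : ℝ) < -1 by norm_num)
      zero_lt_one) measurable_decay.aestronglyMeasurable ?_
    filter_upwards [ae_restrict_mem measurableSet_Ioi] with t ht
    have ht0 : 0 < t := zero_lt_one.trans ht
    rw [Real.norm_of_nonneg (decay_nonneg ht0.le)]
    exact decay_le_rpow (by norm_num) (by linarith) ht0

/-- The weight `t^(-1/2) (decay t)^(1/2)`, which controls the second moment of the contribution at
time `t` to the gradient of the corrector. -/
def gradWeight (d : ℕ) (t : ℝ) : ℝ := t ^ (-(1 / 2) : ℝ) * √(decay d t)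

lemma gradWeight_nonneg {t : ℝ} (ht : 0 ≤ t) : 0 ≤ gradWeight d t := by
  unfold gradWeight; positivity

lemma measurable_gradWeight : Measurable (gradWeight d) :=
  (measurable_id.pow_const _).mul measurable_decay.sqrt

lemma gradWeight_le_rpow {β : ℝ} (hβ : 0 ≤ β) (hβd : β ≤ d / 2) {t : ℝ} (ht : 0 < t) :
    gradWeight d t ≤ t ^ (-((1 + β) / 2)) := by
  have h : √(decay d t) ≤ t ^ (-(β / 2)) := by
    rw [show t ^ (-(β / 2)) = √(t ^ (-β)) by
      rw [Real.sqrt_eq_rpow, ← Real.rpow_mul ht.le]; congr 1; ring]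
    exact Real.sqrt_le_sqrt (decay_le_rpow hβ hβd ht)
  calc gradWeight d t ≤ t ^ (-(1 / 2) : ℝ) * t ^ (-(β / 2)) :=
        mul_le_mul_of_nonneg_left h (by positivity)
    _ = _ := by rw [← Real.rpow_add ht]; congr 1; ring

lemma integrableOn_gradWeight (hd : 3 ≤ d) : IntegrableOn (gradWeight d) (Set.Ioi 0) := by
  have hd' : (3 : ℝ) ≤ d := by exact_mod_cast hd
  rw [← Set.Ioc_union_Ioi_eq_Ioi (zero_le_one (α := ℝ))]
  refine IntegrableOn.union ?_ ?_
  · have h1 : IntegrableOn (fun t : ℝ => t ^ (-(1 / 2) : ℝ)) (Set.Ioc 0 1) :=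
      (intervalIntegrable_iff_integrableOn_Ioc_of_le zero_le_one).1
        (intervalIntegral.intervalIntegrable_rpow' (by norm_num))
    refine Integrable.mono' h1 measurable_gradWeight.aestronglyMeasurable ?_
    filter_upwards [ae_restrict_mem measurableSet_Ioc] with t ht
    rw [Real.norm_of_nonneg (gradWeight_nonneg ht.1.le)]
    refine (gradWeight_le_rpow le_rfl (by positivity) ht.1).trans_eq ?_
    norm_num
  · refine Integrable.mono' (integrableOn_Ioi_rpow_of_lt (show (-(5 / 4) : ℝ) < -1 by norm_num)
      zero_lt_one) measurable_gradWeight.aestronglyMeasurable ?_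
    filter_upwards [ae_restrict_mem measurableSet_Ioi] with t ht
    have ht0 : 0 < t := zero_lt_one.trans ht
    rw [Real.norm_of_nonneg (gradWeight_nonneg ht0.le)]
    refine (gradWeight_le_rpow (β := 3 / 2) (by norm_num) (by linarith) ht0).trans_eq ?_
    norm_num

lemma one_sub_exp_nonneg {lam t : ℝ} (hl : 0 ≤ lam) (ht : 0 ≤ t) : 0 ≤ 1 - Real.exp (-lam * t) := by
  have : Real.exp (-lam * t) ≤ 1 := Real.exp_le_one_iff.2 (by nlinarith [mul_nonneg hl ht])
  linarith

lemma one_sub_exp_le_one (lam t : ℝ) : 1 - Real.exp (-lam * t) ≤ 1 := by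
  linarith [Real.exp_pos (-lam * t)]

/-- By scaling, `∫ (1 - exp (-lam t)) t^(-β) dt` is a multiple of `lam^(β - 1)` for `1 < β < 2`. -/
lemma exists_integral_one_sub_exp_mul_rpow {β : ℝ} (h1 : 1 < β) (h2 : β < 2) :
    ∃ C : ℝ, 0 ≤ C ∧ ∀ lam : ℝ, 0 < lam →
      IntegrableOn (fun t => (1 - Real.exp (-lam * t)) * t ^ (-β)) (Set.Ioi 0) ∧
      ∫ t in Set.Ioi (0 : ℝ), (1 - Real.exp (-lam * t)) * t ^ (-β) = C * lam ^ (β - 1) := by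
  set g : ℝ → ℝ := fun t => (1 - Real.exp (-t)) * t ^ (-β) with hg
  have hgm : Measurable g := by
    have : Measurable fun t : ℝ => t ^ (-β) := measurable_id.pow_const _
    exact (by fun_prop : Measurable fun t : ℝ => 1 - Real.exp (-t)).mul this
  have hg0 : ∀ t, 0 < t → 0 ≤ g t := fun t ht => by
    have := one_sub_exp_nonneg (lam := 1) zero_le_one ht.le
    rw [neg_one_mul] at this
    exact mul_nonneg this (by positivity)
  -- the integrand is of order `t^(1-β)` near `0` and `t^(-β)` at infinity
  have hgi : IntegrableOn g (Set.Ioi 0) := by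
    rw [← Set.Ioc_union_Ioi_eq_Ioi (zero_le_one (α := ℝ))]
    refine IntegrableOn.union ?_ ?_
    · have h3 : IntegrableOn (fun t : ℝ => t ^ (1 - β)) (Set.Ioc 0 1) :=
        (intervalIntegrable_iff_integrableOn_Ioc_of_le zero_le_one).1
          (intervalIntegral.intervalIntegrable_rpow' (by linarith))
      refine Integrable.mono' h3 hgm.aestronglyMeasurable ?_
      filter_upwards [ae_restrict_mem measurableSet_Ioc] with t ht
      rw [Real.norm_of_nonneg (hg0 t ht.1), sub_eq_add_neg, Real.rpow_add ht.1, Real.rpow_one]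
      refine mul_le_mul_of_nonneg_right ?_ (Real.rpow_nonneg ht.1.le _)
      linarith [Real.add_one_le_exp (-t)]
    · refine Integrable.mono' (integrableOn_Ioi_rpow_of_lt (show -β < -1 by linarith)
        zero_lt_one) hgm.aestronglyMeasurable ?_
      filter_upwards [ae_restrict_mem measurableSet_Ioi] with t ht
      have ht0 : 0 < t := zero_lt_one.trans ht
      rw [Real.norm_of_nonneg (hg0 t ht0)]
      exact mul_le_of_le_one_left (by positivity) (by linarith [Real.exp_pos (-t)])
  refine ⟨∫ t in Set.Ioi (0 : ℝ), g t, setIntegral_nonneg measurableSet_Ioi hg0, fun lam hl => ?_⟩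
  have he : ∀ t ∈ Set.Ioi (0 : ℝ), (1 - Real.exp (-lam * t)) * t ^ (-β)
      = lam ^ β * g (lam * t) := fun t ht => by
    have ht : 0 < t := ht
    simp only [hg]
    rw [Real.mul_rpow hl.le ht.le, Real.rpow_neg hl.le, neg_mul]
    field_simp
  have hi := (integrableOn_Ioi_comp_mul_left_iff g 0 hl).2 (by simpa using hgi)
  refine ⟨(integrableOn_congr_fun he measurableSet_Ioi).2 (hi.const_mul _), ?_⟩
  rw [setIntegral_congr_fun measurableSet_Ioi he, integral_const_mul,
    integral_comp_mul_left_Ioi _ _ hl, mul_zero, smul_eq_mul, Real.rpow_sub_one hl.ne']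
  field_simp

lemma rate_nonneg {ε : ℝ} (hε : 0 ≤ ε) : 0 ≤ rate d ε := by
  unfold rate; split_ifs <;> positivity

lemma half_le_abs_log {ε : ℝ} (h0 : 0 < ε) (h : ε ≤ 1 / 2) : 1 / 2 ≤ |Real.log ε| := by
  have h1 := Real.log_le_log h0 h
  rw [one_div, Real.log_inv] at h1
  have := Real.log_two_gt_d9
  rw [abs_of_neg (by linarith)]
  linarith

lemma le_two_mul_rate {ε : ℝ} (h0 : 0 < ε) (h : ε ≤ 1 / 2) : ε ≤ 2 * rate d ε := by
  unfold rate
  split_ifs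
  · have : ε ≤ √ε := Real.le_sqrt_of_sq_le (by nlinarith)
    linarith [Real.sqrt_nonneg ε]
  · have : 1 / 2 ≤ √|Real.log ε| :=
      Real.le_sqrt_of_sq_le (by linarith [half_le_abs_log h0 h])
    nlinarith
  · linarith

lemma exists_integral_decay_le (hd : 3 ≤ d) : ∃ C : ℝ, 0 ≤ C ∧ ∀ ε : ℝ, 0 < ε →
    ∫ t in Set.Ioi (0 : ℝ), (1 - Real.exp (-ε ^ 2 * t)) * decay d t ≤ C * ε := by
  have hd' : (3 : ℝ) ≤ d := by exact_mod_cast hd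
  obtain ⟨C, hC, h⟩ := exists_integral_one_sub_exp_mul_rpow (β := 3 / 2) (by norm_num) (by norm_num)
  refine ⟨C, hC, fun ε hε => ?_⟩
  obtain ⟨hi, he⟩ := h (ε ^ 2) (by positivity)
  have hp : (ε ^ 2) ^ ((3 / 2 : ℝ) - 1) = ε := by
    rw [← Real.rpow_natCast, ← Real.rpow_mul hε.le]; norm_num
  rw [hp] at he
  rw [← he]
  refine integral_mono_of_nonneg ?_ hi ?_
  · filter_upwards [ae_restrict_mem measurableSet_Ioi] with t ht
    exact mul_nonneg (one_sub_exp_nonneg (sq_nonneg ε) (le_of_lt ht)) (decay_nonneg (le_of_lt ht))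
  · filter_upwards [ae_restrict_mem measurableSet_Ioi] with t ht
    exact mul_le_mul_of_nonneg_left (decay_le_rpow (by norm_num) (by linarith) ht)
      (one_sub_exp_nonneg (sq_nonneg ε) (le_of_lt ht))

lemma exists_integral_gradWeight_le (hd : 3 ≤ d) : ∃ C : ℝ, 0 ≤ C ∧ ∀ ε : ℝ, 0 < ε → ε ≤ 1 / 2 →
    ∫ t in Set.Ioi (0 : ℝ), (1 - Real.exp (-ε ^ 2 * t)) * gradWeight d t ≤ C * rate d ε := by
  have key : ∀ γ : ℝ, 0 ≤ γ → γ ≤ d / 2 → 1 < (1 + γ) / 2 → (1 + γ) / 2 < 2 →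
      ∃ C : ℝ, 0 ≤ C ∧ ∀ ε : ℝ, 0 < ε →
        ∫ t in Set.Ioi (0 : ℝ), (1 - Real.exp (-ε ^ 2 * t)) * gradWeight d t ≤ C * ε ^ (γ - 1) := by
    intro γ h0 hγ h1 h2
    obtain ⟨C, hC, h⟩ := exists_integral_one_sub_exp_mul_rpow h1 h2
    refine ⟨C, hC, fun ε hε => ?_⟩
    obtain ⟨hi, he⟩ := h (ε ^ 2) (by positivity)
    have hp : (ε ^ 2) ^ ((1 + γ) / 2 - 1) = ε ^ (γ - 1) := by
      rw [← Real.rpow_natCast, ← Real.rpow_mul hε.le]; congr 1; push_cast; ring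
    rw [hp] at he
    rw [← he]
    refine integral_mono_of_nonneg ?_ hi ?_
    · filter_upwards [ae_restrict_mem measurableSet_Ioi] with t ht
      exact mul_nonneg (one_sub_exp_nonneg (sq_nonneg ε) (le_of_lt ht))
        (gradWeight_nonneg (le_of_lt ht))
    · filter_upwards [ae_restrict_mem measurableSet_Ioi] with t ht
      exact mul_le_mul_of_nonneg_left (gradWeight_le_rpow h0 hγ ht)
        (one_sub_exp_nonneg (sq_nonneg ε) (le_of_lt ht))
  rcases hd.eq_or_lt with rfl | hd4
  · obtain ⟨C, hC, h⟩ := key (3 / 2) (by norm_num) (by norm_num) (by norm_num) (by norm_num)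
    refine ⟨C, hC, fun ε hε _ => (h ε hε).trans_eq ?_⟩
    rw [rate, if_pos rfl, Real.sqrt_eq_rpow]; norm_num
  · have hd' : (4 : ℝ) ≤ d := by exact_mod_cast hd4
    obtain ⟨C, hC, h⟩ := key 2 (by norm_num) (by linarith) (by norm_num) (by norm_num)
    refine ⟨C * 2, by positivity, fun ε hε hε2 => (h ε hε).trans ?_⟩
    rw [mul_assoc]
    refine mul_le_mul_of_nonneg_left ?_ hC
    norm_num
    exact le_two_mul_rate hε hε2

/-- The time integral which controls the variance of the corrector. -/
def timeMass (d : ℕ) (lam : ℝ) : ℝ≥0∞ :=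
  ∫⁻ t in Set.Ioi (0 : ℝ), ENNReal.ofReal (t * Real.exp (-lam * t) * decay d t)

lemma timeMass_three_le {lam : ℝ} (hl : 0 < lam) :
    timeMass 3 lam ≤ ENNReal.ofReal (√Real.pi * lam ^ (-(1 / 2) : ℝ)) := by
  have h := Real.integral_rpow_mul_exp_neg_mul_Ioi (a := 1 / 2) (r := lam) (by norm_num) hl
  rw [Real.Gamma_one_half_eq, one_div lam, Real.inv_rpow hl.le, ← Real.rpow_neg hl.le] at h
  have hi : IntegrableOn (fun t : ℝ => t ^ ((1 / 2 : ℝ) - 1) * Real.exp (-(lam * t))) (Set.Ioi 0) := by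
    by_contra hc
    rw [integral_undef hc] at h
    have : 0 < lam ^ (-(1 / 2) : ℝ) * √Real.pi := by positivity
    linarith
  rw [mul_comm, ← h, ofReal_integral_eq_lintegral_ofReal hi (by
    filter_upwards [ae_restrict_mem measurableSet_Ioi] with t ht
    have ht : 0 < t := ht
    positivity)]
  refine setLIntegral_mono' measurableSet_Ioi fun t ht => ENNReal.ofReal_le_ofReal ?_
  have ht : 0 < t := ht
  calc t * Real.exp (-lam * t) * decay 3 t ≤ t * Real.exp (-lam * t) * t ^ (-(3 / 2) : ℝ) :=
        mul_le_mul_of_nonneg_left (decay_le_rpow (by norm_num) (by norm_num) ht) (by positivity)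
    _ = t ^ (1 : ℝ) * t ^ (-(3 / 2) : ℝ) * Real.exp (-(lam * t)) := by
        rw [Real.rpow_one, neg_mul]; ring
    _ = _ := by rw [← Real.rpow_add ht]; norm_num

/-- In dimension four the integrand behaves like `t⁻¹` on `[1, lam⁻¹]`, which gives the logarithm;
the intervals `(0, 1]` and `(lam⁻¹, ∞)` contribute at most `1` each. -/
lemma timeMass_four_le {lam : ℝ} (hl : 0 < lam) (hl1 : lam ≤ 1) :
    timeMass 4 lam ≤ ENNReal.ofReal (2 + |Real.log lam|) := by
  have hl' : 1 ≤ lam⁻¹ := (one_le_inv₀ hl).2 hl1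
  have hd4 : ∀ t : ℝ, 0 < t → decay 4 t ≤ t⁻¹ ^ 2 := fun t ht =>
    (decay_le_rpow (β := 2) (by norm_num) (by norm_num) ht).trans_eq (by
      rw [Real.rpow_neg ht.le, Real.rpow_two, inv_pow])
  have hexp : ∀ t : ℝ, 0 < t → Real.exp (-lam * t) ≤ 1 := fun t ht =>
    Real.exp_le_one_iff.2 (by nlinarith [mul_pos hl ht])
  rw [timeMass, ← Set.Ioc_union_Ioi_eq_Ioi (zero_le_one (α := ℝ)),
    ← Set.Ioc_union_Ioi_eq_Ioi hl', ENNReal.ofReal_add (by norm_num) (abs_nonneg _),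
    show (2 : ℝ) = 1 + 1 by norm_num, ENNReal.ofReal_add zero_le_one zero_le_one, add_assoc]
  refine (lintegral_union_le _ _ _).trans (add_le_add ?_ ((lintegral_union_le _ _ _).trans ?_))
  · refine (setLIntegral_mono' (g := fun _ => 1) measurableSet_Ioc fun t ht => ?_).trans_eq (by simp)
    rw [← ENNReal.ofReal_one]
    refine ENNReal.ofReal_le_ofReal ?_
    exact mul_le_one₀ (mul_le_one₀ ht.2 (Real.exp_pos _).le (hexp t ht.1)) (decay_nonneg ht.1.le)
      (decay_le_one t)
  · rw [add_comm]
    refine add_le_add ?_ ?_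
    · have hi := integrableOn_exp_mul_Ioi (a := -lam) (by linarith) lam⁻¹
      have he := integral_exp_mul_Ioi (a := -lam) (by linarith) lam⁻¹
      have hi' : IntegrableOn (fun t => lam * Real.exp (-lam * t)) (Set.Ioi lam⁻¹) := hi.const_mul _
      have : ∫ t in Set.Ioi lam⁻¹, lam * Real.exp (-lam * t) ≤ 1 := by
        rw [integral_const_mul, he, neg_div_neg_eq, mul_div_cancel₀ _ hl.ne']
        exact hexp _ (by positivity)
      refine le_trans ?_ (ENNReal.ofReal_le_ofReal this)
      rw [ofReal_integral_eq_lintegral_ofReal hi' (Eventually.of_forall fun t => by positivity)]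
      refine setLIntegral_mono' measurableSet_Ioi fun t ht => ENNReal.ofReal_le_ofReal ?_
      have ht0 : 0 < t := (by positivity : 0 < lam⁻¹).trans ht
      have htl : t⁻¹ ≤ lam := inv_le_of_inv_le₀ hl (le_of_lt ht)
      calc t * Real.exp (-lam * t) * decay 4 t ≤ t * Real.exp (-lam * t) * t⁻¹ ^ 2 :=
            mul_le_mul_of_nonneg_left (hd4 t ht0) (by positivity)
        _ = t⁻¹ * Real.exp (-lam * t) := by field_simp
        _ ≤ _ := mul_le_mul_of_nonneg_right htl (Real.exp_pos _).le
    · have hi : IntegrableOn (fun t : ℝ => t⁻¹) (Set.Ioc 1 lam⁻¹) :=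
        (intervalIntegrable_iff_integrableOn_Ioc_of_le hl').1
          (intervalIntegral.intervalIntegrable_inv (fun t ht => by
            rw [Set.uIcc_of_le hl'] at ht; linarith [ht.1]) continuousOn_id)
      have he : ∫ t in Set.Ioc 1 lam⁻¹, t⁻¹ = |Real.log lam| := by
        rw [← intervalIntegral.integral_of_le hl', integral_inv_of_pos one_pos (by positivity),
          div_one, Real.log_inv, abs_of_nonpos (Real.log_nonpos hl.le hl1)]
      rw [← he, ofReal_integral_eq_lintegral_ofReal hi (by
        filter_upwards [ae_restrict_mem measurableSet_Ioc] with t ht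
        have : 0 < t := zero_lt_one.trans ht.1
        positivity)]
      refine setLIntegral_mono' measurableSet_Ioc fun t ht => ENNReal.ofReal_le_ofReal ?_
      have ht0 : 0 < t := zero_lt_one.trans ht.1
      calc t * Real.exp (-lam * t) * decay 4 t ≤ t * 1 * t⁻¹ ^ 2 :=
            mul_le_mul (mul_le_mul_of_nonneg_left (hexp t ht0) ht0.le) (hd4 t ht0)
              (decay_nonneg ht0.le) (by positivity)
        _ = _ := by field_simp

lemma timeMass_five_le (hd : 5 ≤ d) {lam : ℝ} (hl : 0 < lam) :
    timeMass d lam ≤ ENNReal.ofReal (∫ t in Set.Ioi (0 : ℝ), decay 3 t) := by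
  have hd' : (5 : ℝ) ≤ d := by exact_mod_cast hd
  rw [ofReal_integral_eq_lintegral_ofReal (integrableOn_decay le_rfl) (by
    filter_upwards [ae_restrict_mem measurableSet_Ioi] with t ht
    exact decay_nonneg (le_of_lt ht))]
  refine setLIntegral_mono' measurableSet_Ioi fun t ht => ENNReal.ofReal_le_ofReal ?_
  have ht : 0 < t := ht
  have h1 : t * Real.exp (-lam * t) ≤ t * 1 :=
    mul_le_mul_of_nonneg_left (Real.exp_le_one_iff.2 (by nlinarith [mul_pos hl ht])) ht.le
  refine (mul_le_mul_of_nonneg_right h1 (decay_nonneg ht.le)).trans ?_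
  rw [mul_one]
  refine le_min ?_ ?_
  · rcases le_total t 1 with h | h
    · exact mul_le_one₀ h (decay_nonneg ht.le) (decay_le_one t)
    · refine (mul_le_mul_of_nonneg_left (decay_le_rpow (β := 1) zero_le_one (by linarith) ht)
        ht.le).trans_eq ?_
      rw [Real.rpow_neg_one, mul_inv_cancel₀ ht.ne']
  · refine (mul_le_mul_of_nonneg_left (decay_le_rpow (β := 5 / 2) (by norm_num) (by linarith) ht)
      ht.le).trans_eq ?_
    nth_rewrite 1 [← Real.rpow_one t]
    rw [← Real.rpow_add ht]; norm_num

lemma exists_timeMass_le (hd : 3 ≤ d) : ∃ C : ℝ, 0 ≤ C ∧ ∀ ε : ℝ, 0 < ε → ε ≤ 1 / 2 →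
    ENNReal.ofReal (ε ^ 2) * timeMass d (ε ^ 2) ≤ ENNReal.ofReal (C * rate d ε ^ 2) := by
  rcases hd.eq_or_lt with rfl | hd4
  · refine ⟨√Real.pi, by positivity, fun ε hε _ => ?_⟩
    refine (mul_le_mul_right (timeMass_three_le (by positivity)) _).trans_eq ?_
    rw [← ENNReal.ofReal_mul (by positivity), rate, if_pos rfl, Real.sq_sqrt hε.le,
      ← Real.rpow_natCast, ← Real.rpow_mul hε.le, mul_left_comm, ← Real.rpow_add hε]
    norm_num
  rcases (Nat.succ_le_of_lt hd4).eq_or_lt with rfl | hd5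
  · refine ⟨6, by norm_num, fun ε hε hε2 => ?_⟩
    refine (mul_le_mul_right (timeMass_four_le (by positivity) (by nlinarith)) _).trans ?_
    rw [← ENNReal.ofReal_mul (by positivity)]
    refine ENNReal.ofReal_le_ofReal ?_
    have h := half_le_abs_log hε hε2
    rw [rate, if_neg (by norm_num), if_pos rfl, mul_pow, Real.sq_sqrt (abs_nonneg _), Real.log_pow,
      abs_mul]
    norm_num
    nlinarith [sq_nonneg ε, mul_nonneg (sq_nonneg ε) (sub_nonneg.2 h)]
  · refine ⟨∫ t in Set.Ioi (0 : ℝ), decay 3 t,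
      setIntegral_nonneg measurableSet_Ioi fun t ht => decay_nonneg (le_of_lt ht),
      fun ε hε _ => ?_⟩
    have hd5 : 5 ≤ d := hd5
    refine (mul_le_mul_right (timeMass_five_le hd5 (by positivity)) _).trans_eq ?_
    rw [← ENNReal.ofReal_mul (by positivity), rate, if_neg (by omega), if_neg (by omega), mul_comm]

end TimeIntegrals

/-! ### The homogenized potential -/

section Homogenized

variable {d : ℕ} {Ω : Type*} [MeasurableSpace Ω] [AddAction (Rd d) Ω]
  [MeasurableVAdd₂ (Rd d) Ω] {P : Measure Ω} [IsProbabilityMeasure P]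
  [VAddInvariantMeasure (Rd d) Ω P] {V : Ω → ℝ}

lemma integrableOn_heatCorr (hd : 3 ≤ d) (hV : Measurable V) {M : ℝ} (hM : ∀ ω, |V ω| ≤ M)
    (hR : Integrable (fun x : Rd d => correlation P V x) volume) :
    IntegrableOn (heatCorr P V d) (Set.Ioi 0) := by
  refine Integrable.mono' ((integrableOn_decay hd).const_mul
    (max (M ^ 2) (∫ x : Rd d, |correlation P V x|)))
    (stronglyMeasurable_heatCorr hV).aestronglyMeasurable ?_
  filter_upwards [ae_restrict_mem measurableSet_Ioi] with t ht
  rw [Real.norm_of_nonneg (heatCorr_nonneg hV hM hR ht)]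
  exact heatCorr_le hM hR ht

lemma integral_exp_neg_mul_sq_norm_time (ξ : Rd d) :
    ∫ t in Set.Ioi (0 : ℝ), Real.exp (-t * ‖ξ‖ ^ 2) = (‖ξ‖ ^ 2)⁻¹ := by
  rcases eq_or_ne ξ 0 with rfl | hξ
  · simp [measureReal_def]
  · have h : 0 < ‖ξ‖ ^ 2 := by positivity
    have := integral_exp_mul_Ioi (a := -‖ξ‖ ^ 2) (by linarith) 0
    simp only [mul_zero, Real.exp_zero, neg_div_neg_eq, one_div] at this
    rw [← this]
    refine setIntegral_congr_fun measurableSet_Ioi fun t _ => ?_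
    congr 1; ring

lemma integrable_powerSpectrum_mul_exp (hd : 3 ≤ d) (hV : Measurable V) {M : ℝ}
    (hM : ∀ ω, |V ω| ≤ M) (hR : Integrable (fun x : Rd d => correlation P V x) volume) :
    Integrable (fun q : ℝ × Rd d => powerSpectrum P V q.2 * Real.exp (-q.1 * ‖q.2‖ ^ 2))
      ((volume.restrict (Set.Ioi 0)).prod volume) := by
  have hm : Measurable fun q : ℝ × Rd d => powerSpectrum P V q.2 * Real.exp (-q.1 * ‖q.2‖ ^ 2) :=
    ((measurable_powerSpectrum hV).comp measurable_snd).mul (by fun_prop)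
  rw [integrable_prod_iff hm.aestronglyMeasurable]
  constructor
  · filter_upwards [ae_restrict_mem measurableSet_Ioi] with t ht
    exact (integrable_exp_neg_mul_sq_norm (d := d) ht).bdd_mul
      (c := ((2 * Real.pi) ^ d)⁻¹ * ∫ x : Rd d, |correlation P V x|)
      (measurable_powerSpectrum hV).aestronglyMeasurable
      (Eventually.of_forall fun ξ => abs_powerSpectrum_le ξ)
  · refine (integrableOn_heatCorr hd hV hM hR).congr ?_
    filter_upwards [ae_restrict_mem measurableSet_Ioi] with t ht
    rw [← integral_powerSpectrum_mul_exp hR ht]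
    refine integral_congr_ae (Eventually.of_forall fun ξ => ?_)
    exact (Real.norm_of_nonneg (mul_nonneg (powerSpectrum_nonneg hV hM hR ξ)
      (Real.exp_pos _).le)).symm

lemma integrable_powerSpectrum_div (hd : 3 ≤ d) (hV : Measurable V) {M : ℝ}
    (hM : ∀ ω, |V ω| ≤ M) (hR : Integrable (fun x : Rd d => correlation P V x) volume) :
    Integrable (fun ξ : Rd d => powerSpectrum P V ξ / ‖ξ‖ ^ 2) volume := by
  refine (integrable_powerSpectrum_mul_exp hd hV hM hR).integral_prod_right.congr
    (Eventually.of_forall fun ξ => ?_)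
  simp only
  rw [integral_const_mul, integral_exp_neg_mul_sq_norm_time, div_eq_mul_inv]

/-- The homogenized potential in real space: `|ξ|⁻² = ∫ exp (-t |ξ|²) dt`. -/
lemma homogenizedPotential_eq (hd : 3 ≤ d) (hV : Measurable V) {M : ℝ}
    (hM : ∀ ω, |V ω| ≤ M) (hR : Integrable (fun x : Rd d => correlation P V x) volume) :
    homogenizedPotential d P V = ∫ t in Set.Ioi (0 : ℝ), heatCorr P V d t := by
  have h := integral_integral_swap (f := fun (t : ℝ) (ξ : Rd d) =>
    powerSpectrum P V ξ * Real.exp (-t * ‖ξ‖ ^ 2)) (integrable_powerSpectrum_mul_exp hd hV hM hR)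
  rw [setIntegral_congr_fun measurableSet_Ioi fun t ht => integral_powerSpectrum_mul_exp hR ht] at h
  rw [h, homogenizedPotential]
  congr 1; ext ξ
  rw [integral_const_mul, integral_exp_neg_mul_sq_norm_time, div_eq_mul_inv]

lemma homogenizedPotential_nonneg (hd : 3 ≤ d) (hV : Measurable V) {M : ℝ}
    (hM : ∀ ω, |V ω| ≤ M) (hR : Integrable (fun x : Rd d => correlation P V x) volume) :
    0 ≤ homogenizedPotential d P V := by
  rw [homogenizedPotential_eq hd hV hM hR]
  exact setIntegral_nonneg measurableSet_Ioi fun t ht => heatCorr_nonneg hV hM hR ht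

end Homogenized

/-! ### Averages against the resolvent kernel -/

section KernelBounds

variable {d : ℕ}

lemma ofReal_resK_le (lam : ℝ) (x : Rd d) : ENNReal.ofReal (resK lam x) ≤
    ∫⁻ t in Set.Ioi (0 : ℝ), ENNReal.ofReal (Real.exp (-lam * t) * heat t x) := by
  have hm : Measurable fun t : ℝ => Real.exp (-lam * t) * heat t x :=
    (by fun_prop : Measurable fun t : ℝ => Real.exp (-lam * t)).mul
      (measurable_heat.comp measurable_prodMk_right)
  have h : resK lam x = ∫ t in Set.Ioi (0 : ℝ), Real.exp (-lam * t) * heat t x := by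
    simp only [resK, neg_mul]
  rw [h, integral_eq_lintegral_of_nonneg_ae (by
    filter_upwards [ae_restrict_mem measurableSet_Ioi] with t ht
    exact mul_nonneg (Real.exp_pos _).le (heat_nonneg (le_of_lt ht) x)) hm.aestronglyMeasurable]
  exact ENNReal.ofReal_toReal_le

lemma measurable_exp_mul_heat (lam : ℝ) :
    Measurable fun q : ℝ × Rd d => ENNReal.ofReal (Real.exp (-lam * q.1) * heat q.1 q.2) :=
  ((by fun_prop : Measurable fun q : ℝ × Rd d => Real.exp (-lam * q.1)).mul
    measurable_heat).ennreal_ofReal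

lemma lintegral_heat_mul_le {t : ℝ} (ht : 0 < t) {c : Rd d → ℝ≥0∞} (hc : Measurable c)
    {A B : ℝ≥0∞} (hB : ∀ x, c x ≤ B) (hA : ∫⁻ x, c x ≤ A) :
    ∫⁻ x, ENNReal.ofReal (heat t x) * c x ≤ ENNReal.ofReal (decay d t) * max B A := by
  rw [decay, ENNReal.ofReal_min, ENNReal.ofReal_one, min_mul, one_mul]
  refine le_min (le_trans ?_ (le_max_left _ _)) (le_trans ?_ (mul_le_mul_right (le_max_right B A) _))
  · calc _ ≤ ∫⁻ x, ENNReal.ofReal (heat t x) * B := by gcongr; exact hB _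
      _ = B := by
        rw [lintegral_mul_const _ (continuous_heat t).measurable.ennreal_ofReal, lintegral_heat ht,
          one_mul]
  · calc _ ≤ ∫⁻ x, ENNReal.ofReal (t ^ (-(d : ℝ) / 2)) * c x := by gcongr; exact heat_le ht _
      _ = ENNReal.ofReal (t ^ (-(d : ℝ) / 2)) * ∫⁻ x, c x := lintegral_const_mul _ hc
      _ ≤ _ := by gcongr

lemma lintegral_resK_mul_le {lam : ℝ} (hl : 0 ≤ lam) {c : Rd d → ℝ≥0∞} (hc : Measurable c)
    {A B : ℝ≥0∞} (hB : ∀ x, c x ≤ B) (hA : ∫⁻ x, c x ≤ A) :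
    ∫⁻ x, ENNReal.ofReal (resK lam x) * c x
      ≤ (∫⁻ t in Set.Ioi (0 : ℝ), ENNReal.ofReal (decay d t)) * max B A := by
  have hm := measurable_exp_mul_heat (d := d) lam
  calc _ ≤ ∫⁻ x, ∫⁻ t in Set.Ioi (0 : ℝ),
        ENNReal.ofReal (Real.exp (-lam * t) * heat t x) * c x := by
        refine lintegral_mono fun x => ?_
        have hmx : Measurable fun t => ENNReal.ofReal (Real.exp (-lam * t) * heat t x) :=
          hm.comp measurable_prodMk_right
        rw [lintegral_mul_const _ hmx]
        exact mul_le_mul_left (ofReal_resK_le lam x) _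
    _ = ∫⁻ t in Set.Ioi (0 : ℝ), ∫⁻ x,
        ENNReal.ofReal (Real.exp (-lam * t) * heat t x) * c x := by
        refine lintegral_lintegral_swap ?_
        exact ((hm.comp measurable_swap).mul (hc.comp measurable_fst)).aemeasurable
    _ ≤ ∫⁻ t in Set.Ioi (0 : ℝ), ENNReal.ofReal (decay d t) * max B A := by
        refine setLIntegral_mono' measurableSet_Ioi fun t ht => ?_
        refine le_trans (lintegral_mono fun x => mul_le_mul_left (ENNReal.ofReal_le_ofReal ?_) _)
          (lintegral_heat_mul_le ht hc hB hA)
        have ht : 0 < t := ht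
        exact mul_le_of_le_one_left (heat_nonneg ht.le x)
          (Real.exp_le_one_iff.2 (by nlinarith [mul_nonneg hl ht.le]))
    _ = _ := lintegral_mul_const _ measurable_decay.ennreal_ofReal

lemma lintegral_heat_heat_mul_le {s t : ℝ} (hs : 0 < s) (ht : 0 < t) {Ψ : Rd d × Rd d → ℝ≥0∞}
    (hΨ : Measurable Ψ) {A B : ℝ≥0∞} (hB : ∀ p, Ψ p ≤ B) (hA : ∀ a, ∫⁻ b, Ψ (a, b) ≤ A) :
    ∫⁻ p, ENNReal.ofReal (heat s p.1) * ENNReal.ofReal (heat t p.2) * Ψ p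
      ≤ ENNReal.ofReal (decay d t) * max B A := by
  have hms : Measurable fun x : Rd d => ENNReal.ofReal (heat s x) :=
    (continuous_heat s).measurable.ennreal_ofReal
  have hmt : Measurable fun x : Rd d => ENNReal.ofReal (heat t x) :=
    (continuous_heat t).measurable.ennreal_ofReal
  have hmst : Measurable fun p : Rd d × Rd d =>
      ENNReal.ofReal (heat s p.1) * ENNReal.ofReal (heat t p.2) * Ψ p :=
    ((hms.comp measurable_fst).mul (hmt.comp measurable_snd)).mul hΨ
  rw [Measure.volume_eq_prod, lintegral_prod _ hmst.aemeasurable]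
  calc _ ≤ ∫⁻ a, ENNReal.ofReal (heat s a) * (ENNReal.ofReal (decay d t) * max B A) := by
        refine lintegral_mono fun a => ?_
        simp only [mul_assoc]
        have hma : Measurable fun b => ENNReal.ofReal (heat t b) * Ψ (a, b) :=
          hmt.mul (hΨ.comp measurable_prodMk_left)
        rw [lintegral_const_mul _ hma]
        exact mul_le_mul_right (lintegral_heat_mul_le ht (hΨ.comp measurable_prodMk_left)
          (fun b => hB _) (hA a)) _
    _ = _ := by rw [lintegral_mul_const _ hms, lintegral_heat hs, one_mul]

/-- Two copies of the resolvent kernel against a bounded function with bounded marginals. For the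
pair of times `s ≤ t` the heat kernel at time `t` gives the factor `decay t`; the integral over
`s` gives the factor `t`. -/
lemma lintegral_resK_resK_mul_le {lam : ℝ} (hl : 0 ≤ lam) {Ψ : Rd d × Rd d → ℝ≥0∞}
    (hΨ : Measurable Ψ) {A B : ℝ≥0∞} (hB : ∀ p, Ψ p ≤ B) (hA : ∀ a, ∫⁻ b, Ψ (a, b) ≤ A)
    (hA' : ∀ b, ∫⁻ a, Ψ (a, b) ≤ A) :
    ∫⁻ p : Rd d × Rd d, ENNReal.ofReal (resK lam p.1) * ENNReal.ofReal (resK lam p.2) * Ψ p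
      ≤ 2 * max B A * timeMass d lam := by
  have hm := measurable_exp_mul_heat (d := d) lam
  set μ : Measure ℝ := volume.restrict (Set.Ioi 0) with hμ
  set k : ℝ → Rd d → ℝ≥0∞ := fun t x => ENNReal.ofReal (Real.exp (-lam * t) * heat t x) with hk
  -- the bound for the pair of times `s ≤ t`; the other half of the plane follows by symmetry
  set w : ℝ × ℝ → ℝ≥0∞ := fun q => Set.indicator {q : ℝ × ℝ | q.1 ≤ q.2}
    (fun q => ENNReal.ofReal (Real.exp (-lam * q.2) * decay d q.2)) q with hw
  have hwm : Measurable w := by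
    refine Measurable.indicator ?_ (measurableSet_le measurable_fst measurable_snd)
    exact ((by fun_prop : Measurable fun q : ℝ × ℝ => Real.exp (-lam * q.2)).mul
      (measurable_decay.comp measurable_snd)).ennreal_ofReal
  have hwi : ∫⁻ q, w q ∂(μ.prod μ) ≤ timeMass d lam := by
    rw [lintegral_prod_symm _ hwm.aemeasurable, timeMass]
    refine setLIntegral_mono' measurableSet_Ioi fun t ht => ?_
    have ht : 0 < t := ht
    have h1 : ∀ s, w (s, t) = Set.indicator (Set.Iic t)
        (fun _ => ENNReal.ofReal (Real.exp (-lam * t) * decay d t)) s := fun s => by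
      simp only [hw, Set.indicator, Set.mem_ofPred_eq, Set.mem_Iic]
    simp only [h1]
    rw [lintegral_indicator measurableSet_Iic, lintegral_const, Measure.restrict_apply_univ,
      hμ, Measure.restrict_apply measurableSet_Iic, Set.inter_comm, Set.Ioi_inter_Iic,
      Real.volume_Ioc, sub_zero, mul_comm, ← ENNReal.ofReal_mul ht.le, mul_assoc]
  have hswap : ∫⁻ q, w q.swap ∂(μ.prod μ) = ∫⁻ q, w q ∂(μ.prod μ) :=
    Measure.measurePreserving_swap.lintegral_comp hwm
  have hexp : ∀ {s : ℝ}, 0 < s → Real.exp (-lam * s) ≤ 1 := fun hs =>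
    Real.exp_le_one_iff.2 (by nlinarith [mul_nonneg hl hs.le])
  have hkm1 : Measurable fun r : (Rd d × Rd d) × (ℝ × ℝ) => k r.2.1 r.1.1 :=
    hm.comp (by fun_prop : Measurable fun r : (Rd d × Rd d) × (ℝ × ℝ) => (r.2.1, r.1.1))
  have hkm2 : Measurable fun r : (Rd d × Rd d) × (ℝ × ℝ) => k r.2.2 r.1.2 :=
    hm.comp (by fun_prop : Measurable fun r : (Rd d × Rd d) × (ℝ × ℝ) => (r.2.2, r.1.2))
  calc _ ≤ ∫⁻ p : Rd d × Rd d, ∫⁻ q : ℝ × ℝ, k q.1 p.1 * k q.2 p.2 * Ψ p ∂(μ.prod μ) := by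
        refine lintegral_mono fun p => ?_
        have hk1 : Measurable fun t => k t p.1 := hm.comp measurable_prodMk_right
        have hk2 : Measurable fun t => k t p.2 := hm.comp measurable_prodMk_right
        have hk12 : Measurable fun q : ℝ × ℝ => k q.1 p.1 * k q.2 p.2 :=
          (hk1.comp measurable_fst).mul (hk2.comp measurable_snd)
        rw [lintegral_mul_const _ hk12,
          lintegral_prod_mul hk1.aemeasurable hk2.aemeasurable]
        gcongr
        · exact ofReal_resK_le lam p.1
        · exact ofReal_resK_le lam p.2
    _ = ∫⁻ q : ℝ × ℝ, (∫⁻ p : Rd d × Rd d, k q.1 p.1 * k q.2 p.2 * Ψ p) ∂(μ.prod μ) :=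
        lintegral_lintegral_swap ((hkm1.mul hkm2).mul (hΨ.comp measurable_fst)).aemeasurable
    _ ≤ ∫⁻ q, max B A * (w q + w q.swap) ∂(μ.prod μ) := by
        have hae : ∀ᵐ q ∂(μ.prod μ), 0 < q.1 ∧ 0 < q.2 := by
          rw [hμ, Measure.prod_restrict]
          filter_upwards [ae_restrict_mem (measurableSet_Ioi.prod measurableSet_Ioi)] with q hq
          exact hq
        refine lintegral_mono_ae ?_
        filter_upwards [hae] with ⟨s, t⟩ ⟨hs, ht⟩
        simp only at hs ht
        have hsplit : ∀ p : Rd d × Rd d, k s p.1 * k t p.2 * Ψ p =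
            ENNReal.ofReal (Real.exp (-lam * s) * Real.exp (-lam * t)) *
            (ENNReal.ofReal (heat s p.1) * ENNReal.ofReal (heat t p.2) * Ψ p) := fun p => by
          simp only [hk]
          rw [ENNReal.ofReal_mul (Real.exp_pos _).le, ENNReal.ofReal_mul (Real.exp_pos _).le,
            ENNReal.ofReal_mul (Real.exp_pos _).le]
          ring
        simp only [hsplit]
        rw [lintegral_const_mul' _ _ ENNReal.ofReal_ne_top]
        rcases le_total s t with h | h
        · refine le_trans ?_ (mul_le_mul_right le_self_add _)
          simp only [hw, Set.indicator, Set.mem_ofPred_eq, if_pos h]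
          rw [ENNReal.ofReal_mul (q := decay d t) (Real.exp_pos _).le, mul_comm (max B A), mul_assoc]
          refine mul_le_mul' (ENNReal.ofReal_le_ofReal
            (mul_le_of_le_one_left (Real.exp_pos _).le (hexp hs))) ?_
          exact lintegral_heat_heat_mul_le hs ht hΨ hB hA
        · refine le_trans ?_ (mul_le_mul_right le_add_self _)
          simp only [hw, Set.indicator, Set.mem_ofPred_eq, Prod.swap, if_pos h]
          rw [ENNReal.ofReal_mul (q := decay d s) (Real.exp_pos _).le, mul_comm (max B A), mul_assoc]
          refine mul_le_mul' (ENNReal.ofReal_le_ofReal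
            (mul_le_of_le_one_right (Real.exp_pos _).le (hexp ht))) ?_
          have hsw := (Measure.measurePreserving_swap (μ := (volume : Measure (Rd d)))
            (ν := (volume : Measure (Rd d)))).lintegral_comp
            (f := fun p => ENNReal.ofReal (heat s p.1) * ENNReal.ofReal (heat t p.2) * Ψ p)
            ((((continuous_heat s).measurable.ennreal_ofReal.comp measurable_fst).mul
              ((continuous_heat t).measurable.ennreal_ofReal.comp measurable_snd)).mul hΨ)
          rw [Measure.volume_eq_prod, ← hsw]
          simp only [Prod.fst_swap, Prod.snd_swap]
          have := lintegral_heat_heat_mul_le ht hs (Ψ := fun p => Ψ p.swap)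
            (hΨ.comp measurable_swap) (fun p => hB _) (fun b => hA' b)
          refine le_trans (le_of_eq ?_) this
          rw [Measure.volume_eq_prod]
          refine lintegral_congr fun p => ?_
          ring
    _ ≤ _ := by
        have hws : Measurable fun q : ℝ × ℝ => w q + w q.swap :=
          hwm.add (hwm.comp measurable_swap)
        rw [lintegral_const_mul _ hws,
          lintegral_add_left hwm, hswap, ← two_mul]
        calc _ ≤ max B A * (2 * timeMass d lam) := by gcongr
          _ = _ := by ring

end KernelBounds

/-! ### Spatial averages of the potential -/

section Averages

variable {d : ℕ} {Ω : Type*} [AddAction (Rd d) Ω] {V : Ω → ℝ}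
  {E : Type*} [NormedAddCommGroup E] [InnerProductSpace ℝ E]

/-- The average of the translates of `V` against a kernel `k`. Convolutions of the stationary field
`V` are the stationary fields of such averages. -/
def average (k : Rd d → E) (V : Ω → ℝ) (ω : Ω) : E := ∫ z, V (z +ᵥ ω) • k z

lemma conv_field (K : Rd d → ℝ) (y : Rd d) (ω : Ω) :
    conv K (fun x => field V x ω) y = average K V ((-y) +ᵥ ω) := by
  refine integral_congr_ae (Eventually.of_forall fun z => ?_)
  simp only [field, smul_eq_mul, vadd_vadd]
  rw [mul_comm, show -(y - z) = z + -y by abel]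

variable [MeasurableSpace Ω] [MeasurableVAdd₂ (Rd d) Ω] {P : Measure Ω}

lemma measurable_vadd_left (hV : Measurable V) (ω : Ω) : Measurable fun z : Rd d => V (z +ᵥ ω) :=
  hV.comp (measurable_id.vadd measurable_const)

lemma stronglyMeasurable_average_prod {T : Type*} [MeasurableSpace T] (hV : Measurable V)
    {k : T → Rd d → E} (hk : StronglyMeasurable fun q : T × Rd d => k q.1 q.2) :
    StronglyMeasurable fun q : T × Ω => average (k q.1) V q.2 := by
  have h : StronglyMeasurable fun q : (T × Ω) × Rd d => V (q.2 +ᵥ q.1.2) • k q.1.1 q.2 :=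
    (hV.comp (measurable_snd.vadd (measurable_snd.comp measurable_fst))).stronglyMeasurable.smul
      (hk.comp_measurable (by fun_prop : Measurable fun q : (T × Ω) × Rd d => (q.1.1, q.2)))
  exact h.integral_prod_right'

lemma stronglyMeasurable_average (hV : Measurable V) {k : Rd d → E} (hk : StronglyMeasurable k) :
    StronglyMeasurable (average k V : Ω → E) :=
  (stronglyMeasurable_average_prod (T := Unit) (k := fun _ => k) hV
    (hk.comp_measurable measurable_snd)).comp_measurable
    (measurable_prodMk_left (x := ()))

variable {M : ℝ}

lemma integrable_average (hV : Measurable V) (hM : ∀ ω, |V ω| ≤ M) {k : Rd d → E}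
    (hk : Integrable k) (ω : Ω) : Integrable fun z => V (z +ᵥ ω) • k z :=
  hk.bdd_smul M (measurable_vadd_left hV ω).aestronglyMeasurable
    (Eventually.of_forall fun _ => hM _)

omit [MeasurableSpace Ω] [MeasurableVAdd₂ (Rd d) Ω] in
lemma norm_average_le (hM : ∀ ω, |V ω| ≤ M) {k : Rd d → E} (hk : Integrable k) (ω : Ω) :
    ‖average k V ω‖ ≤ M * ∫ z, ‖k z‖ := by
  rw [← integral_const_mul]
  refine norm_integral_le_of_norm_le (hk.norm.const_mul M) (Eventually.of_forall fun z => ?_)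
  rw [norm_smul]
  exact mul_le_mul_of_nonneg_right (hM _) (norm_nonneg _)

lemma integral_vadd_mul_vadd [VAddInvariantMeasure (Rd d) Ω P] (a b : Rd d) :
    ∫ ω, V (a +ᵥ ω) * V (b +ᵥ ω) ∂P = correlation P V (a - b) := by
  have h := integral_field_mul_field (P := P) (V := V) (-b) (-a)
  rw [show -b - -a = a - b by abel] at h
  rw [← h]
  refine integral_congr_ae (Eventually.of_forall fun ω => ?_)
  simp only [field, neg_neg, mul_comm]

/-- The second moment of an average, `𝔼 |∫ V(z) k(z) dz|² = ∬ R(a - b) k(a) · k(b) da db`. -/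
lemma lintegral_enorm_sq_average_le [CompleteSpace E] [IsProbabilityMeasure P]
    [VAddInvariantMeasure (Rd d) Ω P]
    (hV : Measurable V) (hM : ∀ ω, |V ω| ≤ M) {k : Rd d → E} (hkm : StronglyMeasurable k)
    (hk : Integrable k) :
    ∫⁻ ω, ‖average k V ω‖ₑ ^ 2 ∂P
      ≤ ∫⁻ p : Rd d × Rd d, ‖k p.1‖ₑ * ‖k p.2‖ₑ * ‖correlation P V (p.1 - p.2)‖ₑ := by
  have hHm : StronglyMeasurable fun q : Ω × (Rd d × Rd d) =>
      (V (q.2.1 +ᵥ q.1) * V (q.2.2 +ᵥ q.1)) * inner ℝ (k q.2.1) (k q.2.2) := by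
    have h1 : Measurable fun q : Ω × (Rd d × Rd d) => V (q.2.1 +ᵥ q.1) * V (q.2.2 +ᵥ q.1) :=
      (hV.comp ((measurable_fst.comp measurable_snd).vadd measurable_fst)).mul
        (hV.comp ((measurable_snd.comp measurable_snd).vadd measurable_fst))
    exact h1.stronglyMeasurable.mul
      ((hkm.comp_measurable (measurable_fst.comp measurable_snd)).inner
        (hkm.comp_measurable (measurable_snd.comp measurable_snd)))
  have hHi : Integrable (fun q : Ω × (Rd d × Rd d) =>
      (V (q.2.1 +ᵥ q.1) * V (q.2.2 +ᵥ q.1)) * inner ℝ (k q.2.1) (k q.2.2))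
      (P.prod (volume.prod volume)) := by
    refine Integrable.mono' (((hk.norm.mul_prod hk.norm).comp_snd P).const_mul (M * M))
      hHm.aestronglyMeasurable (Eventually.of_forall fun q => ?_)
    rw [norm_mul, norm_mul]
    exact mul_le_mul (mul_le_mul (hM _) (hM _) (norm_nonneg _) ((abs_nonneg _).trans (hM q.1)))
      (norm_inner_le_norm _ _) (norm_nonneg _)
      (mul_self_nonneg M)
  have h1 : ∀ ω, ∫ p : Rd d × Rd d, (V (p.1 +ᵥ ω) * V (p.2 +ᵥ ω)) * inner ℝ (k p.1) (k p.2)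
      ∂(volume.prod volume) = ‖average k V ω‖ ^ 2 := fun ω => by
    have hi := integrable_average hV hM hk ω
    have hi2 : Integrable (fun p : Rd d × Rd d =>
        (V (p.1 +ᵥ ω) * V (p.2 +ᵥ ω)) * inner ℝ (k p.1) (k p.2)) (volume.prod volume) := by
      refine Integrable.mono' ((hk.norm.mul_prod hk.norm).const_mul (M * M))
        (hHm.comp_measurable measurable_prodMk_left).aestronglyMeasurable
        (Eventually.of_forall fun q => ?_)
      rw [norm_mul, norm_mul]
      exact mul_le_mul (mul_le_mul (hM _) (hM _) (norm_nonneg _) ((abs_nonneg _).trans (hM ω)))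
        (norm_inner_le_norm _ _) (norm_nonneg _) (mul_self_nonneg M)
    rw [integral_prod _ hi2, ← real_inner_self_eq_norm_sq, average, ← integral_inner hi]
    refine integral_congr_ae (Eventually.of_forall fun a => ?_)
    simp only
    rw [real_inner_comm, ← integral_inner hi]
    refine integral_congr_ae (Eventually.of_forall fun b => ?_)
    simp only [real_inner_smul_left, real_inner_smul_right]
    ring
  have h2 : ∀ p : Rd d × Rd d, ∫ ω, (V (p.1 +ᵥ ω) * V (p.2 +ᵥ ω)) * inner ℝ (k p.1) (k p.2) ∂P
      = correlation P V (p.1 - p.2) * inner ℝ (k p.1) (k p.2) := fun p => by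
    rw [integral_mul_const, integral_vadd_mul_vadd]
  have h3 : ∫ ω, ‖average k V ω‖ ^ 2 ∂P = ∫ p : Rd d × Rd d,
      correlation P V (p.1 - p.2) * inner ℝ (k p.1) (k p.2) ∂(volume.prod volume) := by
    have := integral_integral_swap (f := fun ω (p : Rd d × Rd d) =>
      (V (p.1 +ᵥ ω) * V (p.2 +ᵥ ω)) * inner ℝ (k p.1) (k p.2)) hHi
    simpa only [h1, h2] using this
  have hb : Integrable (fun ω => ‖average k V ω‖ ^ 2) P := by
    have := hHi.integral_prod_left
    simpa only [h1] using this
  calc ∫⁻ ω, ‖average k V ω‖ₑ ^ 2 ∂P = ENNReal.ofReal (∫ ω, ‖average k V ω‖ ^ 2 ∂P) := by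
        rw [ofReal_integral_eq_lintegral_ofReal hb (Eventually.of_forall fun ω => by positivity)]
        refine lintegral_congr fun ω => ?_
        rw [ENNReal.ofReal_pow (norm_nonneg _), ofReal_norm]
    _ ≤ ‖∫ p : Rd d × Rd d, correlation P V (p.1 - p.2) * inner ℝ (k p.1) (k p.2)
          ∂(volume.prod volume)‖ₑ := by rw [h3]; exact Real.ofReal_le_enorm _
    _ ≤ _ := by
        refine (enorm_integral_le_lintegral_enorm _).trans ?_
        rw [Measure.volume_eq_prod]
        refine lintegral_mono fun p => ?_
        rw [enorm_mul, mul_comm]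
        refine mul_le_mul_left ?_ _
        rw [← ofReal_norm, ← ofReal_norm (k p.1), ← ofReal_norm (k p.2),
          ← ENNReal.ofReal_mul (norm_nonneg _)]
        exact ENNReal.ofReal_le_ofReal (norm_inner_le_norm _ _)

/-- A common bound of `sup |R|` and `∫ |R|`. -/
def corrBound (d : ℕ) {Ω : Type*} [MeasurableSpace Ω] [AddAction (Rd d) Ω] (P : Measure Ω)
    (V : Ω → ℝ) (M : ℝ) : ℝ :=
  max (M ^ 2) (∫ x : Rd d, |correlation P V x|)

omit [MeasurableVAdd₂ (Rd d) Ω] in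
lemma corrBound_nonneg : 0 ≤ corrBound d P V M := (sq_nonneg M).trans (le_max_left _ _)

variable [IsProbabilityMeasure P] [VAddInvariantMeasure (Rd d) Ω P]

omit [MeasurableVAdd₂ (Rd d) Ω] [VAddInvariantMeasure (Rd d) Ω P] in
lemma enorm_correlation_le (hM : ∀ ω, |V ω| ≤ M) (x : Rd d) :
    ‖correlation P V x‖ₑ ≤ ENNReal.ofReal (corrBound d P V M) := by
  rw [← ofReal_norm]
  exact ENNReal.ofReal_le_ofReal ((abs_correlation_le hM x).trans (le_max_left _ _))

omit [MeasurableVAdd₂ (Rd d) Ω] [IsProbabilityMeasure P] [VAddInvariantMeasure (Rd d) Ω P] in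
lemma lintegral_enorm_correlation_le (hR : Integrable (fun x : Rd d => correlation P V x) volume) :
    ∫⁻ x : Rd d, ‖correlation P V x‖ₑ ≤ ENNReal.ofReal (corrBound d P V M) := by
  rw [← ofReal_integral_norm_eq_lintegral_enorm hR]
  exact ENNReal.ofReal_le_ofReal (le_max_right _ _)

omit [VAddInvariantMeasure (Rd d) Ω P] in
lemma measurable_enorm_correlation_sub (hV : Measurable V) :
    Measurable fun p : Rd d × Rd d => ‖correlation P V (p.1 - p.2)‖ₑ :=
  ((stronglyMeasurable_correlation hV).comp_measurable
    (measurable_fst.sub measurable_snd)).enorm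

lemma lintegral_enorm_sq_average_resK_le (hV : Measurable V) (hM : ∀ ω, |V ω| ≤ M)
    (hR : Integrable (fun x : Rd d => correlation P V x) volume) {lam : ℝ} (hl : 0 < lam) :
    ∫⁻ ω, ‖average (resK lam : Rd d → ℝ) V ω‖ₑ ^ 2 ∂P
      ≤ 2 * ENNReal.ofReal (corrBound d P V M) * timeMass d lam := by
  refine (lintegral_enorm_sq_average_le hV hM (measurable_resK lam).stronglyMeasurable
    (integrable_resK hl)).trans ?_
  have h := lintegral_resK_resK_mul_le (d := d) hl.le (measurable_enorm_correlation_sub (P := P) hV)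
    (fun p => enorm_correlation_le hM _) (A := ENNReal.ofReal (corrBound d P V M)) (fun a => ?_)
    (fun b => ?_)
  · rw [max_self] at h
    refine le_trans (le_of_eq (lintegral_congr fun p => ?_)) h
    rw [Real.enorm_of_nonneg (resK_nonneg _ _), Real.enorm_of_nonneg (resK_nonneg _ _)]
  · simp only
    rw [lintegral_sub_left_eq_self (fun x => ‖correlation P V x‖ₑ) a]
    exact lintegral_enorm_correlation_le hR
  · simp only
    rw [lintegral_sub_right_eq_self (fun x => ‖correlation P V x‖ₑ) b]
    exact lintegral_enorm_correlation_le hR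

lemma decay_antitone {s t : ℝ} (hs : 0 < s) (h : s ≤ t) : decay d t ≤ decay d s :=
  min_le_min le_rfl (Real.rpow_le_rpow_of_nonpos hs h (by
    have : (0 : ℝ) ≤ d := by positivity
    linarith))

/-- Minus the gradient of the heat kernel. -/
def gradHeat (t : ℝ) (x : Rd d) : Rd d := (heat t x / (2 * t)) • x

lemma stronglyMeasurable_gradHeat :
    StronglyMeasurable fun q : ℝ × Rd d => gradHeat q.1 q.2 :=
  ((measurable_heat.div (measurable_fst.const_mul 2)).smul measurable_snd).stronglyMeasurable

lemma norm_gradHeat_le {t : ℝ} (ht : 0 < t) (x : Rd d) :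
    ‖gradHeat t x‖ ≤ 2 ^ ((d : ℝ) / 2) * t ^ (-(1 / 2) : ℝ) * heat (2 * t) x := by
  rw [gradHeat, norm_smul, Real.norm_of_nonneg (div_nonneg (heat_nonneg ht.le x) (by positivity)),
    mul_comm]
  exact norm_mul_heat_le ht x

lemma integrable_gradHeat {t : ℝ} (ht : 0 < t) : Integrable (gradHeat t : Rd d → Rd d) :=
  ((integrable_heat (by positivity : 0 < 2 * t)).const_mul _).mono'
    (stronglyMeasurable_gradHeat.comp_measurable measurable_prodMk_left).aestronglyMeasurable
    (Eventually.of_forall fun x => norm_gradHeat_le ht x)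

/-- The constant in the second moment bound of `average (gradHeat t) V`. -/
def gradConst (d : ℕ) {Ω : Type*} [MeasurableSpace Ω] [AddAction (Rd d) Ω] (P : Measure Ω)
    (V : Ω → ℝ) (M : ℝ) : ℝ := 2 ^ ((d : ℝ) / 2) * √(corrBound d P V M)

lemma lintegral_enorm_sq_average_gradHeat_le (hV : Measurable V) (hM : ∀ ω, |V ω| ≤ M)
    (hR : Integrable (fun x : Rd d => correlation P V x) volume) {t : ℝ} (ht : 0 < t) :
    ∫⁻ ω, ‖average (gradHeat t : Rd d → Rd d) V ω‖ₑ ^ 2 ∂P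
      ≤ ENNReal.ofReal (gradConst d P V M * gradWeight d t) ^ 2 := by
  refine (lintegral_enorm_sq_average_le hV hM
    (stronglyMeasurable_gradHeat.comp_measurable (measurable_prodMk_left (x := t)))
    (integrable_gradHeat ht)).trans ?_
  have h2t : 0 < 2 * t := by positivity
  have h := lintegral_heat_heat_mul_le (d := d) h2t h2t (measurable_enorm_correlation_sub (P := P) hV)
    (fun p => enorm_correlation_le hM _) (A := ENNReal.ofReal (corrBound d P V M)) (fun a => by
      rw [lintegral_sub_left_eq_self (fun x => ‖correlation P V x‖ₑ) a]
      exact lintegral_enorm_correlation_le hR)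
  rw [max_self] at h
  set c : ℝ := 2 ^ ((d : ℝ) / 2) * t ^ (-(1 / 2) : ℝ) with hc
  have hc0 : 0 ≤ c := by positivity
  have hk : ∀ x : Rd d, ‖gradHeat t x‖ₑ ≤ ENNReal.ofReal c * ENNReal.ofReal (heat (2 * t) x) :=
    fun x => by
      rw [← ofReal_norm, ← ENNReal.ofReal_mul hc0]
      exact ENNReal.ofReal_le_ofReal (norm_gradHeat_le ht x)
  calc _ ≤ ∫⁻ p : Rd d × Rd d, ENNReal.ofReal c ^ 2 * (ENNReal.ofReal (heat (2 * t) p.1) *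
        ENNReal.ofReal (heat (2 * t) p.2) * ‖correlation P V (p.1 - p.2)‖ₑ) := by
        refine lintegral_mono fun p => ?_
        refine (mul_le_mul_left (mul_le_mul' (hk _) (hk _)) _).trans_eq ?_
        ring
    _ ≤ ENNReal.ofReal c ^ 2 *
        (ENNReal.ofReal (decay d (2 * t)) * ENNReal.ofReal (corrBound d P V M)) := by
        rw [lintegral_const_mul' _ _ (by simp)]
        exact mul_le_mul_right h _
    _ ≤ _ := by
        rw [← ENNReal.ofReal_pow hc0, ← ENNReal.ofReal_mul (decay_nonneg h2t.le),
          ← ENNReal.ofReal_mul (by positivity),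
          ← ENNReal.ofReal_pow (mul_nonneg (by unfold gradConst; positivity)
            (gradWeight_nonneg ht.le))]
        refine ENNReal.ofReal_le_ofReal ?_
        rw [gradConst, gradWeight, hc]
        simp only [mul_pow]
        rw [Real.sq_sqrt corrBound_nonneg, Real.sq_sqrt (decay_nonneg ht.le)]
        have := decay_antitone (d := d) ht (by linarith : t ≤ 2 * t)
        have h3 : 0 ≤ corrBound d P V M := corrBound_nonneg
        calc _ ≤ (2 ^ ((d : ℝ) / 2)) ^ 2 * (t ^ (-(1 / 2) : ℝ)) ^ 2 *
              (decay d t * corrBound d P V M) := by gcongr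
          _ = _ := by ring

end Averages

/-! ### The limit of the gradients of the correctors -/

section GradientLimit

/-- Minkowski's integral inequality in `L²`, with a bound `w t` on the norm at time `t`. -/
lemma lintegral_sq_lintegral_le {T Ω : Type*} [MeasurableSpace T] [MeasurableSpace Ω]
    {μ : Measure T} {P : Measure Ω} [SFinite μ] [SFinite P] {c w : T → ℝ≥0∞} {Z : T × Ω → ℝ≥0∞}
    (hc : Measurable c) (hw : Measurable w) (hZ : Measurable Z)
    (hw0 : ∀ᵐ t ∂μ, w t ≠ 0 ∧ w t ≠ ⊤) (h : ∀ᵐ t ∂μ, ∫⁻ ω, Z (t, ω) ^ 2 ∂P ≤ w t ^ 2) :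
    ∫⁻ ω, (∫⁻ t, c t * Z (t, ω) ∂μ) ^ 2 ∂P ≤ (∫⁻ t, c t * w t ∂μ) ^ 2 := by
  have hm : Measurable fun q : Ω × T => c q.2 * w q.2 * (Z (q.2, q.1) / w q.2) ^ 2 :=
    ((hc.mul hw).comp measurable_snd).mul
      (((hZ.comp measurable_swap).div (hw.comp measurable_snd)).pow_const 2)
  calc ∫⁻ ω, (∫⁻ t, c t * Z (t, ω) ∂μ) ^ 2 ∂P
      = ∫⁻ ω, (∫⁻ t, c t * w t * (Z (t, ω) / w t) ∂μ) ^ 2 ∂P := by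
        refine lintegral_congr fun ω => ?_
        congr 1
        refine lintegral_congr_ae ?_
        filter_upwards [hw0] with t ht
        rw [mul_assoc, ENNReal.mul_div_cancel ht.1 ht.2]
    _ ≤ ∫⁻ ω, (∫⁻ t, c t * w t ∂μ) * ∫⁻ t, c t * w t * (Z (t, ω) / w t) ^ 2 ∂μ ∂P := by
        refine lintegral_mono fun ω => sq_lintegral_weight_mul_le (hc.mul hw).aemeasurable
          ((hZ.comp measurable_prodMk_right).div hw).aemeasurable
    _ = (∫⁻ t, c t * w t ∂μ) * ∫⁻ t, ∫⁻ ω, c t * w t * (Z (t, ω) / w t) ^ 2 ∂P ∂μ := by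
        rw [lintegral_const_mul _ hm.lintegral_prod_right', lintegral_lintegral_swap hm.aemeasurable]
    _ ≤ (∫⁻ t, c t * w t ∂μ) * ∫⁻ t, c t * w t ∂μ := by
        refine mul_le_mul_right (lintegral_mono_ae ?_) _
        filter_upwards [hw0, h] with t ht h
        have hZt : Measurable fun ω => Z (t, ω) := hZ.comp measurable_prodMk_left
        rw [lintegral_const_mul _ ((hZt.div_const _).pow_const 2)]
        refine mul_le_of_le_one_right' ?_
        simp only [div_eq_mul_inv, mul_pow]
        rw [lintegral_mul_const _ (hZt.pow_const 2), ← ENNReal.inv_pow]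
        exact (mul_le_mul_left h _).trans (ENNReal.mul_inv_le_one _)
    _ = _ := (sq _).symm

variable {d : ℕ} {Ω : Type*} [AddAction (Rd d) Ω] {V : Ω → ℝ}

/-- The limit of the gradients of the correctors, formally `∇Δ⁻¹V`, as `-∫ ∇ exp(tΔ) V dt`;
`average (gradHeat t) V` is minus the gradient of `exp(tΔ) V` at the origin. -/
def limitGradient (d : ℕ) {Ω : Type*} [AddAction (Rd d) Ω] (V : Ω → ℝ) (ω : Ω) : Rd d :=
  ∫ t in Set.Ioi (0 : ℝ), average (gradHeat t) V ω

variable [MeasurableSpace Ω] [MeasurableVAdd₂ (Rd d) Ω] {P : Measure Ω}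
  [IsProbabilityMeasure P] [VAddInvariantMeasure (Rd d) Ω P] {M : ℝ}

lemma stronglyMeasurable_average_gradHeat (hV : Measurable V) :
    StronglyMeasurable fun q : ℝ × Ω => average (gradHeat q.1 : Rd d → Rd d) V q.2 :=
  stronglyMeasurable_average_prod hV stronglyMeasurable_gradHeat

lemma stronglyMeasurable_limitGradient (hV : Measurable V) :
    StronglyMeasurable (limitGradient d V) :=
  ((stronglyMeasurable_average_gradHeat (d := d) hV).comp_measurable
    measurable_swap).integral_prod_right'

/-- A positive constant such that `gradWeight` bounds the contributions to the gradient. -/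
def gradBound (d : ℕ) {Ω : Type*} [MeasurableSpace Ω] [AddAction (Rd d) Ω] (P : Measure Ω)
    (V : Ω → ℝ) (M : ℝ) : ℝ := gradConst d P V M + 1

omit [MeasurableVAdd₂ (Rd d) Ω] [IsProbabilityMeasure P] [VAddInvariantMeasure (Rd d) Ω P] in
lemma gradBound_pos : 0 < gradBound d P V M := by
  unfold gradBound gradConst; positivity

lemma lintegral_sq_lintegral_average_gradHeat_le (hV : Measurable V) (hM : ∀ ω, |V ω| ≤ M)
    (hR : Integrable (fun x : Rd d => correlation P V x) volume) {c : ℝ → ℝ≥0∞}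
    (hc : Measurable c) :
    ∫⁻ ω, (∫⁻ t in Set.Ioi (0 : ℝ), c t * ‖average (gradHeat t : Rd d → Rd d) V ω‖ₑ) ^ 2 ∂P
      ≤ (∫⁻ t in Set.Ioi (0 : ℝ), c t *
          ENNReal.ofReal (gradBound d P V M * gradWeight d t)) ^ 2 := by
  have hpos : ∀ t : ℝ, 0 < t → 0 < gradWeight d t := fun t ht => by
    have : 0 < decay d t := lt_min one_pos (by positivity)
    unfold gradWeight; positivity
  refine lintegral_sq_lintegral_le (Z := fun q : ℝ × Ω => ‖average (gradHeat q.1 : Rd d → Rd d) V q.2‖ₑ)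
    hc (measurable_gradWeight.const_mul _).ennreal_ofReal
    (stronglyMeasurable_average_gradHeat hV).enorm ?_ ?_
  · filter_upwards [ae_restrict_mem measurableSet_Ioi] with t ht
    exact ⟨(ENNReal.ofReal_pos.2 (mul_pos gradBound_pos (hpos t ht))).ne', ENNReal.ofReal_ne_top⟩
  · filter_upwards [ae_restrict_mem measurableSet_Ioi] with t ht
    refine (lintegral_enorm_sq_average_gradHeat_le hV hM hR ht).trans ?_
    gcongr
    · exact gradWeight_nonneg (le_of_lt ht)
    · unfold gradBound; linarith

lemma lintegral_gradWeight_lt_top (hd : 3 ≤ d) (C : ℝ) :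
    ∫⁻ t in Set.Ioi (0 : ℝ), ENNReal.ofReal (C * gradWeight d t) < ⊤ :=
  ((integrableOn_gradWeight hd).const_mul C).lintegral_lt_top

lemma ae_integrableOn_average_gradHeat (hd : 3 ≤ d) (hV : Measurable V) (hM : ∀ ω, |V ω| ≤ M)
    (hR : Integrable (fun x : Rd d => correlation P V x) volume) :
    ∀ᵐ ω ∂P, IntegrableOn (fun t => average (gradHeat t : Rd d → Rd d) V ω) (Set.Ioi 0) := by
  have h := lintegral_sq_lintegral_average_gradHeat_le hV hM hR (c := fun _ => 1) measurable_const
  simp only [one_mul] at h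
  have hm : Measurable fun ω =>
      ∫⁻ t in Set.Ioi (0 : ℝ), ‖average (gradHeat t : Rd d → Rd d) V ω‖ₑ :=
    ((stronglyMeasurable_average_gradHeat hV).comp_measurable
      measurable_swap).enorm.lintegral_prod_right'
  have hlt := h.trans_lt (ENNReal.pow_lt_top (lintegral_gradWeight_lt_top hd _))
  filter_upwards [ae_lt_top (hm.pow_const 2) hlt.ne] with ω hω
  exact ⟨((stronglyMeasurable_average_gradHeat hV).comp_measurable
    measurable_prodMk_right).aestronglyMeasurable,
    (ENNReal.pow_lt_top_iff.1 hω).resolve_right two_ne_zero⟩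

lemma memLp_limitGradient (hd : 3 ≤ d) (hV : Measurable V) (hM : ∀ ω, |V ω| ≤ M)
    (hR : Integrable (fun x : Rd d => correlation P V x) volume) :
    MemLp (limitGradient d V) 2 P := by
  refine ⟨(stronglyMeasurable_limitGradient hV).aestronglyMeasurable, ?_⟩
  have h := lintegral_sq_lintegral_average_gradHeat_le hV hM hR (c := fun _ => 1) measurable_const
  simp only [one_mul] at h
  have h2 : eLpNorm (limitGradient d V) 2 P ^ 2 < ⊤ := by
    rw [eLpNorm_two_sq]
    refine lt_of_le_of_lt (lintegral_mono fun ω => ?_)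
      (h.trans_lt (ENNReal.pow_lt_top (lintegral_gradWeight_lt_top hd _)))
    gcongr
    exact enorm_integral_le_lintegral_enorm _
  exact (ENNReal.pow_lt_top_iff.1 h2).resolve_right two_ne_zero

lemma average_gradK (hV : Measurable V) (hM : ∀ ω, |V ω| ≤ M) {lam : ℝ} (hl : 0 < lam) (ω : Ω) :
    average (gradK lam : Rd d → Rd d) V ω
      = -∫ t in Set.Ioi (0 : ℝ), Real.exp (-lam * t) • average (gradHeat t) V ω := by
  have h := integral_gradKScalar_smul (d := d) hl (F := fun z => V (z +ᵥ ω) • z) (C := M)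
    ((measurable_vadd_left hV ω).smul measurable_id).aestronglyMeasurable (fun z => by
      rw [norm_smul]; exact mul_le_mul_of_nonneg_right (hM _) (norm_nonneg _))
  simp only [average, gradK, gradHeat, smul_neg, integral_neg, neg_mul]
  rw [neg_inj]
  simp only [smul_comm (V _)]
  exact h

/-- The gradient `-average (gradK lam) V` of the corrector at scale `lam` is close to
`limitGradient` in `L²(Ω)`: their difference is the time integral of the same field with the
weight `1 - exp (-lam t)`. -/
lemma lintegral_enorm_sq_average_gradK_add_le (hd : 3 ≤ d) (hV : Measurable V)
    (hM : ∀ ω, |V ω| ≤ M) (hR : Integrable (fun x : Rd d => correlation P V x) volume) {lam : ℝ}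
    (hl : 0 < lam) :
    ∫⁻ ω, ‖average (gradK lam : Rd d → Rd d) V ω + limitGradient d V ω‖ₑ ^ 2 ∂P
      ≤ ENNReal.ofReal (gradBound d P V M *
        ∫ t in Set.Ioi (0 : ℝ), (1 - Real.exp (-lam * t)) * gradWeight d t) ^ 2 := by
  have hcm : Measurable fun t : ℝ => 1 - Real.exp (-lam * t) := by fun_prop
  have h := lintegral_sq_lintegral_average_gradHeat_le hV hM hR
    (c := fun t => ENNReal.ofReal (1 - Real.exp (-lam * t))) hcm.ennreal_ofReal
  refine le_trans (lintegral_mono_ae ?_) (h.trans_eq ?_)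
  · filter_upwards [ae_integrableOn_average_gradHeat hd hV hM hR] with ω hω
    gcongr
    have hi : IntegrableOn (fun t => Real.exp (-lam * t) • average (gradHeat t : Rd d → Rd d) V ω)
        (Set.Ioi 0) := by
      have he : Measurable fun t : ℝ => Real.exp (-lam * t) := by fun_prop
      refine Integrable.bdd_smul hω he.aestronglyMeasurable (C := 1) ?_
      filter_upwards [ae_restrict_mem measurableSet_Ioi] with t ht
      have := one_sub_exp_nonneg hl.le (le_of_lt ht)
      rw [Real.norm_of_nonneg (Real.exp_pos _).le]
      linarith
    rw [average_gradK hV hM hl, limitGradient, neg_add_eq_sub, ← integral_sub hω hi]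
    refine (enorm_integral_le_lintegral_enorm _).trans (setLIntegral_mono' measurableSet_Ioi
      fun t ht => le_of_eq ?_)
    have h1 : average (gradHeat t : Rd d → Rd d) V ω - Real.exp (-lam * t) • average (gradHeat t) V ω
        = (1 - Real.exp (-lam * t)) • average (gradHeat t) V ω := by rw [sub_smul, one_smul]
    rw [h1, enorm_smul, Real.enorm_of_nonneg (one_sub_exp_nonneg hl.le (le_of_lt ht))]
  · have hi : IntegrableOn (fun t => gradBound d P V M * ((1 - Real.exp (-lam * t)) * gradWeight d t))
        (Set.Ioi 0) := by
      refine Integrable.const_mul ?_ _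
      refine (integrableOn_gradWeight hd).bdd_mul (c := 1) hcm.aestronglyMeasurable ?_
      filter_upwards [ae_restrict_mem measurableSet_Ioi] with t ht
      rw [Real.norm_of_nonneg (one_sub_exp_nonneg hl.le (le_of_lt ht))]
      exact one_sub_exp_le_one _ _
    rw [← integral_const_mul, ofReal_integral_eq_lintegral_ofReal hi (by
      filter_upwards [ae_restrict_mem measurableSet_Ioi] with t ht
      exact mul_nonneg gradBound_pos.le (mul_nonneg (one_sub_exp_nonneg hl.le (le_of_lt ht))
        (gradWeight_nonneg (le_of_lt ht))))]
    congr 1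
    refine setLIntegral_congr_fun measurableSet_Ioi fun t ht => ?_
    rw [← ENNReal.ofReal_mul (one_sub_exp_nonneg hl.le (le_of_lt ht))]
    congr 1; ring

end GradientLimit

/-! ### The mean of the potential against the corrector -/

section Mean

variable {d : ℕ} {Ω : Type*} [AddAction (Rd d) Ω] {V : Ω → ℝ}
  [MeasurableSpace Ω] [MeasurableVAdd₂ (Rd d) Ω] {P : Measure Ω}
  [IsProbabilityMeasure P] [VAddInvariantMeasure (Rd d) Ω P] {M : ℝ}

lemma integral_mul_average (hV : Measurable V) (hM : ∀ ω, |V ω| ≤ M) {K : Rd d → ℝ}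
    (hKm : Measurable K) (hK : Integrable K) :
    ∫ ω, V ω * average K V ω ∂P = ∫ z, K z * correlation P V z := by
  have hm : Measurable fun q : Ω × Rd d => V q.1 * (V (q.2 +ᵥ q.1) * K q.2) :=
    (hV.comp measurable_fst).mul ((hV.comp (measurable_snd.vadd measurable_fst)).mul
      (hKm.comp measurable_snd))
  have hi : Integrable (fun q : Ω × Rd d => V q.1 * (V (q.2 +ᵥ q.1) * K q.2)) (P.prod volume) := by
    refine Integrable.mono' ((hK.norm.comp_snd P).const_mul (M * M)) hm.aestronglyMeasurable
      (Eventually.of_forall fun q => ?_)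
    rw [norm_mul, norm_mul, ← mul_assoc]
    exact mul_le_mul_of_nonneg_right (mul_le_mul (hM _) (hM _) (norm_nonneg _)
      ((abs_nonneg _).trans (hM q.1))) (norm_nonneg _)
  have h := integral_integral_swap (f := fun ω z => V ω * (V (z +ᵥ ω) * K z)) hi
  simp only [integral_const_mul] at h
  refine h.trans (integral_congr_ae (Eventually.of_forall fun z => ?_))
  simp only [← mul_assoc]
  rw [integral_mul_const, mul_comm]
  have := integral_vadd_mul_vadd (P := P) (V := V) (0 : Rd d) z
  simp only [zero_vadd, zero_sub] at this
  rw [this, correlation_neg]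

lemma integral_mul_average_resK (hV : Measurable V) (hM : ∀ ω, |V ω| ≤ M) {lam : ℝ}
    (hl : 0 < lam) : ∫ ω, V ω * average (resK lam : Rd d → ℝ) V ω ∂P
      = ∫ t in Set.Ioi (0 : ℝ), Real.exp (-lam * t) * heatCorr P V d t := by
  rw [integral_mul_average hV hM (measurable_resK lam) (integrable_resK hl)]
  have := integral_resK_smul (d := d) hl
    (stronglyMeasurable_correlation (P := P) hV).aestronglyMeasurable
    (fun x => abs_correlation_le (P := P) hM x)
  simpa only [smul_eq_mul, neg_mul, heatCorr] using this

/-- The mean of `V` against the corrector is close to the homogenized potential. -/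
lemma abs_homogenizedPotential_sub_le (hd : 3 ≤ d) (hV : Measurable V) (hM : ∀ ω, |V ω| ≤ M)
    (hR : Integrable (fun x : Rd d => correlation P V x) volume) {lam : ℝ} (hl : 0 < lam) :
    |homogenizedPotential d P V - ∫ ω, V ω * average (resK lam : Rd d → ℝ) V ω ∂P|
      ≤ corrBound d P V M *
        ∫ t in Set.Ioi (0 : ℝ), (1 - Real.exp (-lam * t)) * decay d t := by
  have hcm : Measurable fun t : ℝ => 1 - Real.exp (-lam * t) := by fun_prop
  have hi := integrableOn_heatCorr hd hV hM hR
  have hi2 : IntegrableOn (fun t => Real.exp (-lam * t) * heatCorr P V d t) (Set.Ioi 0) := by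
    refine Integrable.bdd_mul (c := 1) hi (by fun_prop) ?_
    filter_upwards [ae_restrict_mem measurableSet_Ioi] with t ht
    have := one_sub_exp_nonneg hl.le (le_of_lt ht)
    rw [Real.norm_of_nonneg (Real.exp_pos _).le]
    linarith
  rw [homogenizedPotential_eq hd hV hM hR, integral_mul_average_resK hV hM hl,
    ← integral_sub hi hi2, ← integral_const_mul]
  have hi3 : IntegrableOn (fun t => (1 - Real.exp (-lam * t)) * decay d t) (Set.Ioi 0) := by
    refine (integrableOn_decay hd).bdd_mul (c := 1) hcm.aestronglyMeasurable ?_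
    filter_upwards [ae_restrict_mem measurableSet_Ioi] with t ht
    rw [Real.norm_of_nonneg (one_sub_exp_nonneg hl.le (le_of_lt ht))]
    exact one_sub_exp_le_one _ _
  rw [← Real.norm_eq_abs]
  refine norm_integral_le_of_norm_le (hi3.const_mul _) ?_
  filter_upwards [ae_restrict_mem measurableSet_Ioi] with t ht
  have h0 := one_sub_exp_nonneg hl.le (le_of_lt ht)
  rw [show heatCorr P V d t - Real.exp (-lam * t) * heatCorr P V d t
      = (1 - Real.exp (-lam * t)) * heatCorr P V d t by ring,
    Real.norm_of_nonneg (mul_nonneg h0 (heatCorr_nonneg hV hM hR ht))]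
  calc _ ≤ (1 - Real.exp (-lam * t)) * (corrBound d P V M * decay d t) :=
        mul_le_mul_of_nonneg_left (heatCorr_le hM hR ht) h0
    _ = _ := by ring

end Mean

/-! ### Decorrelation of the fluctuations -/

section Covariance

variable {d : ℕ} {Ω : Type*} [AddAction (Rd d) Ω] {V : Ω → ℝ}
  [MeasurableSpace Ω] [MeasurableVAdd₂ (Rd d) Ω] {P : Measure Ω}
  [IsProbabilityMeasure P] [VAddInvariantMeasure (Rd d) Ω P] {M : ℝ}

/-- The product of `V` and the corrector `-average (resK lam) V` at scale `lam`, centred. -/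
def fluctuation (d : ℕ) {Ω : Type*} [AddAction (Rd d) Ω] [MeasurableSpace Ω]
    (P : Measure Ω) (V : Ω → ℝ) (lam : ℝ) (ω : Ω) : ℝ :=
  (∫ ω, V ω * average (resK lam : Rd d → ℝ) V ω ∂P) - V ω * average (resK lam : Rd d → ℝ) V ω

lemma measurable_average_resK (hV : Measurable V) (lam : ℝ) :
    Measurable (average (resK lam : Rd d → ℝ) V) :=
  (stronglyMeasurable_average hV (measurable_resK lam).stronglyMeasurable).measurable

omit [IsProbabilityMeasure P] [VAddInvariantMeasure (Rd d) Ω P] in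
lemma measurable_fluctuation (hV : Measurable V) (lam : ℝ) :
    Measurable (fluctuation d P V lam) :=
  (hV.mul (measurable_average_resK hV lam)).const_sub _

omit [MeasurableSpace Ω] [MeasurableVAdd₂ (Rd d) Ω] in
lemma abs_mul_average_resK_le (hM : ∀ ω, |V ω| ≤ M) {lam : ℝ} (hl : 0 < lam) (ω : Ω) :
    |V ω * average (resK lam : Rd d → ℝ) V ω| ≤ M * (M * lam⁻¹) := by
  have h := norm_average_le hM (integrable_resK (d := d) hl) ω
  simp only [Real.norm_of_nonneg (resK_nonneg _ _), integral_resK hl] at h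
  rw [abs_mul]
  exact mul_le_mul (hM ω) h (abs_nonneg _) ((abs_nonneg _).trans (hM ω))

omit [VAddInvariantMeasure (Rd d) Ω P] in
lemma integrable_mul_average_resK (hV : Measurable V) (hM : ∀ ω, |V ω| ≤ M) {lam : ℝ}
    (hl : 0 < lam) : Integrable (fun ω => V ω * average (resK lam : Rd d → ℝ) V ω) P :=
  Integrable.of_bound (hV.mul (measurable_average_resK hV lam)).aestronglyMeasurable _
    (Eventually.of_forall fun ω => abs_mul_average_resK_le hM hl ω)

omit [IsProbabilityMeasure P] [VAddInvariantMeasure (Rd d) Ω P] in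
omit [MeasurableVAdd₂ (Rd d) Ω] in
lemma exists_abs_fluctuation_le (hM : ∀ ω, |V ω| ≤ M) {lam : ℝ} (hl : 0 < lam) :
    ∃ C, ∀ ω, |fluctuation d P V lam ω| ≤ C :=
  ⟨_, fun ω => (abs_sub _ _).trans (add_le_add_right (abs_mul_average_resK_le hM hl ω) _)⟩

/-- The covariance of the fluctuations is bounded by their variance, hence by the second moment of
the corrector. -/
lemma enorm_correlation_fluctuation_le (hV : Measurable V) (hM : ∀ ω, |V ω| ≤ M)
    (hR : Integrable (fun x : Rd d => correlation P V x) volume) {lam : ℝ} (hl : 0 < lam)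
    (z : Rd d) :
    ‖correlation P (fluctuation d P V lam) z‖ₑ ≤ ENNReal.ofReal (M ^ 2) *
      (2 * ENNReal.ofReal (corrBound d P V M) * timeMass d lam) := by
  set Q := fluctuation d P V lam with hQ
  set q : Ω → ℝ := fun ω => V ω * average (resK lam : Rd d → ℝ) V ω with hq
  obtain ⟨C, hC⟩ := exists_abs_fluctuation_le (d := d) (P := P) hM hl
  have hQm : Measurable Q := measurable_fluctuation hV lam
  have hQ2 : Integrable (fun ω => Q ω ^ 2) P :=
    Integrable.of_bound (hQm.pow_const 2).aestronglyMeasurable (C ^ 2)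
      (Eventually.of_forall fun ω => by
        rw [norm_pow]; exact pow_le_pow_left₀ (norm_nonneg _) (hC ω) 2)
  have hqi : Integrable q P := integrable_mul_average_resK hV hM hl
  have hq2 : Integrable (fun ω => q ω ^ 2) P :=
    Integrable.of_bound ((hV.mul (measurable_average_resK hV lam)).pow_const 2).aestronglyMeasurable
      ((M * (M * lam⁻¹)) ^ 2) (Eventually.of_forall fun ω => by
        rw [norm_pow]
        exact pow_le_pow_left₀ (norm_nonneg _) (abs_mul_average_resK_le hM hl ω) 2)
  have hQq : ∫ ω, Q ω ^ 2 ∂P ≤ ∫ ω, q ω ^ 2 ∂P := by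
    have h1 : ∀ ω, Q ω ^ 2 = q ω ^ 2 - 2 * (∫ ω, q ω ∂P) * q ω + (∫ ω, q ω ∂P) ^ 2 := fun ω => by
      simp only [hQ, fluctuation, hq]; ring
    have i1 : Integrable (fun ω => q ω ^ 2 - 2 * (∫ ω, q ω ∂P) * q ω) P := hq2.sub (hqi.const_mul _)
    simp only [h1]
    rw [integral_add i1 (integrable_const _), integral_sub hq2 (hqi.const_mul _), integral_const_mul]
    simp only [integral_const, probReal_univ, one_smul]
    nlinarith [sq_nonneg (∫ ω, q ω ∂P)]
  have hz2 : ∫ ω, field Q z ω ^ 2 ∂P = ∫ ω, Q ω ^ 2 ∂P :=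
    integral_vadd_eq (-z) fun ω => Q ω ^ 2
  have h02 : ∫ ω, field Q (0 : Rd d) ω ^ 2 ∂P = ∫ ω, Q ω ^ 2 ∂P :=
    integral_vadd_eq (-0) fun ω => Q ω ^ 2
  have hi : ∀ x : Rd d, Integrable (fun ω => field Q x ω ^ 2) P := fun x =>
    (measurePreserving_vadd (-x) P).integrable_comp_of_integrable hQ2
  have h2 : |correlation P Q z| ≤ ∫ ω, Q ω ^ 2 ∂P := by
    have h3 : |correlation P Q z| ≤ ∫ ω, (field Q (0 : Rd d) ω ^ 2 + field Q z ω ^ 2) / 2 ∂P := by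
      rw [← Real.norm_eq_abs]
      refine norm_integral_le_of_norm_le (((hi 0).add (hi z)).div_const 2)
        (Eventually.of_forall fun ω => ?_)
      rw [norm_mul, Real.norm_eq_abs, Real.norm_eq_abs, ← sq_abs (field Q (0 : Rd d) ω),
        ← sq_abs (field Q z ω)]
      nlinarith [sq_nonneg (|field Q (0 : Rd d) ω| - |field Q z ω|)]
    rw [integral_div, integral_add (hi 0) (hi z), hz2, h02] at h3
    linarith
  rw [← ofReal_norm, Real.norm_eq_abs]
  calc ENNReal.ofReal |correlation P Q z| ≤ ENNReal.ofReal (∫ ω, q ω ^ 2 ∂P) :=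
        ENNReal.ofReal_le_ofReal (h2.trans hQq)
    _ ≤ ∫⁻ ω, ENNReal.ofReal (M ^ 2) * ‖average (resK lam : Rd d → ℝ) V ω‖ₑ ^ 2 ∂P := by
        rw [ofReal_integral_eq_lintegral_ofReal hq2 (Eventually.of_forall fun ω => sq_nonneg _)]
        refine lintegral_mono fun ω => ?_
        rw [← ofReal_norm, ← ENNReal.ofReal_pow (norm_nonneg _),
          ← ENNReal.ofReal_mul (sq_nonneg _)]
        refine ENNReal.ofReal_le_ofReal ?_
        simp only [hq, mul_pow, Real.norm_eq_abs, sq_abs]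
        exact mul_le_mul_of_nonneg_right (sq_le_sq' (abs_le.1 (hM ω)).1 (abs_le.1 (hM ω)).2)
          (sq_nonneg _)
    _ ≤ _ := by
        rw [lintegral_const_mul' _ _ ENNReal.ofReal_ne_top]
        exact mul_le_mul_right (lintegral_enorm_sq_average_resK_le hV hM hR hl) _

/-- The difference between the fourth moment of `V` at `0, -a, z, z - b` and the product of the
correlations of the two pairs. -/
def cumulant (P : Measure Ω) (V : Ω → ℝ) (z a b : Rd d) : ℝ :=
  (∫ ω, field V (0 : Rd d) ω * field V (-a) ω * field V z ω * field V (z - b) ω ∂P)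
    - correlation P V a * correlation P V b

/-- The covariance of the fluctuations as an average of fourth order correlations. -/
lemma correlation_fluctuation_eq (hV : Measurable V) (hM : ∀ ω, |V ω| ≤ M) {lam : ℝ}
    (hl : 0 < lam) (z : Rd d) :
    correlation P (fluctuation d P V lam) z
      = ∫ p : Rd d × Rd d, resK lam p.1 * resK lam p.2 * cumulant P V z p.1 p.2
        ∂(volume.prod volume) := by
  set q : Ω → ℝ := fun ω => V ω * average (resK lam : Rd d → ℝ) V ω with hq
  have hqm : Measurable q := hV.mul (measurable_average_resK hV lam)
  have hqi : Integrable q P := integrable_mul_average_resK hV hM hl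
  have hM2 : 0 ≤ M * M := mul_self_nonneg M
  set m := ∫ ω, q ω ∂P with hm
  have hqx : ∀ x : Rd d, Integrable (field q x) P := fun x =>
    (measurePreserving_vadd (-x) P).integrable_comp_of_integrable hqi
  have hqx' : ∀ x : Rd d, ∫ ω, field q x ω ∂P = m := fun x => integral_vadd_eq (-x) q
  have hqq : Integrable (fun ω => field q (0 : Rd d) ω * field q z ω) P :=
    (hqx z).bdd_mul (measurable_field_right hqm 0).aestronglyMeasurable
      (Eventually.of_forall fun ω => abs_mul_average_resK_le hM hl _)
  have hmR : m = ∫ a : Rd d, resK lam a * correlation P V a :=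
    integral_mul_average hV hM (measurable_resK lam) (integrable_resK hl)
  have h1 : correlation P (fluctuation d P V lam) z
      = ∫ ω, field q (0 : Rd d) ω * field q z ω ∂P - m ^ 2 := by
    have : ∀ ω, field (fluctuation d P V lam) (0 : Rd d) ω * field (fluctuation d P V lam) z ω
        = field q (0 : Rd d) ω * field q z ω - m * field q (0 : Rd d) ω - m * field q z ω + m ^ 2 :=
      fun ω => by simp only [field, fluctuation, hq, hm]; ring
    have i1 : Integrable (fun ω => field q (0 : Rd d) ω * field q z ω - m * field q (0 : Rd d) ω) P :=
      hqq.sub ((hqx 0).const_mul m)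
    have i2 : Integrable (fun ω => field q (0 : Rd d) ω * field q z ω - m * field q (0 : Rd d) ω
        - m * field q z ω) P := i1.sub ((hqx z).const_mul m)
    simp only [correlation, this]
    rw [integral_add i2 (integrable_const _), integral_sub i1 ((hqx z).const_mul m),
      integral_sub hqq ((hqx 0).const_mul m), integral_const_mul, integral_const_mul, hqx', hqx']
    simp only [integral_const, probReal_univ, one_smul]
    ring
  -- the product of the two averages as one integral
  set F : Ω → Rd d × Rd d → ℝ := fun ω p =>
    field V (0 : Rd d) ω * field V (-p.1) ω * field V z ω * field V (z - p.2) ω *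
      (resK lam p.1 * resK lam p.2) with hF
  have hf := measurable_field (d := d) hV
  have hFm : Measurable (Function.uncurry F) := by
    have a1 : Measurable fun q : Ω × (Rd d × Rd d) => field V (0 : Rd d) q.1 :=
      hf.comp (by fun_prop : Measurable fun q : Ω × (Rd d × Rd d) => ((0 : Rd d), q.1))
    have a2 : Measurable fun q : Ω × (Rd d × Rd d) => field V (-q.2.1) q.1 :=
      hf.comp (by fun_prop : Measurable fun q : Ω × (Rd d × Rd d) => (-q.2.1, q.1))
    have a3 : Measurable fun q : Ω × (Rd d × Rd d) => field V z q.1 :=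
      hf.comp (by fun_prop : Measurable fun q : Ω × (Rd d × Rd d) => (z, q.1))
    have a4 : Measurable fun q : Ω × (Rd d × Rd d) => field V (z - q.2.2) q.1 :=
      hf.comp (by fun_prop : Measurable fun q : Ω × (Rd d × Rd d) => (z - q.2.2, q.1))
    have a5 : Measurable fun q : Ω × (Rd d × Rd d) => resK lam q.2.1 * resK lam q.2.2 :=
      ((measurable_resK lam).comp (measurable_fst.comp measurable_snd)).mul
        ((measurable_resK lam).comp (measurable_snd.comp measurable_snd))
    exact (((a1.mul a2).mul a3).mul a4).mul a5
  have hGG : Integrable (fun p : Rd d × Rd d => resK lam p.1 * resK lam p.2)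
      (volume.prod volume) := (integrable_resK hl).mul_prod (integrable_resK hl)
  have hFi : Integrable (Function.uncurry F) (P.prod (volume.prod volume)) := by
    refine Integrable.mono' ((hGG.norm.comp_snd P).const_mul (M * M * (M * M)))
      hFm.aestronglyMeasurable (Eventually.of_forall fun q => ?_)
    have hM0 : 0 ≤ M := (abs_nonneg _).trans (hM q.1)
    simp only [Function.uncurry, hF]
    rw [norm_mul]
    refine mul_le_mul_of_nonneg_right ?_ (norm_nonneg _)
    rw [norm_mul, norm_mul, norm_mul, mul_assoc (_ * _)]
    exact mul_le_mul (mul_le_mul (hM _) (hM _) (norm_nonneg _) hM0)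
      (mul_le_mul (hM _) (hM _) (norm_nonneg _) hM0) (by positivity) hM2
  have h2 : ∀ ω, ∫ p, F ω p ∂(volume.prod volume) = field q (0 : Rd d) ω * field q z ω := fun ω => by
    have e : ∀ p : Rd d × Rd d, F ω p = (field V (0 : Rd d) ω * field V z ω) *
        ((V (p.1 +ᵥ ω) • resK lam p.1) * (V (p.2 +ᵥ ((-z) +ᵥ ω)) • resK lam p.2)) := fun p => by
      simp only [hF, field, neg_neg, smul_eq_mul, vadd_vadd, neg_sub]
      rw [sub_eq_add_neg p.2 z]; ring
    simp only [e]
    rw [integral_const_mul, integral_prod_mul (fun a => V (a +ᵥ ω) • resK lam a)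
      (fun b => V (b +ᵥ ((-z) +ᵥ ω)) • resK lam b)]
    simp only [hq, field, neg_zero, zero_vadd, average]
    ring
  have h3 : ∫ ω, field q (0 : Rd d) ω * field q z ω ∂P
      = ∫ p, ∫ ω, F ω p ∂P ∂(volume.prod volume) := by
    rw [← integral_integral_swap hFi]
    simp only [h2]
  have h4 : m ^ 2 = ∫ p : Rd d × Rd d, (resK lam p.1 * correlation P V p.1) *
      (resK lam p.2 * correlation P V p.2) ∂(volume.prod volume) := by
    rw [integral_prod_mul (fun a => resK lam a * correlation P V a)
      (fun b => resK lam b * correlation P V b), ← hmR, sq]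
  have hRi : Integrable fun a : Rd d => resK lam a * correlation P V a :=
    (integrable_resK hl).mul_bdd (stronglyMeasurable_correlation hV).aestronglyMeasurable
      (Eventually.of_forall fun a => abs_correlation_le hM a)
  have hE : Integrable (fun p => ∫ ω, F ω p ∂P) (volume.prod volume) := hFi.integral_prod_right
  rw [h1, h3, h4, ← integral_sub hE (hRi.mul_prod hRi)]
  refine integral_congr_ae (Eventually.of_forall fun p => ?_)
  simp only [hF, cumulant]
  rw [integral_mul_const]
  ring

/-- Truncation turns the product `e(x) e(y)` of two integrable functions into something bounded by
their sum. -/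
lemma min_mul_le (K x y : ℝ≥0∞) : min K (x * y) ≤ (1 + K) * (x + y) := by
  rcases le_total x 1 with h | h
  · calc min K (x * y) ≤ x * y := min_le_right _ _
      _ ≤ 1 * y := by gcongr
      _ ≤ (1 + K) * (x + y) := mul_le_mul' le_self_add le_add_self
  · calc min K (x * y) ≤ K * 1 := by rw [mul_one]; exact min_le_left _ _
      _ ≤ (1 + K) * (x + y) := mul_le_mul' le_add_self (h.trans le_self_add)

lemma min_add_le (K x y : ℝ≥0∞) : min K (x + y) ≤ min K x + min K y := by
  rcases le_total K x with h | h
  · rw [min_eq_left h]; exact (min_le_left _ _).trans le_self_add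
  rcases le_total K y with h' | h'
  · rw [min_eq_left h']; exact (min_le_left _ _).trans le_add_self
  · rw [min_eq_right h, min_eq_right h']; exact min_le_right _ _

/-- The truncated overlap `∫ min K (e(z) e(z + s)) dz`. -/
def overlap (K : ℝ≥0∞) (e : Rd d → ℝ≥0∞) (s : Rd d) : ℝ≥0∞ := ∫⁻ z, min K (e z * e (z + s))

lemma measurable_overlap_integrand {K : ℝ≥0∞} {e : Rd d → ℝ≥0∞} (he : Measurable e) :
    Measurable fun q : Rd d × Rd d => min K (e q.2 * e (q.2 + q.1)) :=
  measurable_const.min ((he.comp measurable_snd).mul (he.comp (measurable_snd.add measurable_fst)))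

lemma measurable_overlap {K : ℝ≥0∞} {e : Rd d → ℝ≥0∞} (he : Measurable e) :
    Measurable (overlap K e) := (measurable_overlap_integrand he).lintegral_prod_right'

lemma overlap_le {K : ℝ≥0∞} {e : Rd d → ℝ≥0∞} (he : Measurable e) (s : Rd d) :
    overlap K e s ≤ (1 + K) * (2 * ∫⁻ z, e z) := by
  calc overlap K e s ≤ ∫⁻ z, (1 + K) * (e z + e (z + s)) := lintegral_mono fun z => min_mul_le _ _ _
    _ = _ := by
      have h : Measurable fun z => e (z + s) := he.comp (measurable_add_const s)
      have h' : Measurable fun z => e z + e (z + s) := he.add h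
      rw [lintegral_const_mul _ h', lintegral_add_left he, lintegral_add_right_eq_self e s,
        two_mul]

lemma lintegral_overlap_le {K : ℝ≥0∞} {e : Rd d → ℝ≥0∞} (he : Measurable e) :
    ∫⁻ s, overlap K e s ≤ (∫⁻ z, e z) ^ 2 := by
  unfold overlap
  rw [lintegral_lintegral_swap (measurable_overlap_integrand he).aemeasurable]
  calc _ ≤ ∫⁻ z, e z * ∫⁻ s, e s := by
        refine lintegral_mono fun z => ?_
        have h : Measurable fun s => e (z + s) := he.comp (measurable_const_add z)
        calc _ ≤ ∫⁻ s, e z * e (z + s) := lintegral_mono fun s => min_le_right _ _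
          _ = _ := by rw [lintegral_const_mul _ h, lintegral_add_left_eq_self e z]
    _ = _ := by rw [lintegral_mul_const _ he, sq]

/-- The maximum of the bounds of the supremum and of the integral of the sum of two overlaps, for
a majorant `e` with integral `N`. -/
def covBound (K N : ℝ≥0∞) : ℝ≥0∞ := max (2 * ((1 + K) * (2 * N))) (2 * N ^ 2)

omit [MeasurableVAdd₂ (Rd d) Ω] [VAddInvariantMeasure (Rd d) Ω P] in
lemma enorm_cumulant_le (hM : ∀ ω, |V ω| ≤ M) {η : ℝ → ℝ} (hη : ∀ r, 0 ≤ r → 0 ≤ η r)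
    (h4 : ∀ x₁ x₂ x₃ x₄ : Rd d,
      |(∫ ω, field V x₁ ω * field V x₂ ω * field V x₃ ω * field V x₄ ω ∂P)
          - correlation P V (x₁ - x₂) * correlation P V (x₃ - x₄)|
        ≤ η ‖x₁ - x₃‖ * η ‖x₂ - x₄‖ + η ‖x₁ - x₄‖ * η ‖x₂ - x₃‖)
    {e : Rd d → ℝ≥0∞} (he : ∀ x, ENNReal.ofReal (η ‖x‖) ≤ e x) (z a b : Rd d) :
    ‖cumulant P V z a b‖ₑ ≤ min (ENNReal.ofReal (2 * M ^ 4)) (e z * e (z + (a - b)))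
      + min (ENNReal.ofReal (2 * M ^ 4)) (e (z - b) * e (z + a)) := by
  have hM0 : 0 ≤ M := by
    obtain ⟨ω⟩ := P.nonempty_of_neZero
    exact (abs_nonneg _).trans (hM ω)
  refine le_trans (le_min ?_ ?_) (min_add_le _ _ _)
  · rw [← ofReal_norm]
    refine ENNReal.ofReal_le_ofReal ((norm_sub_le _ _).trans ?_)
    have h1 := norm_integral_le_of_norm_le_const (μ := P) (f := fun ω =>
      field V (0 : Rd d) ω * field V (-a) ω * field V z ω * field V (z - b) ω) (C := M * M * (M * M))
      (Eventually.of_forall fun ω => by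
        rw [norm_mul, norm_mul, norm_mul, mul_assoc (_ * _)]
        exact mul_le_mul (mul_le_mul (hM _) (hM _) (norm_nonneg _) hM0)
          (mul_le_mul (hM _) (hM _) (norm_nonneg _) hM0) (by positivity) (by positivity))
    rw [probReal_univ, mul_one] at h1
    have h2 : ‖correlation P V a * correlation P V b‖ ≤ M ^ 2 * M ^ 2 := by
      rw [norm_mul]
      exact mul_le_mul (abs_correlation_le hM a) (abs_correlation_le hM b) (norm_nonneg _)
        (by positivity)
    linarith
  · have h := h4 0 (-a) z (z - b)
    rw [show (0 : Rd d) - -a = a by abel, show z - (z - b) = b by abel] at h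
    rw [zero_sub, zero_sub, norm_neg, norm_neg,
      show -a - (z - b) = -(z + (a - b)) by abel, norm_neg, show -a - z = -(z + a) by abel,
      norm_neg] at h
    have hn := fun x : Rd d => hη ‖x‖ (norm_nonneg x)
    rw [← ofReal_norm, Real.norm_eq_abs, cumulant]
    refine (ENNReal.ofReal_le_ofReal h).trans ?_
    rw [ENNReal.ofReal_add (mul_nonneg (hn _) (hn _)) (mul_nonneg (hn _) (hn _)),
      ENNReal.ofReal_mul (hn _), ENNReal.ofReal_mul (hn _)]
    exact add_le_add (mul_le_mul' (he _) (he _)) (mul_le_mul' (he _) (he _))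

/-- The covariance of the fluctuations is integrable, with a norm controlled by the time integral
which bounds the variance of the corrector. After integration in `z` the fourth order correlations
become overlaps at `a - b` and `a + b`, which are bounded and integrable in each variable. -/
lemma lintegral_correlation_fluctuation_le (hV : Measurable V) (hM : ∀ ω, |V ω| ≤ M)
    {η : ℝ → ℝ} (hη : ∀ r, 0 ≤ r → 0 ≤ η r)
    (h4 : ∀ x₁ x₂ x₃ x₄ : Rd d,
      |(∫ ω, field V x₁ ω * field V x₂ ω * field V x₃ ω * field V x₄ ω ∂P)
          - correlation P V (x₁ - x₂) * correlation P V (x₃ - x₄)|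
        ≤ η ‖x₁ - x₃‖ * η ‖x₂ - x₄‖ + η ‖x₁ - x₄‖ * η ‖x₂ - x₃‖)
    {e : Rd d → ℝ≥0∞} (hem : Measurable e) (he : ∀ x, ENNReal.ofReal (η ‖x‖) ≤ e x) {lam : ℝ}
    (hl : 0 < lam) :
    ∫⁻ z : Rd d, ‖correlation P (fluctuation d P V lam) z‖ₑ
      ≤ 2 * covBound (ENNReal.ofReal (2 * M ^ 4)) (∫⁻ x, e x) * timeMass d lam := by
  set K := ENNReal.ofReal (2 * M ^ 4) with hK
  set G : Rd d × Rd d → ℝ≥0∞ := fun p =>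
    ENNReal.ofReal (resK lam p.1) * ENNReal.ofReal (resK lam p.2) with hG
  have hGm : Measurable G :=
    ((measurable_resK lam).comp measurable_fst).ennreal_ofReal.mul
      ((measurable_resK lam).comp measurable_snd).ennreal_ofReal
  set Ψ : Rd d → Rd d × Rd d → ℝ≥0∞ := fun z p =>
    min K (e z * e (z + (p.1 - p.2))) + min K (e (z - p.2) * e (z + p.1)) with hΨ
  have hΨm1 : Measurable fun q : Rd d × (Rd d × Rd d) => min K (e q.1 * e (q.1 + (q.2.1 - q.2.2))) :=
    measurable_const.min ((hem.comp measurable_fst).mul (hem.comp (by fun_prop)))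
  have hΨm2 : Measurable fun q : Rd d × (Rd d × Rd d) => min K (e (q.1 - q.2.2) * e (q.1 + q.2.1)) :=
    measurable_const.min ((hem.comp (by fun_prop)).mul (hem.comp (by fun_prop)))
  have hΨi : ∀ p, ∫⁻ z, Ψ z p = overlap K e (p.1 - p.2) + overlap K e (p.1 + p.2) := fun p => by
    simp only [hΨ]
    have h1 : Measurable fun z => min K (e z * e (z + (p.1 - p.2))) :=
      hΨm1.comp (by fun_prop : Measurable fun z : Rd d => (z, p))
    rw [lintegral_add_left h1]
    congr 1
    rw [← lintegral_add_right_eq_self (fun z => min K (e (z - p.2) * e (z + p.1))) p.2]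
    refine lintegral_congr fun z => ?_
    rw [add_sub_cancel_right, show z + p.2 + p.1 = z + (p.1 + p.2) by abel]
  have hom := measurable_overlap (K := K) hem
  have hKB := lintegral_resK_resK_mul_le (d := d) (lam := lam) hl.le
    (Ψ := fun p => overlap K e (p.1 - p.2) + overlap K e (p.1 + p.2))
    ((hom.comp (measurable_fst.sub measurable_snd)).add
      (hom.comp (measurable_fst.add measurable_snd)))
    (A := 2 * (∫⁻ x, e x) ^ 2) (B := 2 * ((1 + K) * (2 * ∫⁻ x, e x)))
    (fun p => (add_le_add (overlap_le hem _) (overlap_le hem _)).trans_eq (two_mul _).symm)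
    (fun a => by
      simp only
      have : Measurable fun b => overlap K e (a - b) := hom.comp (measurable_const_sub a)
      rw [lintegral_add_left this, lintegral_sub_left_eq_self (overlap K e) a,
        lintegral_add_left_eq_self (overlap K e) a, ← two_mul]
      exact mul_le_mul_right (lintegral_overlap_le hem) _)
    (fun b => by
      simp only
      have : Measurable fun a => overlap K e (a - b) := hom.comp (measurable_sub_const b)
      rw [lintegral_add_left this, lintegral_sub_right_eq_self (overlap K e) b,
        lintegral_add_right_eq_self (overlap K e) b, ← two_mul]
      exact mul_le_mul_right (lintegral_overlap_le hem) _)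
  calc ∫⁻ z : Rd d, ‖correlation P (fluctuation d P V lam) z‖ₑ
      ≤ ∫⁻ z, ∫⁻ p, G p * Ψ z p := by
        refine lintegral_mono fun z => ?_
        rw [correlation_fluctuation_eq hV hM hl]
        refine (enorm_integral_le_lintegral_enorm _).trans ?_
        rw [Measure.volume_eq_prod]
        refine lintegral_mono fun p => ?_
        rw [enorm_mul, enorm_mul, Real.enorm_of_nonneg (resK_nonneg _ _),
          Real.enorm_of_nonneg (resK_nonneg _ _)]
        exact mul_le_mul_right (enorm_cumulant_le hM hη h4 he z p.1 p.2) _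
    _ = ∫⁻ p, ∫⁻ z, G p * Ψ z p :=
        lintegral_lintegral_swap ((hGm.comp measurable_snd).mul (hΨm1.add hΨm2)).aemeasurable
    _ = ∫⁻ p, G p * (overlap K e (p.1 - p.2) + overlap K e (p.1 + p.2)) := by
        refine lintegral_congr fun p => ?_
        have : Measurable fun z => Ψ z p :=
          (hΨm1.add hΨm2).comp (by fun_prop : Measurable fun z : Rd d => (z, p))
        rw [lintegral_const_mul _ this, hΨi]
    _ ≤ _ := hKB

end Covariance

/-! ### Rescaling the correctors -/

section Rescaling

variable {d : ℕ} {Ω : Type*} [AddAction (Rd d) Ω] {V : Ω → ℝ}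

lemma lintegral_eq_comp_smul {f : Rd d → ℝ≥0∞} (hf : Measurable f) {ε : ℝ} (hε : 0 < ε) :
    ∫⁻ x, f x = ENNReal.ofReal (ε ^ d) * ∫⁻ y, f (ε • y) := by
  have h := Measure.map_addHaar_smul (volume : Measure (Rd d)) hε.ne'
  rw [← lintegral_map hf (measurable_const_smul ε), h, lintegral_smul_measure, smul_eq_mul,
    ← mul_assoc, finrank_euclideanSpace, Fintype.card_fin, abs_of_pos (by positivity),
    ← ENNReal.ofReal_mul (by positivity), mul_inv_cancel₀ (by positivity), ENNReal.ofReal_one,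
    one_mul]

lemma integral_eq_comp_smul (f : Rd d → ℝ) {ε : ℝ} (hε : 0 < ε) :
    ∫ x, f x = ε ^ d * ∫ y, f (ε • y) := by
  rw [Measure.integral_comp_smul_of_nonneg (volume : Measure (Rd d)) f ε (hR := hε.le),
    finrank_euclideanSpace, Fintype.card_fin, smul_eq_mul, ← mul_assoc,
    mul_inv_cancel₀ (by positivity), one_mul]

lemma conv_scaledField {ε : ℝ} (hε : 0 < ε) {K K' : Rd d → ℝ} {c : ℝ}
    (h : ∀ y, K (ε • y) * ε ^ d = c * K' y) (x : Rd d) (ω : Ω) :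
    conv K (fun x => scaledField V ε x ω) x = ε⁻¹ * c * average K' V ((-(ε⁻¹ • x)) +ᵥ ω) := by
  rw [conv, integral_eq_comp_smul _ hε, average, ← integral_const_mul, ← integral_const_mul]
  refine integral_congr_ae (Eventually.of_forall fun y => ?_)
  have e : -(ε⁻¹ • (x - ε • y)) = y + -(ε⁻¹ • x) := by
    rw [smul_sub, smul_smul, inv_mul_cancel₀ hε.ne', one_smul]; abel
  simp only [scaledField, field, smul_eq_mul, vadd_vadd, e]
  linear_combination (ε⁻¹ * V ((y + -(ε⁻¹ • x)) +ᵥ ω)) * h y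

lemma average_apply {k : Rd d → Rd d} {ω : Ω} (hi : Integrable fun z => V (z +ᵥ ω) • k z)
    (j : Fin d) : average k V ω j = average (fun z => k z j) V ω :=
  ((EuclideanSpace.proj j : Rd d →L[ℝ] ℝ).integral_comp_comm hi).symm

lemma corrector_eq_conv (ε : ℝ) (x : Rd d) (ω : Ω) :
    corrector V ε x ω = -conv (resK 1) (fun x => scaledField V ε x ω) x := by
  rw [corrector, conv, ← integral_sub_left_eq_self _ volume x]
  congr 1
  refine integral_congr_ae (Eventually.of_forall fun y => ?_)
  simp only [green_eq_resK, sub_sub_cancel, smul_eq_mul]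

lemma corrector_eq_average {ε : ℝ} (hε : 0 < ε) (x : Rd d) (ω : Ω) :
    corrector V ε x ω = -(ε * average (resK (ε ^ 2) : Rd d → ℝ) V ((-(ε⁻¹ • x)) +ᵥ ω)) := by
  rw [corrector_eq_conv, conv_scaledField hε (resK_scale hε)]
  congr 2
  field_simp

lemma fastCorrector_eq_conv {ε : ℝ} (hε : 0 < ε) (y : Rd d) (ω : Ω) :
    fastCorrector V ε y ω = -conv (resK (ε ^ 2)) (fun y => field V y ω) y := by
  rw [fastCorrector, corrector_eq_average hε, conv_field, smul_smul, inv_mul_cancel₀ hε.ne',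
    one_smul]
  field_simp

variable [MeasurableSpace Ω] [MeasurableVAdd₂ (Rd d) Ω] {M : ℝ}

lemma gradConv_scaledField (hV : Measurable V) (hM : ∀ ω, |V ω| ≤ M) {ε : ℝ} (hε : 0 < ε)
    (x : Rd d) (ω : Ω) : gradConv 1 (fun x => scaledField V ε x ω) x
      = average (gradK (ε ^ 2) : Rd d → Rd d) V ((-(ε⁻¹ • x)) +ᵥ ω) := by
  have hg : Integrable (gradK (ε ^ 2) : Rd d → Rd d) := integrable_gradK (by positivity)
  ext j
  rw [average_apply (integrable_average hV hM hg _)]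
  have h : ∀ y : Rd d, gradK 1 (ε • y) j * ε ^ d = ε * gradK (ε ^ 2) y j := fun y => by
    have := congrArg (fun v : Rd d => v j) (gradK_scale hε y)
    simpa [mul_comm] using this
  have := conv_scaledField (V := V) hε (K := fun z => gradK 1 z j)
    (K' := fun z => gradK (ε ^ 2) z j) h x ω
  rw [inv_mul_cancel₀ hε.ne', one_mul] at this
  exact this

lemma gradConv_field (hV : Measurable V) (hM : ∀ ω, |V ω| ≤ M) {lam : ℝ} (hl : 0 < lam)
    (y : Rd d) (ω : Ω) : gradConv lam (fun y => field V y ω) y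
      = average (gradK lam : Rd d → Rd d) V ((-y) +ᵥ ω) := by
  ext j
  rw [average_apply (integrable_average hV hM (integrable_gradK hl) _)]
  exact conv_field _ y ω

lemma measurable_scaledField (hV : Measurable V) (ε : ℝ) :
    Measurable fun q : Rd d × Ω => scaledField V ε q.1 q.2 :=
  ((measurable_field hV).comp ((measurable_fst.const_smul ε⁻¹).prodMk measurable_snd)).const_mul _

variable {P : Measure Ω} [IsProbabilityMeasure P] [VAddInvariantMeasure (Rd d) Ω P]

/-- The norm of the product of a deterministic function and a stationary field. -/
lemma lintegral_prod_mul_stationary {a : Rd d → ℝ≥0∞} {μ : Measure (Rd d)} [SFinite μ]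
    (ha : AEMeasurable a μ) {Y : Ω → ℝ≥0∞} (hY : Measurable Y) (c : ℝ) :
    ∫⁻ q, a q.1 * Y ((-(c • q.1)) +ᵥ q.2) ∂(μ.prod P) = (∫⁻ x, a x ∂μ) * ∫⁻ ω, Y ω ∂P := by
  have hYm : Measurable fun q : Rd d × Ω => Y ((-(c • q.1)) +ᵥ q.2) :=
    hY.comp ((measurable_fst.const_smul c).neg.vadd measurable_snd)
  have hm : AEMeasurable (fun q : Rd d × Ω => a q.1 * Y ((-(c • q.1)) +ᵥ q.2)) (μ.prod P) :=
    (ha.comp_quasiMeasurePreserving Measure.quasiMeasurePreserving_fst).mul hYm.aemeasurable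
  rw [lintegral_prod _ hm, ← lintegral_mul_const'' _ ha]
  refine lintegral_congr fun x => ?_
  have hYx : Measurable fun ω => Y ((-(c • x)) +ᵥ ω) := hYm.comp measurable_prodMk_left
  dsimp only
  rw [lintegral_const_mul _ hYx, lintegral_vadd_eq (-(c • x)) Y]

end Rescaling

/-! ### The energy of an oscillating stationary field -/

section OscillatingEnergy

variable {d : ℕ} {Ω : Type*} [AddAction (Rd d) Ω] [MeasurableSpace Ω] [MeasurableVAdd₂ (Rd d) Ω]
  {P : Measure Ω} [IsProbabilityMeasure P] [VAddInvariantMeasure (Rd d) Ω P]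

lemma lintegral_enorm_mul_translate_le {u : Rd d → ℂ} (hu : AEStronglyMeasurable u volume)
    (z : Rd d) : ∫⁻ x, ‖u x‖ₑ * ‖u (x - z)‖ₑ ≤ ∫⁻ x, ‖u x‖ₑ ^ 2 := by
  have hz : AEStronglyMeasurable (fun x => u (x - z)) volume :=
    hu.comp_measurePreserving (measurePreserving_sub_right volume z)
  have h := sq_lintegral_mul_le hu.enorm hz.enorm
  rw [lintegral_sub_right_eq_self (fun x => ‖u x‖ₑ ^ 2) z, ← sq] at h
  exact (ENNReal.pow_le_pow_left_iff two_ne_zero).1 h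

/-- The mean of the quadratic form of a kernel `K` at `Q(c x) u(x)`, with `Q` stationary, is
`∬ K(z) 𝔼[Q(0) Q(c z)] u(x) conj (u(x - z))`. -/
lemma integrable_energy_and_enorm_le {Q : Ω → ℝ} (hQ : Measurable Q) {C : ℝ}
    (hC : ∀ ω, |Q ω| ≤ C) {K : Rd d → ℝ} (hK : Integrable K) {u : Rd d → ℂ}
    (hu : MemLp u 2 volume) (c : ℝ) {F : Ω → Rd d → ℂ}
    (hF : F = fun ω x => (field Q (c • x) ω : ℂ) * u x) :
    Integrable (fun ω => ∫ x, F ω x * conj (conv K (F ω) x)) P ∧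
    ‖∫ ω, (∫ x, F ω x * conj (conv K (F ω) x)) ∂P‖ₑ
      ≤ (∫⁻ z, ‖K z‖ₑ * ‖correlation P Q (c • z)‖ₑ) * ∫⁻ x, ‖u x‖ₑ ^ 2 := by
  set b : Rd d × Rd d → ℂ := fun q => (K q.2 : ℂ) * (u q.1 * conj (u (q.1 - q.2))) with hb
  have hbi : Integrable b (volume.prod volume) := by
    have := integrable_kernel_mul_translate (L := fun z : Rd d => -z) measurable_neg hK hu hu.star
    refine this.congr (Eventually.of_forall fun q => ?_)
    simp [hb, sub_eq_add_neg]
  set a : Ω → Rd d × Rd d → ℝ := fun ω q => field Q (c • q.1) ω * field Q (c • (q.1 - q.2)) ω with ha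
  have hfQ := measurable_field (d := d) hQ
  have ham : Measurable (Function.uncurry a) :=
    (hfQ.comp (by fun_prop : Measurable fun r : Ω × (Rd d × Rd d) => (c • r.2.1, r.1))).mul
      (hfQ.comp (by fun_prop : Measurable fun r : Ω × (Rd d × Rd d) => (c • (r.2.1 - r.2.2), r.1)))
  have haC : ∀ ω q, ‖(a ω q : ℂ)‖ ≤ C * C := fun ω q => by
    rw [Complex.norm_real, norm_mul]
    exact mul_le_mul (hC _) (hC _) (norm_nonneg _) ((abs_nonneg _).trans (hC ω))
  have hHi : Integrable (Function.uncurry fun ω q => (a ω q : ℂ) * b q)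
      (P.prod (volume.prod volume)) :=
    (hbi.comp_snd P).bdd_mul (c := C * C)
      (Complex.measurable_ofReal.comp ham).aestronglyMeasurable
      (Eventually.of_forall fun r => haC _ _)
  have hωi : ∀ ω, Integrable (fun q => (a ω q : ℂ) * b q) (volume.prod volume) := fun ω =>
    hbi.bdd_mul (c := C * C)
      (Complex.measurable_ofReal.comp (ham.comp measurable_prodMk_left)).aestronglyMeasurable
      (Eventually.of_forall fun r => haC _ _)
  have h1 : ∀ ω, ∫ q, (a ω q : ℂ) * b q ∂(volume.prod volume)
      = ∫ x, F ω x * conj (conv K (F ω) x) := fun ω => by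
    rw [integral_prod _ (hωi ω)]
    refine integral_congr_ae (Eventually.of_forall fun x => ?_)
    dsimp only
    rw [conv, ← integral_conj, ← integral_const_mul]
    refine integral_congr_ae (Eventually.of_forall fun z => ?_)
    simp only [hF, ha, hb, Complex.real_smul, map_mul, Complex.conj_ofReal]
    push_cast; ring
  have h2 : ∀ q : Rd d × Rd d, ∫ ω, (a ω q : ℂ) * b q ∂P
      = (correlation P Q (c • q.2) : ℂ) * b q := fun q => by
    rw [integral_mul_const, integral_complex_ofReal, integral_field_mul_field, ← smul_sub,
      sub_sub_cancel]
  have hint := hHi.integral_prod_left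
  simp only [Function.uncurry, h1] at hint
  refine ⟨hint, ?_⟩
  have h3 := integral_integral_swap hHi
  simp only [h1, h2] at h3
  rw [h3]
  refine (enorm_integral_le_lintegral_enorm _).trans ?_
  have hcm : AEMeasurable (fun q : Rd d × Rd d => ‖(correlation P Q (c • q.2) : ℂ) * b q‖ₑ)
      (volume.prod volume) := by
    have h4 : Measurable fun q : Rd d × Rd d => correlation P Q (c • q.2) :=
      (stronglyMeasurable_correlation hQ).measurable.comp (measurable_snd.const_smul c)
    exact ((Complex.measurable_ofReal.comp h4).aestronglyMeasurable.mul hbi.1).enorm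
  rw [lintegral_prod_symm _ hcm]
  calc _ ≤ ∫⁻ z, ‖K z‖ₑ * ‖correlation P Q (c • z)‖ₑ * ∫⁻ x, ‖u x‖ₑ ^ 2 := by
        refine lintegral_mono fun z => ?_
        refine le_trans ?_ (mul_le_mul_right (lintegral_enorm_mul_translate_le hu.1 z) _)
        rw [← lintegral_const_mul' _ _ (ENNReal.mul_ne_top enorm_ne_top enorm_ne_top)]
        refine lintegral_mono fun x => le_of_eq ?_
        simp only [hb, enorm_mul, RCLike.enorm_conj]
        rw [← ofReal_norm (correlation P Q (c • z) : ℂ), ← ofReal_norm (K z : ℂ), Complex.norm_real,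
          Complex.norm_real, ofReal_norm, ofReal_norm]
        ring
    _ = _ := by
        refine lintegral_mul_const'' _ ?_
        have h4 : Measurable fun z : Rd d => correlation P Q (c • z) :=
          (stronglyMeasurable_correlation hQ).measurable.comp (measurable_id.const_smul c)
        exact hK.1.enorm.mul h4.enorm.aemeasurable

end OscillatingEnergy

/-! ### Rates for the moments of the correctors -/

section MomentBounds

variable {d : ℕ} {Ω : Type*} [AddAction (Rd d) Ω] {V : Ω → ℝ}
  [MeasurableSpace Ω] [MeasurableVAdd₂ (Rd d) Ω] {P : Measure Ω}
  [IsProbabilityMeasure P] [VAddInvariantMeasure (Rd d) Ω P] {M : ℝ}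

/-- The four error terms at scale `ε` are bounded by `κ (rate d ε)²`: the second moment of the
corrector, the defect of the homogenized potential, the energy of the fluctuations and the second
moment of the defect of the gradient of the corrector. -/
structure MomentBounds (d : ℕ) {Ω : Type*} [AddAction (Rd d) Ω] [MeasurableSpace Ω]
    (P : Measure Ω) (V : Ω → ℝ) (κ : ℝ≥0∞) (ε : ℝ) : Prop where
  corrector : ENNReal.ofReal (ε ^ 2) * ∫⁻ ω, ‖average (resK (ε ^ 2) : Rd d → ℝ) V ω‖ₑ ^ 2 ∂P
    ≤ κ * ENNReal.ofReal (rate d ε) ^ 2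
  mean : ENNReal.ofReal ((homogenizedPotential d P V
    - ∫ ω, V ω * average (resK (ε ^ 2) : Rd d → ℝ) V ω ∂P) ^ 2)
    ≤ κ * ENNReal.ofReal (rate d ε) ^ 2
  fluctuation : ∫⁻ z : Rd d, ‖resK 1 z‖ₑ * ‖correlation P (fluctuation d P V (ε ^ 2)) (ε⁻¹ • z)‖ₑ
    ≤ κ * ENNReal.ofReal (rate d ε) ^ 2
  gradient : ∫⁻ ω, ‖average (gradK (ε ^ 2) : Rd d → Rd d) V ω + limitGradient d V ω‖ₑ ^ 2 ∂P
    ≤ κ * ENNReal.ofReal (rate d ε) ^ 2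

lemma lintegral_resK_comp_smul {c : Rd d → ℝ≥0∞} (hc : Measurable c) {ε : ℝ} (hε : 0 < ε) :
    ∫⁻ z, ‖resK 1 z‖ₑ * c (ε⁻¹ • z)
      = ENNReal.ofReal (ε ^ 2) * ∫⁻ y, ENNReal.ofReal (resK (ε ^ 2) y) * c y := by
  have hm : Measurable fun z : Rd d => ‖resK 1 z‖ₑ * c (ε⁻¹ • z) :=
    (measurable_resK 1).enorm.mul (hc.comp (measurable_const_smul _))
  rw [lintegral_eq_comp_smul hm hε, ← lintegral_const_mul' _ _ ENNReal.ofReal_ne_top,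
    ← lintegral_const_mul' _ _ ENNReal.ofReal_ne_top]
  refine lintegral_congr fun y => ?_
  rw [smul_smul, inv_mul_cancel₀ hε.ne', one_smul, ← mul_assoc, ← mul_assoc,
    Real.enorm_of_nonneg (resK_nonneg _ _), ← ENNReal.ofReal_mul (by positivity),
    ← ENNReal.ofReal_mul (by positivity), mul_comm (ε ^ d), resK_scale hε]

/-- An integrable function has a measurable majorant with finite integral. It replaces
`x ↦ η ‖x‖`, which need not be Borel measurable. -/
lemma exists_measurable_majorant {η : Rd d → ℝ} (hη : Integrable η) :
    ∃ e : Rd d → ℝ≥0∞, Measurable e ∧ (∀ x, ENNReal.ofReal (η x) ≤ e x) ∧ ∫⁻ x, e x ≠ ⊤ := by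
  obtain ⟨e, h1, h2, h3⟩ := exists_lt_lowerSemicontinuous_lintegral_ge_of_aemeasurable
    (μ := (volume : Measure (Rd d))) (fun x => (η x).toNNReal) hη.1.aemeasurable.real_toNNReal
    (ε := 1) one_ne_zero
  refine ⟨e, h2.measurable, fun x => (h1 x).le, (h3.trans_lt ?_).ne⟩
  refine ENNReal.add_lt_top.2 ⟨?_, ENNReal.one_lt_top⟩
  exact hη.lintegral_lt_top

lemma exists_momentBounds (hd : 3 ≤ d) (hV : Measurable V) (hM : ∀ ω, |V ω| ≤ M)
    (hR : Integrable (fun x : Rd d => correlation P V x) volume)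
    {η : ℝ → ℝ} (hη0 : ∀ r, 0 ≤ r → 0 ≤ η r) (hη : Integrable (fun x : Rd d => η ‖x‖) volume)
    (h4 : ∀ x₁ x₂ x₃ x₄ : Rd d,
      |(∫ ω, field V x₁ ω * field V x₂ ω * field V x₃ ω * field V x₄ ω ∂P)
          - correlation P V (x₁ - x₂) * correlation P V (x₃ - x₄)|
        ≤ η ‖x₁ - x₃‖ * η ‖x₂ - x₄‖ + η ‖x₁ - x₄‖ * η ‖x₂ - x₃‖) :
    ∃ κ : ℝ≥0∞, κ ≠ ⊤ ∧ ∀ ε : ℝ, 0 < ε → ε ≤ 1 / 2 → MomentBounds d P V κ ε := by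
  obtain ⟨e, hem, he, hei⟩ := exists_measurable_majorant hη
  obtain ⟨CT, hCT, hT⟩ := exists_timeMass_le hd
  obtain ⟨CD, hCD, hD⟩ := exists_integral_decay_le hd
  obtain ⟨CG, hCG, hG⟩ := exists_integral_gradWeight_le hd
  set B := ENNReal.ofReal (corrBound d P V M) with hB
  set K := ENNReal.ofReal (2 * M ^ 4) with hK
  set κ₁ := 2 * B * ENNReal.ofReal CT with hκ₁
  set κ₂ := ENNReal.ofReal ((2 * (corrBound d P V M * CD)) ^ 2) with hκ₂
  set c₃ := max (ENNReal.ofReal (M ^ 2) * (2 * B)) (2 * covBound K (∫⁻ x, e x)) with hc₃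
  set κ₃ := (∫⁻ t in Set.Ioi (0 : ℝ), ENNReal.ofReal (decay d t)) * c₃ * ENNReal.ofReal CT with hκ₃
  set κ₄ := ENNReal.ofReal ((gradBound d P V M * CG) ^ 2) with hκ₄
  have hDtop : ∫⁻ t in Set.Ioi (0 : ℝ), ENNReal.ofReal (decay d t) ≠ ⊤ :=
    (integrableOn_decay hd).lintegral_lt_top.ne
  have hcov : covBound K (∫⁻ x, e x) ≠ ⊤ := by
    refine (max_lt ?_ ?_).ne
    · exact ENNReal.mul_lt_top (by simp) (ENNReal.mul_lt_top (ENNReal.add_lt_top.2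
        ⟨ENNReal.one_lt_top, ENNReal.ofReal_lt_top⟩)
        (ENNReal.mul_lt_top (by simp) hei.lt_top))
    · exact ENNReal.mul_lt_top (by simp) (ENNReal.pow_lt_top hei.lt_top)
  have hc₃top : c₃ ≠ ⊤ := (max_lt (ENNReal.mul_lt_top (by simp) (ENNReal.mul_lt_top (by simp)
    (by simp [hB]))) (ENNReal.mul_lt_top (by simp) hcov.lt_top)).ne
  have ht₁ : κ₁ ≠ ⊤ := ENNReal.mul_ne_top (ENNReal.mul_ne_top (by simp) (by simp [hB])) (by simp)
  have ht₃ : κ₃ ≠ ⊤ := ENNReal.mul_ne_top (ENNReal.mul_ne_top hDtop hc₃top) (by simp)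
  refine ⟨κ₁ + κ₂ + κ₃ + κ₄, ?_, fun ε hε hε2 => ?_⟩
  · simp only [ne_eq, ENNReal.add_eq_top, not_or]
    exact ⟨⟨⟨ht₁, ENNReal.ofReal_ne_top⟩, ht₃⟩, ENNReal.ofReal_ne_top⟩
  have hl : 0 < ε ^ 2 := by positivity
  have hr := rate_nonneg (d := d) hε.le
  have hT' : ENNReal.ofReal (ε ^ 2) * timeMass d (ε ^ 2)
      ≤ ENNReal.ofReal CT * ENNReal.ofReal (rate d ε) ^ 2 := by
    rw [← ENNReal.ofReal_pow hr, ← ENNReal.ofReal_mul hCT]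
    exact hT ε hε hε2
  have hle : ∀ {a κ' : ℝ≥0∞}, a ≤ κ' * ENNReal.ofReal (rate d ε) ^ 2 → κ' ≤ κ₁ + κ₂ + κ₃ + κ₄ →
      a ≤ (κ₁ + κ₂ + κ₃ + κ₄) * ENNReal.ofReal (rate d ε) ^ 2 := fun h h' =>
    h.trans (mul_le_mul_left h' _)
  have hpow : ∀ {a C : ℝ}, 0 ≤ C → |a| ≤ C * rate d ε →
      ENNReal.ofReal (a ^ 2) ≤ ENNReal.ofReal (C ^ 2) * ENNReal.ofReal (rate d ε) ^ 2 :=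
    fun {a C} hC h => by
      rw [← ENNReal.ofReal_pow hr, ← ENNReal.ofReal_mul (by positivity), ← mul_pow, ← sq_abs]
      exact ENNReal.ofReal_le_ofReal (pow_le_pow_left₀ (abs_nonneg _) h 2)
  have hfm : Measurable fun z : Rd d => ‖correlation P (RandomPotential.fluctuation d P V (ε ^ 2)) z‖ₑ :=
    (stronglyMeasurable_correlation (measurable_fluctuation hV _)).enorm
  refine ⟨hle (κ' := κ₁) ?_ ?_, hle (κ' := κ₂) ?_ ?_, hle (κ' := κ₃) ?_ ?_, hle (κ' := κ₄) ?_ ?_⟩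
  · calc _ ≤ ENNReal.ofReal (ε ^ 2) * (2 * B * timeMass d (ε ^ 2)) :=
          mul_le_mul_right (lintegral_enorm_sq_average_resK_le hV hM hR hl) _
      _ = 2 * B * (ENNReal.ofReal (ε ^ 2) * timeMass d (ε ^ 2)) := by ring
      _ ≤ 2 * B * (ENNReal.ofReal CT * ENNReal.ofReal (rate d ε) ^ 2) := mul_le_mul_right hT' _
      _ = _ := by rw [hκ₁]; ring
  · rw [add_assoc, add_assoc]; exact le_self_add
  · refine hpow (by have := corrBound_nonneg (d := d) (P := P) (V := V) (M := M); positivity)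
      ((abs_homogenizedPotential_sub_le hd hV hM hR hl).trans ?_)
    have hB0 := corrBound_nonneg (d := d) (P := P) (V := V) (M := M)
    calc _ ≤ corrBound d P V M * (CD * ε) := mul_le_mul_of_nonneg_left (hD ε hε) hB0
      _ ≤ corrBound d P V M * (CD * (2 * rate d ε)) := by
          gcongr; exact le_two_mul_rate hε hε2
      _ = _ := by ring
  · exact (le_add_self.trans le_self_add).trans le_self_add
  · rw [lintegral_resK_comp_smul hfm hε]
    have h1 := lintegral_resK_mul_le (d := d) hl.le hfm (B := c₃ * timeMass d (ε ^ 2))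
      (A := c₃ * timeMass d (ε ^ 2))
      (fun z => (enorm_correlation_fluctuation_le hV hM hR hl z).trans (by
        rw [← mul_assoc]
        exact mul_le_mul_left (le_max_left _ _) _))
      ((lintegral_correlation_fluctuation_le hV hM hη0 h4 hem he hl).trans
        (mul_le_mul_left (le_max_right _ _) _))
    rw [max_self] at h1
    calc _ ≤ ENNReal.ofReal (ε ^ 2) * ((∫⁻ t in Set.Ioi (0 : ℝ), ENNReal.ofReal (decay d t)) *
          (c₃ * timeMass d (ε ^ 2))) := mul_le_mul_right h1 _
      _ = (∫⁻ t in Set.Ioi (0 : ℝ), ENNReal.ofReal (decay d t)) * c₃ *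
          (ENNReal.ofReal (ε ^ 2) * timeMass d (ε ^ 2)) := by ring
      _ ≤ (∫⁻ t in Set.Ioi (0 : ℝ), ENNReal.ofReal (decay d t)) * c₃ *
          (ENNReal.ofReal CT * ENNReal.ofReal (rate d ε) ^ 2) := mul_le_mul_right hT' _
      _ = _ := by rw [hκ₃]; ring
  · rw [add_assoc, add_comm _ (κ₃ + κ₄), add_assoc]; exact le_self_add
  · refine (lintegral_enorm_sq_average_gradK_add_le hd hV hM hR hl).trans ?_
    have h0 : 0 ≤ ∫ t in Set.Ioi (0 : ℝ), (1 - Real.exp (-ε ^ 2 * t)) * gradWeight d t :=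
      setIntegral_nonneg measurableSet_Ioi fun t ht =>
        mul_nonneg (one_sub_exp_nonneg hl.le (le_of_lt ht)) (gradWeight_nonneg (le_of_lt ht))
    have hg0 := (gradBound_pos (d := d) (P := P) (V := V) (M := M)).le
    rw [← ENNReal.ofReal_pow (by positivity)]
    refine hpow (by positivity) ?_
    rw [abs_of_nonneg (by positivity), mul_assoc]
    exact mul_le_mul_of_nonneg_left (hG ε hε hε2) hg0
  · exact le_add_self

end MomentBounds

/-! ### The expected energy of the remainder -/

section ExpectedEnergy

variable {d : ℕ} {Ω : Type*} [AddAction (Rd d) Ω] {V : Ω → ℝ}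
  [MeasurableSpace Ω] [MeasurableVAdd₂ (Rd d) Ω] {P : Measure Ω}
  [IsProbabilityMeasure P] [VAddInvariantMeasure (Rd d) Ω P] {M : ℝ}

lemma lintegral_enorm_sq_eq {X E : Type*} [MeasurableSpace X] {μ : Measure X}
    [NormedAddCommGroup E] {f : X → E} (hf : MemLp f 2 μ) :
    ∫⁻ x, ‖f x‖ₑ ^ 2 ∂μ = ENNReal.ofReal (∫ x, ‖f x‖ ^ 2 ∂μ) := by
  rw [ofReal_integral_eq_lintegral_ofReal hf.norm.integrable_sq
    (Eventually.of_forall fun x => by positivity)]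
  refine lintegral_congr fun x => ?_
  rw [ENNReal.ofReal_pow (norm_nonneg _), ofReal_norm]

lemma lintegral_const_add_add_add {a : ℝ≥0∞} {b c e : Ω → ℝ≥0∞} (hb : AEMeasurable b P)
    (hc : AEMeasurable c P) :
    ∫⁻ ω, (a + b ω + c ω + e ω) ∂P
      = a + (∫⁻ ω, b ω ∂P) + (∫⁻ ω, c ω ∂P) + ∫⁻ ω, e ω ∂P := by
  have h1 : AEMeasurable (fun ω => a + b ω) P := hb.const_add a
  have h2 : AEMeasurable (fun ω => a + b ω + c ω) P := h1.add hc
  rw [lintegral_add_left' h2, lintegral_add_left' h1, lintegral_add_left' aemeasurable_const,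
    lintegral_const, measure_univ, mul_one]

/-- The gradient of the corrector in the slow variable. -/
def gradCorrector (V : Ω → ℝ) (ε : ℝ) (x : Rd d) (ω : Ω) : Rd d :=
  -gradConv 1 (fun x => scaledField V ε x ω) x

/-- The remainder `u_ε - u + i ψ_ε u` of the first order expansion. -/
def remainder (V : Ω → ℝ) (ε : ℝ) (u : Rd d → ℂ) (uε : Rd d → Ω → ℂ) (x : Rd d) (ω : Ω) : ℂ :=
  uε x ω - u x + Complex.I * ((corrector V ε x ω : ℝ) * u x)

/-- The gradient of the remainder of the first order expansion. -/
def gradRemainder (V : Ω → ℝ) (ε : ℝ) (u : Rd d → ℂ) (g : Rd d → EuclideanSpace ℂ (Fin d))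
    (gε : Rd d → Ω → EuclideanSpace ℂ (Fin d)) (x : Rd d) (ω : Ω) : EuclideanSpace ℂ (Fin d) :=
  gε x ω - g x + Complex.I • ((corrector V ε x ω : ℂ) • g x +
    u x • toComplexVec (gradCorrector V ε x ω))

lemma isBoundedCorrector_corrector (hV : Measurable V) (hM : ∀ ω, |V ω| ≤ M) (ε : ℝ) (ω : Ω) :
    IsBoundedCorrector 1 (fun x => scaledField V ε x ω) (fun x : Rd d => corrector V ε x ω)
      (fun x => gradCorrector V ε x ω) := by
  simp only [corrector_eq_conv]
  refine isBoundedCorrector_conv one_pos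
    ((measurable_scaledField hV ε).comp measurable_prodMk_right) (C := |ε⁻¹| * M) fun x => ?_
  rw [scaledField, norm_mul, Real.norm_eq_abs]
  exact mul_le_mul_of_nonneg_left (hM _) (abs_nonneg _)

lemma measurable_corrector (hV : Measurable V) (ε : ℝ) :
    Measurable fun q : Rd d × Ω => corrector V ε q.1 q.2 := by
  simp only [corrector_eq_conv]
  exact (stronglyMeasurable_conv_prod (F := fun q : Rd d × Ω => scaledField V ε q.1 q.2)
    (measurable_resK 1) (measurable_scaledField hV ε)).measurable.neg

omit [AddAction (Rd d) Ω] [MeasurableVAdd₂ (Rd d) Ω] in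
lemma measurable_gradConv_prod {F : Rd d × Ω → ℝ} (hF : Measurable F) (lam : ℝ) :
    Measurable fun q : Rd d × Ω => gradConv lam (fun x => F (x, q.2)) q.1 := by
  have h : Measurable fun q : Rd d × Ω => fun j : Fin d =>
      conv (fun z => gradK lam z j) (fun x => F (x, q.2)) q.1 :=
    measurable_pi_lambda _ fun j =>
      (stronglyMeasurable_conv_prod (measurable_gradK_apply lam j) hF).measurable
  exact (PiLp.continuous_toLp 2 _).measurable.comp h

lemma measurable_gradCorrector (hV : Measurable V) (ε : ℝ) :
    Measurable fun q : Rd d × Ω => gradCorrector V ε q.1 q.2 :=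
  (measurable_gradConv_prod (measurable_scaledField hV ε) 1).neg

omit [IsProbabilityMeasure P] [VAddInvariantMeasure (Rd d) Ω P] in
lemma aestronglyMeasurable_remainder (hV : Measurable V) (ε : ℝ) {u : Rd d → ℂ}
    (hu : AEStronglyMeasurable u volume) {uε : Rd d → Ω → ℂ}
    (hε : AEStronglyMeasurable (fun p : Rd d × Ω => uε p.1 p.2) (volume.prod P)) :
    AEStronglyMeasurable (fun p : Rd d × Ω => remainder V ε u uε p.1 p.2) (volume.prod P) := by
  have h1 : AEStronglyMeasurable (fun p : Rd d × Ω => u p.1) (volume.prod P) := hu.comp_fst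
  have h2 : AEStronglyMeasurable (fun p : Rd d × Ω => ((corrector V ε p.1 p.2 : ℝ) : ℂ))
      (volume.prod P) :=
    (Complex.measurable_ofReal.comp (measurable_corrector hV ε)).aestronglyMeasurable
  exact (hε.sub h1).add ((h2.mul h1).const_mul _)

omit [IsProbabilityMeasure P] [VAddInvariantMeasure (Rd d) Ω P] in
lemma aestronglyMeasurable_gradRemainder (hV : Measurable V) (ε : ℝ) {u : Rd d → ℂ}
    (hu : AEStronglyMeasurable u volume) {g : Rd d → EuclideanSpace ℂ (Fin d)}
    (hg : AEStronglyMeasurable g volume) {gε : Rd d → Ω → EuclideanSpace ℂ (Fin d)}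
    (hε : AEStronglyMeasurable (fun p : Rd d × Ω => gε p.1 p.2) (volume.prod P)) :
    AEStronglyMeasurable (fun p : Rd d × Ω => gradRemainder V ε u g gε p.1 p.2)
      (volume.prod P) := by
  have h1 : AEStronglyMeasurable (fun p : Rd d × Ω => u p.1) (volume.prod P) := hu.comp_fst
  have h1' : AEStronglyMeasurable (fun p : Rd d × Ω => g p.1) (volume.prod P) := hg.comp_fst
  have h2 : AEStronglyMeasurable (fun p : Rd d × Ω => ((corrector V ε p.1 p.2 : ℝ) : ℂ))
      (volume.prod P) :=
    (Complex.measurable_ofReal.comp (measurable_corrector hV ε)).aestronglyMeasurable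
  have h3 : AEStronglyMeasurable (fun p : Rd d × Ω => toComplexVec (gradCorrector V ε p.1 p.2))
      (volume.prod P) :=
    (continuous_toComplexVec.measurable.comp (measurable_gradCorrector hV ε)).aestronglyMeasurable
  exact (hε.sub h1').add (((h2.smul h1').add (h1.smul h3)).const_smul Complex.I)

/-- The second moment of the corrector against a deterministic function. -/
lemma lintegral_corrector_mul {ε : ℝ} (hε : 0 < ε) (hV : Measurable V) {a : Rd d → ℝ≥0∞}
    (ha : AEMeasurable a volume) :
    ∫⁻ q : Rd d × Ω, a q.1 * ‖corrector V ε q.1 q.2‖ₑ ^ 2 ∂(volume.prod P) = (∫⁻ x, a x) *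
      (ENNReal.ofReal (ε ^ 2) * ∫⁻ ω, ‖average (resK (ε ^ 2) : Rd d → ℝ) V ω‖ₑ ^ 2 ∂P) := by
  rw [← lintegral_const_mul' _ _ ENNReal.ofReal_ne_top, ← lintegral_prod_mul_stationary ha
    (((measurable_average_resK hV (ε ^ 2)).enorm.pow_const 2).const_mul _) ε⁻¹]
  refine lintegral_congr fun q => ?_
  rw [corrector_eq_average hε, enorm_neg, enorm_mul, mul_pow, Real.enorm_of_nonneg hε.le,
    ENNReal.ofReal_pow hε.le]

/-- The expected energy of the remainder is bounded by the four error terms. -/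
theorem lintegral_remainder_le (hV : Measurable V) (hM : ∀ ω, |V ω| ≤ M) {ε : ℝ} (hε : 0 < ε)
    {ρ : ℝ} {f u : Rd d → ℂ} (hf : MemLp f 2 volume) {g : Rd d → EuclideanSpace ℂ (Fin d)}
    (hu : IsWeakSolution (fun _ => 1 + (ρ : ℂ)) f u g) {uε : Rd d → Ω → ℂ}
    {gε : Rd d → Ω → EuclideanSpace ℂ (Fin d)} (huε : IsRandomSolution P V ε f uε gε) :
    (∫⁻ q : Rd d × Ω, ‖remainder V ε u uε q.1 q.2‖ₑ ^ 2 ∂(volume.prod P))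
      + ∫⁻ q : Rd d × Ω, ‖gradRemainder V ε u g gε q.1 q.2‖ₑ ^ 2 ∂(volume.prod P)
    ≤ ENNReal.ofReal 8 *
      (ENNReal.ofReal ((ρ - ∫ ω, V ω * average (resK (ε ^ 2) : Rd d → ℝ) V ω ∂P) ^ 2)
          * (∫⁻ x, ‖u x‖ₑ ^ 2)
        + (∫⁻ z : Rd d, ‖resK 1 z‖ₑ * ‖correlation P (fluctuation d P V (ε ^ 2)) (ε⁻¹ • z)‖ₑ)
          * (∫⁻ x, ‖u x‖ₑ ^ 2)
        + (∫⁻ x, ‖g x‖ₑ ^ 2) *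
          (ENNReal.ofReal (ε ^ 2) * ∫⁻ ω, ‖average (resK (ε ^ 2) : Rd d → ℝ) V ω‖ₑ ^ 2 ∂P)
        + (∫⁻ x, ‖f x - (1 + (ρ : ℂ)) * u x‖ₑ ^ 2) *
          (ENNReal.ofReal (ε ^ 2) * ∫⁻ ω, ‖average (resK (ε ^ 2) : Rd d → ℝ) V ω‖ₑ ^ 2 ∂P)) := by
  have hl : 0 < ε ^ 2 := by positivity
  set μ := ∫ ω, V ω * average (resK (ε ^ 2) : Rd d → ℝ) V ω ∂P with hμ
  set F : Ω → Rd d → ℂ := fun ω x => (field (fluctuation d P V (ε ^ 2)) (ε⁻¹ • x) ω : ℂ) * u x with hF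
  -- `V_ε ψ_ε` is minus `V Φ` in the fast variable, so that its mean is `-μ`
  have hFW : ∀ ω, F ω = fun x =>
      ((scaledField V ε x ω * corrector V ε x ω - -μ : ℝ) : ℂ) * u x := fun ω => by
    ext x
    simp only [hF]
    congr 2
    rw [corrector_eq_average hε, scaledField, field, field, fluctuation]
    field_simp
    ring
  obtain ⟨C, hC⟩ := exists_abs_fluctuation_le (d := d) (P := P) hM hl
  obtain ⟨hT2, hT2le⟩ := integrable_energy_and_enorm_le (P := P) (measurable_fluctuation hV (ε ^ 2))
    hC (integrable_resK one_pos) hu.memH1.memLp ε⁻¹ hF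
  have hh : MemLp (fun x => f x - (1 + (ρ : ℂ)) * u x) 2 volume :=
    hf.sub (hu.memH1.memLp.const_mul _)
  have hwm := aestronglyMeasurable_remainder hV ε hu.memH1.memLp.1 huε.aestronglyMeasurable
  have hgwm := aestronglyMeasurable_gradRemainder hV ε hu.memH1.memLp.1 hu.memH1.memLp_grad.1
    huε.aestronglyMeasurable_grad
  have hcm := measurable_corrector (d := d) hV ε
  have hgm : AEMeasurable (fun q : Rd d × Ω => ‖g q.1‖ₑ ^ 2 * ‖corrector V ε q.1 q.2‖ₑ ^ 2)
      (volume.prod P) :=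
    ((hu.memH1.memLp_grad.1.comp_fst.enorm).pow_const 2).mul (hcm.enorm.pow_const 2).aemeasurable
  have hhm : AEMeasurable (fun q : Rd d × Ω =>
      ‖f q.1 - (1 + (ρ : ℂ)) * u q.1‖ₑ ^ 2 * ‖corrector V ε q.1 q.2‖ₑ ^ 2) (volume.prod P) :=
    ((hh.1.comp_fst.enorm).pow_const 2).mul (hcm.enorm.pow_const 2).aemeasurable
  -- the deterministic energy estimate, for almost every `ω`
  have hω : ∀ᵐ ω ∂P, ∫⁻ x, (‖remainder V ε u uε x ω‖ₑ ^ 2 + ‖gradRemainder V ε u g gε x ω‖ₑ ^ 2)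
      ≤ ENNReal.ofReal 8 * (ENNReal.ofReal ((ρ - μ) ^ 2) * (∫⁻ x, ‖u x‖ₑ ^ 2)
        + ENNReal.ofReal (∫ x, F ω x * conj (conv (resK 1) (F ω) x)).re
        + (∫⁻ x, ‖g x‖ₑ ^ 2 * ‖corrector V ε x ω‖ₑ ^ 2)
        + ∫⁻ x, ‖f x - (1 + (ρ : ℂ)) * u x‖ₑ ^ 2 * ‖corrector V ε x ω‖ₑ ^ 2) := by
    filter_upwards [huε.weakSolution] with ω hsol
    have hψ := isBoundedCorrector_corrector (d := d) hV hM ε ω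
    have hH := memH1_remainder hψ hsol.memH1 hu.memH1
    have hle := remainder_energy_le hψ hf hu hsol rfl rfl (-μ) (hFW ω)
    have iψg := integrable_sq_norm_corrector_mul_vec hψ hu.memH1.memLp_grad
    have iψh := integrable_sq_norm_corrector_mul hψ hh
    have e1 : ∫⁻ x, ‖g x‖ₑ ^ 2 * ‖corrector V ε x ω‖ₑ ^ 2
        = ENNReal.ofReal (∫ x, corrector V ε x ω ^ 2 * ‖g x‖ ^ 2) := by
      rw [ofReal_integral_eq_lintegral_ofReal iψg (Eventually.of_forall fun x => by positivity)]
      refine lintegral_congr fun x => ?_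
      rw [ENNReal.ofReal_mul (sq_nonneg _), ENNReal.ofReal_pow (norm_nonneg _), ofReal_norm,
        ← sq_abs, ENNReal.ofReal_pow (abs_nonneg _), ← Real.norm_eq_abs, ofReal_norm, mul_comm]
    have e2 : ∫⁻ x, ‖f x - (1 + (ρ : ℂ)) * u x‖ₑ ^ 2 * ‖corrector V ε x ω‖ₑ ^ 2
        = ENNReal.ofReal (∫ x, corrector V ε x ω ^ 2 * ‖f x - (1 + (ρ : ℂ)) * u x‖ ^ 2) := by
      rw [ofReal_integral_eq_lintegral_ofReal iψh (Eventually.of_forall fun x => by positivity)]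
      refine lintegral_congr fun x => ?_
      rw [ENNReal.ofReal_mul (sq_nonneg _), ENNReal.ofReal_pow (norm_nonneg _), ofReal_norm,
        ← sq_abs, ENNReal.ofReal_pow (abs_nonneg _), ← Real.norm_eq_abs, ofReal_norm, mul_comm]
    have hT0 : 0 ≤ (∫ x, F ω x * conj (conv (resK 1) (F ω) x)).re := by
      rw [← re_integral_mul_conj_conv ((hFW ω).symm ▸ memLp_fluctuation hψ (-μ) hu.memH1.memLp)]
      exact add_nonneg (integral_nonneg fun x => by positivity)
        (integral_nonneg fun x => by positivity)
    have n1 : 0 ≤ ∫ x, ‖u x‖ ^ 2 := integral_nonneg fun x => by positivity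
    have n2 : 0 ≤ ∫ x, corrector V ε x ω ^ 2 * ‖g x‖ ^ 2 := integral_nonneg fun x => by positivity
    have n3 : 0 ≤ ∫ x, corrector V ε x ω ^ 2 * ‖f x - (1 + (ρ : ℂ)) * u x‖ ^ 2 :=
      integral_nonneg fun x => by positivity
    have n4 : 0 ≤ ∫ x, ‖remainder V ε u uε x ω‖ ^ 2 := integral_nonneg fun x => by positivity
    have n5 : 0 ≤ ∫ x, ‖gradRemainder V ε u g gε x ω‖ ^ 2 := integral_nonneg fun x => by positivity
    have e3 : ∫⁻ x, ‖remainder V ε u uε x ω‖ₑ ^ 2 = _ := lintegral_enorm_sq_eq hH.memLp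
    have e4 : ∫⁻ x, ‖gradRemainder V ε u g gε x ω‖ₑ ^ 2 = _ := lintegral_enorm_sq_eq hH.memLp_grad
    have hwω : AEMeasurable (fun x => ‖remainder V ε u uε x ω‖ₑ ^ 2) volume :=
      hH.memLp.1.enorm.pow_const 2
    rw [lintegral_add_left' hwω, e1, e2,
      lintegral_enorm_sq_eq hu.memH1.memLp, ← ENNReal.ofReal_mul (sq_nonneg _),
      ← ENNReal.ofReal_add (by positivity) hT0, ← ENNReal.ofReal_add (by positivity) n2,
      ← ENNReal.ofReal_add (by positivity) n3, ← ENNReal.ofReal_mul (by norm_num)]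
    refine (add_le_add e3.le e4.le).trans ?_
    rw [← ENNReal.ofReal_add n4 n5]
    exact ENNReal.ofReal_le_ofReal hle
  have hsum : AEMeasurable (fun q : Rd d × Ω => ‖remainder V ε u uε q.1 q.2‖ₑ ^ 2
      + ‖gradRemainder V ε u g gε q.1 q.2‖ₑ ^ 2) (volume.prod P) :=
    (hwm.enorm.pow_const 2).add (hgwm.enorm.pow_const 2)
  rw [← lintegral_add_left' (hwm.enorm.pow_const 2),
    lintegral_prod_symm _ hsum]
  refine (lintegral_mono_ae hω).trans ?_
  rw [lintegral_const_mul' _ _ ENNReal.ofReal_ne_top]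
  refine mul_le_mul_right ?_ _
  have hTm : AEMeasurable (fun ω => ENNReal.ofReal
      (∫ x, F ω x * conj (conv (resK 1) (F ω) x)).re) P :=
    hT2.re.1.aemeasurable.ennreal_ofReal
  have hGm : AEMeasurable (fun ω => ∫⁻ x, ‖g x‖ₑ ^ 2 * ‖corrector V ε x ω‖ₑ ^ 2) P :=
    hgm.lintegral_prod_left'
  rw [lintegral_const_add_add_add hTm hGm, ← lintegral_prod_symm _ hgm,
    ← lintegral_prod_symm _ hhm]
  refine add_le_add (add_le_add (add_le_add le_rfl ?_) (le_of_eq ?_)) (le_of_eq ?_)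
  · refine le_trans ?_ hT2le
    have hre : Integrable (fun ω => (∫ x, F ω x * conj (conv (resK 1) (F ω) x)).re) P := hT2.re
    rw [← ofReal_integral_eq_lintegral_ofReal hre]
    · have : ∫ ω, (∫ x, F ω x * conj (conv (resK 1) (F ω) x)).re ∂P = _ := integral_re hT2
      rw [this, ← ofReal_norm]
      exact ENNReal.ofReal_le_ofReal (RCLike.re_le_norm _)
    · filter_upwards [huε.weakSolution] with ω hsol
      have hψ := isBoundedCorrector_corrector (d := d) hV hM ε ω
      simp only [Pi.zero_apply]
      rw [← re_integral_mul_conj_conv ((hFW ω).symm ▸ memLp_fluctuation hψ (-μ) hu.memH1.memLp)]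
      exact add_nonneg (integral_nonneg fun x => by positivity)
        (integral_nonneg fun x => by positivity)
  · exact lintegral_corrector_mul hε hV (hu.memH1.memLp_grad.1.enorm.pow_const 2)
  · exact lintegral_corrector_mul hε hV (hh.1.enorm.pow_const 2)

end ExpectedEnergy

/-! ### Error estimates for bounded potentials -/

section ErrorEstimates

variable {d : ℕ} {Ω : Type*} [AddAction (Rd d) Ω] {V : Ω → ℝ}
  [MeasurableSpace Ω] [MeasurableVAdd₂ (Rd d) Ω] {P : Measure Ω}
  [IsProbabilityMeasure P] [VAddInvariantMeasure (Rd d) Ω P] {M : ℝ}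

lemma enorm_add_sq_le {E : Type*} [NormedAddCommGroup E] (a b : E) :
    ‖a + b‖ₑ ^ 2 ≤ 2 * ‖a‖ₑ ^ 2 + 2 * ‖b‖ₑ ^ 2 := by
  have h := ENNReal.rpow_add_le_mul_rpow_add_rpow ‖a‖ₑ ‖b‖ₑ (p := 2) (by norm_num)
  norm_num at h
  rw [← mul_add]
  exact (pow_le_pow_left₀ zero_le (enorm_add_le a b) 2).trans h

lemma enorm_I : ‖Complex.I‖ₑ = 1 := by rw [← ofReal_norm, Complex.norm_I, ENNReal.ofReal_one]

lemma lintegral_enorm_add_sq_le {X E : Type*} [MeasurableSpace X] {μ : Measure X}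
    [NormedAddCommGroup E] {a : X → E} (b : X → E) (ha : AEStronglyMeasurable a μ) :
    ∫⁻ x, ‖a x + b x‖ₑ ^ 2 ∂μ ≤ 2 * (∫⁻ x, ‖a x‖ₑ ^ 2 ∂μ) + 2 * ∫⁻ x, ‖b x‖ₑ ^ 2 ∂μ := by
  have hm : AEMeasurable (fun x => 2 * ‖a x‖ₑ ^ 2) μ := (ha.enorm.pow_const 2).const_mul 2
  refine (lintegral_mono fun x => enorm_add_sq_le (a x) (b x)).trans ?_
  rw [lintegral_add_left' hm, lintegral_const_mul' _ _ (by simp),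
    lintegral_const_mul' _ _ (by simp)]

lemma IsWeakSolution.lintegral_le {ρ : ℝ} (hρ : 0 ≤ ρ) {f u : Rd d → ℂ}
    {g : Rd d → EuclideanSpace ℂ (Fin d)} (h : IsWeakSolution (fun _ => 1 + (ρ : ℂ)) f u g)
    (hf : MemLp f 2 volume) :
    ∫⁻ x, ‖u x‖ₑ ^ 2 ≤ ∫⁻ x, ‖f x‖ₑ ^ 2 ∧ ∫⁻ x, ‖g x‖ₑ ^ 2 ≤ ∫⁻ x, ‖f x‖ₑ ^ 2 := by
  have he := h.energy_le hρ hf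
  have n1 : 0 ≤ ∫ x, ‖u x‖ ^ 2 := integral_nonneg fun x => by positivity
  have n2 : 0 ≤ ∫ x, ‖g x‖ ^ 2 := integral_nonneg fun x => by positivity
  rw [lintegral_enorm_sq_eq h.memH1.memLp, lintegral_enorm_sq_eq h.memH1.memLp_grad,
    lintegral_enorm_sq_eq hf]
  exact ⟨ENNReal.ofReal_le_ofReal (by linarith), ENNReal.ofReal_le_ofReal (by linarith)⟩

/-- The constant in the estimate of the energy of the remainder. -/
def remainderConst (κ : ℝ≥0∞) (ρ : ℝ) : ℝ≥0∞ :=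
  ENNReal.ofReal 8 * (κ * (5 + 2 * ‖1 + (ρ : ℂ)‖ₑ ^ 2))

variable {κ : ℝ≥0∞} {ε : ℝ} {f u : Rd d → ℂ} {g : Rd d → EuclideanSpace ℂ (Fin d)}
  {uε : Rd d → Ω → ℂ} {gε : Rd d → Ω → EuclideanSpace ℂ (Fin d)}

lemma lintegral_remainder_le_rate (hV : Measurable V) (hM : ∀ ω, |V ω| ≤ M)
    (hρ : 0 ≤ homogenizedPotential d P V) (hε : 0 < ε) (H : MomentBounds d P V κ ε)
    (hf : MemLp f 2 volume)
    (hu : IsWeakSolution (fun _ => 1 + ((homogenizedPotential d P V : ℝ) : ℂ)) f u g)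
    (huε : IsRandomSolution P V ε f uε gε) :
    (∫⁻ q : Rd d × Ω, ‖remainder V ε u uε q.1 q.2‖ₑ ^ 2 ∂(volume.prod P))
      + ∫⁻ q : Rd d × Ω, ‖gradRemainder V ε u g gε q.1 q.2‖ₑ ^ 2 ∂(volume.prod P)
    ≤ remainderConst κ (homogenizedPotential d P V) *
      (ENNReal.ofReal (rate d ε) ^ 2 * ∫⁻ x, ‖f x‖ₑ ^ 2) := by
  set ρ := homogenizedPotential d P V with hρ'
  set r := ENNReal.ofReal (rate d ε) ^ 2
  set N := ∫⁻ x, ‖f x‖ₑ ^ 2 with hN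
  obtain ⟨h1, h2⟩ := hu.lintegral_le hρ hf
  have h3 : ∫⁻ x, ‖f x - (1 + (ρ : ℂ)) * u x‖ₑ ^ 2 ≤ (2 + 2 * ‖1 + (ρ : ℂ)‖ₑ ^ 2) * N := by
    simp only [sub_eq_add_neg]
    refine (lintegral_enorm_add_sq_le _ hf.1).trans ?_
    simp only [enorm_neg, enorm_mul, mul_pow]
    rw [lintegral_const_mul' _ _ (by finiteness), add_mul, mul_assoc]
    gcongr
  refine (lintegral_remainder_le hV hM hε hf hu huε).trans ?_
  rw [remainderConst, mul_assoc]
  refine mul_le_mul_right ?_ _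
  calc _ ≤ κ * r * N + κ * r * N + N * (κ * r) + (2 + 2 * ‖1 + (ρ : ℂ)‖ₑ ^ 2) * N * (κ * r) :=
        add_le_add (add_le_add (add_le_add (mul_le_mul' H.mean h1)
          (mul_le_mul' H.fluctuation h1)) (mul_le_mul' h2 H.corrector))
          (mul_le_mul' h3 H.corrector)
    _ = _ := by ring

lemma lintegral_corrector_mul_le_rate {E : Type*} [NormedAddCommGroup E] [NormedSpace ℂ E]
    (hV : Measurable V) (hε : 0 < ε) (H : MomentBounds d P V κ ε) {a : Rd d → E}
    (ha : AEStronglyMeasurable a volume) :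
    ∫⁻ q : Rd d × Ω, ‖((corrector V ε q.1 q.2 : ℝ) : ℂ) • a q.1‖ₑ ^ 2 ∂(volume.prod P)
      ≤ κ * (ENNReal.ofReal (rate d ε) ^ 2 * ∫⁻ x, ‖a x‖ₑ ^ 2) := by
  have h := lintegral_corrector_mul (P := P) hε hV (ha.enorm.pow_const 2)
  calc _ = ∫⁻ q : Rd d × Ω, ‖a q.1‖ₑ ^ 2 * ‖corrector V ε q.1 q.2‖ₑ ^ 2 ∂(volume.prod P) := by
        refine lintegral_congr fun q => ?_
        rw [enorm_smul, mul_pow, mul_comm, ← ofReal_norm (Complex.ofReal _), Complex.norm_real,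
          ofReal_norm]
    _ ≤ (∫⁻ x, ‖a x‖ₑ ^ 2) * (κ * ENNReal.ofReal (rate d ε) ^ 2) := by
        rw [h]; exact mul_le_mul_right H.corrector _
    _ = _ := by ring

/-- The `L²` error is the remainder minus the first order term. -/
lemma lintegral_sub_le_rate (hV : Measurable V) (hM : ∀ ω, |V ω| ≤ M)
    (hρ : 0 ≤ homogenizedPotential d P V) (hε : 0 < ε) (H : MomentBounds d P V κ ε)
    (hf : MemLp f 2 volume)
    (hu : IsWeakSolution (fun _ => 1 + ((homogenizedPotential d P V : ℝ) : ℂ)) f u g)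
    (huε : IsRandomSolution P V ε f uε gε) :
    ∫⁻ q : Rd d × Ω, ‖uε q.1 q.2 - u q.1‖ₑ ^ 2 ∂(volume.prod P)
    ≤ (2 * remainderConst κ (homogenizedPotential d P V) + 2 * κ) *
      (ENNReal.ofReal (rate d ε) ^ 2 * ∫⁻ x, ‖f x‖ₑ ^ 2) := by
  have hwm := aestronglyMeasurable_remainder hV ε hu.memH1.memLp.1 huε.aestronglyMeasurable
  have h1 := lintegral_remainder_le_rate hV hM hρ hε H hf hu huε
  have h2 := lintegral_corrector_mul_le_rate hV hε H hu.memH1.memLp.1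
  have h3 := (hu.lintegral_le hρ hf).1
  calc _ = ∫⁻ q : Rd d × Ω, ‖remainder V ε u uε q.1 q.2
        + -(Complex.I * (((corrector V ε q.1 q.2 : ℝ) : ℂ) • u q.1))‖ₑ ^ 2 ∂(volume.prod P) := by
        refine lintegral_congr fun q => ?_
        rw [remainder, smul_eq_mul, add_neg_cancel_right]
    _ ≤ _ := lintegral_enorm_add_sq_le _ hwm
    _ ≤ 2 * (remainderConst κ (homogenizedPotential d P V) *
          (ENNReal.ofReal (rate d ε) ^ 2 * ∫⁻ x, ‖f x‖ₑ ^ 2))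
        + 2 * (κ * (ENNReal.ofReal (rate d ε) ^ 2 * ∫⁻ x, ‖f x‖ₑ ^ 2)) := by
        simp only [enorm_neg, enorm_mul, enorm_I, one_mul]
        gcongr
        · exact le_self_add.trans h1
        · exact h2.trans (by gcongr)
    _ = _ := by ring

/-- The error in the gradient is the gradient of the remainder, minus the corrector times the
gradient of the limit, minus the defect of the gradient of the corrector. -/
lemma lintegral_grad_le_rate (hV : Measurable V) (hM : ∀ ω, |V ω| ≤ M)
    (hρ : 0 ≤ homogenizedPotential d P V) (hε : 0 < ε) (H : MomentBounds d P V κ ε)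
    (hf : MemLp f 2 volume)
    (hu : IsWeakSolution (fun _ => 1 + ((homogenizedPotential d P V : ℝ) : ℂ)) f u g)
    (huε : IsRandomSolution P V ε f uε gε) :
    ∫⁻ q : Rd d × Ω, ‖gε q.1 q.2 - g q.1 + (Complex.I * u q.1) •
      toComplexVec (limitGradient d V ((-(ε⁻¹ • q.1)) +ᵥ q.2))‖ₑ ^ 2 ∂(volume.prod P)
    ≤ (2 * remainderConst κ (homogenizedPotential d P V) + 8 * κ) *
      (ENNReal.ofReal (rate d ε) ^ 2 * ∫⁻ x, ‖f x‖ₑ ^ 2) := by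
  have hl : 0 < ε ^ 2 := by positivity
  have hgwm := aestronglyMeasurable_gradRemainder hV ε hu.memH1.memLp.1 hu.memH1.memLp_grad.1
    huε.aestronglyMeasurable_grad
  have h1 := lintegral_remainder_le_rate hV hM hρ hε H hf hu huε
  have h2 := lintegral_corrector_mul_le_rate hV hε H hu.memH1.memLp_grad.1
  obtain ⟨h3, h3'⟩ := hu.lintegral_le hρ hf
  set Y : Ω → Rd d := fun ω => average (gradK (ε ^ 2) : Rd d → Rd d) V ω + limitGradient d V ω
    with hY
  have hYm : Measurable fun ω => ‖Y ω‖ₑ ^ 2 :=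
    (((stronglyMeasurable_average hV (measurable_gradK _).stronglyMeasurable).measurable).add
      (stronglyMeasurable_limitGradient hV).measurable).enorm.pow_const 2
  have h4 : ∫⁻ q : Rd d × Ω, ‖u q.1 • toComplexVec (Y ((-(ε⁻¹ • q.1)) +ᵥ q.2))‖ₑ ^ 2
      ∂(volume.prod P) ≤ κ * (ENNReal.ofReal (rate d ε) ^ 2 * ∫⁻ x, ‖f x‖ₑ ^ 2) := by
    calc _ = ∫⁻ q : Rd d × Ω, ‖u q.1‖ₑ ^ 2 * ‖Y ((-(ε⁻¹ • q.1)) +ᵥ q.2)‖ₑ ^ 2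
          ∂(volume.prod P) := by
          refine lintegral_congr fun q => ?_
          rw [enorm_smul, mul_pow, ← ofReal_norm (toComplexVec _), norm_toComplexVec, ofReal_norm]
      _ = (∫⁻ x, ‖u x‖ₑ ^ 2) * ∫⁻ ω, ‖Y ω‖ₑ ^ 2 ∂P :=
          lintegral_prod_mul_stationary (hu.memH1.memLp.1.enorm.pow_const 2) hYm ε⁻¹
      _ ≤ (∫⁻ x, ‖f x‖ₑ ^ 2) * (κ * ENNReal.ofReal (rate d ε) ^ 2) := mul_le_mul' h3 H.gradient
      _ = _ := by ring
  have hψg : AEStronglyMeasurable (fun q : Rd d × Ω =>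
      -((corrector V ε q.1 q.2 : ℝ) : ℂ) • g q.1) (volume.prod P) :=
    (Complex.measurable_ofReal.comp (measurable_corrector hV ε)).neg.aestronglyMeasurable.smul
      hu.memH1.memLp_grad.1.comp_fst
  calc _ = ∫⁻ q : Rd d × Ω, ‖gradRemainder V ε u g gε q.1 q.2
        + Complex.I • (-((corrector V ε q.1 q.2 : ℝ) : ℂ) • g q.1
          + u q.1 • toComplexVec (Y ((-(ε⁻¹ • q.1)) +ᵥ q.2)))‖ₑ ^ 2 ∂(volume.prod P) := by
        refine lintegral_congr fun q => ?_
        have hneg : toComplexVec (gradCorrector V ε q.1 q.2)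
            = -toComplexVec (average (gradK (ε ^ 2) : Rd d → Rd d) V ((-(ε⁻¹ • q.1)) +ᵥ q.2)) := by
          rw [gradCorrector, gradConv_scaledField hV hM hε]
          ext j; simp
        congr 2
        rw [gradRemainder, hneg, hY]
        simp only [toComplexVec_add, smul_add, mul_smul, smul_neg, neg_smul]
        abel
    _ ≤ _ := lintegral_enorm_add_sq_le _ hgwm
    _ ≤ 2 * (remainderConst κ (homogenizedPotential d P V) *
          (ENNReal.ofReal (rate d ε) ^ 2 * ∫⁻ x, ‖f x‖ₑ ^ 2))
        + 2 * (2 * (κ * (ENNReal.ofReal (rate d ε) ^ 2 * ∫⁻ x, ‖f x‖ₑ ^ 2))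
          + 2 * (κ * (ENNReal.ofReal (rate d ε) ^ 2 * ∫⁻ x, ‖f x‖ₑ ^ 2))) := by
        simp only [enorm_smul _ (_ + _), enorm_I, one_mul]
        gcongr
        · exact le_add_self.trans h1
        · refine (lintegral_enorm_add_sq_le _ hψg).trans ?_
          simp only [neg_smul, enorm_neg]
          gcongr
          exact h2.trans (by gcongr)
    _ = _ := by ring

end ErrorEstimates

/-! ### Convergence of the rate -/

lemma tendsto_rate (d : ℕ) : Tendsto (rate d) (𝓝[>] 0) (𝓝 0) := by
  unfold rate
  have hid : Tendsto (fun ε : ℝ => ε) (𝓝[>] 0) (𝓝 0) := tendsto_id.mono_left nhdsWithin_le_nhds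
  split_ifs
  · simpa using hid.sqrt
  · have h1 : Tendsto (fun ε : ℝ => √(ε * |ε * Real.log ε|)) (𝓝[>] 0) (𝓝 0) := by
      have h := (Real.continuous_mul_log.tendsto 0).mono_left
        (nhdsWithin_le_nhds (s := Set.Ioi (0 : ℝ)))
      simpa using (hid.mul h.abs).sqrt
    refine h1.congr' ?_
    filter_upwards [self_mem_nhdsWithin] with ε (hε : 0 < ε)
    rw [abs_mul, abs_of_pos hε, ← mul_assoc, Real.sqrt_mul (by positivity), Real.sqrt_mul_self hε.le]
  · exact hid

/-- A bound for squared norms gives a bound for norms. -/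
lemma eLpNorm_le_of_lintegral_le {X Y E F : Type*} [MeasurableSpace X] {μ : Measure X}
    [MeasurableSpace Y] {ν : Measure Y} [NormedAddCommGroup E] [NormedAddCommGroup F] {a : X → E}
    {b : Y → F} {K : ℝ≥0∞} {C r : ℝ} (hC : 0 ≤ C) (hK : K ≤ ENNReal.ofReal C ^ 2)
    (h : ∫⁻ x, ‖a x‖ₑ ^ 2 ∂μ ≤ K * (ENNReal.ofReal r ^ 2 * ∫⁻ x, ‖b x‖ₑ ^ 2 ∂ν)) :
    eLpNorm a 2 μ ≤ ENNReal.ofReal (C * r) * eLpNorm b 2 ν := by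
  rw [← ENNReal.pow_le_pow_left_iff two_ne_zero, eLpNorm_two_sq, mul_pow, eLpNorm_two_sq,
    ENNReal.ofReal_mul hC, mul_pow, mul_assoc]
  exact h.trans (mul_le_mul_left hK _)

/-! ### Convergence of the gradients of the correctors in `L²_loc` -/

section CorrectorGradient

variable {d : ℕ} {Ω : Type*} [AddAction (Rd d) Ω] {V : Ω → ℝ}
  [MeasurableSpace Ω] [MeasurableVAdd₂ (Rd d) Ω] {P : Measure Ω}
  [IsProbabilityMeasure P] [VAddInvariantMeasure (Rd d) Ω P] {M : ℝ}

lemma exists_le_ofReal_sq {K : ℝ≥0∞} (hK : K ≠ ⊤) :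
    ∃ C : ℝ, 0 ≤ C ∧ K ≤ ENNReal.ofReal C ^ 2 := by
  refine ⟨√K.toReal, Real.sqrt_nonneg _, ?_⟩
  rw [← ENNReal.ofReal_pow (Real.sqrt_nonneg _), Real.sq_sqrt ENNReal.toReal_nonneg,
    ENNReal.ofReal_toReal hK]

lemma isWeakGradient_fastCorrector (hV : Measurable V) (hM : ∀ ω, |V ω| ≤ M) {ε : ℝ} (hε : 0 < ε)
    (ω : Ω) : IsWeakGradient (fun y : Rd d => fastCorrector V ε y ω)
      (fun y => -gradConv (ε ^ 2) (fun y => field V y ω) y) := by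
  simp only [fastCorrector_eq_conv hε]
  exact (isBoundedCorrector_conv (lam := ε ^ 2) (by positivity) (measurable_field_left hV ω)
    (C := M) fun x => hM _).weakGradient

theorem isCorrectorGradient_limitGradient (hd : 3 ≤ d) (hV : Measurable V) (hM : ∀ ω, |V ω| ≤ M)
    (hR : Integrable (fun x : Rd d => correlation P V x) volume) {κ : ℝ≥0∞} (hκ : κ ≠ ⊤)
    (H : ∀ ε : ℝ, 0 < ε → ε ≤ 1 / 2 → MomentBounds d P V κ ε) :
    IsCorrectorGradient P V (limitGradient d V) := by
  refine ⟨memLp_limitGradient hd hV hM hR,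
    fun ε y ω => -gradConv (ε ^ 2) (fun y => field V y ω) y, fun ε hε => ⟨?_, ?_⟩, fun K hK => ?_⟩
  · exact (measurable_gradConv_prod (measurable_field hV) _).neg.aestronglyMeasurable
  · exact Eventually.of_forall fun ω => isWeakGradient_fastCorrector hV hM hε ω
  obtain ⟨C, hC, hCκ⟩ := exists_le_ofReal_sq hκ
  have : IsFiniteMeasure (volume.restrict K) := ⟨by simpa using hK.measure_lt_top⟩
  have hS : eLpNorm (fun _ : Rd d => (1 : ℝ)) 2 (volume.restrict K) ≠ ⊤ := (memLp_const 1).2.ne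
  have hlim : Tendsto (fun ε : ℝ => ENNReal.ofReal (C * rate d ε)
      * eLpNorm (fun _ : Rd d => (1 : ℝ)) 2 (volume.restrict K)) (𝓝[>] 0) (𝓝 0) := by
    have h := ENNReal.Tendsto.mul_const (b := eLpNorm (fun _ : Rd d => (1 : ℝ)) 2
      (volume.restrict K)) (ENNReal.tendsto_ofReal ((tendsto_rate d).const_mul C)) (Or.inr hS)
    simpa using h
  refine tendsto_of_tendsto_of_tendsto_of_le_of_le' tendsto_const_nhds hlim
    (Eventually.of_forall fun ε => zero_le) ?_
  filter_upwards [Ioc_mem_nhdsGT (show (0 : ℝ) < 1 / 2 by norm_num)] with ε hε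
  have hl : 0 < ε ^ 2 := by have := hε.1; positivity
  refine eLpNorm_le_of_lintegral_le hC hCκ ?_
  set Y : Ω → Rd d := fun ω => average (gradK (ε ^ 2) : Rd d → Rd d) V ω + limitGradient d V ω
    with hY
  have hYm : Measurable fun ω => ‖Y ω‖ₑ ^ 2 :=
    (((stronglyMeasurable_average hV (measurable_gradK _).stronglyMeasurable).measurable).add
      (stronglyMeasurable_limitGradient hV).measurable).enorm.pow_const 2
  calc _ = ∫⁻ q : Rd d × Ω, 1 * ‖Y ((-((1 : ℝ) • q.1)) +ᵥ q.2)‖ₑ ^ 2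
          ∂((volume.restrict K).prod P) := by
        refine lintegral_congr fun q => ?_
        rw [one_mul, one_smul, gradConv_field hV hM hl, ← neg_add', enorm_neg]
    _ = (∫⁻ _ in K, 1) * ∫⁻ ω, ‖Y ω‖ₑ ^ 2 ∂P :=
        lintegral_prod_mul_stationary aemeasurable_const hYm 1
    _ ≤ (∫⁻ _ in K, 1) * (κ * ENNReal.ofReal (rate d ε) ^ 2) :=
        mul_le_mul_right (H ε hε.1 hε.2).gradient _
    _ = _ := by simp only [enorm_one, one_pow]; ring

end CorrectorGradient

/-! ### Potentials that agree almost surely -/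

section Congruence

variable {d : ℕ} {Ω : Type*} [AddAction (Rd d) Ω] {V V' : Ω → ℝ}
  [MeasurableSpace Ω] [MeasurableVAdd₂ (Rd d) Ω] {P : Measure Ω}
  [VAddInvariantMeasure (Rd d) Ω P]

lemma field_ae_eq (h : V =ᵐ[P] V') (x : Rd d) : field V x =ᵐ[P] field V' x :=
  (measurePreserving_vadd (-x) P).quasiMeasurePreserving.ae_eq_comp h

lemma correlation_congr (h : V =ᵐ[P] V') :
    (correlation P V : Rd d → ℝ) = correlation P V' := by
  ext x
  refine integral_congr_ae ?_
  filter_upwards [field_ae_eq h (0 : Rd d), field_ae_eq h x] with ω h1 h2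
  rw [h1, h2]

lemma powerSpectrum_congr (h : V =ᵐ[P] V') :
    (powerSpectrum P V : Rd d → ℝ) = powerSpectrum P V' := by
  ext ξ
  rw [powerSpectrum, powerSpectrum, correlation_congr h]

lemma homogenizedPotential_congr (h : V =ᵐ[P] V') :
    homogenizedPotential d P V = homogenizedPotential d P V' := by
  rw [homogenizedPotential, homogenizedPotential, powerSpectrum_congr h]

variable [SFinite P]

lemma ae_ae_field_eq (hV : Measurable V) (hV' : Measurable V') (h : V =ᵐ[P] V') (c : ℝ) :
    ∀ᵐ ω ∂P, ∀ᵐ x : Rd d, field V (c • x) ω = field V' (c • x) ω := by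
  have hm : ∀ {W : Ω → ℝ}, Measurable W →
      Measurable fun q : Rd d × Ω => field W (c • q.1) q.2 := fun hW =>
    (measurable_field hW).comp ((measurable_fst.const_smul c).prodMk measurable_snd)
  refine ae_ae_swap ((Measure.ae_prod_iff_ae_ae (p := fun q : Rd d × Ω =>
    field V (c • q.1) q.2 = field V' (c • q.1) q.2) (measurableSet_eq_fun (hm hV) (hm hV'))).2 ?_)
  exact Eventually.of_forall fun x => field_ae_eq h (c • x)

lemma ae_ae_scaledField_eq (hV : Measurable V) (hV' : Measurable V') (h : V =ᵐ[P] V') (ε : ℝ) :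
    ∀ᵐ ω ∂P, ∀ᵐ x : Rd d, scaledField V ε x ω = scaledField V' ε x ω := by
  filter_upwards [ae_ae_field_eq (d := d) hV hV' h ε⁻¹] with ω hω
  filter_upwards [hω] with x hx
  rw [scaledField, scaledField, hx]

lemma ae_corrector_eq (hV : Measurable V) (hV' : Measurable V') (h : V =ᵐ[P] V') (ε : ℝ) :
    ∀ᵐ ω ∂P, ∀ x : Rd d, corrector V ε x ω = corrector V' ε x ω := by
  filter_upwards [ae_ae_scaledField_eq (d := d) hV hV' h ε] with ω hω x
  rw [corrector, corrector]
  congr 1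
  refine integral_congr_ae ?_
  filter_upwards [hω] with y hy
  rw [hy]

lemma IsWeakSolution.congr_coeff {c c' f u : Rd d → ℂ} {g : Rd d → EuclideanSpace ℂ (Fin d)}
    (h : IsWeakSolution c f u g) (hc : c =ᵐ[volume] c') : IsWeakSolution c' f u g := by
  refine ⟨h.memH1, fun v gv hv => ?_⟩
  rw [← h.weakForm v gv hv]
  refine integral_congr_ae ?_
  filter_upwards [hc] with x hx
  rw [hx]

lemma IsRandomSolution.congr (hV : Measurable V) (hV' : Measurable V') (h : V =ᵐ[P] V') {ε : ℝ}
    {f : Rd d → ℂ} {u : Rd d → Ω → ℂ} {g : Rd d → Ω → EuclideanSpace ℂ (Fin d)}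
    (hu : IsRandomSolution P V ε f u g) : IsRandomSolution P V' ε f u g := by
  refine ⟨hu.aestronglyMeasurable, hu.aestronglyMeasurable_grad, ?_⟩
  filter_upwards [hu.weakSolution, ae_ae_scaledField_eq (d := d) hV hV' h ε] with ω h1 h2
  refine h1.congr_coeff ?_
  filter_upwards [h2] with x hx
  rw [hx]

lemma IsCorrectorGradient.congr (hV : Measurable V) (hV' : Measurable V') (h : V =ᵐ[P] V')
    {X : Ω → Rd d} (hX : IsCorrectorGradient P V X) : IsCorrectorGradient P V' X := by
  obtain ⟨h1, D, h2, h3⟩ := hX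
  refine ⟨h1, D, fun ε hε => ⟨(h2 ε hε).1, ?_⟩, h3⟩
  filter_upwards [(h2 ε hε).2, ae_corrector_eq (d := d) hV hV' h ε] with ω a b
  simpa only [fastCorrector, b] using a

end Congruence

/-! ### Well-posedness and error estimates -/

section WellPosedness

variable {d : ℕ} {Ω : Type*} [AddAction (Rd d) Ω] {V : Ω → ℝ}
  [MeasurableSpace Ω] [MeasurableVAdd₂ (Rd d) Ω] {P : Measure Ω}
  [IsProbabilityMeasure P] {M ε : ℝ} {f : Rd d → ℂ}

lemma exists_isRandomSolution (hV : Measurable V) (hM : ∀ ω, |V ω| ≤ M) (ε : ℝ)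
    (hf : MemLp f 2 volume) : ∃ u g, IsRandomSolution P V ε f u g := by
  obtain ⟨u, g, hu, hg, h⟩ := exists_random_weakSolution (P := P)
    (W := fun (x : Rd d) ω => scaledField V ε x ω) (measurable_scaledField hV ε) (M := |ε⁻¹| * M)
    (fun x ω => by
      rw [scaledField, abs_mul]
      exact mul_le_mul_of_nonneg_left (hM _) (abs_nonneg _)) hf
  exact ⟨u, g, hu.aestronglyMeasurable, hg.aestronglyMeasurable, h⟩

lemma IsRandomSolution.ae_eq (hV : Measurable V) (hM : ∀ ω, |V ω| ≤ M)
    {u u' : Rd d → Ω → ℂ} {g g' : Rd d → Ω → EuclideanSpace ℂ (Fin d)}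
    (h : IsRandomSolution P V ε f u g) (h' : IsRandomSolution P V ε f u' g') :
    (fun p : Rd d × Ω => u p.1 p.2) =ᵐ[volume.prod P] fun p => u' p.1 p.2 := by
  refine ae_eq_prod_of_ae_ae h.aestronglyMeasurable h'.aestronglyMeasurable ?_
  filter_upwards [h.weakSolution, h'.weakSolution] with ω h1 h2
  have hm : Measurable fun x : Rd d => scaledField V ε x ω :=
    (measurable_scaledField hV ε).comp measurable_prodMk_right
  refine h1.ae_eq h2 (((Complex.measurable_ofReal.comp hm).const_mul
    Complex.I).const_sub 1).aestronglyMeasurable (C := 1 + |ε⁻¹| * M)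
    (Eventually.of_forall fun x => ?_) (Eventually.of_forall fun x => by simp)
  refine (norm_sub_le _ _).trans ?_
  rw [norm_one, norm_mul, Complex.norm_I, one_mul, Complex.norm_real, scaledField, norm_mul]
  exact add_le_add le_rfl (mul_le_mul_of_nonneg_left (hM _) (abs_nonneg _))

lemma IsWeakSolution.ae_eq_of_const {ρ : ℝ} (hρ : 0 ≤ ρ) {u u' : Rd d → ℂ}
    {g g' : Rd d → EuclideanSpace ℂ (Fin d)}
    (h : IsWeakSolution (fun _ => 1 + (ρ : ℂ)) f u g)
    (h' : IsWeakSolution (fun _ => 1 + (ρ : ℂ)) f u' g') : u =ᵐ[volume] u' :=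
  h.ae_eq h' aestronglyMeasurable_const (Eventually.of_forall fun _ => le_rfl)
    (Eventually.of_forall fun _ => by simpa using hρ)

lemma exists_isWeakSolution_of_const {ρ : ℝ} (hρ : 0 ≤ ρ) (hf : MemLp f 2 volume) :
    ∃ u g, IsWeakSolution (fun _ => 1 + (ρ : ℂ)) f u g := by
  have h := exists_weakSolution (lam := 1 + ρ) (by linarith) hf
  simpa using h

end WellPosedness

section Estimates

variable {d : ℕ} {Ω : Type*} [AddAction (Rd d) Ω] {V : Ω → ℝ}
  [MeasurableSpace Ω] [MeasurableVAdd₂ (Rd d) Ω] {P : Measure Ω}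
  [IsProbabilityMeasure P] [VAddInvariantMeasure (Rd d) Ω P] {M : ℝ}

/-- The three error estimates for an everywhere bounded potential, with a common constant. -/
theorem exists_error_bound (hV : Measurable V) (hM : ∀ ω, |V ω| ≤ M)
    (hρ : 0 ≤ homogenizedPotential d P V) {κ : ℝ≥0∞} (hκ : κ ≠ ⊤)
    (H : ∀ ε : ℝ, 0 < ε → ε ≤ 1 / 2 → MomentBounds d P V κ ε) :
    ∃ C : ℝ, ∀ f : Rd d → ℂ, MemLp f 2 volume →
      ∀ u g, IsWeakSolution (fun _ => 1 + ((homogenizedPotential d P V : ℝ) : ℂ)) f u g →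
      ∀ ε : ℝ, 0 < ε → ε ≤ 1 / 2 → ∀ uε gε, IsRandomSolution P V ε f uε gε →
        eLpNorm (fun p : Rd d × Ω => uε p.1 p.2 - u p.1) 2 (volume.prod P)
            ≤ ENNReal.ofReal (C * rate d ε) * eLpNorm f 2 volume ∧
        eLpNorm (fun p : Rd d × Ω => remainder V ε u uε p.1 p.2) 2 (volume.prod P) ^ 2
          + eLpNorm (fun p : Rd d × Ω => gradRemainder V ε u g gε p.1 p.2) 2 (volume.prod P) ^ 2
            ≤ (ENNReal.ofReal (C * rate d ε) * eLpNorm f 2 volume) ^ 2 ∧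
        eLpNorm (fun p : Rd d × Ω => gε p.1 p.2 - g p.1 + (Complex.I * u p.1) •
          toComplexVec (limitGradient d V ((-(ε⁻¹ • p.1)) +ᵥ p.2))) 2 (volume.prod P)
            ≤ ENNReal.ofReal (C * rate d ε) * eLpNorm f 2 volume := by
  set E := remainderConst κ (homogenizedPotential d P V) with hE
  have hEtop : E ≠ ⊤ := by rw [hE, remainderConst]; finiteness
  obtain ⟨C, hC, hCK⟩ := exists_le_ofReal_sq (K := 2 * E + 8 * κ) (by finiteness)
  refine ⟨C, fun f hf u g hu ε hε hε2 uε gε huε => ⟨?_, ?_, ?_⟩⟩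
  · exact eLpNorm_le_of_lintegral_le hC (le_trans (by gcongr; norm_num) hCK)
      (lintegral_sub_le_rate hV hM hρ hε (H ε hε hε2) hf hu huε)
  · have h1 : E ≤ 2 * E + 8 * κ := by
      rw [two_mul, add_assoc]; exact le_self_add
    rw [eLpNorm_two_sq, eLpNorm_two_sq, mul_pow, eLpNorm_two_sq, ENNReal.ofReal_mul hC, mul_pow,
      mul_assoc]
    exact (lintegral_remainder_le_rate hV hM hρ hε (H ε hε hε2) hf hu huε).trans
      (mul_le_mul_left (h1.trans hCK) _)
  · exact eLpNorm_le_of_lintegral_le hC hCK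
      (lintegral_grad_le_rate hV hM hρ hε (H ε hε hε2) hf hu huε)

omit [MeasurableSpace Ω] [MeasurableVAdd₂ (Rd d) Ω] in
lemma sub_firstOrderTerm {ε : ℝ} (hε : 0 < ε) (V : Ω → ℝ) (u : Rd d → ℂ) (uε : Rd d → Ω → ℂ)
    (x : Rd d) (ω : Ω) :
    uε x ω - u x - (ε : ℂ) * firstOrderTerm V ε u x ω = remainder V ε u uε x ω := by
  have : (ε : ℂ) ≠ 0 := by exact_mod_cast hε.ne'
  rw [firstOrderTerm, remainder]
  field_simp
  ring

end Estimates

end RandomPotential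

end

open RandomPotential
theorem theorem2 {d : ℕ} (hd : 3 ≤ d)
    {Ω : Type*} [MeasurableSpace Ω] (P : Measure Ω) [IsProbabilityMeasure P]
    [AddAction (Rd d) Ω] [MeasurableVAdd₂ (Rd d) Ω] [VAddInvariantMeasure (Rd d) Ω P]
    (hergodic : IsErgodic d P)
    (V : Ω → ℝ) (hVmeas : Measurable V) (hVbdd : ∃ M : ℝ, ∀ᵐ ω ∂P, |V ω| ≤ M)
    (hR : Integrable (fun x : Rd d => correlation P V x) volume)
    (η : ℝ → ℝ) (hη_nonneg : ∀ r, 0 ≤ r → 0 ≤ η r)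
    (hη : Integrable (fun x : Rd d => η ‖x‖) volume)
    (h4 : ∀ x₁ x₂ x₃ x₄ : Rd d,
      |(∫ ω, field V x₁ ω * field V x₂ ω * field V x₃ ω * field V x₄ ω ∂P)
          - correlation P V (x₁ - x₂) * correlation P V (x₃ - x₄)|
        ≤ η ‖x₁ - x₃‖ * η ‖x₂ - x₄‖ + η ‖x₁ - x₄‖ * η ‖x₂ - x₃‖) :
    -- the constant `ρ` is well defined
    Integrable (fun ξ : Rd d => powerSpectrum P V ξ / ‖ξ‖ ^ 2) volume ∧
    -- the limiting problem and the random problem are well posed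
    (∀ f : Rd d → ℂ, MemLp f 2 volume →
      (∃ u g, IsWeakSolution (fun _ => 1 + ((homogenizedPotential d P V : ℝ) : ℂ)) f u g) ∧
      (∀ u g u' g', IsWeakSolution (fun _ => 1 + ((homogenizedPotential d P V : ℝ) : ℂ)) f u g →
        IsWeakSolution (fun _ => 1 + ((homogenizedPotential d P V : ℝ) : ℂ)) f u' g' →
        u =ᵐ[volume] u') ∧
      ∀ ε : ℝ, 0 < ε →
        (∃ u g, IsRandomSolution P V ε f u g) ∧
        ∀ u g u' g', IsRandomSolution P V ε f u g → IsRandomSolution P V ε f u' g' →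
          (fun p : Rd d × Ω => u p.1 p.2) =ᵐ[volume.prod P] fun p => u' p.1 p.2) ∧
    -- convergence of `u_ε` to `u` in `L²(ℝ^d; L²(Ω))`
    (∀ f : Rd d → ℂ, MemLp f 2 volume →
      ∀ u g, IsWeakSolution (fun _ => 1 + ((homogenizedPotential d P V : ℝ) : ℂ)) f u g →
      ∀ (uε : ℝ → Rd d → Ω → ℂ) (gε : ℝ → Rd d → Ω → EuclideanSpace ℂ (Fin d)),
        (∀ ε : ℝ, 0 < ε → IsRandomSolution P V ε f (uε ε) (gε ε)) →
        Tendsto (fun ε : ℝ => eLpNorm (fun p : Rd d × Ω => uε ε p.1 p.2 - u p.1) 2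
          (volume.prod P)) (𝓝[>] 0) (𝓝 0)) ∧
    -- rates of convergence
    ∃ X : Ω → Rd d, IsCorrectorGradient P V X ∧
      ∃ C : ℝ, ∀ f : Rd d → ℂ, MemLp f 2 volume →
        ∀ u g, IsWeakSolution (fun _ => 1 + ((homogenizedPotential d P V : ℝ) : ℂ)) f u g →
        ∀ ε : ℝ, 0 < ε → ε ≤ 1 / 2 →
        ∀ uε gε, IsRandomSolution P V ε f uε gε →
          -- `‖u_ε - u‖`
          eLpNorm (fun p : Rd d × Ω => uε p.1 p.2 - u p.1) 2 (volume.prod P)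
            ≤ ENNReal.ofReal (C * rate d ε) * eLpNorm f 2 volume ∧
          -- `‖u_ε - u - ε u_1‖` in `H¹(ℝ^d; L²(Ω))`
          (∃ w : Rd d → Ω → EuclideanSpace ℂ (Fin d),
            AEStronglyMeasurable (fun p : Rd d × Ω => w p.1 p.2) (volume.prod P) ∧
            (∀ᵐ ω ∂P, MemH1
              (fun x => uε x ω - u x - (ε : ℂ) * firstOrderTerm V ε u x ω)
              (fun x => w x ω)) ∧
            eLpNorm (fun p : Rd d × Ω =>
                uε p.1 p.2 - u p.1 - (ε : ℂ) * firstOrderTerm V ε u p.1 p.2) 2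
                (volume.prod P) ^ 2
              + eLpNorm (fun p : Rd d × Ω => w p.1 p.2) 2 (volume.prod P) ^ 2
              ≤ (ENNReal.ofReal (C * rate d ε) * eLpNorm f 2 volume) ^ 2) ∧
          -- `‖∇u_ε - ∇u + i u Ξ(· / ε)‖`
          eLpNorm (fun p : Rd d × Ω =>
              gε p.1 p.2 - g p.1
                + (Complex.I * u p.1) • (WithLp.toLp 2
                  (fun j : Fin d => ((X ((-(ε⁻¹ • p.1)) +ᵥ p.2) j : ℝ) : ℂ)) :
                    EuclideanSpace ℂ (Fin d))) 2 (volume.prod P)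
            ≤ ENNReal.ofReal (C * rate d ε) * eLpNorm f 2 volume := by
  obtain ⟨M, hM⟩ := hVbdd
  -- Truncation makes the potential bounded everywhere and changes it on a null set only.
  set V' : Ω → ℝ := fun ω => max (-|M|) (min (V ω) |M|) with hV'
  have hV'm : Measurable V' := measurable_const.max (hVmeas.min measurable_const)
  have hM' : ∀ ω, |V' ω| ≤ |M| := fun ω =>
    abs_le.2 ⟨le_max_left _ _, max_le (by linarith [abs_nonneg M]) (min_le_right _ _)⟩
  have hVV' : V =ᵐ[P] V' := by
    filter_upwards [hM] with ω hω
    have h := abs_le.1 (hω.trans (le_abs_self M))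
    simp only [hV', min_eq_left h.2, max_eq_right h.1]
  have hR' : Integrable (fun x : Rd d => correlation P V' x) volume := by
    rw [← correlation_congr hVV']; exact hR
  have h4' : ∀ x₁ x₂ x₃ x₄ : Rd d,
      |(∫ ω, field V' x₁ ω * field V' x₂ ω * field V' x₃ ω * field V' x₄ ω ∂P)
          - correlation P V' (x₁ - x₂) * correlation P V' (x₃ - x₄)|
        ≤ η ‖x₁ - x₃‖ * η ‖x₂ - x₄‖ + η ‖x₁ - x₄‖ * η ‖x₂ - x₃‖ := fun x₁ x₂ x₃ x₄ => by
    have hint : ∫ ω, field V' x₁ ω * field V' x₂ ω * field V' x₃ ω * field V' x₄ ω ∂P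
        = ∫ ω, field V x₁ ω * field V x₂ ω * field V x₃ ω * field V x₄ ω ∂P := by
      refine integral_congr_ae ?_
      filter_upwards [field_ae_eq hVV' x₁, field_ae_eq hVV' x₂, field_ae_eq hVV' x₃,
        field_ae_eq hVV' x₄] with ω a b c e
      rw [a, b, c, e]
    rw [hint, ← correlation_congr hVV']
    exact h4 x₁ x₂ x₃ x₄
  have hρ' : 0 ≤ homogenizedPotential d P V' := homogenizedPotential_nonneg hd hV'm hM' hR'
  rw [homogenizedPotential_congr (d := d) hVV', powerSpectrum_congr hVV']
  obtain ⟨κ, hκ, H⟩ := exists_momentBounds hd hV'm hM' hR' hη_nonneg hη h4'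
  obtain ⟨C, hC⟩ := exists_error_bound hV'm hM' hρ' hκ H
  refine ⟨integrable_powerSpectrum_div hd hV'm hM' hR', fun f hf => ⟨?_, ?_, fun ε hε => ⟨?_, ?_⟩⟩,
    ?_, limitGradient d V', ?_, C, ?_⟩
  · exact exists_isWeakSolution_of_const hρ' hf
  · exact fun u g u' g' h h' => h.ae_eq_of_const hρ' h'
  · obtain ⟨u, g, h⟩ := exists_isRandomSolution (P := P) hV'm hM' ε hf
    exact ⟨u, g, h.congr hV'm hVmeas hVV'.symm⟩
  · exact fun u g u' g' h h' => (h.congr hVmeas hV'm hVV').ae_eq hV'm hM'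
      (h'.congr hVmeas hV'm hVV')
  · intro f hf u g hu uε gε huε
    have hlim : Tendsto (fun ε : ℝ => ENNReal.ofReal (C * rate d ε) * eLpNorm f 2 volume)
        (𝓝[>] 0) (𝓝 0) := by
      have h := ENNReal.Tendsto.mul_const (b := eLpNorm f 2 volume)
        (ENNReal.tendsto_ofReal ((tendsto_rate d).const_mul C)) (Or.inr hf.2.ne)
      simpa using h
    refine tendsto_of_tendsto_of_tendsto_of_le_of_le' tendsto_const_nhds hlim
      (Eventually.of_forall fun ε => zero_le) ?_
    filter_upwards [Ioc_mem_nhdsGT (show (0 : ℝ) < 1 / 2 by norm_num)] with ε hε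
    exact (hC f hf u g hu ε hε.1 hε.2 _ _ ((huε ε hε.1).congr hVmeas hV'm hVV')).1
  · exact (isCorrectorGradient_limitGradient hd hV'm hM' hR' hκ H).congr hV'm hVmeas hVV'.symm
  · intro f hf u g hu ε hε hε2 uε gε huε
    have huε' := huε.congr hVmeas hV'm hVV'
    obtain ⟨h1, h2, h3⟩ := hC f hf u g hu ε hε hε2 uε gε huε'
    have hrem : ∀ᵐ ω ∂P, ∀ x, uε x ω - u x - (ε : ℂ) * firstOrderTerm V ε u x ω
        = remainder V' ε u uε x ω := by
      filter_upwards [ae_corrector_eq (d := d) hVmeas hV'm hVV' ε] with ω hω x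
      rw [← sub_firstOrderTerm hε, firstOrderTerm, firstOrderTerm, hω x]
    have hremp : (fun p : Rd d × Ω => uε p.1 p.2 - u p.1 - (ε : ℂ) * firstOrderTerm V ε u p.1 p.2)
        =ᵐ[volume.prod P] fun p => remainder V' ε u uε p.1 p.2 := by
      filter_upwards [Measure.quasiMeasurePreserving_snd.ae hrem] with p hp
      exact hp p.1
    refine ⟨h1, ⟨fun x ω => gradRemainder V' ε u g gε x ω, ?_, ?_, ?_⟩, h3⟩
    · exact aestronglyMeasurable_gradRemainder hV'm ε hu.memH1.memLp.1 hu.memH1.memLp_grad.1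
        huε.aestronglyMeasurable_grad
    · filter_upwards [huε.weakSolution, hrem] with ω hω hr
      simp only [hr]
      exact memH1_remainder (isBoundedCorrector_corrector hV'm hM' ε ω) hω.memH1 hu.memH1
    · rw [eLpNorm_congr_ae hremp]
      exact h2
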